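/- **Conventions.** Let $k$ be a commutative ring and $\mathrm{Ch}$ the category of unbounded ($\mathbb Z$-graded) chain complexes of $k$-modules, with the tensor product and symmetry given by the Koszul sign rule. Let $\mathbb A$ be the category of finite rooted trees all of whose vertices have at least two inputs; a morphism $S\to T$ is a map of trees preserving the root and inducing a bijection between the sets of leaves, i.e. an isomorphism of $S$ onto a tree obtained from $T$ by contracting inner edges; its codimension is the number of inner edges of $T$ not in its image. For trees $S,R$ with at least one vertex and a leaf $a$ of $S$, $S\circ_a R$ is the tree obtained by grafting $R$ on $S$ at $a$. A *linear $\infty$-operad* is a functor $M:\mathbb A^{op}\to \mathrm{Ch}$ with chain maps $\theta: M(S\circ_aR)\to M(S)\otimes M(R)$ that are natural in $S$ and $R$, satisfy the sequential and the parallel associativity axioms of partial compositions, and are quasi-isomorphisms. A *linear $\infty$-cooperad* is a functor $Y:\mathbb A\to\mathrm{Ch}$ with natural chain maps $\Delta:Y(S\circ_aR)\to Y(S)\otimes Y(R)$ with the same axioms, which are quasi-isomorphisms. Morphisms are natural transformations that commute strictly with the structure maps. For a tree $S$ consider triples $(\alpha,d|e)$, where $\alpha:S\to T$ is a morphism of $\mathbb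 A$, $d$ an enumeration of the inner edges of $S$, and $e=(e_0,\dots,e_{p-1})$ an enumeration of the inner edges of $T$ not in the image of $\alpha$. In exponents of $-1$, sequences stand for their lengths. Below $s$ and $s^{-1}$ denote (de)suspension, so that $\partial(sx)=-s\partial x$ and $\partial(s^{-1}y)=-s^{-1}\partial y$. **Bar construction.** $\mathrm B(M)(S)$ is generated by the $(\alpha,d|e,sx)$, $x\in M(T)$, of degree $d+e+1+|x|$: it is the quotient of $\bigoplus_{(\alpha,d|e)}sM(T)$ by $(\alpha,d|e,s\vartheta^*x')=(\vartheta\alpha,d|\vartheta e,sx')$ for isomorphisms $\vartheta:T\to T'$ and $(\alpha,d|e,sx)=(-1)^\sigma(-1)^\tau(\alpha,d\sigma|e\tau,sx)$ for permutations $\sigma,\tau$. The structure is as follows. * $\partial(\alpha,d|e,sx)=\sum_i(-1)^{d+i}(\partial_{e_i}^*\alpha,d|e_0\dots\hat e_i\dots e_{p-1},s\,\partial_{e_i}^*x)+(-1)^{d+e}(\alpha,d|e,\partial(sx))$, where $\partial_{e_i}:\partial_{e_i}T\to T$ contracts $e_i$ and $\alpha=\partial_{e_i}\circ\partial_{e_i}^*\alpha$.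 * For $\gamma:S\to S'$, $\gamma_*(\alpha,d|e,sx)=0$ if $\alpha$ does not factor through $\gamma$, and $\gamma_*(\beta\gamma,d|\beta(e')e'',sx)=(\beta,\gamma(d)e'|e'',sx)$. * If $\alpha:S\circ_aR\to T$ is grafted from $\alpha_S:S\to T_S$ and $\alpha_R:R\to T_R$ (so $T=T_S\circ_{\alpha(a)}T_R$), and $\theta(x)=\sum x_1\otimes x_2$, then $$\Delta(\alpha,a\,d_Sd_R|e_Se_R,sx)=\sum(-1)^{\kappa}(\alpha_S,d_S|e_S,sx_1)\otimes(\alpha_R,d_R|e_R,sx_2),$$ $$\kappa=1+d_S+e_S+d_R+e_R+e_Sd_R+(d_R+e_R)(|x_1|+1)+|x_1|.$$ **Cobar construction.** $\Omega(Y)(R)$ is generated by the $(\alpha,b|d,s^{-1}y)$, $\alpha:R\to T$, $y\in Y(T)$, of degree $|y|-1-b-d$: it is the quotient of $\bigoplus_{(\alpha,b|d)}s^{-1}Y(T)$ by $(\alpha,b|d,s^{-1}y)=(\vartheta\alpha,b|\vartheta d,s^{-1}\vartheta_*y)$ and the same sign rule for permutations. The structure is as follows. * $\partial(\alpha,b|d,s^{-1}y)=\sum_{f}(f\alpha,b|d\,f,s^{-1}f_*y)+(-1)^{b+d}(\alpha,b|d,\partial(s^{-1}y))$,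 the sum being over isomorphism classes of codimension one morphisms $f:T\to T'$, whose new edge is also denoted $f$ (and $d$ also denotes its image in $T'$). * For $\beta:R'\to R$, $\beta^*(\alpha,\beta(b')b''|d,s^{-1}y)=(\alpha\beta,b'|\alpha(b'')d,s^{-1}y)$, where $b''$ enumerates the inner edges of $R$ not in the image of $\beta$. * With $\Delta(y)=\sum y_1\otimes y_2$, the structure map $\Omega(Y)(S\circ_aR)\to\Omega(Y)(S)\otimes\Omega(Y)(R)$ sends $(\alpha,a\,d_Sd_R|e_Se_R,s^{-1}y)$ to $$\sum(-1)^{\lambda}(\alpha_S,d_S|e_S,s^{-1}y_1)\otimes(\alpha_R,d_R|e_R,s^{-1}y_2),$$ $$\lambda=(d_S+e_S)(d_R+e_R)+d_Re_S+(d_R+e_R)(|y_1|-1)+|y_1|.$$ **Proposition.** These formulas define functors $\mathrm B$ from linear $\infty$-operads to linear $\infty$-cooperads and $\Omega$ from linear $\infty$-cooperads to linear $\infty$-operads, given on morphisms by $\mathrm B(f)(\alpha,d|e,sx)=(\alpha,d|e,sf(x))$ and $\Omega(f)(\alpha,b|d,s^{-1}y)=(\alpha,b|d,s^{-1}f(y))$.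 There is an adjunction $\Omega\dashv \mathrm B$ whose unit $\eta:Y\to \mathrm B\Omega(Y)$ (a map of $\infty$-cooperads) and counit $\varepsilon:\Omega \mathrm B(M)\to M$ (a map of $\infty$-operads) are given by $$\eta_S(y)=\sum_{\alpha}\bigl(\alpha,a|e,s(\mathrm{id}_T,\alpha(a)\,e|-,s^{-1}\alpha_*y)\bigr),$$ the sum being over isomorphism classes of morphisms $\alpha:S\to T$ in $\mathbb A$, with any choice of enumerations $a$ of the inner edges of $S$ and $e$ of the inner edges of $T$ not in the image of $\alpha$, and $$\varepsilon_S\bigl(\alpha,a|e,s^{-1}(\beta,\alpha(a)\,e|f,sx)\bigr)=\begin{cases}\alpha^*\beta^*x&\text{if }\operatorname{codim}\beta=0,\\0&\text{if }\operatorname{codim}\beta>0.\end{cases}$$ -/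

import Mathlib

open CategoryTheory MonoidalCategory Opposite
open scoped DirectSum

universe u

/-! ## Open reduced trees -/

/-- A finite rooted tree all of whose vertices have at least two inputs, described by its partially
ordered set `E` of edges: `x ≤ y` means that the path from `x` to the root passes through `y`.
The leaves are the minimal edges; a vertex is the same thing as an edge `e` that is not a leaf (the
output of the vertex), and the inputs of that vertex are the edges covered by `e`. The tree with a
single edge and no vertex is allowed. -/
structure IsReducedTree (E : Type) [PartialOrder E] (root : E) : Prop where
  le_root : ∀ e : E, e ≤ root
  comparable : ∀ {e x y : E}, e ≤ x → e ≤ y → x ≤ y ∨ y ≤ x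
  two_inputs : ∀ e : E, ¬ IsMin e → ∃ x y : E, x ≠ y ∧ x ⋖ e ∧ y ⋖ e

/-- The elements of a finite set of names, without any order. -/
def EdgeSet (s : Finset ℕ) : Type := {n : ℕ // n ∈ s}

theorem EdgeSet.ext {s : Finset ℕ} {x y : EdgeSet s} (h : x.1 = y.1) : x = y := Subtype.ext h

/-- The objects of the category `𝔸`: open reduced trees. The edges carry natural numbers as names
(only in order to obtain a small category; the order of `ℕ` plays no role). -/
structure RTree : Type where
  names : Finset ℕ
  order : PartialOrder (EdgeSet names)
  root : EdgeSet names
  isTree : @IsReducedTree (EdgeSet names) order root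

namespace RTree

/-- The type of edges of a tree. -/
def Edge (T : RTree) : Type := EdgeSet T.names

instance (T : RTree) : PartialOrder T.Edge := T.order
instance (T : RTree) : DecidableEq T.Edge :=
  inferInstanceAs (DecidableEq {n : ℕ // n ∈ T.names})
instance (T : RTree) : Fintype T.Edge :=
  inferInstanceAs (Fintype {n : ℕ // n ∈ T.names})

/-- The root edge. -/
def rootEdge (T : RTree) : T.Edge := T.root

theorem tree (T : RTree) : IsReducedTree T.Edge T.rootEdge := T.isTree

/-- The set of leaves. -/
def leaves (T : RTree) : Set T.Edge := {e | IsMin e}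

/-- Inner edges: neither a leaf nor the root. -/
def IsInner (T : RTree) (e : T.Edge) : Prop := ¬ IsMin e ∧ e ≠ T.rootEdge

/-- Morphisms of `𝔸`: maps of trees preserving the root and inducing a bijection between the sets
of leaves. Such a map is an isomorphism onto a tree obtained by contracting inner edges, that is,
onto a set of edges containing the root and all leaves, with the induced order. -/
@[ext] structure Hom (S T : RTree) : Type where
  toEmb : S.Edge ↪o T.Edge
  map_root : toEmb S.rootEdge = T.rootEdge
  bijOn_leaves : Set.BijOn toEmb S.leaves T.leaves

instance : Category RTree where
  Hom := Hom
  id S := ⟨RelEmbedding.refl _, rfl, Set.bijOn_id _⟩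
  comp f g := ⟨f.toEmb.trans g.toEmb,
    (congrArg g.toEmb f.map_root).trans g.map_root, g.bijOn_leaves.comp f.bijOn_leaves⟩

instance (S T : RTree) : CoeFun (S ⟶ T) (fun _ => S.Edge → T.Edge) where
  coe f := Hom.toEmb f

theorem isMin_map_iff {S T : RTree} (f : S ⟶ T) (e : S.Edge) : IsMin (f e) ↔ IsMin e := by
  constructor
  · intro h x hx
    have := h ((Hom.toEmb f).le_iff_le.2 hx)
    exact (Hom.toEmb f).le_iff_le.1 this
  · intro h
    exact (Hom.bijOn_leaves f).1 h

theorem isInner_map_iff {S T : RTree} (f : S ⟶ T) (e : S.Edge) : T.IsInner (f e) ↔ S.IsInner e := by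
  unfold IsInner
  rw [isMin_map_iff, ← Hom.map_root f]
  exact and_congr Iff.rfl (Hom.toEmb f).injective.ne_iff

/-! ### Contraction of an inner edge -/

section Contract

variable (T : RTree) (c : T.Edge)

/-- The inclusion of the edges other than `c`. -/
def eraseIncl (x : EdgeSet (T.names.erase c.1)) : T.Edge :=
  ⟨x.1, Finset.mem_of_mem_erase x.2⟩

theorem eraseIncl_injective : Function.Injective (T.eraseIncl c) := by
  intro x y h
  exact EdgeSet.ext (congrArg (fun e : T.Edge => e.1) h)

theorem eraseIncl_ne (x : EdgeSet (T.names.erase c.1)) : T.eraseIncl c x ≠ c := by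
  intro h
  exact Finset.ne_of_mem_erase x.2 (congrArg (fun e : T.Edge => e.1) h)

theorem exists_eraseIncl {y : T.Edge} (h : y ≠ c) : ∃ x, T.eraseIncl c x = y :=
  ⟨⟨y.1, Finset.mem_erase.2 ⟨fun h' => h (EdgeSet.ext h'), y.2⟩⟩, rfl⟩

variable {c}

/-- The face `∂_c T` of `T` that contracts the inner edge `c`. -/
def contract (hc : T.IsInner c) : RTree where
  names := T.names.erase c.1
  order := PartialOrder.lift (T.eraseIncl c) (T.eraseIncl_injective c)
  root := ⟨T.rootEdge.1, Finset.mem_erase.2 ⟨fun h => hc.2 (EdgeSet.ext h.symm), T.rootEdge.2⟩⟩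
  isTree := by
    let _ : PartialOrder (EdgeSet (T.names.erase c.1)) :=
      PartialOrder.lift (T.eraseIncl c) (T.eraseIncl_injective c)
    have hle : ∀ x y : EdgeSet (T.names.erase c.1),
        x ≤ y ↔ T.eraseIncl c x ≤ T.eraseIncl c y := fun _ _ => Iff.rfl
    have hlt : ∀ x y : EdgeSet (T.names.erase c.1),
        x < y ↔ T.eraseIncl c x < T.eraseIncl c y := fun _ _ => Iff.rfl
    refine ⟨fun e => T.tree.le_root _, fun h h' => T.tree.comparable h h', fun e he => ?_⟩
    have he' : ¬ IsMin (T.eraseIncl c e) := by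
      intro h
      exact he fun x hx => h hx
    by_cases hce : c ⋖ T.eraseIncl c e
    · obtain ⟨p, q, hpq, hp, hq⟩ := T.tree.two_inputs c hc.1
      have key : ∀ p : T.Edge, p ⋖ c → ∃ x, T.eraseIncl c x = p ∧ x ⋖ e := by
        intro p hp
        obtain ⟨x, hx⟩ := T.exists_eraseIncl c hp.lt.ne
        refine ⟨x, hx, (hlt _ _).2 (hx ▸ hp.lt.trans hce.lt), fun z hz hz' => ?_⟩
        rw [hlt, hx] at hz
        rw [hlt] at hz'
        rcases T.tree.comparable hz.le hp.le with h | h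
        · exact hp.2 hz (lt_of_le_of_ne h (T.eraseIncl_ne c z))
        · exact hce.2 (lt_of_le_of_ne h (T.eraseIncl_ne c z).symm) hz'
      obtain ⟨x, hx, hxe⟩ := key p hp
      obtain ⟨y, hy, hye⟩ := key q hq
      exact ⟨x, y, fun h => hpq (by rw [← hx, ← hy, h]), hxe, hye⟩
    · obtain ⟨p, q, hpq, hp, hq⟩ := T.tree.two_inputs _ he'
      have key : ∀ p : T.Edge, p ⋖ T.eraseIncl c e → ∃ x, T.eraseIncl c x = p ∧ x ⋖ e := by
        intro p hp
        obtain ⟨x, hx⟩ := T.exists_eraseIncl c (y := p) (fun h => hce (h ▸ hp))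
        refine ⟨x, hx, (hlt _ _).2 (hx ▸ hp.lt), fun z hz hz' => ?_⟩
        rw [hlt, hx] at hz
        exact hp.2 hz hz'
      obtain ⟨x, hx, hxe⟩ := key p hp
      obtain ⟨y, hy, hye⟩ := key q hq
      exact ⟨x, y, fun h => hpq (by rw [← hx, ← hy, h]), hxe, hye⟩

/-- The face map `∂_c : ∂_c T ⟶ T`. -/
def face (hc : T.IsInner c) : T.contract hc ⟶ T where
  toEmb := ⟨⟨T.eraseIncl c, T.eraseIncl_injective c⟩, Iff.rfl⟩
  map_root := rfl
  bijOn_leaves := by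
    refine ⟨fun x hx y hy => ?_, (T.eraseIncl_injective c).injOn, fun y hy => ?_⟩
    · change y ≤ T.eraseIncl c x at hy
      change T.eraseIncl c x ≤ y
      have hx' : ∀ z, T.eraseIncl c z ≤ T.eraseIncl c x → T.eraseIncl c x ≤ T.eraseIncl c z :=
        fun z hz => hx hz
      by_cases hyc : y = c
      · subst hyc
        obtain ⟨p, -, -, hp, -⟩ := T.tree.two_inputs y hc.1
        obtain ⟨z, hz⟩ := T.exists_eraseIncl y hp.lt.ne
        have := hx' z (hz ▸ hp.le.trans hy)
        exact this.trans (hz ▸ hp.le)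
      · obtain ⟨z, rfl⟩ := T.exists_eraseIncl c hyc
        exact hx' z hy
    · have hyc : y ≠ c := fun h => hc.1 (h ▸ hy)
      obtain ⟨z, rfl⟩ := T.exists_eraseIncl c hyc
      exact ⟨z, fun w hw => hy hw, rfl⟩

variable {T} in
/-- An edge other than `c`, seen as an edge of `∂_c T`. -/
def restrictEdge (hc : T.IsInner c) (y : T.Edge) (hy : y ≠ c) : (T.contract hc).Edge :=
  ⟨y.1, Finset.mem_erase.2 ⟨fun h => hy (EdgeSet.ext h), y.2⟩⟩

theorem range_face (hc : T.IsInner c) : Set.range (T.face hc) = {c}ᶜ := by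
  ext y
  constructor
  · rintro ⟨x, rfl⟩
    exact T.eraseIncl_ne c x
  · intro h
    exact T.exists_eraseIncl c h

variable {T}

/-- The unique factorisation `∂_c^* α` of `α : S ⟶ T` through the face map `∂_c`, when the inner
edge `c` is not in the image of `α`. -/
def liftFace {S : RTree} (hc : T.IsInner c) (α : S ⟶ T) (h : c ∉ Set.range α) :
    S ⟶ T.contract hc where
  toEmb := ⟨⟨fun x => ⟨(α x).1, Finset.mem_erase.2
      ⟨fun h' => h ⟨x, EdgeSet.ext h'⟩, (α x).2⟩⟩, fun x y hxy => by
        apply (Hom.toEmb α).injective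
        exact EdgeSet.ext (congrArg (fun e => e.1) hxy)⟩, (Hom.toEmb α).le_iff_le⟩
  map_root := EdgeSet.ext (congrArg (fun e : T.Edge => e.1) (Hom.map_root α))
  bijOn_leaves := by
    refine ⟨fun x hx => ?_, ?_, fun y hy => ?_⟩
    · intro w hw
      exact (Hom.bijOn_leaves α).1 hx hw
    · intro x _ y _ hxy
      apply (Hom.toEmb α).injective
      exact EdgeSet.ext (congrArg (fun e => e.1) hxy)
    · obtain ⟨x, hx, hxy⟩ := (Hom.bijOn_leaves α).2.2 ((Hom.bijOn_leaves (T.face hc)).1 hy)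
      exact ⟨x, hx, EdgeSet.ext (congrArg (fun e => e.1) hxy)⟩

theorem liftFace_face {S : RTree} (hc : T.IsInner c) (α : S ⟶ T) (h : c ∉ Set.range α) :
    liftFace hc α h ≫ T.face hc = α := rfl

end Contract

/-! ### Grafting -/

/-- A presentation of the tree `T` as the grafting `S ∘_a R` of `R` on top of `S` at the leaf `a` of
`S`, both trees having at least one vertex: `S` is embedded as the set of edges of `T` that are not
strictly below `inl a` in the order of `T`, `R` as the set of edges that are `≤ inl a`, and the root
of `R` is identified with `a`. The inner edges of `T` are then those of `S`, those of `R` and `a`.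
Such a `T` exists and is unique up to a unique isomorphism compatible with the embeddings. -/
structure Grafting (S : RTree) (a : S.Edge) (R T : RTree) : Type where
  inl : S.Edge ↪o T.Edge
  inr : R.Edge ↪o T.Edge
  isMin : IsMin a
  ne_root : a ≠ S.rootEdge
  has_vertex : ¬ IsMin R.rootEdge
  glue : inl a = inr R.rootEdge
  range_inl : Set.range inl = {e | ¬ e < inl a}
  range_inr : Set.range inr = {e | e ≤ inl a}

/-- `δ : T ⟶ T'` is the morphism `β ∘ γ : S ∘_a R ⟶ S' ∘_{a'} R'` induced by `β` and `γ`. -/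
structure Grafting.Compatible {S S' R R' T T' : RTree} {a : S.Edge} {a' : S'.Edge}
    (g : Grafting S a R T) (g' : Grafting S' a' R' T')
    (β : S ⟶ S') (γ : R ⟶ R') (δ : T ⟶ T') : Prop where
  map_leaf : β a = a'
  inl : ∀ e, δ (g.inl e) = g'.inl (β e)
  inr : ∀ e, δ (g.inr e) = g'.inr (γ e)

end RTree

/-! ## Chain complexes -/

/-- The Koszul sign `(-1)^p` in the differential `d(x ⊗ y) = dx ⊗ y + (-1)^p x ⊗ dy`, `x` of
degree `p`, of the tensor product of chain complexes graded by the integers. -/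
instance instTensorSignsDownInt : ComplexShape.TensorSigns (ComplexShape.down ℤ) where
  ε' := MonoidHom.mk' (fun i : Multiplicative ℤ => Int.negOnePow i.toAdd)
    (fun i j => Int.negOnePow_add i.toAdd j.toAdd)
  rel_add p q r (hpq : q + 1 = p) := by change q + r + 1 = p + r; lia
  add_rel p q r (hpq : q + 1 = p) := by change r + q + 1 = r + p; lia
  ε'_succ p q (hpq : q + 1 = p) := by
    subst hpq
    change Int.negOnePow q = - Int.negOnePow (q + 1)
    rw [Int.negOnePow_succ, neg_neg]

/-- Unbounded chain complexes of `k`-modules. -/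
abbrev Ch (k : Type u) [CommRing k] := ChainComplex (ModuleCat.{u} k) ℤ

noncomputable section

section

variable {k : Type u} [CommRing k]

/-- The component in degree `m` of the symmetry `x ⊗ y ↦ (-1)^{pq} y ⊗ x` of the tensor product. -/
def koszulSwapX (K L : Ch k) (m : ℤ) : (K ⊗ L).X m ⟶ (L ⊗ K).X m :=
  HomologicalComplex.mapBifunctorDesc (fun p q (h : p + q = m) =>
    (p * q).negOnePow • ((β_ (K.X p) (L.X q)).hom ≫
      HomologicalComplex.ιTensorObj L K q p m (by rw [add_comm, h])))

/-- The symmetry `K ⊗ L ⟶ L ⊗ K` of the tensor product of chain complexes. -/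
def koszulSwap (K L : Ch k) : K ⊗ L ⟶ L ⊗ K where
  f m := koszulSwapX K L m
  comm' m m' hm := by
    have hm' : m' + 1 = m := hm
    apply HomologicalComplex.mapBifunctor.hom_ext
    intro p q (h : p + q = m)
    change _ ≫ koszulSwapX K L m ≫ (HomologicalComplex.tensorObj L K).d m m' =
      _ ≫ (HomologicalComplex.tensorObj K L).d m m' ≫ koszulSwapX K L m'
    have hp : (ComplexShape.down ℤ).Rel p (p - 1) := by change p - 1 + 1 = p; lia
    have hq : (ComplexShape.down ℤ).Rel q (q - 1) := by change q - 1 + 1 = q; lia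
    rw [koszulSwapX, HomologicalComplex.ι_mapBifunctorDesc_assoc,
      HomologicalComplex.mapBifunctor.d_eq, HomologicalComplex.mapBifunctor.d_eq]
    simp only [Preadditive.comp_add, Preadditive.add_comp, Linear.units_smul_comp, Category.assoc,
      HomologicalComplex.mapBifunctor.ι_D₁, HomologicalComplex.mapBifunctor.ι_D₂,
      HomologicalComplex.mapBifunctor.ι_D₁_assoc, HomologicalComplex.mapBifunctor.ι_D₂_assoc]
    rw [HomologicalComplex.mapBifunctor.d₁_eq L K _ _ hq p m' (by change q - 1 + p = m'; lia),
      HomologicalComplex.mapBifunctor.d₂_eq L K _ _ q hp m' (by change q + (p - 1) = m'; lia),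
      HomologicalComplex.mapBifunctor.d₁_eq K L _ _ hp q m' (by change p - 1 + q = m'; lia),
      HomologicalComplex.mapBifunctor.d₂_eq K L _ _ p hq m' (by change p + (q - 1) = m'; lia)]
    simp only [koszulSwapX, Linear.units_smul_comp, Category.assoc,
      HomologicalComplex.ι_mapBifunctorDesc, Linear.comp_units_smul]
    have e₁ : (β_ (K.X p) (L.X q)).hom ≫ (L.d q (q - 1) ▷ K.X p) =
        (K.X p ◁ L.d q (q - 1)) ≫ (β_ (K.X p) (L.X (q - 1))).hom :=
      (BraidedCategory.braiding_naturality_right _ _).symm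
    have e₂ : (β_ (K.X p) (L.X q)).hom ≫ (L.X q ◁ K.d p (p - 1)) =
        (K.d p (p - 1) ▷ L.X q) ≫ (β_ (K.X (p - 1)) (L.X q)).hom :=
      (BraidedCategory.braiding_naturality_left _ _).symm
    have s₁ : ((p * q).negOnePow : ℤˣ) = p.negOnePow * (p * (q - 1)).negOnePow := by
      rw [← Int.negOnePow_add]; congr 1; ring
    have s₂ : ((p * q).negOnePow : ℤˣ) * q.negOnePow = ((p - 1) * q).negOnePow := by
      rw [← Int.negOnePow_add, show p * q + q = (p - 1) * q + 2 * q by ring, Int.negOnePow_add,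
        Int.negOnePow_two_mul, mul_one]
    change (p * q).negOnePow • (1 : ℤˣ) • ((β_ (K.X p) (L.X q)).hom ≫
        (L.d q (q - 1) ▷ K.X p) ≫ HomologicalComplex.ιTensorObj L K (q - 1) p m' _) +
      (p * q).negOnePow • q.negOnePow • ((β_ (K.X p) (L.X q)).hom ≫
        (L.X q ◁ K.d p (p - 1)) ≫ HomologicalComplex.ιTensorObj L K q (p - 1) m' _) =
      (1 : ℤˣ) • ((p - 1) * q).negOnePow • ((K.d p (p - 1) ▷ L.X q) ≫
        (β_ (K.X (p - 1)) (L.X q)).hom ≫ HomologicalComplex.ιTensorObj L K q (p - 1) m' _) +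
      p.negOnePow • (p * (q - 1)).negOnePow • ((K.X p ◁ L.d q (q - 1)) ≫
        (β_ (K.X p) (L.X (q - 1))).hom ≫ HomologicalComplex.ιTensorObj L K (q - 1) p m' _)
    rw [reassoc_of% e₁, reassoc_of% e₂, one_smul, one_smul, smul_smul, smul_smul, ← s₁, s₂,
      add_comm]

end

/-! ## Linear ∞-operads and ∞-cooperads -/

variable (k : Type u) [CommRing k]

/-- A linear `∞`-preoperad: a presheaf of chain complexes `M` on `𝔸` with natural structure maps
`θ : M(S ∘_a R) ⟶ M(S) ⊗ M(R)` satisfying the two associativity axioms of partial compositions. -/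
structure LinearPreoperad where
  /-- the underlying presheaf -/
  pre : RTreeᵒᵖ ⥤ Ch k
  /-- the structure maps, one for each presentation of a tree `T` as a grafting `S ∘_a R` -/
  θ : ∀ {S : RTree} {a : S.Edge} {R T : RTree}, RTree.Grafting S a R T →
    (pre.obj (op T) ⟶ pre.obj (op S) ⊗ pre.obj (op R))
  /-- naturality in `S` and `R` -/
  naturality : ∀ {S S' R R' T T' : RTree} {a : S.Edge} {a' : S'.Edge}
    (g : RTree.Grafting S a R T) (g' : RTree.Grafting S' a' R' T')
    (β : S ⟶ S') (γ : R ⟶ R') (δ : T ⟶ T'), g.Compatible g' β γ δ →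
    pre.map δ.op ≫ θ g = θ g' ≫ (pre.map β.op ⊗ₘ pre.map γ.op)
  /-- `T = S ∘_a (R ∘_b Q) = (S ∘_a R) ∘_b Q` -/
  assoc_seq : ∀ {S R Q RQ SR T : RTree} {a : S.Edge} {b : R.Edge}
    (g₁ : RTree.Grafting R b Q RQ) (g₂ : RTree.Grafting S a RQ T)
    (g₃ : RTree.Grafting S a R SR) (g₄ : RTree.Grafting SR (g₃.inr b) Q T),
    (∀ e, g₄.inl (g₃.inl e) = g₂.inl e) → (∀ e, g₄.inl (g₃.inr e) = g₂.inr (g₁.inl e)) →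
    (∀ e, g₄.inr e = g₂.inr (g₁.inr e)) →
    θ g₂ ≫ (pre.obj (op S) ◁ θ g₁) = θ g₄ ≫ (θ g₃ ▷ pre.obj (op Q)) ≫ (α_ _ _ _).hom
  /-- `T = (S ∘_a R) ∘_c Q = (S ∘_c Q) ∘_a R` for distinct leaves `a`, `c` of `S` -/
  assoc_par : ∀ {S R Q SR SQ T : RTree} {a c : S.Edge}, a ≠ c →
    ∀ (g₁ : RTree.Grafting S a R SR) (g₂ : RTree.Grafting SR (g₁.inl c) Q T)
    (g₃ : RTree.Grafting S c Q SQ) (g₄ : RTree.Grafting SQ (g₃.inl a) R T),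
    (∀ e, g₂.inl (g₁.inl e) = g₄.inl (g₃.inl e)) → (∀ e, g₂.inl (g₁.inr e) = g₄.inr e) →
    (∀ e, g₂.inr e = g₄.inl (g₃.inr e)) →
    θ g₂ ≫ (θ g₁ ▷ pre.obj (op Q)) ≫ (α_ _ _ _).hom ≫
      (pre.obj (op S) ◁ koszulSwap (pre.obj (op R)) (pre.obj (op Q))) =
    θ g₄ ≫ (θ g₃ ▷ pre.obj (op R)) ≫ (α_ _ _ _).hom

/-- A linear `∞`-precooperad: a covariant functor `Y` from `𝔸` to chain complexes with natural
structure maps `Δ : Y(S ∘_a R) ⟶ Y(S) ⊗ Y(R)` satisfying the two coassociativity axioms. -/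
structure LinearPrecooperad where
  /-- the underlying functor -/
  cop : RTree ⥤ Ch k
  /-- the structure maps, one for each presentation of a tree `T` as a grafting `S ∘_a R` -/
  Δ : ∀ {S : RTree} {a : S.Edge} {R T : RTree}, RTree.Grafting S a R T →
    (cop.obj T ⟶ cop.obj S ⊗ cop.obj R)
  /-- naturality in `S` and `R` -/
  naturality : ∀ {S S' R R' T T' : RTree} {a : S.Edge} {a' : S'.Edge}
    (g : RTree.Grafting S a R T) (g' : RTree.Grafting S' a' R' T')
    (β : S ⟶ S') (γ : R ⟶ R') (δ : T ⟶ T'), g.Compatible g' β γ δ →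
    cop.map δ ≫ Δ g' = Δ g ≫ (cop.map β ⊗ₘ cop.map γ)
  /-- `T = S ∘_a (R ∘_b Q) = (S ∘_a R) ∘_b Q` -/
  assoc_seq : ∀ {S R Q RQ SR T : RTree} {a : S.Edge} {b : R.Edge}
    (g₁ : RTree.Grafting R b Q RQ) (g₂ : RTree.Grafting S a RQ T)
    (g₃ : RTree.Grafting S a R SR) (g₄ : RTree.Grafting SR (g₃.inr b) Q T),
    (∀ e, g₄.inl (g₃.inl e) = g₂.inl e) → (∀ e, g₄.inl (g₃.inr e) = g₂.inr (g₁.inl e)) →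
    (∀ e, g₄.inr e = g₂.inr (g₁.inr e)) →
    Δ g₂ ≫ (cop.obj S ◁ Δ g₁) = Δ g₄ ≫ (Δ g₃ ▷ cop.obj Q) ≫ (α_ _ _ _).hom
  /-- `T = (S ∘_a R) ∘_c Q = (S ∘_c Q) ∘_a R` for distinct leaves `a`, `c` of `S` -/
  assoc_par : ∀ {S R Q SR SQ T : RTree} {a c : S.Edge}, a ≠ c →
    ∀ (g₁ : RTree.Grafting S a R SR) (g₂ : RTree.Grafting SR (g₁.inl c) Q T)
    (g₃ : RTree.Grafting S c Q SQ) (g₄ : RTree.Grafting SQ (g₃.inl a) R T),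
    (∀ e, g₂.inl (g₁.inl e) = g₄.inl (g₃.inl e)) → (∀ e, g₂.inl (g₁.inr e) = g₄.inr e) →
    (∀ e, g₂.inr e = g₄.inl (g₃.inr e)) →
    Δ g₂ ≫ (Δ g₁ ▷ cop.obj Q) ≫ (α_ _ _ _).hom ≫
      (cop.obj S ◁ koszulSwap (cop.obj R) (cop.obj Q)) =
    Δ g₄ ≫ (Δ g₃ ▷ cop.obj R) ≫ (α_ _ _ _).hom

variable {k}

/-- A morphism of `∞`-preoperads: a morphism of presheaves compatible with the structure maps. -/
@[ext] structure LinearPreoperad.Hom (M N : LinearPreoperad k) where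
  nat : M.pre ⟶ N.pre
  comm : ∀ {S : RTree} {a : S.Edge} {R T : RTree} (g : RTree.Grafting S a R T),
    M.θ g ≫ (nat.app (op S) ⊗ₘ nat.app (op R)) = nat.app (op T) ≫ N.θ g

instance : Category (LinearPreoperad k) where
  Hom := LinearPreoperad.Hom
  id M := ⟨𝟙 _, fun g => by simp⟩
  comp f f' := ⟨f.nat ≫ f'.nat, fun g => by
    rw [NatTrans.comp_app, NatTrans.comp_app, ← MonoidalCategory.tensorHom_comp_tensorHom,
      reassoc_of% (f.comm g), f'.comm g, NatTrans.comp_app, Category.assoc]⟩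
  id_comp f := LinearPreoperad.Hom.ext (Category.id_comp _)
  comp_id f := LinearPreoperad.Hom.ext (Category.comp_id _)
  assoc f f' f'' := LinearPreoperad.Hom.ext (Category.assoc _ _ _)

/-- A morphism of `∞`-precooperads: a natural transformation compatible with the structure maps. -/
@[ext] structure LinearPrecooperad.Hom (Y Z : LinearPrecooperad k) where
  nat : Y.cop ⟶ Z.cop
  comm : ∀ {S : RTree} {a : S.Edge} {R T : RTree} (g : RTree.Grafting S a R T),
    Y.Δ g ≫ (nat.app S ⊗ₘ nat.app R) = nat.app T ≫ Z.Δ g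

instance : Category (LinearPrecooperad k) where
  Hom := LinearPrecooperad.Hom
  id M := ⟨𝟙 _, fun g => by simp⟩
  comp f f' := ⟨f.nat ≫ f'.nat, fun g => by
    rw [NatTrans.comp_app, NatTrans.comp_app, ← MonoidalCategory.tensorHom_comp_tensorHom,
      reassoc_of% (f.comm g), f'.comm g, NatTrans.comp_app, Category.assoc]⟩
  id_comp f := LinearPrecooperad.Hom.ext (Category.id_comp _)
  comp_id f := LinearPrecooperad.Hom.ext (Category.comp_id _)
  assoc f f' f'' := LinearPrecooperad.Hom.ext (Category.assoc _ _ _)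

/-- The structure maps are quasi-isomorphisms. -/
def LinearPreoperad.IsInftyOperad : ObjectProperty (LinearPreoperad k) := fun M =>
  ∀ {S : RTree} {a : S.Edge} {R T : RTree} (g : RTree.Grafting S a R T), QuasiIso (M.θ g)

/-- The structure maps are quasi-isomorphisms. -/
def LinearPrecooperad.IsInftyCooperad : ObjectProperty (LinearPrecooperad k) := fun Y =>
  ∀ {S : RTree} {a : S.Edge} {R T : RTree} (g : RTree.Grafting S a R T), QuasiIso (Y.Δ g)

variable (k) in
/-- The category of linear `∞`-operads. -/
abbrev LinearInftyOperad := (LinearPreoperad.IsInftyOperad (k := k)).FullSubcategory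

variable (k) in
/-- The category of linear `∞`-cooperads. -/
abbrev LinearInftyCooperad := (LinearPrecooperad.IsInftyCooperad (k := k)).FullSubcategory

/-! ## Extensions of a tree -/

/-- `l` is an enumeration of the finite set `s`. -/
def Enumerates {α : Type} (l : List α) (s : Set α) : Prop := l.Nodup ∧ ∀ x, x ∈ l ↔ x ∈ s

/-- The index set of the bar and cobar constructions at the tree `S`: a morphism `map : S ⟶ tgt` of
`𝔸`, an enumeration `old` of the inner edges of `S` and an enumeration `new` of the inner edges
of `tgt` that are not in the image of `S`. Written `(α, d|e)` below. -/
structure Extension (S : RTree) : Type where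
  tgt : RTree
  map : S ⟶ tgt
  old : List S.Edge
  new : List tgt.Edge
  old_enum : Enumerates old {e | S.IsInner e}
  new_enum : Enumerates new {e | tgt.IsInner e ∧ e ∉ Set.range map}

namespace Extension

variable {S : RTree}

/-- The number of inner edges of the target. -/
def len (x : Extension S) : ℕ := x.old.length + x.new.length

/-- The morphisms of the groupoid `H_S` acting on these data: an isomorphism `θ` of extensions of
`S`, together with permutations of the two enumerations (written as permutations of the enumerated
edges). -/
structure Arrow (x y : Extension S) : Type where
  θ : x.tgt ≅ y.tgt
  map_eq : x.map ≫ θ.hom = y.map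
  σ : Equiv.Perm S.Edge
  τ : Equiv.Perm x.tgt.Edge
  σ_fix : ∀ e, e ∉ x.old → σ e = e
  τ_fix : ∀ e, e ∉ x.new → τ e = e
  old_eq : y.old = x.old.map σ
  new_eq : y.new = (x.new.map τ).map (fun e => θ.hom e)

/-- The sign `(-1)^σ (-1)^τ`. -/
def Arrow.sign {x y : Extension S} (φ : Arrow x y) : ℤˣ :=
  Equiv.Perm.sign φ.σ * Equiv.Perm.sign φ.τ

/-- The set of connected components of the groupoid `H_S`. -/
def Component (S : RTree) : Type := Quot fun x y : Extension S => Nonempty (Arrow x y)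

/-- The set of connected components of the groupoid `H_S` consisting of extensions of
codimension `1`. -/
def Component₁ (S : RTree) : Type :=
  Quot fun x y : {x : Extension S // x.new.length = 1} => Nonempty (Arrow x.1 y.1)

theorem get_inner (x : Extension S) (i : Fin x.new.length) : x.tgt.IsInner (x.new.get i) :=
  ((x.new_enum.2 _).1 (x.new.get_mem i)).1

theorem get_notMem (x : Extension S) (i : Fin x.new.length) :
    x.new.get i ∉ Set.range x.map :=
  ((x.new_enum.2 _).1 (x.new.get_mem i)).2

theorem ne_of_mem_eraseIdx (x : Extension S) (i : Fin x.new.length) :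
    ∀ e ∈ x.new.eraseIdx i, e ≠ x.new.get i := by
  intro e he h
  rw [← x.new_enum.1.erase_get i, h] at he
  exact x.new_enum.1.not_mem_erase he

/-- For `(α : S ⟶ T, d|e)`, the index `(∂_c^* α, d|e_0 … ê_i … e_{p-1})` with `c = e_i`. -/
def face (x : Extension S) (i : Fin x.new.length) : Extension S where
  tgt := x.tgt.contract (x.get_inner i)
  map := RTree.liftFace (x.get_inner i) x.map (x.get_notMem i)
  old := x.old
  new := (x.new.eraseIdx i).pmap (RTree.restrictEdge (x.get_inner i)) (x.ne_of_mem_eraseIdx i)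
  old_enum := x.old_enum
  new_enum := by
    refine ⟨(x.new_enum.1.eraseIdx _).pmap fun a _ b _ h =>
      EdgeSet.ext (congrArg (fun e => e.1) h), fun e => ?_⟩
    rw [List.mem_pmap]
    constructor
    · rintro ⟨a, ha, rfl⟩
      obtain ⟨h, h'⟩ := (x.new_enum.2 a).1 (List.mem_of_mem_eraseIdx ha)
      refine ⟨(RTree.isInner_map_iff (x.tgt.face (x.get_inner i)) _).1 h, ?_⟩
      rintro ⟨b, hb⟩
      exact h' ⟨b, congrArg (x.tgt.face (x.get_inner i)) hb⟩
    · rintro ⟨h, h'⟩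
      have hne : x.tgt.face (x.get_inner i) e ≠ x.new.get i := x.tgt.eraseIncl_ne _ e
      have hmem : x.tgt.face (x.get_inner i) e ∈ x.new := by
        refine (x.new_enum.2 _).2 ⟨(RTree.isInner_map_iff _ _).2 h, ?_⟩
        rintro ⟨b, hb⟩
        exact h' ⟨b, (RTree.Hom.toEmb (x.tgt.face (x.get_inner i))).injective hb⟩
      refine ⟨x.tgt.face (x.get_inner i) e, ?_, rfl⟩
      rw [← x.new_enum.1.erase_get i]
      exact (List.mem_erase_of_ne hne).2 hmem

theorem len_face (x : Extension S) (i : Fin x.new.length) : (x.face i).len + 1 = x.len := by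
  have h : (x.new.eraseIdx i).length + 1 = x.new.length := List.length_eraseIdx_add_one i.2
  simp only [len, face, List.length_pmap]
  lia

/-- The composite of `(α : S ⟶ T, d|e)` with an extension `(β : T ⟶ U, _|f)`, namely
`(β α, d|β(e) f)`. -/
def comp (x : Extension S) (z : Extension x.tgt) : Extension S where
  tgt := z.tgt
  map := x.map ≫ z.map
  old := x.old
  new := x.new.map z.map ++ z.new
  old_enum := x.old_enum
  new_enum := by
    refine ⟨?_, fun e => ?_⟩
    · refine List.nodup_append'.2 ⟨x.new_enum.1.map (RTree.Hom.toEmb z.map).injective,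
        z.new_enum.1, fun e he he' => ?_⟩
      obtain ⟨a, -, rfl⟩ := List.mem_map.1 he
      exact ((z.new_enum.2 _).1 he').2 ⟨a, rfl⟩
    · rw [List.mem_append, List.mem_map, z.new_enum.2]
      constructor
      · rintro (⟨a, ha, rfl⟩ | ⟨h, h'⟩)
        · obtain ⟨h, h'⟩ := (x.new_enum.2 _).1 ha
          refine ⟨(RTree.isInner_map_iff _ _).2 h, ?_⟩
          rintro ⟨b, hb⟩
          exact h' ⟨b, (RTree.Hom.toEmb z.map).injective hb⟩
        · refine ⟨h, ?_⟩
          rintro ⟨b, rfl⟩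
          exact h' ⟨x.map b, rfl⟩
      · rintro ⟨h, h'⟩
        by_cases hz : e ∈ Set.range z.map
        · obtain ⟨a, rfl⟩ := hz
          refine Or.inl ⟨a, (x.new_enum.2 _).2 ⟨(RTree.isInner_map_iff _ _).1 h, ?_⟩, rfl⟩
          rintro ⟨b, rfl⟩
          exact h' ⟨b, rfl⟩
        · exact Or.inr ⟨h, hz⟩

/-- For `(α : S ⟶ T, d|e)`, the index `(id_T, α(d) e|-)` at the tree `T`. -/
def top (x : Extension S) : Extension x.tgt where
  tgt := x.tgt
  map := 𝟙 _
  old := x.old.map x.map ++ x.new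
  new := []
  old_enum := by
    refine ⟨?_, fun e => ?_⟩
    · refine List.nodup_append'.2 ⟨x.old_enum.1.map (RTree.Hom.toEmb x.map).injective,
        x.new_enum.1, fun e he he' => ?_⟩
      obtain ⟨a, -, rfl⟩ := List.mem_map.1 he
      exact ((x.new_enum.2 _).1 he').2 ⟨a, rfl⟩
    · rw [List.mem_append, List.mem_map, x.new_enum.2]
      constructor
      · rintro (⟨a, ha, rfl⟩ | ⟨h, h'⟩)
        · exact (RTree.isInner_map_iff _ _).2 ((x.old_enum.2 _).1 ha)
        · exact h
      · intro h
        by_cases hz : e ∈ Set.range x.map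
        · obtain ⟨a, rfl⟩ := hz
          exact Or.inl ⟨a, (x.old_enum.2 _).2 ((RTree.isInner_map_iff _ _).1 h), rfl⟩
        · exact Or.inr ⟨h, hz⟩
  new_enum := ⟨List.nodup_nil, fun e => ⟨fun h => (List.not_mem_nil h).elim,
    fun h => (h.2 ⟨e, rfl⟩).elim⟩⟩

theorem len_comp (x : Extension S) (z : Extension x.tgt) :
    (x.comp z).len = x.len + z.new.length := by
  simp only [len, comp, List.length_append, List.length_map]
  lia

theorem len_top (x : Extension S) : x.top.len = x.len := by
  simp only [len, top, List.length_append, List.length_map, List.length_nil]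
  lia

/-- The extension `x = (α : S ∘_a R ⟶ T, a d_S d_R|e_S e_R)` is degrafted into
`xS = (α_S : S ⟶ T_S, d_S|e_S)` and `xR = (α_R : R ⟶ T_R, d_R|e_R)`, where
`T = T_S ∘_{α a} T_R` and `α = α_S ∘ α_R`. -/
structure Degrafting {S : RTree} {a : S.Edge} {R U : RTree} (g : RTree.Grafting S a R U)
    (x : Extension U) (xS : Extension S) (xR : Extension R) : Type where
  /-- the presentation `T = T_S ∘_{α a} T_R` -/
  graft : RTree.Grafting xS.tgt (xS.map a) xR.tgt x.tgt
  compat : g.Compatible graft xS.map xR.map x.map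
  old_eq : x.old = g.inl a :: (xS.old.map g.inl ++ xR.old.map g.inr)
  new_eq : x.new = xS.new.map graft.inl ++ xR.new.map graft.inr

theorem Degrafting.len_eq {S : RTree} {a : S.Edge} {R U : RTree} {g : RTree.Grafting S a R U}
    {x : Extension U} {xS : Extension S} {xR : Extension R} (D : Degrafting g x xS xR) :
    x.len = 1 + xS.len + xR.len := by
  simp only [len, D.old_eq, D.new_eq, List.length_cons, List.length_append, List.length_map]
  lia

end Extension
/-! ## The bar construction -/

section Bar

variable {k : Type u} [CommRing k]

/-- The summands of `⨁ M(T)` contributing to degree `m` of the bar construction at `S`: an element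
`(α, d|e, sx)` with `x` of degree `n` has degree `|d| + |e| + (n + 1)`. -/
def BarIndex (S : RTree) (m : ℤ) : Type := Σ x : Extension S, {n : ℤ // x.len + (n + 1) = m}

open Classical in
/-- The identifications `(α, d|e, s θ^* v) = ± (θ α, d σ|θ e τ, s v)` made in the coinvariants. -/
def barRelations (M : RTreeᵒᵖ ⥤ Ch k) (S : RTree) (m : ℤ) :
    Set (⨁ i : BarIndex S m, (M.obj (op i.1.tgt)).X i.2.1) :=
  {w | ∃ (x y : Extension S) (φ : Extension.Arrow x y) (n : ℤ) (hx : x.len + (n + 1) = m)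
    (hy : y.len + (n + 1) = m) (v : (M.obj (op y.tgt)).X n),
    w = DirectSum.lof k (BarIndex S m) (fun i => (M.obj (op i.1.tgt)).X i.2.1) ⟨x, n, hx⟩
        ((M.map φ.θ.hom.op).f n v)
      - ((φ.sign : ℤˣ) : ℤ) • DirectSum.lof k (BarIndex S m)
        (fun i => (M.obj (op i.1.tgt)).X i.2.1) ⟨y, n, hy⟩ v}

/-- The module `Bar_m(M)(S)`: the coinvariants of `⨁ sM(T)`, the sum over `(α : S ⟶ T, d|e)`. -/
def barX (M : RTreeᵒᵖ ⥤ Ch k) (S : RTree) (m : ℤ) : ModuleCat.{u} k :=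
  ModuleCat.of k ((⨁ i : BarIndex S m, (M.obj (op i.1.tgt)).X i.2.1) ⧸
    Submodule.span k (barRelations M S m))

open Classical in
/-- The map `v ↦ (α, d|e, sv)`. -/
def barι (M : RTreeᵒᵖ ⥤ Ch k) {S : RTree} (x : Extension S) (n m : ℤ) (h : x.len + (n + 1) = m) :
    (M.obj (op x.tgt)).X n ⟶ barX M S m :=
  ModuleCat.ofHom ((Submodule.span k (barRelations M S m)).mkQ ∘ₗ
    DirectSum.lof k (BarIndex S m) (fun i => (M.obj (op i.1.tgt)).X i.2.1) ⟨x, n, h⟩)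

/-- An identification of the graded modules underlying a precooperad `Y` with the bar construction
of `M`. -/
abbrev BarIso (M : LinearPreoperad k) (Y : LinearPrecooperad k) :=
  ∀ (S : RTree) (m : ℤ), barX M.pre S m ≅ (Y.cop.obj S).X m

/-- The map `v ↦ (α, d|e, sv)`, as a map to `Y(S)`. -/
def BarIso.ι {M : LinearPreoperad k} {Y : LinearPrecooperad k} (b : BarIso M Y) {S : RTree}
    (x : Extension S) (n m : ℤ) (h : x.len + (n + 1) = m) :
    (M.pre.obj (op x.tgt)).X n ⟶ (Y.cop.obj S).X m :=
  barι M.pre x n m h ≫ (b S m).hom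

/-- Under the identification `b`, the differential, the covariant functoriality and the structure
maps of `Y` are those of the bar construction of `M`. -/
structure BarIso.IsBar {M : LinearPreoperad k} {Y : LinearPrecooperad k} (b : BarIso M Y) :
    Prop where
  /-- The differential `∂_ext + ∂_int`:
  `∂ (α, d|e, sv) = ∑ i, (-1)^{d+i} (∂_{e_i}^* α, d|e_0 … ê_i … e_{p-1}, s ∂_{e_i}^* v)
    + (-1)^{d+e} (α, d|e, ∂(sv))`, with `∂(sv) = - s ∂v`. -/
  d_eq : ∀ {S : RTree} (x : Extension S) (n m : ℤ) (h : x.len + (n + 1) = m),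
    b.ι x n m h ≫ (Y.cop.obj S).d m (m - 1) =
      ∑ i : Fin x.new.length, Int.negOnePow (x.old.length + (i : ℕ)) •
        ((M.pre.map (x.tgt.face (x.get_inner i)).op).f n ≫
          b.ι (x.face i) n (m - 1) (by have := x.len_face i; lia))
      + Int.negOnePow (x.old.length + x.new.length + 1) •
        ((M.pre.obj (op x.tgt)).d n (n - 1) ≫ b.ι x (n - 1) (m - 1) (by lia))
  /-- `γ_* (α, d|e, sv) = 0` if `α` does not factor through `γ : S ⟶ S'`. -/
  map_eq_zero : ∀ {S S' : RTree} (γ : S ⟶ S') (x : Extension S) (n m : ℤ)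
    (h : x.len + (n + 1) = m), (¬ ∃ β : S' ⟶ x.tgt, γ ≫ β = x.map) →
    b.ι x n m h ≫ (Y.cop.map γ).f m = 0
  /-- `γ_* (β γ, d|β(e') e'', sv) = (β, γ(d) e'|e'', sv)`. -/
  map_eq : ∀ {S S' T : RTree} (γ : S ⟶ S') (β : S' ⟶ T) (d : List S.Edge) (e' : List S'.Edge)
    (e'' : List T.Edge) (h₁ h₂ h₃ h₄) (n m : ℤ) (h h'),
    b.ι ⟨T, γ ≫ β, d, e'.map β ++ e'', h₁, h₂⟩ n m h ≫ (Y.cop.map γ).f m =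
      b.ι ⟨T, β, d.map γ ++ e', e'', h₃, h₄⟩ n m h'
  /-- `Δ (α, a d_S d_R|e_S e_R, sv) =
    ∑ ± (α_S, d_S|e_S, s θ_{(1)} v) ⊗ (α_R, d_R|e_R, s θ_{(2)} v)`; the sign is the product of
  the sign `(-1)^{1 + d_S + e_S + d_R + e_R + e_S d_R}`, of the sign `(-1)^{(d_R + e_R)(p + 1)}`
  that moves `s θ_{(1)} v` past `(α_R, d_R|e_R)`, and of the sign `(-1)^p` in
  `(s ⊗ s)(θ_{(1)} v ⊗ θ_{(2)} v)`, where `p` is the degree of `θ_{(1)} v`. -/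
  comul_eq : ∀ {S : RTree} {a : S.Edge} {R U : RTree} (g : RTree.Grafting S a R U)
    (x : Extension U) (xS : Extension S) (xR : Extension R) (D : x.Degrafting g xS xR)
    (n m : ℤ) (h : x.len + (n + 1) = m),
    b.ι x n m h ≫ (Y.Δ g).f m =
      (M.θ D.graft).f n ≫ HomologicalComplex.mapBifunctorDesc (fun p q (hpq : p + q = n) =>
        Int.negOnePow ((1 + xS.old.length + xS.new.length + xR.old.length + xR.new.length
            + xS.new.length * xR.old.length : ℕ)
          + (xR.old.length + xR.new.length : ℕ) * (p + 1) + p) •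
        ((b.ι xS p (xS.len + (p + 1)) rfl ⊗ₘ b.ι xR q (xR.len + (q + 1)) rfl) ≫
          HomologicalComplex.ιTensorObj (Y.cop.obj S) (Y.cop.obj R) _ _ m
            (by have := D.len_eq; omega)))

end Bar

/-! ## The cobar construction -/

section Cobar

variable {k : Type u} [CommRing k]

/-- The summands of `⨁ Y(T)` contributing to degree `m` of the cobar construction at `R`: an
element `(α, b|d, s⁻¹y)` with `y` of degree `n` has degree `(n - 1) - (|b| + |d|)`. -/
def CobarIndex (R : RTree) (m : ℤ) : Type := Σ x : Extension R, {n : ℤ // n - 1 - x.len = m}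

open Classical in
/-- The identifications `(α, b|d, s⁻¹v) = ± (θ α, b σ|θ d τ, s⁻¹ θ_* v)` made in the coinvariants. -/
def cobarRelations (Y : RTree ⥤ Ch k) (R : RTree) (m : ℤ) :
    Set (⨁ i : CobarIndex R m, (Y.obj i.1.tgt).X i.2.1) :=
  {w | ∃ (x y : Extension R) (φ : Extension.Arrow x y) (n : ℤ) (hx : n - 1 - x.len = m)
    (hy : n - 1 - y.len = m) (v : (Y.obj x.tgt).X n),
    w = DirectSum.lof k (CobarIndex R m) (fun i => (Y.obj i.1.tgt).X i.2.1) ⟨x, n, hx⟩ v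
      - ((φ.sign : ℤˣ) : ℤ) • DirectSum.lof k (CobarIndex R m)
        (fun i => (Y.obj i.1.tgt).X i.2.1) ⟨y, n, hy⟩ ((Y.map φ.θ.hom).f n v)}

/-- The module `Cobar_m(Y)(R)`: the coinvariants of `⨁ s⁻¹Y(T)`, the sum over
`(α : R ⟶ T, b|d)`. -/
def cobarX (Y : RTree ⥤ Ch k) (R : RTree) (m : ℤ) : ModuleCat.{u} k :=
  ModuleCat.of k ((⨁ i : CobarIndex R m, (Y.obj i.1.tgt).X i.2.1) ⧸
    Submodule.span k (cobarRelations Y R m))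

open Classical in
/-- The map `v ↦ (α, b|d, s⁻¹v)`. -/
def cobarι (Y : RTree ⥤ Ch k) {R : RTree} (x : Extension R) (n m : ℤ) (h : n - 1 - x.len = m) :
    (Y.obj x.tgt).X n ⟶ cobarX Y R m :=
  ModuleCat.ofHom ((Submodule.span k (cobarRelations Y R m)).mkQ ∘ₗ
    DirectSum.lof k (CobarIndex R m) (fun i => (Y.obj i.1.tgt).X i.2.1) ⟨x, n, h⟩)

/-- An identification of the graded modules underlying a preoperad `M` with the cobar construction
of `Y`. -/
abbrev CobarIso (Y : LinearPrecooperad k) (M : LinearPreoperad k) :=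
  ∀ (R : RTree) (m : ℤ), cobarX Y.cop R m ≅ (M.pre.obj (op R)).X m

/-- The map `v ↦ (α, b|d, s⁻¹v)`, as a map to `M(R)`. -/
def CobarIso.ι {Y : LinearPrecooperad k} {M : LinearPreoperad k} (c : CobarIso Y M) {R : RTree}
    (x : Extension R) (n m : ℤ) (h : n - 1 - x.len = m) :
    (Y.cop.obj x.tgt).X n ⟶ (M.pre.obj (op R)).X m :=
  cobarι Y.cop x n m h ≫ (c R m).hom

/-- Under the identification `c`, the differential, the contravariant functoriality and the
structure maps of `M` are those of the cobar construction of `Y`. -/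
structure CobarIso.IsCobar {Y : LinearPrecooperad k} {M : LinearPreoperad k} (c : CobarIso Y M) :
    Prop where
  /-- The differential `∂_ext + ∂_int`:
  `∂ (α, b|d, s⁻¹v) = ∑_f (f α, b|d f, s⁻¹ f_* v) + (-1)^{b+d} (α, b|d, ∂(s⁻¹v))`, with
  `∂(s⁻¹v) = - s⁻¹ ∂v`. The sum is over the (finitely many) classes of codimension one extensions
  `f : T ⟶ T'` of the target `T` of `α`, and `f` also denotes the new edge. -/
  d_eq : ∀ {R : RTree} (x : Extension R) (n m : ℤ) (h : n - 1 - x.len = m),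
    c.ι x n m h ≫ (M.pre.obj (op R)).d m (m - 1) =
      (∑ᶠ z : Extension.Component₁ x.tgt,
        (Y.cop.map z.out.1.map).f n ≫
          c.ι (x.comp z.out.1) n (m - 1) (by
            have := x.len_comp z.out.1; have := z.out.2; lia))
      + Int.negOnePow (x.old.length + x.new.length + 1) •
        ((Y.cop.obj x.tgt).d n (n - 1) ≫ c.ι x (n - 1) (m - 1) (by lia))
  /-- `β^* (α, b' b''|d, s⁻¹v) = (α β, b'|α(b'') d, s⁻¹v)`, where the edges `b'` of `R` are in the
  image of `β : R' ⟶ R` and the edges `b''` are not. -/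
  map_eq : ∀ {R R' T : RTree} (β : R' ⟶ R) (α : R ⟶ T) (b' : List R'.Edge) (b'' : List R.Edge)
    (d : List T.Edge) (h₁ h₂ h₃ h₄) (n m : ℤ) (h h'),
    c.ι ⟨T, α, b'.map β ++ b'', d, h₁, h₂⟩ n m h ≫ (M.pre.map β.op).f m =
      c.ι ⟨T, β ≫ α, b', b''.map α ++ d, h₃, h₄⟩ n m h'
  /-- `θ (α, a d_S d_R|e_S e_R, s⁻¹v) =
    ∑ ± (α_S, d_S|e_S, s⁻¹ Δ_{(1)} v) ⊗ (α_R, d_R|e_R, s⁻¹ Δ_{(2)} v)`; the sign is the product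
  of the sign `(-1)^{(d_S + e_S)(d_R + e_R) + d_R e_S}`, of the sign `(-1)^{(d_R + e_R)(p - 1)}`
  that moves `s⁻¹ Δ_{(1)} v` past `(α_R, d_R|e_R)`, and of the sign `(-1)^p` in
  `(s⁻¹ ⊗ s⁻¹)(Δ_{(1)} v ⊗ Δ_{(2)} v)`, where `p` is the degree of `Δ_{(1)} v`. -/
  mul_eq : ∀ {S : RTree} {a : S.Edge} {R U : RTree} (g : RTree.Grafting S a R U)
    (x : Extension U) (xS : Extension S) (xR : Extension R) (D : x.Degrafting g xS xR)
    (n m : ℤ) (h : n - 1 - x.len = m),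
    c.ι x n m h ≫ (M.θ g).f m =
      (Y.Δ D.graft).f n ≫ HomologicalComplex.mapBifunctorDesc (fun p q (hpq : p + q = n) =>
        Int.negOnePow (((xS.old.length + xS.new.length) * (xR.old.length + xR.new.length)
            + xR.old.length * xS.new.length : ℕ)
          + (xR.old.length + xR.new.length : ℕ) * (p - 1) + p) •
        ((c.ι xS p (p - 1 - xS.len) rfl ⊗ₘ c.ι xR q (q - 1 - xR.len) rfl) ≫
          HomologicalComplex.ιTensorObj (M.pre.obj (op S)) (M.pre.obj (op R)) _ _ m
            (by have := D.len_eq; omega)))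

end Cobar

end

noncomputable section

/-! ## Graded maps between chain complexes -/

section GradedMaps

variable {k : Type u} [CommRing k]

/-- Families of linear maps `K_p ⟶ L_{p + a}`. -/
@[ext] structure GradedMap (a : ℤ) (K L : Ch k) where
  /-- the components -/
  app : ∀ p q : ℤ, p + a = q → (K.X p ⟶ L.X q)

instance (a : ℤ) (K L : Ch k) :
    CoeFun (GradedMap a K L) (fun _ => ∀ p q : ℤ, p + a = q → (K.X p ⟶ L.X q)) where
  coe := GradedMap.app

instance (a : ℤ) (K L : Ch k) : Add (GradedMap a K L) where
  add u v := ⟨fun p q h => u p q h + v p q h⟩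

instance (a : ℤ) (K L : Ch k) : Zero (GradedMap a K L) where
  zero := ⟨fun _ _ _ => 0⟩

instance (a : ℤ) (K L : Ch k) : Neg (GradedMap a K L) where
  neg u := ⟨fun p q h => - u p q h⟩

instance (a : ℤ) (K L : Ch k) : AddCommGroup (GradedMap a K L) where
  add_assoc _ _ _ := GradedMap.ext (funext₃ fun _ _ _ => add_assoc _ _ _)
  zero_add _ := GradedMap.ext (funext₃ fun _ _ _ => zero_add _)
  add_zero _ := GradedMap.ext (funext₃ fun _ _ _ => add_zero _)
  neg_add_cancel _ := GradedMap.ext (funext₃ fun _ _ _ => neg_add_cancel _)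
  add_comm _ _ := GradedMap.ext (funext₃ fun _ _ _ => add_comm _ _)
  nsmul := nsmulRec
  zsmul := zsmulRec

namespace GradedMap

variable {a b c a' b' : ℤ} {K L N K' L' N' K'' L'' : Ch k}

theorem hom_ext {u v : GradedMap a K L} (h : ∀ p q h, u p q h = v p q h) : u = v :=
  GradedMap.ext (funext₃ h)

theorem units_smul_apply (s : ℤˣ) (u : GradedMap a K L) (p q : ℤ) (h) :
    (s • u) p q h = s • u p q h := by
  rcases Int.units_eq_one_or s with rfl | rfl
  · rw [one_smul, one_smul]
  · rw [Units.neg_smul, one_smul, Units.neg_smul, one_smul]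
    rfl

/-- Composition with a chain map. -/
def post (u : GradedMap a K L) (f : L ⟶ N) : GradedMap a K N := ⟨fun p q h => u p q h ≫ f.f q⟩

/-- Precomposition with a chain map. -/
def pre (f : K ⟶ L) (u : GradedMap a L N) : GradedMap a K N := ⟨fun p q h => f.f p ≫ u p q h⟩

/-- Composition of graded maps. -/
def comp (u : GradedMap a K L) (v : GradedMap b L N) : GradedMap (a + b) K N :=
  ⟨fun p q h => u p (p + a) rfl ≫ v (p + a) q (by rw [← h, add_assoc])⟩

/-- Composition with the differential of the target. -/
def postD (u : GradedMap a K L) : GradedMap (a - 1) K L :=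
  ⟨fun p q _ => u p (p + a) rfl ≫ L.d (p + a) q⟩

/-- Precomposition with the differential of the source. -/
def preD (u : GradedMap a K L) : GradedMap (a - 1) K L :=
  ⟨fun p q h => K.d p (p - 1) ≫ u (p - 1) q (by lia)⟩

theorem postD_apply (u : GradedMap a K L) {p q r : ℤ} (h : p + (a - 1) = q) (h' : p + a = r) :
    u.postD p q h = u p r h' ≫ L.d r q := by
  subst h'; rfl

/-- The Koszul tensor product `x ⊗ y ↦ (-1)^{|v||x|} u x ⊗ v y` of graded maps. -/
def tens (u : GradedMap a K L) (v : GradedMap b K' L') :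
    GradedMap (a + b) (K ⊗ K') (L ⊗ L') := ⟨fun _ m h =>
  HomologicalComplex.mapBifunctorDesc (fun p q (hpq : p + q = _) =>
    (b * p).negOnePow • ((u p (p + a) rfl ⊗ₘ v q (q + b) rfl) ≫
      HomologicalComplex.ιTensorObj L L' (p + a) (q + b) m (by lia)))⟩

end GradedMap

theorem units_smul_tensorHom (s : ℤˣ) {X Y Z W : ModuleCat.{u} k} (f : X ⟶ Y) (g : Z ⟶ W) :
    (s • f) ⊗ₘ g = s • (f ⊗ₘ g) := by
  rcases Int.units_eq_one_or s with rfl | rfl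
  · simp
  · rw [Units.neg_smul, one_smul, Units.neg_smul, one_smul, eq_neg_iff_add_eq_zero,
      ← MonoidalPreadditive.add_tensor,
      neg_add_cancel, MonoidalPreadditive.zero_tensor]

theorem tensorHom_units_smul (s : ℤˣ) {X Y Z W : ModuleCat.{u} k} (f : X ⟶ Y) (g : Z ⟶ W) :
    f ⊗ₘ (s • g) = s • (f ⊗ₘ g) := by
  rcases Int.units_eq_one_or s with rfl | rfl
  · simp
  · rw [Units.neg_smul, one_smul, Units.neg_smul, one_smul, eq_neg_iff_add_eq_zero,
      ← MonoidalPreadditive.tensor_add,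
      neg_add_cancel, MonoidalPreadditive.tensor_zero]

/-- The inclusion of a summand of the tensor product. -/
def tensorIncl (K L : Ch k) (p q n : ℤ) (h : p + q = n) : K.X p ⊗ L.X q ⟶ (K ⊗ L).X n :=
  HomologicalComplex.ιTensorObj K L p q n h

theorem tensor_hom_ext {K L : Ch k} {n : ℤ} {A : ModuleCat.{u} k} {f g : (K ⊗ L).X n ⟶ A}
    (h : ∀ p q hpq, tensorIncl K L p q n hpq ≫ f = tensorIncl K L p q n hpq ≫ g) : f = g :=
  HomologicalComplex.mapBifunctor.hom_ext fun p q hpq => h p q hpq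

theorem tensorIncl_tensorHom {K L K' L' : Ch k} (f : K ⟶ L) (g : K' ⟶ L') (p q n : ℤ) (h) :
    tensorIncl K K' p q n h ≫ (f ⊗ₘ g).f n = (f.f p ⊗ₘ g.f q) ≫ tensorIncl L L' p q n h := by
  refine (HomologicalComplex.ι_mapBifunctorMap f g _ _ p q n h).trans ?_
  rw [MonoidalCategory.tensorHom_def, Category.assoc]
  rfl

theorem tensorIncl_tensorHom_assoc {K L K' L' : Ch k} (f : K ⟶ L) (g : K' ⟶ L') (p q n : ℤ) (h)
    {A : ModuleCat.{u} k} (w : (L ⊗ L').X n ⟶ A) :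
    tensorIncl K K' p q n h ≫ (f ⊗ₘ g).f n ≫ w =
      (f.f p ⊗ₘ g.f q) ≫ tensorIncl L L' p q n h ≫ w := by
  rw [← Category.assoc, tensorIncl_tensorHom, Category.assoc]

theorem tensorIncl_d {K L : Ch k} (p q p' q' n n' : ℤ) (h : p + q = n) (hn : n' + 1 = n)
    (hp : p' + 1 = p) (hq : q' + 1 = q) :
    tensorIncl K L p q n h ≫ (K ⊗ L).d n n' =
      (K.d p p' ▷ L.X q) ≫ tensorIncl K L p' q n' (by lia) +
      p.negOnePow • (K.X p ◁ L.d q q') ≫ tensorIncl K L p q' n' (by lia) := by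
  refine (congrArg _ (HomologicalComplex.mapBifunctor.d_eq K L _ _ n n')).trans ?_
  rw [Preadditive.comp_add]
  erw [HomologicalComplex.mapBifunctor.ι_D₁, HomologicalComplex.mapBifunctor.ι_D₂]
  rw [HomologicalComplex.mapBifunctor.d₁_eq K L _ _ hp q n' (by change p' + q = n'; lia),
    HomologicalComplex.mapBifunctor.d₂_eq K L _ _ p hq n' (by change p + q' = n'; lia)]
  change (1 : ℤˣ) • _ + _ = _
  rw [one_smul]
  rfl

theorem tensorIncl_d_assoc {K L : Ch k} (p q p' q' n n' : ℤ) (h : p + q = n) (hn : n' + 1 = n)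
    (hp : p' + 1 = p) (hq : q' + 1 = q) {A : ModuleCat.{u} k} (w : (K ⊗ L).X n' ⟶ A) :
    tensorIncl K L p q n h ≫ (K ⊗ L).d n n' ≫ w =
      ((K.d p p' ▷ L.X q) ≫ tensorIncl K L p' q n' (by lia) +
        p.negOnePow • (K.X p ◁ L.d q q') ≫ tensorIncl K L p q' n' (by lia)) ≫ w := by
  rw [← Category.assoc, tensorIncl_d p q p' q' n n' h hn hp hq]

theorem tensorIncl_koszulSwap {K L : Ch k} (p q n : ℤ) (h : p + q = n) :
    tensorIncl K L p q n h ≫ (koszulSwap K L).f n =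
      (p * q).negOnePow • (β_ (K.X p) (L.X q)).hom ≫ tensorIncl L K q p n (by lia) := by
  change HomologicalComplex.ιTensorObj K L p q n h ≫ koszulSwapX K L n = _
  rw [koszulSwapX, HomologicalComplex.ι_mapBifunctorDesc]
  rfl

theorem tensorIncl_koszulSwap_assoc {K L : Ch k} (p q n : ℤ) (h : p + q = n)
    {A : ModuleCat.{u} k} (w : (L ⊗ K).X n ⟶ A) :
    tensorIncl K L p q n h ≫ (koszulSwap K L).f n ≫ w =
      ((p * q).negOnePow • (β_ (K.X p) (L.X q)).hom ≫ tensorIncl L K q p n (by lia)) ≫ w := by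
  rw [← Category.assoc, tensorIncl_koszulSwap]

theorem tensorIncl_associator {K L N : Ch k} (p q r pq qr n : ℤ) (h₁ : p + q = pq)
    (h₂ : pq + r = n) (h₃ : q + r = qr) (h₄ : p + qr = n) :
    (tensorIncl K L p q pq h₁ ▷ N.X r) ≫ tensorIncl (K ⊗ L) N pq r n h₂ ≫ (α_ K L N).hom.f n =
      (α_ _ _ _).hom ≫ (K.X p ◁ tensorIncl L N q r qr h₃) ≫
        tensorIncl K (L ⊗ N) p qr n h₄ := by
  have e₁ := HomologicalComplex.mapBifunctor₁₂.ι_eq (curriedTensor (ModuleCat.{u} k))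
    (curriedTensor (ModuleCat.{u} k)) K L N (ComplexShape.down ℤ) (ComplexShape.down ℤ)
    p q r pq n h₁ h₂
  have e₂ := HomologicalComplex.mapBifunctor₂₃.ι_eq (curriedTensor (ModuleCat.{u} k))
    (curriedTensor (ModuleCat.{u} k)) K L N (ComplexShape.down ℤ) (ComplexShape.down ℤ)
    (ComplexShape.down ℤ) p q r qr n h₃ h₄
  have e₃ := HomologicalComplex.ι_mapBifunctorAssociatorX_hom
    (curriedAssociatorNatIso (ModuleCat.{u} k)) K L N (ComplexShape.down ℤ) (ComplexShape.down ℤ)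
    (ComplexShape.down ℤ) p q r n (by rw [← h₂, ← h₁]; rfl)
  rw [e₁, e₂] at e₃
  rw [← Category.assoc]
  exact e₃

theorem tensorIncl_associator_assoc {K L N : Ch k} (p q r pq qr n : ℤ) (h₁ : p + q = pq)
    (h₂ : pq + r = n) (h₃ : q + r = qr) (h₄ : p + qr = n) {A : ModuleCat.{u} k}
    (w : (K ⊗ L ⊗ N).X n ⟶ A) :
    (tensorIncl K L p q pq h₁ ▷ N.X r) ≫ tensorIncl (K ⊗ L) N pq r n h₂ ≫
        (α_ K L N).hom.f n ≫ w =
      (α_ _ _ _).hom ≫ (K.X p ◁ tensorIncl L N q r qr h₃) ≫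
        tensorIncl K (L ⊗ N) p qr n h₄ ≫ w := by
  have e := congrArg (· ≫ w) (tensorIncl_associator (K := K) (L := L) (N := N) p q r pq qr n
    h₁ h₂ h₃ h₄)
  simpa only [Category.assoc] using e

theorem tensor₃_hom_ext {K L N : Ch k} {n : ℤ} {A : ModuleCat.{u} k}
    {f g : ((K ⊗ L) ⊗ N).X n ⟶ A}
    (h : ∀ p q r pq h₁ h₂, (tensorIncl K L p q pq h₁ ▷ N.X r) ≫
        tensorIncl (K ⊗ L) N pq r n h₂ ≫ f =
      (tensorIncl K L p q pq h₁ ▷ N.X r) ≫ tensorIncl (K ⊗ L) N pq r n h₂ ≫ g) : f = g := by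
  refine HomologicalComplex.mapBifunctor₁₂.hom_ext (F₁₂ := curriedTensor (ModuleCat.{u} k))
    (G := curriedTensor (ModuleCat.{u} k)) (c₁₂ := ComplexShape.down ℤ) ?_
  intro p q r hpqr
  have e₁ := HomologicalComplex.mapBifunctor₁₂.ι_eq (curriedTensor (ModuleCat.{u} k))
    (curriedTensor (ModuleCat.{u} k)) K L N (ComplexShape.down ℤ) (ComplexShape.down ℤ)
    p q r (p + q) n rfl hpqr
  rw [e₁, Category.assoc, Category.assoc]
  exact h p q r (p + q) rfl hpqr

namespace GradedMap

variable {a b c a' b' : ℤ} {K L N K' L' N' K'' L'' : Ch k}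

theorem tensorIncl_tens (u : GradedMap a K L) (v : GradedMap b K' L') {p q p' q' n m : ℤ}
    (h : p + q = n) (hp : p + a = p') (hq : q + b = q') (hnm : n + (a + b) = m) :
    tensorIncl K K' p q n h ≫ u.tens v n m hnm =
      (b * p).negOnePow • (u p p' hp ⊗ₘ v q q' hq) ≫ tensorIncl L L' p' q' m (by lia) := by
  subst hp hq
  change HomologicalComplex.ιTensorObj K K' p q n h ≫ _ = _
  rw [tens, HomologicalComplex.ι_mapBifunctorDesc]
  rfl

theorem tensorIncl_tens_assoc (u : GradedMap a K L) (v : GradedMap b K' L') {p q p' q' n m : ℤ}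
    (h : p + q = n) (hp : p + a = p') (hq : q + b = q') (hnm : n + (a + b) = m)
    {A : ModuleCat.{u} k} (w : (L ⊗ L').X m ⟶ A) :
    tensorIncl K K' p q n h ≫ u.tens v n m hnm ≫ w =
      ((b * p).negOnePow • (u p p' hp ⊗ₘ v q q' hq) ≫
        tensorIncl L L' p' q' m (by lia)) ≫ w := by
  rw [← Category.assoc, tensorIncl_tens u v h hp hq]

theorem tens_post (u : GradedMap a K L) (v : GradedMap b K' L') (f : L ⟶ N) (g : L' ⟶ N')
    (n m : ℤ) (h : n + (a + b) = m) :
    u.tens v n m h ≫ (f ⊗ₘ g).f m = (u.post f).tens (v.post g) n m h := by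
  refine tensor_hom_ext fun p q hpq => ?_
  rw [tensorIncl_tens_assoc _ _ hpq rfl rfl, tensorIncl_tens _ _ hpq rfl rfl,
    Linear.units_smul_comp, Category.assoc, tensorIncl_tensorHom,
    MonoidalCategory.tensorHom_comp_tensorHom_assoc]
  rfl

theorem pre_tens (u : GradedMap a L N) (v : GradedMap b L' N') (f : K ⟶ L) (g : K' ⟶ L')
    (n m : ℤ) (h : n + (a + b) = m) :
    (f ⊗ₘ g).f n ≫ u.tens v n m h = (u.pre f).tens (v.pre g) n m h := by
  refine tensor_hom_ext fun p q hpq => ?_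
  rw [tensorIncl_tensorHom_assoc, tensorIncl_tens _ _ hpq rfl rfl, tensorIncl_tens _ _ hpq rfl rfl,
    Linear.comp_units_smul, MonoidalCategory.tensorHom_comp_tensorHom_assoc]
  rfl

theorem tens_comp (u : GradedMap a K L) (v : GradedMap b K' L') (u' : GradedMap a' L N)
    (v' : GradedMap b' L' N') (n m r : ℤ) (h : n + (a + b) = m) (h' : m + (a' + b') = r) :
    u.tens v n m h ≫ u'.tens v' m r h' =
      (b' * a).negOnePow • (u.comp u').tens (v.comp v') n r (by lia) := by
  refine tensor_hom_ext fun p q hpq => ?_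
  rw [tensorIncl_tens_assoc _ _ hpq rfl rfl, Linear.comp_units_smul,
    tensorIncl_tens _ _ hpq (p' := p + a + a') (q' := q + b + b') (by lia) (by lia),
    Linear.units_smul_comp, Category.assoc, tensorIncl_tens _ _ _ rfl rfl,
    Linear.comp_units_smul, MonoidalCategory.tensorHom_comp_tensorHom_assoc, smul_smul, smul_smul,
    ← Int.negOnePow_add, ← Int.negOnePow_add]
  congr 2
  ring

theorem tens_d (u : GradedMap a K L) (v : GradedMap b K' L') (n m r : ℤ) (h : n + (a + b) = m)
    (hr : r + 1 = m) :
    u.tens v n m h ≫ (L ⊗ L').d m r =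
      u.postD.tens v n r (by lia) + a.negOnePow • u.tens v.postD n r (by lia) := by
  refine tensor_hom_ext fun p q hpq => ?_
  rw [tensorIncl_tens_assoc _ _ hpq rfl rfl, Preadditive.comp_add, Linear.comp_units_smul,
    tensorIncl_tens _ _ hpq (p' := p + a - 1) (q' := q + b) (by lia) (by lia),
    tensorIncl_tens _ _ hpq (p' := p + a) (q' := q + b - 1) (by lia) (by lia),
    Linear.units_smul_comp, Category.assoc,
    tensorIncl_d _ _ (p + a - 1) (q + b - 1) _ _ _ hr (by lia) (by lia),
    postD_apply _ _ rfl, postD_apply _ _ rfl, Preadditive.comp_add, smul_add,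
    Linear.comp_units_smul, smul_smul, smul_smul, ← Int.negOnePow_add, ← Int.negOnePow_add,
    ← id_tensorHom, ← tensorHom_id, MonoidalCategory.tensorHom_comp_tensorHom_assoc,
    MonoidalCategory.tensorHom_comp_tensorHom_assoc, Category.comp_id, Category.comp_id]
  congr 2
  rw [Int.negOnePow_eq_iff]
  exact ⟨p, by ring⟩

theorem d_tens (u : GradedMap a K L) (v : GradedMap b K' L') (n m r : ℤ) (h : m + (a + b) = r)
    (hm : m + 1 = n) :
    (K ⊗ K').d n m ≫ u.tens v m r h =
      b.negOnePow • u.preD.tens v n r (by lia) + u.tens v.preD n r (by lia) := by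
  refine tensor_hom_ext fun p q hpq => ?_
  rw [tensorIncl_d_assoc _ _ (p - 1) (q - 1) _ _ _ hm (by lia) (by lia), Preadditive.comp_add,
    Preadditive.add_comp, Linear.comp_units_smul,
    tensorIncl_tens _ _ hpq (p' := p - 1 + a) (q' := q + b) (by lia) (by lia),
    tensorIncl_tens _ _ hpq (p' := p + a) (q' := q - 1 + b) (by lia) (by lia),
    Category.assoc, Linear.units_smul_comp, Category.assoc,
    tensorIncl_tens _ _ _ rfl rfl, tensorIncl_tens _ _ _ rfl rfl,
    Linear.comp_units_smul, Linear.comp_units_smul, smul_smul, smul_smul, ← Int.negOnePow_add,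
    ← Int.negOnePow_add,
    ← id_tensorHom, ← tensorHom_id, MonoidalCategory.tensorHom_comp_tensorHom_assoc,
    MonoidalCategory.tensorHom_comp_tensorHom_assoc, Category.id_comp, Category.id_comp]
  congr 2
  · rw [Int.negOnePow_eq_iff]
    exact ⟨-b, by ring⟩
  · rw [Int.negOnePow_eq_iff]
    exact ⟨p, by ring⟩

theorem tens_tens_associator (u : GradedMap a K L) (v : GradedMap b K' L')
    (w : GradedMap c K'' L'') (n m : ℤ) (h : n + (a + b + c) = m) :
    (u.tens v).tens w n m h ≫ (α_ L L' L'').hom.f m =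
      (α_ K K' K'').hom.f n ≫ u.tens (v.tens w) n m (by lia) := by
  refine tensor₃_hom_ext fun p q r pq h₁ h₂ => ?_
  rw [tensorIncl_tens_assoc _ _ h₂ rfl rfl, tensorIncl_associator_assoc _ _ _ _ _ _ h₁ h₂ rfl
    (by lia), tensorIncl_tens _ _ _ rfl rfl, Linear.units_smul_comp, Linear.comp_units_smul,
    Linear.comp_units_smul, Linear.comp_units_smul, Category.assoc, ← tensorHom_id,
    MonoidalCategory.tensorHom_comp_tensorHom_assoc, tensorIncl_tens _ _ h₁ rfl rfl,
    Category.id_comp, ← id_tensorHom, MonoidalCategory.tensorHom_comp_tensorHom_assoc,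
    tensorIncl_tens _ _ rfl rfl rfl, Category.id_comp]
  rw [tensorHom_units_smul, units_smul_tensorHom, Linear.units_smul_comp, Linear.units_smul_comp,
    Linear.comp_units_smul,
    smul_smul, smul_smul, ← Int.negOnePow_add, ← Int.negOnePow_add]
  congr 1
  · congr 1
    rw [← h₁]
    ring
  · rw [← Category.comp_id (w r (r + c) _), ← MonoidalCategory.tensorHom_comp_tensorHom,
      tensorHom_id, Category.assoc, tensorIncl_associator _ _ _ _ (q + r + (b + c)) _ _ _ (by lia)
      (by lia), Category.comp_id, MonoidalCategory.associator_naturality_assoc, ← id_tensorHom,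
      MonoidalCategory.tensorHom_comp_tensorHom_assoc, Category.comp_id]

theorem tens_koszulSwap (u : GradedMap a K L) (v : GradedMap b K' L') (n m : ℤ)
    (h : n + (a + b) = m) :
    u.tens v n m h ≫ (koszulSwap L L').f m =
      (a * b).negOnePow • (koszulSwap K K').f n ≫ v.tens u n m (by lia) := by
  refine tensor_hom_ext fun p q hpq => ?_
  rw [tensorIncl_tens_assoc _ _ hpq rfl rfl, Linear.units_smul_comp, Category.assoc,
    tensorIncl_koszulSwap, Linear.comp_units_smul, Linear.comp_units_smul,
    tensorIncl_koszulSwap_assoc, Linear.units_smul_comp, Category.assoc,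
    tensorIncl_tens _ _ _ rfl rfl, Linear.comp_units_smul, smul_smul, smul_smul, smul_smul,
    BraidedCategory.braiding_naturality_assoc, ← Int.negOnePow_add, ← Int.negOnePow_add,
    ← Int.negOnePow_add]
  congr 1
  rw [Int.negOnePow_eq_iff]
  exact ⟨b * p, by ring⟩

theorem add_tens (u u' : GradedMap a K L) (v : GradedMap b K' L') (n m : ℤ) (h) :
    (u + u').tens v n m h = u.tens v n m h + u'.tens v n m h := by
  refine tensor_hom_ext fun p q hpq => ?_
  rw [Preadditive.comp_add, tensorIncl_tens _ _ hpq rfl rfl, tensorIncl_tens _ _ hpq rfl rfl,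
    tensorIncl_tens _ _ hpq rfl rfl, ← smul_add, ← Preadditive.add_comp,
        ← MonoidalPreadditive.add_tensor]
  rfl

theorem tens_add (u : GradedMap a K L) (v v' : GradedMap b K' L') (n m : ℤ) (h) :
    u.tens (v + v') n m h = u.tens v n m h + u.tens v' n m h := by
  refine tensor_hom_ext fun p q hpq => ?_
  rw [Preadditive.comp_add, tensorIncl_tens _ _ hpq rfl rfl, tensorIncl_tens _ _ hpq rfl rfl,
    tensorIncl_tens _ _ hpq rfl rfl, ← smul_add, ← Preadditive.add_comp,
        ← MonoidalPreadditive.tensor_add]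
  rfl

theorem units_smul_tens (s : ℤˣ) (u : GradedMap a K L) (v : GradedMap b K' L') (n m : ℤ) (h) :
    (s • u).tens v n m h = s • u.tens v n m h := by
  refine tensor_hom_ext fun p q hpq => ?_
  rw [Linear.comp_units_smul, tensorIncl_tens _ _ hpq rfl rfl, tensorIncl_tens _ _ hpq rfl rfl,
    smul_comm, units_smul_apply, units_smul_tensorHom, Linear.units_smul_comp]

theorem tens_units_smul (s : ℤˣ) (u : GradedMap a K L) (v : GradedMap b K' L') (n m : ℤ) (h) :
    u.tens (s • v) n m h = s • u.tens v n m h := by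
  refine tensor_hom_ext fun p q hpq => ?_
  rw [Linear.comp_units_smul, tensorIncl_tens _ _ hpq rfl rfl, tensorIncl_tens _ _ hpq rfl rfl,
    smul_comm, units_smul_apply, tensorHom_units_smul, Linear.units_smul_comp]

end GradedMap

end GradedMaps

end

/-! ## Permutations of lists with signs -/

/-- `SPerm l l' s`: the list `l'` is obtained from `l` by a permutation of sign `s`. -/
inductive SPerm {α : Type} : List α → List α → ℤˣ → Prop
  | nil : SPerm [] [] 1
  | cons (a : α) {l l' : List α} {s : ℤˣ} : SPerm l l' s → SPerm (a :: l) (a :: l') s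
  | swap (a b : α) (l : List α) : SPerm (a :: b :: l) (b :: a :: l) (-1)
  | trans {l l' l'' : List α} {s t : ℤˣ} : SPerm l l' s → SPerm l' l'' t → SPerm l l'' (s * t)

namespace SPerm

variable {α β : Type} {l l' l₁ l₁' l₂ l₂' : List α} {s t : ℤˣ}

theorem refl (l : List α) : SPerm l l 1 := by
  induction l with
  | nil => exact nil
  | cons a l ih => exact ih.cons a

theorem of_eq (h : l = l') : SPerm l l' 1 := h ▸ refl l

theorem cast (h : SPerm l l' s) (e : s = t) : SPerm l l' t := e ▸ h

theorem symm (h : SPerm l l' s) : SPerm l' l s := by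
  induction h with
  | nil => exact nil
  | cons a _ ih => exact ih.cons a
  | swap a b l => exact swap b a l
  | trans _ _ ih ih' => exact (ih'.trans ih).cast (mul_comm _ _)

theorem perm (h : SPerm l l' s) : l.Perm l' := by
  induction h with
  | nil => exact .nil
  | cons a _ ih => exact ih.cons a
  | swap a b l => exact .swap b a l
  | trans _ _ ih ih' => exact ih.trans ih'

theorem exists_of_perm (h : l.Perm l') : ∃ s, SPerm l l' s := by
  induction h with
  | nil => exact ⟨1, nil⟩
  | cons a _ ih => exact ⟨_, ih.choose_spec.cons a⟩
  | swap a b l => exact ⟨-1, swap b a l⟩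
  | trans _ _ ih ih' => exact ⟨_, ih.choose_spec.trans ih'.choose_spec⟩

theorem map (f : α → β) (h : SPerm l l' s) : SPerm (l.map f) (l'.map f) s := by
  induction h with
  | nil => exact nil
  | cons a _ ih => exact ih.cons _
  | swap a b l => exact swap _ _ _
  | trans _ _ ih ih' => exact ih.trans ih'

theorem append_left (l₀ : List α) (h : SPerm l l' s) : SPerm (l₀ ++ l) (l₀ ++ l') s := by
  induction l₀ with
  | nil => exact h
  | cons a _ ih => exact ih.cons a

theorem append_right (l₀ : List α) (h : SPerm l l' s) : SPerm (l ++ l₀) (l' ++ l₀) s := by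
  induction h with
  | nil => exact refl _
  | cons a _ ih => exact ih.cons a
  | swap a b l => exact swap a b _
  | trans _ _ ih ih' => exact ih.trans ih'

theorem append (h : SPerm l₁ l₁' s) (h' : SPerm l₂ l₂' t) :
    SPerm (l₁ ++ l₂) (l₁' ++ l₂') (s * t) :=
  (h.append_right l₂).trans (h'.append_left l₁')

theorem middle (a : α) (l l' : List α) : SPerm (l ++ a :: l') (a :: (l ++ l')) ((-1) ^ l.length)
    := by
  induction l with
  | nil => exact (refl _).cast (by simp)
  | cons b l ih =>
    exact ((ih.cons b).trans (swap b a _)).cast (by simp [pow_succ])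

theorem append_comm (l l' : List α) :
    SPerm (l ++ l') (l' ++ l) ((-1) ^ (l.length * l'.length)) := by
  induction l with
  | nil => exact (of_eq (by simp)).cast (by simp)
  | cons a l ih =>
    refine ((ih.cons a).trans (middle a l' l).symm).cast ?_
    rw [List.length_cons, add_mul, pow_add, one_mul]

/-- Exchange of the two middle blocks. -/
theorem middle_comm (l₁ l₂ l₃ l₄ : List α) :
    SPerm (l₁ ++ l₂ ++ (l₃ ++ l₄)) (l₁ ++ l₃ ++ (l₂ ++ l₄)) ((-1) ^ (l₂.length * l₃.length)) := by
  have := ((append_comm l₂ l₃).append_right l₄).append_left l₁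
  simpa only [List.append_assoc] using this

section Perm

variable [Fintype α] [DecidableEq α]

theorem exists_equiv (h : SPerm l l' s) (hl : l.Nodup) :
    ∃ σ : Equiv.Perm α, (∀ e, e ∉ l → σ e = e) ∧ l' = l.map σ ∧ Equiv.Perm.sign σ = s := by
  induction h with
  | nil => exact ⟨1, fun _ _ => rfl, rfl, Equiv.Perm.sign_one⟩
  | cons a _ ih =>
    obtain ⟨σ, h, rfl, rfl⟩ := ih (List.nodup_cons.1 hl).2
    refine ⟨σ, fun e he => h e fun h' => he (List.mem_cons_of_mem _ h'), ?_, rfl⟩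
    rw [List.map_cons, h a (List.nodup_cons.1 hl).1]
  | swap a b l =>
    have hab : a ≠ b := fun h => (List.nodup_cons.1 hl).1 (h ▸ List.mem_cons_self)
    refine ⟨Equiv.swap a b, fun e he => ?_, ?_, Equiv.Perm.sign_swap hab⟩
    · rw [List.mem_cons, List.mem_cons, not_or, not_or] at he
      exact Equiv.swap_apply_of_ne_of_ne he.1 he.2.1
    · rw [List.map_cons, List.map_cons, Equiv.swap_apply_left, Equiv.swap_apply_right]
      congr 2
      refine (List.map_id l).symm.trans (List.map_congr_left fun e he => ?_)
      refine (Equiv.swap_apply_of_ne_of_ne ?_ ?_).symm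
      · rintro rfl
        exact (List.nodup_cons.1 hl).1 (List.mem_cons_of_mem _ he)
      · rintro rfl
        exact (List.nodup_cons.1 (List.nodup_cons.1 hl).2).1 he
  | trans h _ ih ih' =>
    obtain ⟨σ, h₁, rfl, rfl⟩ := ih hl
    obtain ⟨τ, h₂, rfl, rfl⟩ := ih' (h.perm.nodup_iff.1 hl)
    refine ⟨τ * σ, fun e he => ?_, by simp, by rw [map_mul, mul_comm]⟩
    rw [Equiv.Perm.mul_apply, h₁ e he]
    exact h₂ e fun h' => he (h.perm.mem_iff.2 h')

theorem of_equiv (hl : l.Nodup) (σ : Equiv.Perm α) (hσ : ∀ e, e ∉ l → σ e = e) :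
    SPerm l (l.map σ) (Equiv.Perm.sign σ) := by
  have hp : l.Perm (l.map σ) := by
    refine (List.perm_ext_iff_of_nodup hl (hl.map σ.injective)).2 fun a => ?_
    rw [List.mem_map]
    constructor
    · intro ha
      refine ⟨σ.symm a, ?_, σ.apply_symm_apply a⟩
      by_contra h
      have := hσ _ h
      rw [σ.apply_symm_apply] at this
      exact h (this ▸ ha)
    · rintro ⟨b, hb, rfl⟩
      by_contra h
      have := σ.injective (hσ _ h)
      exact h (this.symm ▸ hb)
  obtain ⟨s, hs⟩ := exists_of_perm hp
  obtain ⟨τ, h₁, h₂, rfl⟩ := hs.exists_equiv hl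
  have : σ = τ := by
    ext e
    by_cases he : e ∈ l
    · exact List.map_inj_left.1 h₂ e he
    · rw [hσ e he, h₁ e he]
  exact this ▸ hs

theorem unique (hl : l.Nodup) (h : SPerm l l' s) (h' : SPerm l l' t) : s = t := by
  obtain ⟨σ, h₁, h₂, rfl⟩ := h.exists_equiv hl
  obtain ⟨τ, h₃, h₄, rfl⟩ := h'.exists_equiv hl
  congr 1
  ext e
  by_cases he : e ∈ l
  · exact List.map_inj_left.1 (h₂.symm.trans h₄) e he
  · rw [h₁ e he, h₃ e he]

end Perm

theorem eraseIdx (l : List α) (i : Fin l.length) :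
    SPerm l (l.get i :: l.eraseIdx i) ((-1) ^ (i : ℕ)) := by
  have h := middle (l.get i) (l.take i) (l.drop (i + 1))
  rw [List.length_take, min_eq_left i.2.le, ← List.eraseIdx_eq_take_drop_succ] at h
  have e : l.take i ++ l.get i :: l.drop (i + 1) = l := by
    rw [List.get_eq_getElem, List.getElem_cons_drop, List.take_append_drop]
  rwa [e] at h

end SPerm

theorem Enumerates.perm {α : Type} {l l' : List α} {s : Set α} (h : Enumerates l s)
    (h' : Enumerates l' s) : l.Perm l' :=
  (List.perm_ext_iff_of_nodup h.1 h'.1).2 fun a => (h.2 a).trans (h'.2 a).symm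

theorem Enumerates.of_perm {α : Type} {l l' : List α} {s : Set α} (h : Enumerates l s)
    (h' : l.Perm l') : Enumerates l' s :=
  ⟨h'.nodup_iff.1 h.1, fun a => h'.mem_iff.symm.trans (h.2 a)⟩

theorem exists_enumerates {α : Type} [Finite α] (s : Set α) : ∃ l, Enumerates l s :=
  ⟨s.toFinite.toFinset.toList, Finset.nodup_toList _, fun x => by simp⟩

theorem enumerates_congr {α : Type} {l : List α} {s t : Set α} (h : Enumerates l s) (e : s = t) :
    Enumerates l t := e ▸ h

/-! ## Combinatorics of trees -/

namespace RTree

theorem hom_ext {S T : RTree} {f g : S ⟶ T} (h : ∀ e, f e = g e) : f = g :=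
  Hom.ext (RelEmbedding.ext h)

theorem comp_apply {S T U : RTree} (f : S ⟶ T) (g : T ⟶ U) (e : S.Edge) : (f ≫ g) e = g (f e) := rfl

theorem map_le_iff {S T : RTree} (f : S ⟶ T) {e e' : S.Edge} : f e ≤ f e' ↔ e ≤ e' :=
  (Hom.toEmb f).le_iff_le

theorem map_injective {S T : RTree} (f : S ⟶ T) : Function.Injective f := (Hom.toEmb f).injective

theorem iso_hom_inv_apply {S T : RTree} (θ : S ≅ T) (e : S.Edge) : θ.inv (θ.hom e) = e :=
  congrArg (fun f : S ⟶ S => f e) θ.hom_inv_id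

theorem iso_inv_hom_apply {S T : RTree} (θ : S ≅ T) (e : T.Edge) : θ.hom (θ.inv e) = e :=
  congrArg (fun f : T ⟶ T => f e) θ.inv_hom_id

theorem exists_leaf_le {T : RTree} (e : T.Edge) : ∃ l, IsMin l ∧ l ≤ e := by
  obtain ⟨l, hl, hm⟩ := Set.Finite.exists_le_minimal (Set.toFinite (Set.univ : Set T.Edge))
    (Set.mem_univ e)
  exact ⟨l, fun b hb => hm.2 (Set.mem_univ b) hb, hl⟩

/-- An edge of a reduced tree is determined by the leaves above it. -/
theorem le_of_leaves {T : RTree} {e e' : T.Edge} (h : ∀ l, IsMin l → l ≤ e → l ≤ e') : e ≤ e' := by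
  obtain ⟨l, hl, hle⟩ := exists_leaf_le e
  rcases T.tree.comparable hle (h l hl hle) with h₁ | h₁
  · exact h₁
  by_contra hne
  have hlt : e' < e := lt_of_le_not_ge h₁ hne
  obtain ⟨x, y, hxy, hx, hy⟩ := T.tree.two_inputs e fun hm => hne (hm h₁)
  have key : ∀ x y : T.Edge, x ≠ y → x ⋖ e → y ⋖ e → e' ≤ x → False := by
    intro x y hxy hx hy hex
    obtain ⟨m, hm, hmy⟩ := exists_leaf_le y
    have := (h m hm (hmy.trans hy.le)).trans hex
    rcases T.tree.comparable this hmy with h₂ | h₂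
    · exact hx.2 (lt_of_le_of_ne h₂ hxy) hy.lt
    · exact hy.2 (lt_of_le_of_ne h₂ hxy.symm) hx.lt
  obtain ⟨m, hm, hmx⟩ := exists_leaf_le x
  rcases T.tree.comparable (h m hm (hmx.trans hx.le)) hmx with h₂ | h₂
  · exact key x y hxy hx hy h₂
  · rcases h₂.lt_or_eq with h₃ | h₃
    · exact hx.2 h₃ hlt
    · exact key x y hxy hx hy h₃.ge

/-- The edges of `S` that are mapped above the edge `e` of `T`. -/
def below {S T : RTree} (α : S ⟶ T) (e : T.Edge) : Set S.Edge := {s | α s ≤ e}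

theorem below_subset_iff {S T : RTree} (α : S ⟶ T) {e e' : T.Edge} :
    below α e ⊆ below α e' ↔ e ≤ e' := by
  refine ⟨fun h => le_of_leaves fun l hl hle => ?_, fun h s hs => le_trans hs h⟩
  obtain ⟨s, -, rfl⟩ := (Hom.bijOn_leaves α).2.2 hl
  exact h hle

theorem below_injective {S T : RTree} (α : S ⟶ T) : Function.Injective (below α) := fun _ _ h =>
  le_antisymm ((below_subset_iff α).1 h.le) ((below_subset_iff α).1 h.ge)

theorem below_comp {S T U : RTree} (α : S ⟶ T) (f : T ⟶ U) (e : T.Edge) :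
    below (α ≫ f) (f e) = below α e := by
  ext s
  exact map_le_iff f

theorem below_map {S T : RTree} (α : S ⟶ T) (e : S.Edge) : below α (α e) = Set.Iic e := by
  ext s
  exact map_le_iff α

/-- Morphisms under `S` are unique. -/
theorem hom_unique {S T U : RTree} (α : S ⟶ T) {f g : T ⟶ U} (h : α ≫ f = α ≫ g) : f = g := by
  refine hom_ext fun e => below_injective (α ≫ f) ?_
  rw [below_comp, h, below_comp]

theorem exists_hom_of_below {S T U : RTree} (α : S ⟶ T) (β : S ⟶ U)
    (h : Set.range (below α) ⊆ Set.range (below β)) : ∃ f : T ⟶ U, α ≫ f = β := by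
  choose f hf using fun e => h ⟨e, rfl⟩
  have hle : ∀ e e', f e ≤ f e' ↔ e ≤ e' := fun e e' => by
    rw [← below_subset_iff β, hf, hf, below_subset_iff]
  have hα : ∀ s, f (α s) = β s := fun s => below_injective β (by rw [hf, below_map, below_map])
  refine ⟨⟨OrderEmbedding.ofMapLEIff f hle, ?_, ?_, ?_, ?_⟩, hom_ext hα⟩
  · change f _ = _
    rw [← Hom.map_root α, hα, Hom.map_root]
  · intro l hl
    obtain ⟨s, hs, rfl⟩ := (Hom.bijOn_leaves α).2.2 hl
    change IsMin (f _)
    rw [hα]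
    exact (Hom.bijOn_leaves β).1 hs
  · exact (OrderEmbedding.ofMapLEIff f hle).injective.injOn
  · intro l hl
    obtain ⟨s, hs, rfl⟩ := (Hom.bijOn_leaves β).2.2 hl
    exact ⟨α s, (Hom.bijOn_leaves α).1 hs, hα s⟩

theorem exists_iso_of_homs {S T U : RTree} (α : S ⟶ T) (β : S ⟶ U) (f : T ⟶ U) (g : U ⟶ T)
    (hf : α ≫ f = β) (hg : β ≫ g = α) : ∃ θ : T ≅ U, θ.hom = f ∧ θ.inv = g :=
  ⟨⟨f, g, hom_unique α (by rw [← Category.assoc, hf, hg, Category.comp_id]),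
    hom_unique β (by rw [← Category.assoc, hg, hf, Category.comp_id])⟩, rfl, rfl⟩

theorem exists_iso_iff {S T U : RTree} (α : S ⟶ T) (β : S ⟶ U) :
    (∃ θ : T ≅ U, α ≫ θ.hom = β) ↔ Set.range (below α) = Set.range (below β) := by
  constructor
  · rintro ⟨θ, rfl⟩
    ext c
    constructor
    · rintro ⟨e, rfl⟩
      exact ⟨θ.hom e, below_comp _ _ _⟩
    · rintro ⟨e, rfl⟩
      exact ⟨θ.inv e, by rw [← below_comp α θ.hom, iso_inv_hom_apply]⟩
  · intro h
    obtain ⟨f, hf⟩ := exists_hom_of_below α β h.le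
    obtain ⟨g, hg⟩ := exists_hom_of_below β α h.ge
    obtain ⟨θ, rfl, -⟩ := exists_iso_of_homs α β f g hf hg
    exact ⟨θ, hf⟩

/-- Lifting along a morphism of trees. -/
theorem exists_lift {S T U : RTree} (f : S ⟶ U) (g : T ⟶ U) (h : Set.range f ⊆ Set.range g) :
    ∃ γ : S ⟶ T, γ ≫ g = f := by
  choose γ hγ using fun e => h ⟨e, rfl⟩
  have hle : ∀ e e', γ e ≤ γ e' ↔ e ≤ e' := fun e e' => by
    rw [← map_le_iff g, hγ, hγ, map_le_iff]
  refine ⟨⟨OrderEmbedding.ofMapLEIff γ hle, ?_, ?_, ?_, ?_⟩, hom_ext hγ⟩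
  · refine map_injective g ?_
    change g (γ _) = _
    rw [hγ, Hom.map_root, Hom.map_root]
  · intro l hl
    change IsMin (γ l)
    rw [← isMin_map_iff g, hγ]
    exact (isMin_map_iff f l).2 hl
  · exact (OrderEmbedding.ofMapLEIff γ hle).injective.injOn
  · intro l hl
    obtain ⟨s, hs, hsl⟩ := (Hom.bijOn_leaves f).2.2 ((Hom.bijOn_leaves g).1 hl)
    exact ⟨s, hs, map_injective g ((hγ s).trans hsl)⟩

theorem exists_iso_of_range_eq {S T U : RTree} (f : S ⟶ U) (g : T ⟶ U)
    (h : Set.range f = Set.range g) : ∃ θ : S ≅ T, θ.hom ≫ g = f := by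
  obtain ⟨γ, hγ⟩ := exists_lift f g h.le
  obtain ⟨δ, hδ⟩ := exists_lift g f h.ge
  refine ⟨⟨γ, δ, hom_ext fun e => map_injective f ?_, hom_ext fun e => map_injective g ?_⟩, hγ⟩
  · rw [← comp_apply _ f, Category.assoc, hδ, hγ]
    rfl
  · rw [← comp_apply _ g, Category.assoc, hγ, hδ]
    rfl

end RTree

namespace Extension

variable {S : RTree}

theorem Arrow.sperm_old {x y : Extension S} (φ : Arrow x y) :
    SPerm x.old y.old (Equiv.Perm.sign φ.σ) :=
  φ.old_eq ▸ SPerm.of_equiv x.old_enum.1 φ.σ φ.σ_fix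

theorem Arrow.sperm_new {x y : Extension S} (φ : Arrow x y) :
    SPerm (x.new.map φ.θ.hom) y.new (Equiv.Perm.sign φ.τ) :=
  φ.new_eq ▸ (SPerm.of_equiv x.new_enum.1 φ.τ φ.τ_fix).map _

theorem Arrow.exists_of_sperm {x y : Extension S} (θ : x.tgt ≅ y.tgt) (h : x.map ≫ θ.hom = y.map)
    {s t : ℤˣ} (hs : SPerm x.old y.old s) (ht : SPerm (x.new.map θ.hom) y.new t) :
    ∃ φ : Arrow x y, φ.θ = θ ∧ φ.sign = s * t := by
  obtain ⟨σ, h₁, h₂, h₃⟩ := hs.exists_equiv x.old_enum.1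
  have ht' := ht.map θ.inv
  rw [List.map_map, show (θ.inv : y.tgt.Edge → x.tgt.Edge) ∘ θ.hom = id from
    funext (RTree.iso_hom_inv_apply θ), List.map_id] at ht'
  obtain ⟨τ, h₄, h₅, h₆⟩ := ht'.exists_equiv x.new_enum.1
  refine ⟨⟨θ, h, σ, τ, h₁, h₄, h₂, ?_⟩, rfl, ?_⟩
  · rw [← h₅, List.map_map]
    refine (List.map_id _).symm.trans (List.map_congr_left fun e _ => ?_)
    exact (RTree.iso_inv_hom_apply θ e).symm
  · rw [Arrow.sign, h₃, h₆]

theorem map_new_enum {x y : Extension S} (θ : x.tgt ≅ y.tgt) (h : x.map ≫ θ.hom = y.map) :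
    Enumerates (x.new.map θ.hom) {e | y.tgt.IsInner e ∧ e ∉ Set.range y.map} := by
  refine ⟨x.new_enum.1.map (RTree.map_injective θ.hom), fun e => ?_⟩
  rw [List.mem_map]
  constructor
  · rintro ⟨a, ha, rfl⟩
    obtain ⟨h₁, h₂⟩ := (x.new_enum.2 a).1 ha
    refine ⟨(RTree.isInner_map_iff _ _).2 h₁, ?_⟩
    rintro ⟨b, hb⟩
    exact h₂ ⟨b, RTree.map_injective θ.hom (by rw [← hb, ← h]; rfl)⟩
  · rintro ⟨h₁, h₂⟩
    refine ⟨θ.inv e, (x.new_enum.2 _).2 ⟨(RTree.isInner_map_iff _ _).2 h₁, ?_⟩,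
      RTree.iso_inv_hom_apply θ e⟩
    rintro ⟨b, hb⟩
    exact h₂ ⟨b, by rw [← h, RTree.comp_apply, hb, RTree.iso_inv_hom_apply]⟩

theorem Arrow.exists_of_iso {x y : Extension S} (θ : x.tgt ≅ y.tgt) (h : x.map ≫ θ.hom = y.map) :
    ∃ φ : Arrow x y, φ.θ = θ := by
  obtain ⟨s, hs⟩ := SPerm.exists_of_perm (x.old_enum.perm y.old_enum)
  obtain ⟨t, ht⟩ := SPerm.exists_of_perm ((map_new_enum θ h).perm y.new_enum)
  obtain ⟨φ, h, -⟩ := Arrow.exists_of_sperm θ h hs ht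
  exact ⟨φ, h⟩

theorem nonempty_arrow_iff_iso {x y : Extension S} :
    Nonempty (Arrow x y) ↔ ∃ θ : x.tgt ≅ y.tgt, x.map ≫ θ.hom = y.map :=
  ⟨fun ⟨φ⟩ => ⟨φ.θ, φ.map_eq⟩, fun ⟨_, h⟩ => ⟨(Arrow.exists_of_iso _ h).choose⟩⟩

theorem nonempty_arrow_iff {x y : Extension S} :
    Nonempty (Arrow x y) ↔ Set.range (RTree.below x.map) = Set.range (RTree.below y.map) :=
  nonempty_arrow_iff_iso.trans (RTree.exists_iso_iff _ _)

theorem Arrow.θ_hom_eq {x y : Extension S} (φ ψ : Arrow x y) : φ.θ.hom = ψ.θ.hom :=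
  RTree.hom_unique x.map (φ.map_eq.trans ψ.map_eq.symm)

theorem Arrow.θ_eq {x y : Extension S} (φ ψ : Arrow x y) : φ.θ = ψ.θ := Iso.ext (φ.θ_hom_eq ψ)

/-- The sign of an arrow depends only on its ends. -/
theorem Arrow.sign_unique {x y : Extension S} (φ ψ : Arrow x y) : φ.sign = ψ.sign := by
  have h := φ.sperm_new
  rw [φ.θ_eq ψ] at h
  exact congrArg₂ _ (φ.sperm_old.unique x.old_enum.1 ψ.sperm_old)
    (h.unique (map_new_enum ψ.θ ψ.map_eq).1 ψ.sperm_new)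

theorem Arrow.exists_refl (x : Extension S) : ∃ φ : Arrow x x, φ.θ = Iso.refl _ ∧ φ.sign = 1 := by
  have := Arrow.exists_of_sperm (x := x) (y := x) (Iso.refl _) (Category.comp_id _) (SPerm.refl _)
    (t := 1) (SPerm.of_eq (List.map_id x.new))
  simpa using this

theorem Arrow.exists_symm {x y : Extension S} (φ : Arrow x y) :
    ∃ ψ : Arrow y x, ψ.θ = φ.θ.symm ∧ ψ.sign = φ.sign := by
  have ht := (φ.sperm_new.map φ.θ.inv).symm
  rw [List.map_map, show (φ.θ.inv : y.tgt.Edge → x.tgt.Edge) ∘ φ.θ.hom = id from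
    funext (RTree.iso_hom_inv_apply φ.θ), List.map_id] at ht
  exact Arrow.exists_of_sperm φ.θ.symm ((Iso.comp_inv_eq φ.θ).2 φ.map_eq.symm) φ.sperm_old.symm ht

theorem Arrow.exists_trans {x y z : Extension S} (φ : Arrow x y) (ψ : Arrow y z) :
    ∃ χ : Arrow x z, χ.θ = φ.θ ≪≫ ψ.θ ∧ χ.sign = φ.sign * ψ.sign := by
  have ht := (φ.sperm_new.map ψ.θ.hom).trans ψ.sperm_new
  rw [List.map_map] at ht
  obtain ⟨χ, h, h'⟩ := Arrow.exists_of_sperm (φ.θ ≪≫ ψ.θ)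
    (by rw [Iso.trans_hom, ← Category.assoc, φ.map_eq, ψ.map_eq])
    (φ.sperm_old.trans ψ.sperm_old) ht
  exact ⟨χ, h, h'.trans (mul_mul_mul_comm _ _ _ _)⟩

theorem Arrow.old_length {x y : Extension S} (φ : Arrow x y) : x.old.length = y.old.length :=
  φ.sperm_old.perm.length_eq

theorem Arrow.new_length {x y : Extension S} (φ : Arrow x y) : x.new.length = y.new.length := by
  have := φ.sperm_new.perm.length_eq
  rwa [List.length_map] at this

theorem Arrow.len_eq {x y : Extension S} (φ : Arrow x y) : x.len = y.len := by
  rw [len, len, φ.old_length, φ.new_length]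

theorem arrow_equivalence (S : RTree) :
    Equivalence fun x y : Extension S => Nonempty (Arrow x y) where
  refl x := ⟨(Arrow.exists_refl x).choose⟩
  symm := fun ⟨φ⟩ => ⟨φ.exists_symm.choose⟩
  trans := fun ⟨φ⟩ ⟨ψ⟩ => ⟨(φ.exists_trans ψ).choose⟩

/-- The class of an extension. -/
def toComponent (x : Extension S) : Component S := Quot.mk _ x

theorem toComponent_eq_iff {x y : Extension S} :
    x.toComponent = y.toComponent ↔ Nonempty (Arrow x y) := 
  Quot.eq.trans (arrow_equivalence S).eqvGen_iff

/-- The chosen representative of a class. -/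
noncomputable def Component.rep (z : Component S) : Extension S := z.out

theorem nonempty_arrow_rep (x : Extension S) : Nonempty (Arrow x x.toComponent.rep) :=
  toComponent_eq_iff.1 (Quot.out_eq _).symm

theorem rep_eq_of_arrow {z : Component S} {x : Extension S} (h : Nonempty (Arrow x z.rep)) :
    x.toComponent = z := (toComponent_eq_iff.2 h).trans (Quot.out_eq z)

theorem toComponent_rep (z : Component S) : z.rep.toComponent = z := Quot.out_eq z

instance (S : RTree) : Finite (Component S) := by
  have : Finite (Set (Set S.Edge)) := inferInstance
  refine Finite.of_injective (Quot.lift (fun x : Extension S => Set.range (RTree.below x.map))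
    fun x y h => nonempty_arrow_iff.1 h) fun z w => ?_
  induction z using Quot.ind
  induction w using Quot.ind
  exact fun h => Quot.sound (nonempty_arrow_iff.2 h)

noncomputable instance (S : RTree) : Fintype (Component S) := Fintype.ofFinite _

theorem arrow₁_equivalence (S : RTree) :
    Equivalence fun x y : {x : Extension S // x.new.length = 1} => Nonempty (Arrow x.1 y.1) :=
  (arrow_equivalence S).comap Subtype.val

/-- The class of an extension of codimension one. -/
def toComponent₁ (x : Extension S) (h : x.new.length = 1) : Component₁ S := Quot.mk _ ⟨x, h⟩

theorem toComponent₁_eq_iff {x y : Extension S} {h h'} :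
    x.toComponent₁ h = y.toComponent₁ h' ↔ Nonempty (Arrow x y) := 
  Quot.eq.trans (arrow₁_equivalence S).eqvGen_iff

/-- The chosen representative of a class. -/
noncomputable def Component₁.rep (z : Component₁ S) : Extension S := z.out.1

theorem Component₁.rep_length (z : Component₁ S) : z.rep.new.length = 1 := z.out.2

theorem toComponent₁_rep (z : Component₁ S) : z.rep.toComponent₁ z.rep_length = z := Quot.out_eq z

theorem nonempty_arrow_rep₁ (x : Extension S) (h) :
    Nonempty (Arrow x (x.toComponent₁ h).rep) :=
  (toComponent₁_eq_iff (h := h) (h' := (x.toComponent₁ h).rep_length)).1 (toComponent₁_rep _).symm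

theorem rep₁_eq_of_arrow {z : Component₁ S} {x : Extension S} (h : Nonempty (Arrow x z.rep)) (h') :
    x.toComponent₁ h' = z :=
  (toComponent₁_eq_iff (h' := z.rep_length).2 h).trans (toComponent₁_rep z)

instance (S : RTree) : Finite (Component₁ S) := by
  refine Finite.of_injective (fun z : Component₁ S => z.rep.toComponent) fun z w h => ?_
  rw [← toComponent₁_rep z]
  exact rep₁_eq_of_arrow (toComponent_eq_iff.1 h) z.rep_length

noncomputable instance (S : RTree) : Fintype (Component₁ S) := Fintype.ofFinite _

end Extension

/-! ## Trees from abstract partially ordered sets -/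

namespace RTree

theorem _root_.IsReducedTree.of_orderIso {E F : Type} [PartialOrder E] [PartialOrder F] (e : E ≃o F)
    {r : E} (h : IsReducedTree E r) : IsReducedTree F (e r) where
  le_root f := by
    rw [← e.apply_symm_apply f]
    exact e.le_iff_le.2 (h.le_root _)
  comparable {f x y} hx hy := by
    rw [← e.symm.le_iff_le] at hx hy
    rw [← e.symm.le_iff_le, ← e.symm.le_iff_le (x := y)]
    exact h.comparable hx hy
  two_inputs f hf := by
    obtain ⟨x, y, hxy, hx, hy⟩ := h.two_inputs (e.symm f) fun hm => hf fun a ha => by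
      rw [← e.symm.le_iff_le] at ha ⊢
      exact hm ha
    refine ⟨e x, e y, e.injective.ne hxy, ?_, ?_⟩
    · rw [← e.apply_symm_apply f]
      exact (apply_covBy_apply_iff e).2 hx
    · rw [← e.apply_symm_apply f]
      exact (apply_covBy_apply_iff e).2 hy

/-- Every finite partially ordered set which is a reduced tree is isomorphic to the set of edges of
an object of `𝔸`. -/
theorem exists_orderIso (E : Type) [Finite E] [PartialOrder E] {r : E} (h : IsReducedTree E r) :
    ∃ (T : RTree) (e : E ≃o T.Edge), e r = T.rootEdge := by
  have := Fintype.ofFinite E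
  let n := Fintype.card E
  let f : E ≃ EdgeSet (Finset.range n) := (Fintype.equivFin E).trans
    ⟨fun i => ⟨i, Finset.mem_range.2 i.2⟩, fun i => ⟨i.1, Finset.mem_range.1 i.2⟩,
      fun _ => rfl, fun _ => rfl⟩
  let ord : PartialOrder (EdgeSet (Finset.range n)) := PartialOrder.lift f.symm f.symm.injective
  let e : E ≃o EdgeSet (Finset.range n) := ⟨f, fun {a b} => by
    change f.symm (f a) ≤ f.symm (f b) ↔ _
    rw [f.symm_apply_apply, f.symm_apply_apply]⟩
  exact ⟨⟨Finset.range n, ord, e r, h.of_orderIso e⟩, e, rfl⟩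

end RTree

/-! ## Grafting -/

namespace RTree

theorem isMin_iff_forall {T : RTree} {e : T.Edge} : IsMin e ↔ ∀ x, x ≤ e → x = e :=
  ⟨fun h _ hx => le_antisymm hx (h hx), fun h x hx => (h x hx).ge⟩

namespace Grafting

variable {S R T S' R' T' S'' R'' T'' : RTree} {a : S.Edge} {a' : S'.Edge} {a'' : S''.Edge}
  (g : Grafting S a R T) (g' : Grafting S' a' R' T') (g'' : Grafting S'' a'' R'' T'')

theorem cover (e : T.Edge) : (∃ s, g.inl s = e) ∨ ∃ r, g.inr r = e := by
  by_cases h : e < g.inl a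
  · exact Or.inr ((Set.ext_iff.1 g.range_inr e).2 h.le)
  · exact Or.inl ((Set.ext_iff.1 g.range_inl e).2 h)

theorem inr_le (r : R.Edge) : g.inr r ≤ g.inl a := (Set.ext_iff.1 g.range_inr _).1 ⟨r, rfl⟩

theorem not_inl_lt (s : S.Edge) : ¬ g.inl s < g.inl a := (Set.ext_iff.1 g.range_inl _).1 ⟨s, rfl⟩

theorem inr_le_inl_iff {r : R.Edge} {s : S.Edge} : g.inr r ≤ g.inl s ↔ a ≤ s := by
  constructor
  · intro h
    rcases T.tree.comparable h (g.inr_le r) with h' | h'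
    · exact (g.inl.le_iff_le.1 (h'.lt_or_eq.resolve_left (g.not_inl_lt s)).ge)
    · exact g.inl.le_iff_le.1 h'
  · exact fun h => (g.inr_le r).trans (g.inl.le_iff_le.2 h)

theorem inl_le_inr_iff {r : R.Edge} {s : S.Edge} : g.inl s ≤ g.inr r ↔ s = a ∧ r = R.rootEdge := by
  constructor
  · intro h
    have h₁ := g.inl.le_iff_le.1 (h.trans (g.inr_le r))
    have h₂ : s = a := isMin_iff_forall.1 g.isMin s h₁
    refine ⟨h₂, le_antisymm (R.tree.le_root r) ?_⟩
    rw [h₂, g.glue] at h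
    exact g.inr.le_iff_le.1 h
  · rintro ⟨rfl, rfl⟩
    exact g.glue.le

theorem inl_eq_inr_iff {r : R.Edge} {s : S.Edge} : g.inl s = g.inr r ↔ s = a ∧ r = R.rootEdge :=
  ⟨fun h => g.inl_le_inr_iff.1 h.le, by rintro ⟨rfl, rfl⟩; exact g.glue⟩

theorem inl_root : g.inl S.rootEdge = T.rootEdge := by
  refine le_antisymm (T.tree.le_root _) ?_
  rcases g.cover T.rootEdge with ⟨s, hs⟩ | ⟨r, hr⟩
  · exact hs ▸ g.inl.le_iff_le.2 (S.tree.le_root s)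
  · exact hr ▸ g.inr_le_inl_iff.2 (S.tree.le_root a)

theorem isMin_inr_iff {r : R.Edge} : IsMin (g.inr r) ↔ IsMin r := by
  constructor
  · intro h x hx
    exact g.inr.le_iff_le.1 (h (g.inr.le_iff_le.2 hx))
  · intro h
    refine isMin_iff_forall.2 fun x hx => ?_
    obtain ⟨y, rfl⟩ := (Set.ext_iff.1 g.range_inr x).2 (hx.trans (g.inr_le r))
    rw [isMin_iff_forall.1 h y (g.inr.le_iff_le.1 hx)]

theorem isMin_inl_iff {s : S.Edge} : IsMin (g.inl s) ↔ IsMin s ∧ s ≠ a := by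
  constructor
  · intro h
    refine ⟨fun x hx => g.inl.le_iff_le.1 (h (g.inl.le_iff_le.2 hx)), ?_⟩
    rintro rfl
    rw [g.glue, isMin_inr_iff] at h
    exact g.has_vertex h
  · rintro ⟨h, hne⟩
    refine isMin_iff_forall.2 fun x hx => ?_
    rcases g.cover x with ⟨y, rfl⟩ | ⟨r, rfl⟩
    · rw [isMin_iff_forall.1 h y (g.inl.le_iff_le.1 hx)]
    · exact (hne (isMin_iff_forall.1 h a (g.inr_le_inl_iff.1 hx)).symm).elim

theorem isInner_inl_iff {s : S.Edge} : T.IsInner (g.inl s) ↔ s = a ∨ S.IsInner s := by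
  unfold IsInner
  rw [isMin_inl_iff, ← g.inl_root, g.inl.injective.ne_iff]
  by_cases h : s = a
  · subst h
    simp [g.ne_root]
  · simp [h]

theorem isInner_inr_iff {r : R.Edge} : T.IsInner (g.inr r) ↔ r = R.rootEdge ∨ R.IsInner r := by
  unfold IsInner
  have h₀ : g.inr r ≠ T.rootEdge := by
    rw [← g.inl_root]
    intro h
    exact g.ne_root (g.inl_eq_inr_iff.1 h.symm).1.symm
  rw [isMin_inr_iff]
  by_cases h : r = R.rootEdge
  · subst h
    simp [h₀, g.has_vertex]
  · simp [h, h₀]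

variable {g g' g''} in
theorem Compatible.comp {β : S ⟶ S'} {γ : R ⟶ R'} {δ : T ⟶ T'} {β' : S' ⟶ S''} {γ' : R' ⟶ R''}
    {δ' : T' ⟶ T''} (h : g.Compatible g' β γ δ) (h' : g'.Compatible g'' β' γ' δ') :
    g.Compatible g'' (β ≫ β') (γ ≫ γ') (δ ≫ δ') where
  map_leaf := by rw [comp_apply, h.map_leaf, h'.map_leaf]
  inl e := by rw [comp_apply, h.inl, h'.inl]; rfl
  inr e := by rw [comp_apply, h.inr, h'.inr]; rfl

theorem compatible_id : g.Compatible g (𝟙 S) (𝟙 R) (𝟙 T) := ⟨rfl, fun _ => rfl, fun _ => rfl⟩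

variable {g g'} in
theorem Compatible.hom_eq {β : S ⟶ S'} {γ : R ⟶ R'} {δ δ' : T ⟶ T'}
    (h : g.Compatible g' β γ δ) (h' : g.Compatible g' β γ δ') : δ = δ' := by
  refine hom_ext fun e => ?_
  rcases g.cover e with ⟨s, rfl⟩ | ⟨r, rfl⟩
  · rw [h.inl, h'.inl]
  · rw [h.inr, h'.inr]

/-- Morphisms `β` and `γ` induce a morphism `β ∘ γ` between the graftings. -/
theorem exists_glue (β : S ⟶ S') (γ : R ⟶ R') (h : β a = a') :
    ∃ δ : T ⟶ T', g.Compatible g' β γ δ := by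
  classical
  let f : T.Edge → T'.Edge := fun e =>
    if h : ∃ s, g.inl s = e then g'.inl (β h.choose)
    else g'.inr (γ ((g.cover e).resolve_left h).choose)
  have hl : ∀ s, f (g.inl s) = g'.inl (β s) := fun s => by
    have h : ∃ s', g.inl s' = g.inl s := ⟨s, rfl⟩
    simp only [f, dif_pos h]
    rw [g.inl.injective h.choose_spec]
  have hr : ∀ r, f (g.inr r) = g'.inr (γ r) := fun r => by
    by_cases hs : ∃ s', g.inl s' = g.inr r
    · obtain ⟨s, hs⟩ := hs
      rw [← hs, hl]
      obtain ⟨rfl, rfl⟩ := g.inl_eq_inr_iff.1 hs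
      rw [h, Hom.map_root, g'.glue]
    · simp only [f, dif_neg hs]
      rw [g.inr.injective ((g.cover (g.inr r)).resolve_left hs).choose_spec]
  have hle : ∀ e e', f e ≤ f e' ↔ e ≤ e' := fun e e' => by
    rcases g.cover e with ⟨s, rfl⟩ | ⟨r, rfl⟩ <;> rcases g.cover e' with ⟨s', rfl⟩ | ⟨r', rfl⟩
    · rw [hl, hl, g'.inl.le_iff_le, g.inl.le_iff_le, map_le_iff]
    · rw [hl, hr, inl_le_inr_iff, inl_le_inr_iff, ← h, (map_injective β).eq_iff, ← Hom.map_root γ,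
        (map_injective γ).eq_iff]
    · rw [hl, hr, inr_le_inl_iff, inr_le_inl_iff, ← h, map_le_iff]
    · rw [hr, hr, g'.inr.le_iff_le, g.inr.le_iff_le, map_le_iff]
  have hmin : ∀ e, IsMin (f e) ↔ IsMin e := fun e => by
    rcases g.cover e with ⟨s, rfl⟩ | ⟨r, rfl⟩
    · rw [hl, isMin_inl_iff, isMin_inl_iff, ← h, (map_injective β).ne_iff, isMin_map_iff]
    · rw [hr, isMin_inr_iff, isMin_inr_iff, isMin_map_iff]
  refine ⟨⟨OrderEmbedding.ofMapLEIff f hle, ?_, fun e he => (hmin e).2 he,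
    (OrderEmbedding.ofMapLEIff f hle).injective.injOn, fun e he => ?_⟩, h, hl, hr⟩
  · change f _ = _
    rw [← g.inl_root, hl, Hom.map_root, g'.inl_root]
  · have he : IsMin e := he
    rcases g'.cover e with ⟨s, rfl⟩ | ⟨r, rfl⟩
    · obtain ⟨h₁, h₂⟩ := g'.isMin_inl_iff.1 he
      obtain ⟨s, hs, rfl⟩ := (Hom.bijOn_leaves β).2.2 h₁
      refine ⟨g.inl s, g.isMin_inl_iff.2 ⟨hs, ?_⟩, hl s⟩
      rintro rfl
      exact h₂ h
    · obtain ⟨r, hr', rfl⟩ := (Hom.bijOn_leaves γ).2.2 (g'.isMin_inr_iff.1 he)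
      exact ⟨g.inr r, g.isMin_inr_iff.2 hr', hr r⟩

/-- A morphism between graftings that maps the edge of the grafting to the edge of the grafting
is of the form `β ∘ γ`. -/
theorem exists_restrict (δ : T ⟶ T') (h : δ (g.inl a) = g'.inl a') :
    ∃ (β : S ⟶ S') (γ : R ⟶ R'), g.Compatible g' β γ δ := by
  have h₁ : ∀ s, ∃ s', g'.inl s' = δ (g.inl s) := fun s => by
    refine (Set.ext_iff.1 g'.range_inl _).2 fun hlt => ?_
    rw [← h] at hlt
    exact g.not_inl_lt s ((Hom.toEmb δ).lt_iff_lt.1 hlt)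
  have h₂ : ∀ r, ∃ r', g'.inr r' = δ (g.inr r) := fun r => by
    refine (Set.ext_iff.1 g'.range_inr _).2 ?_
    change δ _ ≤ _
    rw [← h]
    exact (map_le_iff δ).2 (g.inr_le r)
  choose β hβ using h₁
  choose γ hγ using h₂
  have hβle : ∀ e e', β e ≤ β e' ↔ e ≤ e' := fun e e' => by
    rw [← g'.inl.le_iff_le, hβ, hβ, map_le_iff, g.inl.le_iff_le]
  have hγle : ∀ e e', γ e ≤ γ e' ↔ e ≤ e' := fun e e' => by
    rw [← g'.inr.le_iff_le, hγ, hγ, map_le_iff, g.inr.le_iff_le]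
  have hβa : β a = a' := g'.inl.injective (by rw [hβ, h])
  have hβinj : Function.Injective β := (OrderEmbedding.ofMapLEIff β hβle).injective
  have hβmin : ∀ s, IsMin (β s) ↔ IsMin s := fun s => by
    by_cases hs : s = a
    · subst hs
      rw [hβa]
      exact iff_of_true g'.isMin g.isMin
    · have h₁ := g'.isMin_inl_iff (s := β s)
      have h₂ := g.isMin_inl_iff (s := s)
      rw [hβ, isMin_map_iff] at h₁
      have hs' : β s ≠ a' := fun h => hs (hβinj (h.trans hβa.symm))
      exact ⟨fun h => (h₂.1 (h₁.2 ⟨h, hs'⟩)).1, fun h => (h₁.1 (h₂.2 ⟨h, hs⟩)).1⟩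
  have hγmin : ∀ r, IsMin (γ r) ↔ IsMin r := fun r => by
    rw [← g'.isMin_inr_iff, hγ, isMin_map_iff, g.isMin_inr_iff]
  refine ⟨⟨OrderEmbedding.ofMapLEIff β hβle, ?_, fun e he => (hβmin e).2 he, hβinj.injOn,
      fun e he => ?_⟩, ⟨OrderEmbedding.ofMapLEIff γ hγle, ?_, fun e he => (hγmin e).2 he,
      (OrderEmbedding.ofMapLEIff γ hγle).injective.injOn, fun e he => ?_⟩, hβa,
      fun e => (hβ e).symm, fun e => (hγ e).symm⟩
  · refine g'.inl.injective ?_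
    change g'.inl (β _) = _
    rw [hβ, g.inl_root, g'.inl_root, Hom.map_root]
  · have he : IsMin e := he
    by_cases hea : e = a'
    · exact ⟨a, g.isMin, hβa.trans hea.symm⟩
    · obtain ⟨d, hd, hde⟩ := (Hom.bijOn_leaves δ).2.2 (g'.isMin_inl_iff.2 ⟨he, hea⟩)
      rcases g.cover d with ⟨s, rfl⟩ | ⟨r, rfl⟩
      · exact ⟨s, (g.isMin_inl_iff.1 hd).1, g'.inl.injective ((hβ s).trans hde)⟩
      · rw [← hγ] at hde
        exact (hea (g'.inl_eq_inr_iff.1 hde.symm).1).elim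
  · refine g'.inr.injective ?_
    change g'.inr (γ _) = _
    rw [hγ, ← g.glue, ← g'.glue, h]
  · have he : IsMin e := he
    obtain ⟨d, hd, hde⟩ := (Hom.bijOn_leaves δ).2.2 (g'.isMin_inr_iff.2 he)
    rcases g.cover d with ⟨s, rfl⟩ | ⟨r, rfl⟩
    · rw [← hβ] at hde
      obtain ⟨h₁, h₂⟩ := g'.inl_eq_inr_iff.1 hde
      rw [← hβa] at h₁
      exact ((g.isMin_inl_iff.1 hd).2 (hβinj h₁)).elim
    · exact ⟨r, g.isMin_inr_iff.1 hd, g'.inr.injective ((hγ r).trans hde)⟩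

/-- Isomorphisms can be glued. -/
theorem exists_glue_iso (θS : S ≅ S') (θR : R ≅ R') (h : θS.hom a = a') :
    ∃ θ : T ≅ T', g.Compatible g' θS.hom θR.hom θ.hom := by
  obtain ⟨δ, hδ⟩ := g.exists_glue g' θS.hom θR.hom h
  obtain ⟨δ', hδ'⟩ := g'.exists_glue g θS.inv θR.inv (by rw [← h, iso_hom_inv_apply])
  refine ⟨⟨δ, δ', ?_, ?_⟩, hδ⟩
  · have := hδ.comp hδ'
    rw [Iso.hom_inv_id, Iso.hom_inv_id] at this
    exact this.hom_eq g.compatible_id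
  · have := hδ'.comp hδ
    rw [Iso.inv_hom_id, Iso.inv_hom_id] at this
    exact this.hom_eq g'.compatible_id

/-- Isomorphisms can be restricted. -/
theorem exists_restrict_iso (θ : T ≅ T') (h : θ.hom (g.inl a) = g'.inl a') :
    ∃ (θS : S ≅ S') (θR : R ≅ R'), g.Compatible g' θS.hom θR.hom θ.hom := by
  obtain ⟨β, γ, hδ⟩ := g.exists_restrict g' θ.hom h
  obtain ⟨β', γ', hδ'⟩ := g'.exists_restrict g θ.inv (by rw [← h, iso_hom_inv_apply])
  have h₁ := hδ.comp hδ'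
  have h₂ := hδ'.comp hδ
  rw [Iso.hom_inv_id] at h₁
  rw [Iso.inv_hom_id] at h₂
  exact ⟨⟨β, β', hom_ext fun e => g.inl.injective (h₁.inl e).symm,
    hom_ext fun e => g'.inl.injective (h₂.inl e).symm⟩,
    ⟨γ, γ', hom_ext fun e => g.inr.injective (h₁.inr e).symm,
    hom_ext fun e => g'.inr.injective (h₂.inr e).symm⟩, hδ⟩

end Grafting

/-! ### Existence of graftings -/

/-- The edges of the tree `S ∘_a R`. -/
inductive GraftEdge (S : RTree) (a : S.Edge) (R : RTree) : Type
  | inl (s : S.Edge)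
  | inr (r : {r : R.Edge // r ≠ R.rootEdge})

namespace GraftEdge

variable {S R : RTree} {a : S.Edge}

instance : Finite (GraftEdge S a R) :=
  Finite.of_surjective (Sum.elim inl inr : S.Edge ⊕ {r : R.Edge // r ≠ R.rootEdge} → _) fun x => by
    rcases x with s | r
    · exact ⟨Sum.inl s, rfl⟩
    · exact ⟨Sum.inr r, rfl⟩

/-- The order on the edges of `S ∘_a R`. -/
def le : GraftEdge S a R → GraftEdge S a R → Prop
  | inl s, inl s' => s ≤ s'
  | inl _, inr _ => False
  | inr _, inl s => a ≤ s
  | inr r, inr r' => r.1 ≤ r'.1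

instance : PartialOrder (GraftEdge S a R) where
  le := le
  le_refl x := by
    rcases x with s | r
    · exact le_refl s
    · exact le_refl r.1
  le_trans x y z hxy hyz := by
    rcases x with s | r <;> rcases y with s' | r' <;> rcases z with s'' | r''
    · exact le_trans (α := S.Edge) hxy hyz
    · exact hyz.elim
    · exact hxy.elim
    · exact hxy.elim
    · exact le_trans (α := S.Edge) hxy hyz
    · exact hyz.elim
    · exact hyz
    · exact le_trans (α := R.Edge) hxy hyz
  le_antisymm x y hxy hyx := by
    rcases x with s | r <;> rcases y with s' | r'
    · exact congrArg GraftEdge.inl (le_antisymm (α := S.Edge) hxy hyx)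
    · exact hxy.elim
    · exact hyx.elim
    · exact congrArg GraftEdge.inr (Subtype.ext (le_antisymm (α := R.Edge) hxy hyx))

theorem inl_le_inl {s s' : S.Edge} :
    (inl s : GraftEdge S a R) ≤ (inl s' : GraftEdge S a R) ↔ s ≤ s' := Iff.rfl

theorem inr_le_inl {r} {s' : S.Edge} :
    (inr r : GraftEdge S a R) ≤ (inl s' : GraftEdge S a R) ↔ a ≤ s' := Iff.rfl

theorem not_inl_le_inr {r} {s : S.Edge} :
    ¬ (inl s : GraftEdge S a R) ≤ (inr r : GraftEdge S a R) := fun h => h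

theorem inr_le_inr {r r'} :
    (inr r : GraftEdge S a R) ≤ (inr r' : GraftEdge S a R) ↔ r.1 ≤ r'.1 := Iff.rfl

theorem inl_covBy_inl {s s' : S.Edge} (h : s ⋖ s') :
    (inl s : GraftEdge S a R) ⋖ (inl s' : GraftEdge S a R) := by
  refine ⟨lt_of_le_not_ge h.le fun h' => h.lt.not_ge h', fun x h₁ h₂ => ?_⟩
  rcases x with t | r
  · exact h.2 (lt_of_le_not_ge h₁.le fun h' => h₁.not_ge h')
      (lt_of_le_not_ge h₂.le fun h' => h₂.not_ge h')
  · exact not_inl_le_inr h₁.le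

theorem inr_covBy_inr {r r' : {r : R.Edge // r ≠ R.rootEdge}} (h : r.1 ⋖ r'.1) :
    (inr r : GraftEdge S a R) ⋖ (inr r' : GraftEdge S a R) := by
  refine ⟨lt_of_le_not_ge h.le fun h' => h.lt.not_ge h', fun x h₁ h₂ => ?_⟩
  rcases x with t | t
  · exact not_inl_le_inr h₂.le
  · exact h.2 (lt_of_le_not_ge h₁.le fun h' => h₁.not_ge h')
      (lt_of_le_not_ge h₂.le fun h' => h₂.not_ge h')

theorem inr_covBy_inl (ha : IsMin a) {r : {r : R.Edge // r ≠ R.rootEdge}} (h : r.1 ⋖ R.rootEdge) :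
    (inr r : GraftEdge S a R) ⋖ (inl a : GraftEdge S a R) := by
  refine ⟨lt_of_le_not_ge (le_refl a) not_inl_le_inr, fun x h₁ h₂ => ?_⟩
  rcases x with t | t
  · exact h₂.not_ge (ha h₂.le)
  · exact h.2 (lt_of_le_not_ge h₁.le fun h' => h₁.not_ge h')
      (lt_of_le_of_ne (R.tree.le_root _) t.2)

theorem isReducedTree (ha : IsMin a) (hR : ¬ IsMin R.rootEdge) :
    IsReducedTree (GraftEdge S a R) (inl S.rootEdge) where
  le_root e := by
    rcases e with s | r
    · exact S.tree.le_root s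
    · exact S.tree.le_root a
  comparable {e x y} hx hy := by
    rcases x with s | r <;> rcases y with s' | r'
    · rcases e with t | t
      · exact S.tree.comparable (e := t) hx hy
      · exact S.tree.comparable (e := a) hx hy
    · rcases e with t | t
      · exact hy.elim
      · exact Or.inr hx
    · rcases e with t | t
      · exact hx.elim
      · exact Or.inl hy
    · rcases e with t | t
      · exact hx.elim
      · exact R.tree.comparable (e := t.1) hx hy
  two_inputs e he := by
    have key : ∀ r : R.Edge, ¬ IsMin r → ∃ x y : {r : R.Edge // r ≠ R.rootEdge},
        x ≠ y ∧ x.1 ⋖ r ∧ y.1 ⋖ r := fun r hr => by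
      obtain ⟨x, y, hxy, hx, hy⟩ := R.tree.two_inputs r hr
      exact ⟨⟨x, fun h => hx.lt.not_ge (h ▸ R.tree.le_root r)⟩,
        ⟨y, fun h => hy.lt.not_ge (h ▸ R.tree.le_root r)⟩,
        fun h => hxy (congrArg Subtype.val h), hx, hy⟩
    rcases e with s | r
    · by_cases hs : s = a
      · subst hs
        obtain ⟨x, y, hxy, hx, hy⟩ := key _ hR
        exact ⟨inr x, inr y, fun h => hxy (GraftEdge.inr.inj h), inr_covBy_inl ha hx,
          inr_covBy_inl ha hy⟩
      · obtain ⟨x, y, hxy, hx, hy⟩ := S.tree.two_inputs s fun hm => he fun z hz => by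
          rcases z with t | t
          · exact hm hz
          · exact (hs (isMin_iff_forall.1 hm a hz).symm).elim
        exact ⟨inl x, inl y, fun h => hxy (GraftEdge.inl.inj h), inl_covBy_inl hx,
          inl_covBy_inl hy⟩
    · obtain ⟨x, y, hxy, hx, hy⟩ := key r.1 fun hm => he fun z hz => by
        rcases z with t | t
        · exact hz.elim
        · exact hm hz
      exact ⟨inr x, inr y, fun h => hxy (GraftEdge.inr.inj h), inr_covBy_inr hx,
        inr_covBy_inr hy⟩

end GraftEdge

/-- The grafting `S ∘_a R` exists. -/
theorem exists_grafting {S R : RTree} {a : S.Edge} (ha : IsMin a) (hne : a ≠ S.rootEdge)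
    (hR : ¬ IsMin R.rootEdge) : ∃ T : RTree, Nonempty (Grafting S a R T) := by
  classical
  obtain ⟨T, e, -⟩ := exists_orderIso (GraftEdge S a R) (GraftEdge.isReducedTree ha hR)
  let f : R.Edge → GraftEdge S a R := fun r => if h :
      r = R.rootEdge then GraftEdge.inl a else GraftEdge.inr ⟨r, h⟩
  have hf₀ : f R.rootEdge = GraftEdge.inl a := dif_pos rfl
  have hf₁ : ∀ r h, f r = GraftEdge.inr ⟨r, h⟩ := fun r h => dif_neg h
  have hf : ∀ r r', f r ≤ f r' ↔ r ≤ r' := fun r r' => by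
    by_cases h : r = R.rootEdge <;> by_cases h' : r' = R.rootEdge
    · rw [h, h']
      exact iff_of_true le_rfl le_rfl
    · rw [h, hf₀, hf₁ r' h']
      exact iff_of_false GraftEdge.not_inl_le_inr
        fun hle => h' (le_antisymm (R.tree.le_root _) hle)
    · rw [h', hf₀, hf₁ r h]
      exact iff_of_true (GraftEdge.inr_le_inl.2 le_rfl) (R.tree.le_root _)
    · rw [hf₁ r h, hf₁ r' h']
      exact GraftEdge.inr_le_inr
  refine ⟨T, ⟨(OrderEmbedding.ofMapLEIff (fun s => (GraftEdge.inl s : GraftEdge S a R))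
    fun _ _ => Iff.rfl).trans e.toOrderEmbedding,
    (OrderEmbedding.ofMapLEIff f hf).trans e.toOrderEmbedding, ha, hne, hR, ?_, ?_, ?_⟩⟩
  · change e (GraftEdge.inl a) = e (f R.rootEdge)
    rw [hf₀]
  · ext x
    obtain ⟨y, rfl⟩ := e.surjective x
    change (∃ s : S.Edge, e (GraftEdge.inl s) = e y) ↔ ¬ e y < e (GraftEdge.inl a)
    rw [e.lt_iff_lt]
    rcases y with s | r
    · refine iff_of_true ⟨s, rfl⟩ fun h => h.not_ge (ha ?_)
      exact GraftEdge.inl_le_inl.1 h.le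
    · refine iff_of_false ?_ ?_
      · rintro ⟨s, hs⟩
        cases e.injective hs
      · rw [not_not]
        exact lt_of_le_not_ge (GraftEdge.inr_le_inl.2 le_rfl) GraftEdge.not_inl_le_inr
  · ext x
    obtain ⟨y, rfl⟩ := e.surjective x
    change (∃ r : R.Edge, e (f r) = e y) ↔ e y ≤ e (GraftEdge.inl a)
    rw [e.le_iff_le]
    rcases y with s | r
    · constructor
      · rintro ⟨r, hr⟩
        have hr := e.injective hr
        by_cases h : r = R.rootEdge
        · rw [h, hf₀] at hr
          exact hr.ge
        · rw [hf₁ r h] at hr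
          cases hr
      · intro h
        have h : s ≤ a := h
        rw [isMin_iff_forall.1 ha s h]
        exact ⟨R.rootEdge, by rw [hf₀]⟩
    · exact iff_of_true ⟨r.1, by rw [hf₁ r.1 r.2]⟩ (GraftEdge.inr_le_inl.2 le_rfl)

/-- Every tree can be cut at an inner edge. -/
theorem exists_degrafting {T : RTree} {c : T.Edge} (hc : T.IsInner c) :
    ∃ (S R : RTree) (a : S.Edge) (g : Grafting S a R T), g.inl a = c := by
  have covBy : ∀ (p : T.Edge → Prop) (x y : {e : T.Edge // p e}), x.1 ⋖ y.1 → x ⋖ y :=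
    fun p x y h => ⟨h.1, fun z h₁ h₂ => h.2 h₁ h₂⟩
  have hS : IsReducedTree {e : T.Edge // ¬ e < c}
      ⟨T.rootEdge, fun h => h.not_ge (T.tree.le_root c)⟩ := by
    refine ⟨fun e => T.tree.le_root _, fun h h' => T.tree.comparable h h', fun e he => ?_⟩
    have hec : ¬ e.1 ≤ c := fun h => he fun x hx => by
      have h₁ : e.1 = c := h.lt_or_eq.resolve_left e.2
      have h₂ : x.1 ≤ c := le_trans (show x.1 ≤ e.1 from hx) h
      change e.1 ≤ x.1
      rw [h₁, h₂.lt_or_eq.resolve_left x.2]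
    obtain ⟨x, y, hxy, hx, hy⟩ := T.tree.two_inputs e.1 fun hm => he fun z hz => hm hz
    have key : ∀ x : T.Edge, x ⋖ e.1 → ¬ x < c := fun x hx h => by
      rcases T.tree.comparable h.le hx.le with h₁ | h₁
      · exact hx.2 h (lt_of_le_not_ge h₁ hec)
      · exact hec h₁
    exact ⟨⟨x, key x hx⟩, ⟨y, key y hy⟩, fun h => hxy (congrArg Subtype.val h),
      covBy _ _ _ hx, covBy _ _ _ hy⟩
  have hR : IsReducedTree {e : T.Edge // e ≤ c} ⟨c, le_rfl⟩ := by
    refine ⟨fun e => e.2, fun h h' => T.tree.comparable h h', fun e he => ?_⟩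
    obtain ⟨x, y, hxy, hx, hy⟩ := T.tree.two_inputs e.1 fun hm => he fun z hz => hm hz
    exact ⟨⟨x, hx.le.trans e.2⟩, ⟨y, hy.le.trans e.2⟩, fun h => hxy (congrArg Subtype.val h),
      covBy _ _ _ hx, covBy _ _ _ hy⟩
  have : Finite {e : T.Edge // ¬ e < c} := inferInstance
  obtain ⟨S, e, he⟩ := exists_orderIso _ hS
  obtain ⟨R, f, hf⟩ := exists_orderIso _ hR
  let a₀ : {e : T.Edge // ¬ e < c} := ⟨c, lt_irrefl c⟩
  have ha₀ : IsMin (e a₀) := isMin_iff_forall.2 fun x hx => by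
    obtain ⟨x, rfl⟩ := e.surjective x
    have hx : x.1 ≤ c := e.le_iff_le.1 hx
    exact congrArg e (Subtype.ext (hx.lt_or_eq.resolve_left x.2))
  refine ⟨S, R, e a₀, ⟨e.symm.toOrderEmbedding.trans (OrderEmbedding.subtype _),
    f.symm.toOrderEmbedding.trans (OrderEmbedding.subtype _), ha₀, ?_, ?_, ?_, ?_, ?_⟩, ?_⟩
  · rw [← he]
    exact fun h => hc.2 (congrArg Subtype.val (e.injective h))
  · rw [← hf]
    intro h
    obtain ⟨x, -, -, hx, -⟩ := T.tree.two_inputs c hc.1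
    have := h (f.le_iff_le.2 (show (⟨x, hx.le⟩ : {e : T.Edge // e ≤ c}) ≤ ⟨c, le_rfl⟩ from hx.le))
    exact hx.lt.not_ge (f.le_iff_le.1 this)
  · change (e.symm (e a₀)).1 = (f.symm R.rootEdge).1
    rw [← hf, f.symm_apply_apply, e.symm_apply_apply]
  · ext x
    change (∃ s, (e.symm s).1 = x) ↔ ¬ x < (e.symm (e a₀)).1
    rw [e.symm_apply_apply]
    constructor
    · rintro ⟨s, rfl⟩
      exact (e.symm s).2
    · intro h
      exact ⟨e ⟨x, h⟩, by rw [e.symm_apply_apply]⟩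
  · ext x
    change (∃ s, (f.symm s).1 = x) ↔ x ≤ (e.symm (e a₀)).1
    rw [e.symm_apply_apply]
    constructor
    · rintro ⟨s, rfl⟩
      exact (f.symm s).2
    · intro h
      exact ⟨f ⟨x, h⟩, by rw [f.symm_apply_apply]⟩
  · change (e.symm (e a₀)).1 = c
    rw [e.symm_apply_apply]

end RTree

namespace Extension

section SetLists

variable {S : RTree}

/-- Change of the enumeration of the inner edges of the source. -/
abbrev setOld (x : Extension S) (l : List S.Edge) (h : x.old.Perm l) : Extension S :=
  ⟨x.tgt, x.map, l, x.new, x.old_enum.of_perm h, x.new_enum⟩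

/-- Change of the enumeration of the new inner edges. -/
abbrev setNew (x : Extension S) (l : List x.tgt.Edge) (h : x.new.Perm l) : Extension S :=
  ⟨x.tgt, x.map, x.old, l, x.old_enum, x.new_enum.of_perm h⟩

theorem exists_arrow_setOld (x : Extension S) {l s} (h : SPerm x.old l s) :
    ∃ φ : Arrow x (x.setOld l h.perm), φ.θ = Iso.refl _ ∧ φ.sign = s := by
  have := Arrow.exists_of_sperm (x := x) (y := x.setOld l h.perm) (Iso.refl _)
    (Category.comp_id _) h (t := 1) (SPerm.of_eq (List.map_id x.new))
  simpa using this

theorem exists_arrow_setNew (x : Extension S) {l s} (h : SPerm x.new l s) :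
    ∃ φ : Arrow x (x.setNew l h.perm), φ.θ = Iso.refl _ ∧ φ.sign = s := by
  have := Arrow.exists_of_sperm (x := x) (y := x.setNew l h.perm) (Iso.refl _)
    (Category.comp_id _) (s := 1) (SPerm.refl _)
    (t := s)
    (((SPerm.of_eq (List.map_id x.new)).trans h).cast (one_mul s))
  simpa using this

end SetLists

section Degrafting

variable {S : RTree} {a : S.Edge} {R U : RTree} {g : RTree.Grafting S a R U}

theorem enumerates_graft_old (g : RTree.Grafting S a R U) {lS : List S.Edge} {lR : List R.Edge}
    (hS : Enumerates lS {e | S.IsInner e}) (hR : Enumerates lR {e | R.IsInner e}) :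
    Enumerates (g.inl a :: (lS.map g.inl ++ lR.map g.inr)) {e | U.IsInner e} := by
  refine ⟨List.nodup_cons.2 ⟨fun h => ?_, List.nodup_append'.2 ⟨hS.1.map g.inl.injective,
    hR.1.map g.inr.injective, fun e h₁ h₂ => ?_⟩⟩, fun e => ?_⟩
  · rcases List.mem_append.1 h with h | h
    · obtain ⟨s, hs, hsa⟩ := List.mem_map.1 h
      rw [g.inl.injective hsa] at hs
      exact ((hS.2 a).1 hs).1 g.isMin
    · obtain ⟨r, hr, hra⟩ := List.mem_map.1 h
      rw [(g.inl_eq_inr_iff.1 hra.symm).2] at hr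
      exact ((hR.2 _).1 hr).2 rfl
  · obtain ⟨s, hs, rfl⟩ := List.mem_map.1 h₁
    obtain ⟨r, hr, hrs⟩ := List.mem_map.1 h₂
    rw [(g.inl_eq_inr_iff.1 hrs.symm).2] at hr
    exact ((hR.2 _).1 hr).2 rfl
  · rw [List.mem_cons, List.mem_append, List.mem_map, List.mem_map]
    constructor
    · rintro (rfl | ⟨s, hs, rfl⟩ | ⟨r, hr, rfl⟩)
      · exact g.isInner_inl_iff.2 (Or.inl rfl)
      · exact g.isInner_inl_iff.2 (Or.inr ((hS.2 s).1 hs))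
      · exact g.isInner_inr_iff.2 (Or.inr ((hR.2 r).1 hr))
    · intro h
      rcases g.cover e with ⟨s, rfl⟩ | ⟨r, rfl⟩
      · rcases g.isInner_inl_iff.1 h with rfl | h
        · exact Or.inl rfl
        · exact Or.inr (Or.inl ⟨s, (hS.2 s).2 h, rfl⟩)
      · rcases g.isInner_inr_iff.1 h with rfl | h
        · exact Or.inl g.glue.symm
        · exact Or.inr (Or.inr ⟨r, (hR.2 r).2 h, rfl⟩)

theorem enumerates_graft_new {S' R' U' : RTree} {a' : S'.Edge} {g' : RTree.Grafting S' a' R' U'}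
    {β : S ⟶ S'} {γ : R ⟶ R'} {δ : U ⟶ U'} (h : g.Compatible g' β γ δ) {lS : List S'.Edge}
    {lR : List R'.Edge} (hS : Enumerates lS {e | S'.IsInner e ∧ e ∉ Set.range β})
    (hR : Enumerates lR {e | R'.IsInner e ∧ e ∉ Set.range γ}) :
    Enumerates (lS.map g'.inl ++ lR.map g'.inr) {e | U'.IsInner e ∧ e ∉ Set.range δ} := by
  have hrl : ∀ s, g'.inl s ∈ Set.range δ ↔ s ∈ Set.range β := fun s => by
    constructor
    · rintro ⟨e, he⟩
      rcases g.cover e with ⟨t, rfl⟩ | ⟨r, rfl⟩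
      · exact ⟨t, g'.inl.injective (by rw [← he, h.inl])⟩
      · rw [h.inr] at he
        exact ⟨a, h.map_leaf.trans (g'.inl_eq_inr_iff.1 he.symm).1.symm⟩
    · rintro ⟨t, rfl⟩
      exact ⟨_, h.inl t⟩
  have hrr : ∀ r, g'.inr r ∈ Set.range δ ↔ r ∈ Set.range γ := fun r => by
    constructor
    · rintro ⟨e, he⟩
      rcases g.cover e with ⟨t, rfl⟩ | ⟨t, rfl⟩
      · rw [h.inl] at he
        exact ⟨R.rootEdge, (RTree.Hom.map_root γ).trans (g'.inl_eq_inr_iff.1 he).2.symm⟩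
      · exact ⟨t, g'.inr.injective (by rw [← he, h.inr])⟩
    · rintro ⟨t, rfl⟩
      exact ⟨_, h.inr t⟩
  refine ⟨List.nodup_append'.2 ⟨hS.1.map g'.inl.injective,
    hR.1.map g'.inr.injective, fun e h₁ h₂ => ?_⟩, fun e => ?_⟩
  · obtain ⟨s, hs, rfl⟩ := List.mem_map.1 h₁
    obtain ⟨r, hr, hrs⟩ := List.mem_map.1 h₂
    rw [(g'.inl_eq_inr_iff.1 hrs.symm).2] at hr
    exact ((hR.2 _).1 hr).1.2 rfl
  · rw [List.mem_append, List.mem_map, List.mem_map]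
    constructor
    · rintro (⟨s, hs, rfl⟩ | ⟨r, hr, rfl⟩)
      · obtain ⟨h₁, h₂⟩ := (hS.2 s).1 hs
        exact ⟨g'.isInner_inl_iff.2 (Or.inr h₁), fun h' => h₂ ((hrl s).1 h')⟩
      · obtain ⟨h₁, h₂⟩ := (hR.2 r).1 hr
        exact ⟨g'.isInner_inr_iff.2 (Or.inr h₁), fun h' => h₂ ((hrr r).1 h')⟩
    · rintro ⟨h₁, h₂⟩
      rcases g'.cover e with ⟨s, rfl⟩ | ⟨r, rfl⟩
      · rw [hrl] at h₂
        refine Or.inl ⟨s, (hS.2 s).2 ⟨(g'.isInner_inl_iff.1 h₁).resolve_left ?_, h₂⟩, rfl⟩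
        rintro rfl
        exact h₂ ⟨a, h.map_leaf⟩
      · rw [hrr] at h₂
        refine Or.inr ⟨r, (hR.2 r).2 ⟨(g'.isInner_inr_iff.1 h₁).resolve_left ?_, h₂⟩, rfl⟩
        rintro rfl
        exact h₂ ⟨R.rootEdge, RTree.Hom.map_root γ⟩

/-- The extension `α_S ∘ α_R` with its standard enumerations. -/
def ofGraft {xS : Extension S} {xR : Extension R} {T : RTree} (g : RTree.Grafting S a R U)
    (g' : RTree.Grafting xS.tgt (xS.map a) xR.tgt T) (α : U ⟶ T)
    (h : g.Compatible g' xS.map xR.map α) : Extension U where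
  tgt := T
  map := α
  old := g.inl a :: (xS.old.map g.inl ++ xR.old.map g.inr)
  new := xS.new.map g'.inl ++ xR.new.map g'.inr
  old_enum := enumerates_graft_old g xS.old_enum xR.old_enum
  new_enum := enumerates_graft_new h xS.new_enum xR.new_enum

/-- The degrafting of `α_S ∘ α_R`. -/
def degraftingOfGraft {xS : Extension S} {xR : Extension R} {T : RTree}
    (g : RTree.Grafting S a R U) (g' : RTree.Grafting xS.tgt (xS.map a) xR.tgt T) (α : U ⟶ T)
    (h : g.Compatible g' xS.map xR.map α) : (ofGraft g g' α h).Degrafting g xS xR :=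
  ⟨g', h, rfl, rfl⟩

theorem exists_degrafting_of_pair (g : RTree.Grafting S a R U) (xS : Extension S)
    (xR : Extension R) : ∃ x : Extension U, Nonempty (x.Degrafting g xS xR) := by
  obtain ⟨T, ⟨g'⟩⟩ := RTree.exists_grafting (S := xS.tgt) (a := xS.map a) (R := xR.tgt)
    ((RTree.isMin_map_iff _ _).2 g.isMin)
    (by rw [← RTree.Hom.map_root xS.map]; exact (RTree.map_injective _).ne g.ne_root)
    (by rw [← RTree.Hom.map_root xR.map, RTree.isMin_map_iff]; exact g.has_vertex)
  obtain ⟨α, h⟩ := g.exists_glue g' xS.map xR.map rfl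
  exact ⟨ofGraft g g' α h, ⟨degraftingOfGraft g g' α h⟩⟩

theorem exists_degrafting (g : RTree.Grafting S a R U) (x : Extension U) :
    ∃ (xS : Extension S) (xR : Extension R) (y : Extension U),
      Nonempty (Arrow x y) ∧ Nonempty (y.Degrafting g xS xR) := by
  obtain ⟨S', R', a', g', hg'⟩ := RTree.exists_degrafting (T := x.tgt) (c := x.map (g.inl a))
    ((RTree.isInner_map_iff _ _).2 (g.isInner_inl_iff.2 (Or.inl rfl)))
  obtain ⟨β, γ, h⟩ := g.exists_restrict g' x.map hg'.symm
  obtain rfl := h.map_leaf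
  obtain ⟨lS, hlS⟩ := exists_enumerates {e | S.IsInner e}
  obtain ⟨lR, hlR⟩ := exists_enumerates {e | R.IsInner e}
  obtain ⟨mS, hmS⟩ := exists_enumerates {e | S'.IsInner e ∧ e ∉ Set.range β}
  obtain ⟨mR, hmR⟩ := exists_enumerates {e | R'.IsInner e ∧ e ∉ Set.range γ}
  let xS : Extension S := ⟨S', β, lS, mS, hlS, hmS⟩
  let xR : Extension R := ⟨R', γ, lR, mR, hlR, hmR⟩
  exact ⟨xS, xR, ofGraft (xS := xS) (xR := xR) g g' x.map h,
    nonempty_arrow_iff_iso.2 ⟨Iso.refl _, Category.comp_id _⟩,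
    ⟨degraftingOfGraft (xS := xS) (xR := xR) g g' x.map h⟩⟩

variable {x x' : Extension U} {xS xS' : Extension S} {xR xR' : Extension R}

theorem Degrafting.exists_arrow (D : x.Degrafting g xS xR) (D' : x'.Degrafting g xS' xR')
    (φS : Arrow xS xS') (φR : Arrow xR xR') :
    ∃ φ : Arrow x x', D.graft.Compatible D'.graft φS.θ.hom φR.θ.hom φ.θ.hom ∧
      φ.sign = φS.sign * φR.sign := by
  obtain ⟨θ, hθ⟩ := D.graft.exists_glue_iso D'.graft φS.θ φR.θ
    (by rw [← RTree.comp_apply, φS.map_eq])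
  have hmap : x.map ≫ θ.hom = x'.map := by
    have := D.compat.comp hθ
    rw [φS.map_eq, φR.map_eq] at this
    exact this.hom_eq D'.compat
  have hold : SPerm x.old x'.old (Equiv.Perm.sign φS.σ * Equiv.Perm.sign φR.σ) := by
    rw [D.old_eq, D'.old_eq]
    exact ((φS.sperm_old.map _).append (φR.sperm_old.map _)).cons _
  have hnew : SPerm (x.new.map θ.hom) x'.new (Equiv.Perm.sign φS.τ * Equiv.Perm.sign φR.τ) := by
    rw [D.new_eq, D'.new_eq]
    have e := (φS.sperm_new.map D'.graft.inl).append (φR.sperm_new.map D'.graft.inr)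
    rw [List.map_map, List.map_map] at e
    rw [List.map_append, List.map_map, List.map_map]
    rw [show (θ.hom : x.tgt.Edge → _) ∘ D.graft.inl = D'.graft.inl ∘ φS.θ.hom from funext hθ.inl,
      show (θ.hom : x.tgt.Edge → _) ∘ D.graft.inr = D'.graft.inr ∘ φR.θ.hom from funext hθ.inr]
    exact e
  obtain ⟨φ, rfl, hφ⟩ := Arrow.exists_of_sperm θ hmap hold hnew
  exact ⟨φ, hθ, hφ.trans (mul_mul_mul_comm _ _ _ _)⟩

theorem Degrafting.nonempty_arrow_iff (D : x.Degrafting g xS xR) (D' : x'.Degrafting g xS' xR') :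
    Nonempty (Arrow x x') ↔ Nonempty (Arrow xS xS') ∧ Nonempty (Arrow xR xR') := by
  constructor
  · rintro ⟨φ⟩
    have h₀ : φ.θ.hom (D.graft.inl (xS.map a)) = D'.graft.inl (xS'.map a) := by
      rw [← D.compat.inl, ← D'.compat.inl, ← RTree.comp_apply, φ.map_eq]
    obtain ⟨θS, θR, hθ⟩ := D.graft.exists_restrict_iso D'.graft φ.θ h₀
    have h := D.compat.comp hθ
    rw [φ.map_eq] at h
    refine ⟨nonempty_arrow_iff_iso.2 ⟨θS, RTree.hom_ext fun e => ?_⟩,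
      nonempty_arrow_iff_iso.2 ⟨θR, RTree.hom_ext fun e => ?_⟩⟩
    · exact D'.graft.inl.injective ((h.inl e).symm.trans (D'.compat.inl e))
    · exact D'.graft.inr.injective ((h.inr e).symm.trans (D'.compat.inr e))
  · rintro ⟨⟨φS⟩, ⟨φR⟩⟩
    exact ⟨(D.exists_arrow D' φS φR).choose⟩

theorem Degrafting.old_length (D : x.Degrafting g xS xR) :
    x.old.length = 1 + xS.old.length + xR.old.length := by
  rw [D.old_eq, List.length_cons, List.length_append, List.length_map, List.length_map]
  lia

theorem Degrafting.new_length (D : x.Degrafting g xS xR) :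
    x.new.length = xS.new.length + xR.new.length := by
  rw [D.new_eq, List.length_append, List.length_map, List.length_map]

/-- A chosen grafting of extensions. -/
noncomputable def graftPair (g : RTree.Grafting S a R U) (xS : Extension S) (xR : Extension R) :
    Extension U := (exists_degrafting_of_pair g xS xR).choose

/-- The degrafting of the chosen grafting of extensions. -/
noncomputable def graftPairD (g : RTree.Grafting S a R U) (xS : Extension S) (xR : Extension R) :
    (graftPair g xS xR).Degrafting g xS xR := (exists_degrafting_of_pair g xS xR).choose_spec.some

section Comp

variable (D : x.Degrafting g xS xR) {f : Extension x.tgt} {fS : Extension xS.tgt}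
  {fR : Extension xR.tgt} (E : f.Degrafting D.graft fS fR)

/-- The standard enumeration of the new edges of a composite of graftings. -/
def Degrafting.compNew : List f.tgt.Edge :=
  (xS.comp fS).new.map E.graft.inl ++ (xR.comp fR).new.map E.graft.inr

theorem Degrafting.sperm_compNew :
    SPerm (x.comp f).new (D.compNew E) ((-1) ^ (xR.new.length * fS.new.length)) := by
  have h := SPerm.middle_comm ((xS.new.map fS.map).map E.graft.inl)
    ((xR.new.map fR.map).map E.graft.inr) (fS.new.map E.graft.inl) (fR.new.map E.graft.inr)
  rw [List.length_map, List.length_map, List.length_map] at h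
  have e₁ : (x.comp f).new = (xS.new.map fS.map).map E.graft.inl ++
      (xR.new.map fR.map).map E.graft.inr ++ (fS.new.map E.graft.inl ++ fR.new.map E.graft.inr)
          := by
    change x.new.map f.map ++ f.new = _
    rw [D.new_eq, E.new_eq, List.map_append, List.map_map, List.map_map, List.map_map,
      List.map_map,
      show (f.map : x.tgt.Edge → _) ∘ D.graft.inl = E.graft.inl ∘ fS.map from funext E.compat.inl,
      show (f.map : x.tgt.Edge → _) ∘ D.graft.inr = E.graft.inr ∘ fR.map from funext E.compat.inr]
  have e₂ : D.compNew E = (xS.new.map fS.map).map E.graft.inl ++ fS.new.map E.graft.inl ++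
      ((xR.new.map fR.map).map E.graft.inr ++ fR.new.map E.graft.inr) := by
    change (xS.new.map fS.map ++ fS.new).map _ ++ (xR.new.map fR.map ++ fR.new).map _ = _
    rw [List.map_append, List.map_append]
  rw [e₁, e₂]
  exact h

/-- Composites of graftings. -/
def Degrafting.comp : ((x.comp f).setNew (D.compNew E) (D.sperm_compNew E).perm).Degrafting g
    (xS.comp fS) (xR.comp fR) :=
  ⟨E.graft, D.compat.comp E.compat, D.old_eq, rfl⟩

end Comp

section Top

variable (D : x.Degrafting g xS xR)

/-- The standard enumeration of the inner edges of a grafting. -/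
def Degrafting.topOld : List x.tgt.Edge :=
  D.graft.inl (xS.map a) :: (xS.top.old.map D.graft.inl ++ xR.top.old.map D.graft.inr)

theorem Degrafting.sperm_topOld :
    SPerm x.top.old D.topOld ((-1) ^ (xR.old.length * xS.new.length)) := by
  have h := SPerm.middle_comm ((xS.old.map xS.map).map D.graft.inl)
    ((xR.old.map xR.map).map D.graft.inr) (xS.new.map D.graft.inl) (xR.new.map D.graft.inr)
  rw [List.length_map, List.length_map, List.length_map] at h
  have e₁ : x.top.old = D.graft.inl (xS.map a) :: ((xS.old.map xS.map).map D.graft.inl ++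
      (xR.old.map xR.map).map D.graft.inr ++
        (xS.new.map D.graft.inl ++ xR.new.map D.graft.inr)) := by
    change x.old.map x.map ++ x.new = _
    rw [D.old_eq, D.new_eq, List.map_cons, List.map_append, List.map_map, List.map_map,
      List.map_map, List.map_map, D.compat.inl,
      show (x.map : U.Edge → _) ∘ g.inl = D.graft.inl ∘ xS.map from funext D.compat.inl,
      show (x.map : U.Edge → _) ∘ g.inr = D.graft.inr ∘ xR.map from funext D.compat.inr]
    rfl
  have e₂ : D.topOld = D.graft.inl (xS.map a) :: ((xS.old.map xS.map).map D.graft.inl ++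
      xS.new.map D.graft.inl ++
        ((xR.old.map xR.map).map D.graft.inr ++ xR.new.map D.graft.inr)) := by
    change _ :: ((xS.old.map xS.map ++ xS.new).map _ ++ (xR.old.map xR.map ++ xR.new).map _) = _
    rw [List.map_append, List.map_append]
  rw [e₁, e₂]
  exact h.cons _

/-- The degrafting of the top of a grafting. -/
def Degrafting.top : (x.top.setOld D.topOld D.sperm_topOld.perm).Degrafting D.graft
    xS.top xR.top :=
  ⟨D.graft, D.graft.compatible_id, rfl, by
    change [] = List.map _ [] ++ List.map _ []
    rfl⟩

end Top

end Degrafting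

end Extension

namespace Extension

/-! ### Ranges and faces -/

section Faces

variable {S : RTree}

theorem mem_range_map_iff (x : Extension S) (e : x.tgt.Edge) : e ∈ Set.range x.map ↔ e ∉ x.new := by
  constructor
  · exact fun h h' => ((x.new_enum.2 e).1 h').2 h
  · intro h
    by_contra h'
    refine h ((x.new_enum.2 e).2 ⟨⟨fun hm => h' ?_, fun hr => h' ?_⟩, h'⟩)
    · obtain ⟨s, -, hs⟩ := (RTree.Hom.bijOn_leaves x.map).2.2 hm
      exact ⟨s, hs⟩
    · exact ⟨S.rootEdge, (RTree.Hom.map_root x.map).trans hr.symm⟩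

theorem exists_iso_of_new_eq_nil (x : Extension S) (h : x.new = []) :
    ∃ θ : S ≅ x.tgt, θ.hom = x.map := by
  obtain ⟨θ, hθ⟩ := RTree.exists_iso_of_range_eq x.map (𝟙 x.tgt) (by
    ext e
    rw [mem_range_map_iff, h]
    exact iff_of_true List.not_mem_nil ⟨e, rfl⟩)
  exact ⟨θ, by rwa [Category.comp_id] at hθ⟩

/-- A chosen extension with given underlying morphism. -/
noncomputable abbrev ofHom {T : RTree} (α : S ⟶ T) : Extension S :=
  ⟨T, α, (exists_enumerates {e | S.IsInner e}).choose,
    (exists_enumerates {e | T.IsInner e ∧ e ∉ Set.range α}).choose,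
    (exists_enumerates _).choose_spec, (exists_enumerates _).choose_spec⟩

theorem new_ofHom_id (S : RTree) : (ofHom (𝟙 S)).new = [] :=
  List.eq_nil_iff_forall_not_mem.2 fun e he => (((ofHom (𝟙 S)).new_enum.2 e).1 he).2 ⟨e, rfl⟩

theorem nonempty_arrow_ofHom_id (x : Extension S) (h : x.new = []) :
    Nonempty (Arrow x (ofHom (𝟙 S))) := by
  obtain ⟨θ, hθ⟩ := x.exists_iso_of_new_eq_nil h
  refine nonempty_arrow_iff_iso.2 ⟨θ.symm, ?_⟩
  rw [← hθ]
  exact θ.hom_inv_id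

/-- The face map `∂_c : ∂_c T ⟶ T` with `c = e_i`, as an extension of the target of the `i`-th face
of `(α : S ⟶ T, d|e)`. -/
noncomputable abbrev faceTop (x : Extension S) (i : Fin x.new.length)
    : Extension (x.face i).tgt where
  tgt := x.tgt
  map := x.tgt.face (x.get_inner i)
  old := (exists_enumerates {e | (x.face i).tgt.IsInner e}).choose
  new := [x.new.get i]
  old_enum := (exists_enumerates {e | (x.face i).tgt.IsInner e}).choose_spec
  new_enum := by
    refine ⟨List.nodup_singleton _, fun e => ?_⟩
    change _ ↔ _ ∧ e ∉ Set.range (x.tgt.face (x.get_inner i))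
    rw [RTree.range_face, List.mem_singleton]
    change _ ↔ _ ∧ ¬ ¬ e = x.new.get i
    rw [not_not]
    exact ⟨fun h => ⟨h ▸ x.get_inner i, h⟩, fun h => h.2⟩

theorem map_face_faceTop (x : Extension S) (i : Fin x.new.length) :
    (x.face i).map ≫ (x.faceTop i).map = x.map := rfl

theorem new_face_comp_faceTop (x : Extension S) (i : Fin x.new.length) :
    ((x.face i).comp (x.faceTop i)).new = x.new.eraseIdx i ++ [x.new.get i] := by
  refine congrArg (· ++ [x.new.get i]) ?_
  have h := List.map_pmap (g := x.tgt.face (x.get_inner i))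
    (f := RTree.restrictEdge (x.get_inner i)) (x.ne_of_mem_eraseIdx i)
  refine h.trans ?_
  exact (List.pmap_eq_map (f := fun e : x.tgt.Edge => e) (x.ne_of_mem_eraseIdx i)).trans
    (List.map_id _)

theorem sperm_face_comp_faceTop (x : Extension S) (i : Fin x.new.length) :
    SPerm x.new ((x.face i).comp (x.faceTop i)).new
      ((-1) ^ ((i : ℕ) + (x.new.length - 1))) := by
  rw [new_face_comp_faceTop]
  refine ((SPerm.eraseIdx x.new i).trans (SPerm.append_comm [x.new.get i] _)).cast ?_
  rw [← pow_add, List.length_singleton, one_mul, List.length_eraseIdx_of_lt i.2]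

theorem face_eq_of_arrow (x : Extension S) {i j : Fin x.new.length}
    (h : Nonempty (Arrow (x.face i) (x.face j))) : i = j := by
  obtain ⟨φ⟩ := h
  have h : φ.θ.hom ≫ (x.faceTop j).map = (x.faceTop i).map := by
    refine RTree.hom_unique (x.face i).map ?_
    rw [← Category.assoc, φ.map_eq, map_face_faceTop, map_face_faceTop]
  have hi : x.new.get i ∉ Set.range (x.faceTop i).map := fun h =>
    (mem_range_map_iff _ _).1 h (List.mem_singleton_self _)
  have hi' : x.new.get i ∉ Set.range (x.faceTop j).map := by
    rintro ⟨e, he⟩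
    refine hi ⟨φ.θ.inv e, ?_⟩
    rw [← h, RTree.comp_apply, RTree.iso_inv_hom_apply, he]
  rw [mem_range_map_iff, not_not] at hi'
  exact x.new_enum.1.injective_get (List.mem_singleton.1 hi')

theorem range_map_of_new_eq {f : Extension S} {c : f.tgt.Edge} (h : f.new = [c]) :
    Set.range f.map = {c}ᶜ := by
  ext e
  rw [mem_range_map_iff, h, List.mem_singleton]
  rfl

theorem _root_.RTree.range_comp_iso {A B C : RTree} {u : A ⟶ B} {c : B.Edge} (h :
    Set.range u = {c}ᶜ)
    (θ : B ≅ C) : Set.range (u ≫ θ.hom) = {θ.hom c}ᶜ := by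
  ext e
  constructor
  · rintro ⟨s, rfl⟩ h'
    exact (h ▸ Set.mem_range_self s : u s ∈ ({c}ᶜ : Set _)) (RTree.map_injective θ.hom h')
  · intro h'
    have : θ.inv e ∈ Set.range u := by
      rw [h]
      intro h''
      exact h' (by rw [← Set.mem_singleton_iff.1 h'', RTree.iso_inv_hom_apply]; rfl)
    obtain ⟨s, hs⟩ := this
    exact ⟨s, by rw [RTree.comp_apply, hs, RTree.iso_inv_hom_apply]⟩

/-- If the `i`-th face of `x` is isomorphic to `y`, then `x` is isomorphic to a codimension one
extension of `y`. -/
theorem exists_comp_of_face {x y : Extension S} {i : Fin x.new.length} (φ : Arrow (x.face i) y) :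
    ∃ (f : Extension y.tgt) (θ : x.tgt ≅ f.tgt), f.new.length = 1 ∧
      x.map ≫ θ.hom = y.map ≫ f.map ∧
      x.tgt.face (x.get_inner i) ≫ θ.hom = φ.θ.hom ≫ f.map ∧
      SPerm (x.new.map θ.hom) (y.new.map f.map ++ f.new)
        ((-1) ^ ((i : ℕ) + (x.new.length - 1)) * Equiv.Perm.sign φ.τ) := by
  let f : Extension y.tgt :=
    { tgt := x.tgt
      map := φ.θ.inv ≫ (x.faceTop i).map
      old := (exists_enumerates {e | y.tgt.IsInner e}).choose
      new := (x.faceTop i).new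
      old_enum := (exists_enumerates {e | y.tgt.IsInner e}).choose_spec
      new_enum := by
        refine enumerates_congr (x.faceTop i).new_enum ?_
        ext e
        refine and_congr Iff.rfl (not_congr ⟨?_, ?_⟩)
        · rintro ⟨s, rfl⟩
          exact ⟨φ.θ.hom s, by rw [RTree.comp_apply, RTree.iso_hom_inv_apply]⟩
        · rintro ⟨s, rfl⟩
          exact ⟨φ.θ.inv s, rfl⟩ }
  have h₁ := x.sperm_face_comp_faceTop i
  have h₂ : SPerm ((x.face i).comp (x.faceTop i)).new (y.comp f).new (Equiv.Perm.sign φ.τ) := by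
    refine SPerm.append_right (l := (x.face i).new.map (x.faceTop i).map) (x.faceTop i).new
      (l' := y.new.map f.map) ?_
    have := φ.sperm_new.map f.map
    rw [List.map_map, show (f.map : y.tgt.Edge → _) ∘ φ.θ.hom = (x.faceTop i).map from
      funext fun e => by
        change (x.faceTop i).map (φ.θ.inv (φ.θ.hom e)) = _
        rw [RTree.iso_hom_inv_apply]] at this
    exact this
  refine ⟨f, Iso.refl x.tgt, rfl, ?_, ?_, ((SPerm.of_eq (List.map_id x.new)).trans
    (h₁.trans h₂)).cast (one_mul _)⟩
  · change x.map ≫ 𝟙 _ = y.map ≫ φ.θ.inv ≫ (x.faceTop i).map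
    rw [← φ.map_eq, Category.assoc, Iso.hom_inv_id_assoc, Category.comp_id]
    rfl
  · exact (Category.comp_id (x.faceTop i).map).trans (Iso.hom_inv_id_assoc φ.θ _).symm

theorem exists_face_of_comp {x y : Extension S} {f : Extension y.tgt} (hf : f.new.length = 1)
    (θ : x.tgt ≅ f.tgt) (h : x.map ≫ θ.hom = y.map ≫ f.map) :
    ∃ i, Nonempty (Arrow (x.face i) y) := by
  obtain ⟨c, hc⟩ := List.length_eq_one_iff.1 hf
  have hfr := range_map_of_new_eq hc
  have hcx : θ.inv c ∈ x.new := by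
    by_contra h'
    obtain ⟨s, hs⟩ := (mem_range_map_iff _ _).2 h'
    have hs' : (y.map ≫ f.map) s = c := by
      rw [← h, RTree.comp_apply, hs, RTree.iso_inv_hom_apply]
    have : c ∈ Set.range f.map := ⟨y.map s, hs'⟩
    rw [hfr] at this
    exact this rfl
  obtain ⟨i, hi⟩ := List.get_of_mem hcx
  have hi' : θ.hom (x.new.get i) = c := by rw [hi, RTree.iso_inv_hom_apply]
  obtain ⟨ψ, hψ⟩ := RTree.exists_iso_of_range_eq (x.tgt.face (x.get_inner i) ≫ θ.hom) f.map (by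
    rw [RTree.range_comp_iso (x.tgt.range_face (x.get_inner i)) θ, hfr, hi'])
  refine ⟨i, nonempty_arrow_iff_iso.2 ⟨ψ, ?_⟩⟩
  refine RTree.hom_ext fun s => RTree.map_injective f.map ?_
  have h₁ := congrArg (fun k => k ((x.face i).map s)) hψ
  have h₂ := congrArg (fun k => k s) h
  exact h₁.trans h₂

theorem nonempty_arrow_of_comp {y : Extension S} {f f' : Extension y.tgt}
    (h : Nonempty (Arrow (y.comp f) (y.comp f'))) : Nonempty (Arrow f f') := by
  obtain ⟨ψ⟩ := h
  exact nonempty_arrow_iff_iso.2 ⟨ψ.θ, RTree.hom_unique y.map ψ.map_eq⟩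

theorem sperm_comp_new {T : RTree} (l : List T.Edge) {f f' : Extension T} (φ : Arrow f f') :
    SPerm ((l.map f.map ++ f.new).map φ.θ.hom) (l.map f'.map ++ f'.new)
      (Equiv.Perm.sign φ.τ) := by
  rw [List.map_append, List.map_map, show (φ.θ.hom : f.tgt.Edge → _) ∘ f.map = f'.map from
    funext fun s => congrArg (fun k => k s) φ.map_eq]
  exact φ.sperm_new.append_left (l.map f'.map)

theorem exists_arrow_comp (y : Extension S) {f f' : Extension y.tgt} (φ : Arrow f f') :
    ∃ ψ : Arrow (y.comp f) (y.comp f'), ψ.θ = φ.θ ∧ ψ.sign = Equiv.Perm.sign φ.τ := by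
  obtain ⟨ψ, h₁, h₂⟩ := Arrow.exists_of_sperm (x := y.comp f) (y := y.comp f') φ.θ
    (by change (y.map ≫ f.map) ≫ _ = y.map ≫ f'.map; rw [Category.assoc, φ.map_eq])
    (SPerm.refl _) (sperm_comp_new y.new φ)
  exact ⟨ψ, h₁, h₂.trans (one_mul _)⟩

theorem sign_τ_of_new_length {x y : Extension S} (φ : Arrow x y) (h : x.new.length = 1) :
    Equiv.Perm.sign φ.τ = 1 := by
  obtain ⟨c, hc⟩ := List.length_eq_one_iff.1 h
  have e : φ.τ = 1 := by
    ext e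
    by_cases he : e = c
    · subst he
      by_contra hne
      have := φ.τ_fix (φ.τ e) (by rw [hc, List.mem_singleton]; exact hne)
      exact hne (φ.τ.injective this)
    · exact φ.τ_fix e (by rw [hc, List.mem_singleton]; exact he)
  rw [e, Equiv.Perm.sign_one]

end Faces

/-! ### Sums over the classes of codimension one -/

section Sums

variable {A : Type*} [AddCommGroup A] {S R T T' : RTree}

/-- The sum over the classes of codimension one extensions. -/
noncomputable def sum₁ (G : ∀ f : Extension T, f.new.length = 1 → A) : A :=
  ∑ z : Component₁ T, G z.rep z.rep_length

theorem finsum_eq_sum₁ (G : ∀ f : Extension T, f.new.length = 1 → A) :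
    ∑ᶠ z : Component₁ T, G z.out.1 z.out.2 = sum₁ G := finsum_eq_sum_of_fintype _

/-- Functions on codimension one extensions that are invariant under isomorphisms. -/
def Invariant₁ (G : ∀ f : Extension T, f.new.length = 1 → A) : Prop :=
  ∀ f f' h h', Nonempty (Arrow f f') → G f h = G f' h'

theorem sum₁_congr {G G' : ∀ f : Extension T, f.new.length = 1 → A} (h : ∀ f hf, G f hf = G' f hf) :
    sum₁ G = sum₁ G' := Finset.sum_congr rfl fun _ _ => h _ _

theorem map_sum₁ {B : Type*} [AddCommGroup B] (u : A →+ B)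
    (G : ∀ f : Extension T, f.new.length = 1 → A) :
    u (sum₁ G) = sum₁ fun f h => u (G f h) := map_sum u _ _

theorem sum₁_eq_single {G : ∀ f : Extension T, f.new.length = 1 → A} (hG : Invariant₁ G)
    (f : Extension T) (hf : f.new.length = 1)
    (h : ∀ f' hf', ¬ Nonempty (Arrow f' f) → G f' hf' = 0) : sum₁ G = G f hf := by
  refine (Finset.sum_eq_single (f.toComponent₁ hf) (fun z _ hz => h _ _ fun hz' => hz ?_)
    fun h => (h (Finset.mem_univ _)).elim).trans (hG _ _ _ _ ?_)
  · exact (rep₁_eq_of_arrow ((arrow_equivalence _).symm hz') hf).symm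
  · exact (arrow_equivalence _).symm (nonempty_arrow_rep₁ f hf)

theorem sum₁_eq_zero {G : ∀ f : Extension T, f.new.length = 1 → A} (h : ∀ f hf, G f hf = 0) :
    sum₁ G = 0 := Finset.sum_eq_zero fun _ _ => h _ _

theorem sum₁_reindex {G : ∀ f : Extension T, f.new.length = 1 → A} (hG : Invariant₁ G)
    (e : Extension T' → Extension T) (he : ∀ f, f.new.length = 1 → (e f).new.length = 1)
    (hinj : ∀ f f', Nonempty (Arrow (e f) (e f')) ↔ Nonempty (Arrow f f'))
    (hsurj : ∀ f : Extension T, f.new.length = 1 → ∃ f', f'.new.length = 1 ∧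
      Nonempty (Arrow (e f') f)) :
    sum₁ G = sum₁ fun f h => G (e f) (he f h) := by
  refine Function.Bijective.sum_comp (e := fun z : Component₁ T' =>
    (e z.rep).toComponent₁ (he _ z.rep_length)) ⟨fun z w h => ?_, fun z => ?_⟩
    (fun z => G z.rep z.rep_length) |>.symm.trans ?_
  · rw [toComponent₁_eq_iff, hinj] at h
    rw [← toComponent₁_rep w]
    exact (rep₁_eq_of_arrow ((arrow_equivalence _).symm h) w.rep_length).symm
  · obtain ⟨f, hf, h⟩ := hsurj z.rep z.rep_length
    refine ⟨f.toComponent₁ hf, rep₁_eq_of_arrow ((arrow_equivalence _).trans ?_ h) _⟩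
    exact (hinj _ _).2 ((arrow_equivalence _).symm (nonempty_arrow_rep₁ f hf))
  · exact Finset.sum_congr rfl fun z _ =>
      (hG _ _ _ _ (nonempty_arrow_rep₁ (e z.rep) (he _ z.rep_length))).symm

/-- Transport of extensions along an isomorphism. -/
abbrev precompIso (θ : T ≅ T') (f : Extension T') : Extension T where
  tgt := f.tgt
  map := θ.hom ≫ f.map
  old := f.old.map θ.inv
  new := f.new
  old_enum := by
    refine ⟨f.old_enum.1.map (RTree.map_injective θ.inv), fun e => ?_⟩
    rw [List.mem_map]
    constructor
    · rintro ⟨s, hs, rfl⟩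
      exact (RTree.isInner_map_iff _ _).2 ((f.old_enum.2 s).1 hs)
    · exact fun h => ⟨θ.hom e, (f.old_enum.2 _).2 ((RTree.isInner_map_iff _ _).2 h),
        RTree.iso_hom_inv_apply θ e⟩
  new_enum := by
    refine enumerates_congr f.new_enum ?_
    ext e
    refine and_congr Iff.rfl (not_congr ⟨?_, ?_⟩)
    · rintro ⟨s, rfl⟩
      exact ⟨θ.inv s, by rw [RTree.comp_apply, RTree.iso_inv_hom_apply]⟩
    · rintro ⟨s, rfl⟩
      exact ⟨θ.hom s, rfl⟩

theorem sum₁_precompIso {G : ∀ f : Extension T, f.new.length = 1 → A} (hG : Invariant₁ G)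
    (θ : T ≅ T') : sum₁ G = sum₁ fun f h => G (precompIso θ f) h := by
  refine sum₁_reindex hG (precompIso θ) (fun _ h => h) (fun f f' => ?_) fun f hf => ?_
  · rw [nonempty_arrow_iff_iso, nonempty_arrow_iff_iso]
    refine exists_congr fun ψ => ?_
    change (θ.hom ≫ f.map) ≫ _ = θ.hom ≫ f'.map ↔ _
    rw [Category.assoc]
    exact Iso.cancel_iso_hom_left θ _ _
  · refine ⟨precompIso θ.symm f, hf, nonempty_arrow_iff_iso.2 ⟨Iso.refl _, ?_⟩⟩
    change (θ.hom ≫ θ.inv ≫ f.map) ≫ 𝟙 _ = _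
    rw [Category.comp_id, Iso.hom_inv_id_assoc]

/-- The classes of codimension one extensions of a grafting. -/
theorem sum₁_graft {a : S.Edge} (g : RTree.Grafting S a R T)
    {G : ∀ f : Extension T, f.new.length = 1 → A} (hG : Invariant₁ G) :
    sum₁ G = sum₁ (fun f h => G (graftPair g f (ofHom (𝟙 R)))
        (by rw [(graftPairD _ _ _).new_length, new_ofHom_id, h]; rfl)) +
      sum₁ (fun f h => G (graftPair g (ofHom (𝟙 S)) f)
        (by rw [(graftPairD _ _ _).new_length, new_ofHom_id, h]; rfl)) := by
  have hS : ∀ f : Extension S, f.new.length = 1 →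
      (graftPair g f (ofHom (𝟙 R))).new.length = 1 := fun f h => by
    rw [(graftPairD _ _ _).new_length, new_ofHom_id, h]; rfl
  have hR : ∀ f : Extension R, f.new.length = 1 →
      (graftPair g (ofHom (𝟙 S)) f).new.length = 1 := fun f h => by
    rw [(graftPairD _ _ _).new_length, new_ofHom_id, h]; rfl
  let i : Component₁ S ⊕ Component₁ R → Component₁ T := Sum.elim
    (fun z => (graftPair g z.rep (ofHom (𝟙 R))).toComponent₁ (hS _ z.rep_length))
    (fun z => (graftPair g (ofHom (𝟙 S)) z.rep).toComponent₁ (hR _ z.rep_length))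
  have hi : Function.Bijective i := by
    constructor
    · rintro (z | z) (w | w) h
      · have h := toComponent₁_eq_iff.1 h
        rw [(graftPairD _ _ _).nonempty_arrow_iff (graftPairD _ _ _)] at h
        rw [← toComponent₁_rep w]
        exact congrArg Sum.inl (rep₁_eq_of_arrow ((arrow_equivalence _).symm h.1) w.rep_length).symm
      · have h := toComponent₁_eq_iff.1 h
        rw [(graftPairD _ _ _).nonempty_arrow_iff (graftPairD _ _ _)] at h
        have := h.1.some.new_length
        rw [z.rep_length, new_ofHom_id] at this
        cases this
      · have h := toComponent₁_eq_iff.1 h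
        rw [(graftPairD _ _ _).nonempty_arrow_iff (graftPairD _ _ _)] at h
        have := h.1.some.new_length
        rw [w.rep_length, new_ofHom_id] at this
        cases this
      · have h := toComponent₁_eq_iff.1 h
        rw [(graftPairD _ _ _).nonempty_arrow_iff (graftPairD _ _ _)] at h
        rw [← toComponent₁_rep w]
        exact congrArg Sum.inr (rep₁_eq_of_arrow ((arrow_equivalence _).symm h.2) w.rep_length).symm
    · intro z
      obtain ⟨fS, fR, y, hy, ⟨D⟩⟩ := exists_degrafting g z.rep
      have hl := D.new_length
      rw [← hy.some.new_length, z.rep_length] at hl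
      rcases Nat.eq_zero_or_pos fR.new.length with h₀ | h₀
      · have h₁ : fS.new.length = 1 := by lia
        refine ⟨Sum.inl (fS.toComponent₁ h₁), rep₁_eq_of_arrow ?_ (hS _ (fS.toComponent₁
            h₁).rep_length)⟩
        refine (arrow_equivalence _).trans ?_ ((arrow_equivalence _).symm hy)
        exact ((graftPairD _ _ _).nonempty_arrow_iff D).2
          ⟨(arrow_equivalence _).symm (nonempty_arrow_rep₁ fS h₁),
            (arrow_equivalence _).symm
              (nonempty_arrow_ofHom_id _ (List.length_eq_zero_iff.1 h₀))⟩
      · have h₁ : fR.new.length = 1 := by lia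
        have h₂ : fS.new.length = 0 := by lia
        refine ⟨Sum.inr (fR.toComponent₁ h₁), rep₁_eq_of_arrow ?_ (hR _ (fR.toComponent₁
            h₁).rep_length)⟩
        refine (arrow_equivalence _).trans ?_ ((arrow_equivalence _).symm hy)
        exact ((graftPairD _ _ _).nonempty_arrow_iff D).2
          ⟨(arrow_equivalence _).symm
              (nonempty_arrow_ofHom_id _ (List.length_eq_zero_iff.1 h₂)),
            (arrow_equivalence _).symm (nonempty_arrow_rep₁ fR h₁)⟩
  rw [sum₁, ← hi.sum_comp (fun z => G z.rep z.rep_length), Fintype.sum_sum_type]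
  exact congrArg₂ _
    (Finset.sum_congr rfl fun z _ => (hG _ _ _ _ (nonempty_arrow_rep₁ _ (hS _ z.rep_length))).symm)
    (Finset.sum_congr rfl fun z _ => (hG _ _ _ _ (nonempty_arrow_rep₁ _ (hR _ z.rep_length))).symm)

/-- Functions on codimension two extensions that are alternating in the new edges. -/
def Alternating₂ (G : ∀ f : Extension T, f.new.length = 2 → A) : Prop :=
  ∀ (f f' : Extension T) (h h') (θ : f.tgt ≅ f'.tgt), f.map ≫ θ.hom = f'.map →
    SPerm (f.new.map θ.hom) f'.new (-1) → G f h = - G f' h'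

theorem comp_new_length {f : Extension T} {f' : Extension f.tgt} (h : f.new.length = 1)
    (h' : f'.new.length = 1) : (f.comp f').new.length = 2 := by
  change (f.new.map _ ++ f'.new).length = 2
  rw [List.length_append, List.length_map, h, h']

theorem eq_of_sperm_one {α : Type} [Fintype α] [DecidableEq α] {l l' : List α} (hl : l.Nodup)
    (h2 : l.length = 2) (h : SPerm l l' 1) : l = l' := by
  obtain ⟨a, b, rfl⟩ := List.length_eq_two.1 h2
  obtain ⟨c, d, rfl⟩ := List.length_eq_two.1 (h.perm.length_eq.symm.trans h2)
  have hc : c ∈ [a, b] := h.perm.mem_iff.2 List.mem_cons_self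
  have hd : d ∈ [a, b] := h.perm.mem_iff.2 (List.mem_cons_of_mem _ List.mem_cons_self)
  have hcd := h.perm.nodup_iff.1 hl
  simp only [List.mem_cons, List.not_mem_nil, or_false] at hc hd
  rcases hc with rfl | rfl <;> rcases hd with rfl | rfl
  · simp at hcd
  · rfl
  · have := h.unique hl (SPerm.swap _ _ _)
    exact absurd this (by decide)
  · simp at hcd

/-- The pairs of composable classes of codimension one extensions. -/
structure Pair (T : RTree) : Type where
  fst : Component₁ T
  snd : Component₁ fst.rep.tgt

namespace Pair

/-- Pairs as elements of a sum of finite types. -/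
def equivSigma (T : RTree) : (Σ z : Component₁ T, Component₁ z.rep.tgt) ≃ Pair T :=
  ⟨fun p => ⟨p.1, p.2⟩, fun p => ⟨p.1, p.2⟩, fun _ => rfl, fun _ => rfl⟩

noncomputable instance : Fintype (Pair T) := Fintype.ofEquiv _ (equivSigma T)

/-- The new edges of the composite of a pair. -/
noncomputable def new (p : Pair T) : List p.snd.rep.tgt.Edge :=
  p.fst.rep.new.map p.snd.rep.map ++ p.snd.rep.new

theorem new_nodup (p : Pair T) : p.new.Nodup := (p.fst.rep.comp p.snd.rep).new_enum.1

theorem new_length (p : Pair T) : p.new.length = 2 :=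
  comp_new_length p.fst.rep_length p.snd.rep_length

/-- Two pairs have the same composite, up to a permutation of sign `s` of the two new edges. -/
def Rel (s : ℤˣ) (p q : Pair T) : Prop :=
  ∃ θ : p.snd.rep.tgt ≅ q.snd.rep.tgt,
    (p.fst.rep.map ≫ p.snd.rep.map) ≫ θ.hom = q.fst.rep.map ≫ q.snd.rep.map ∧
    SPerm (p.new.map θ.hom) q.new s

theorem Rel.trans {s t : ℤˣ} {p q r : Pair T} (h : p.Rel s q) (h' : q.Rel t r) :
    p.Rel (s * t) r := by
  obtain ⟨θ, h₁, h₂⟩ := h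
  obtain ⟨ψ, h₃, h₄⟩ := h'
  refine ⟨θ ≪≫ ψ, by rw [Iso.trans_hom, ← Category.assoc, h₁, h₃], ?_⟩
  have := (h₂.map ψ.hom).trans h₄
  rwa [List.map_map] at this

theorem eq_of_rel {p q : Pair T} (h : p.Rel 1 q) : p = q := by
  obtain ⟨θ, h₁, h₂⟩ := h
  have hl := eq_of_sperm_one (p.new_nodup.map (RTree.map_injective θ.hom))
    (by rw [List.length_map, new_length]) h₂
  rw [new, new] at hl
  obtain ⟨z, w⟩ := p
  obtain ⟨z', w'⟩ := q
  dsimp only at θ h₁ hl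
  obtain ⟨c, hc⟩ := List.length_eq_one_iff.1 z.rep_length
  obtain ⟨d, hd⟩ := List.length_eq_one_iff.1 w.rep_length
  obtain ⟨c', hc'⟩ := List.length_eq_one_iff.1 z'.rep_length
  obtain ⟨d', hd'⟩ := List.length_eq_one_iff.1 w'.rep_length
  rw [hc, hd, hc', hd'] at hl
  have hdd : θ.hom d = d' := (List.cons.inj (List.cons.inj hl).2).1
  obtain ⟨ψ, hψ⟩ := RTree.exists_iso_of_range_eq (w.rep.map ≫ θ.hom) w'.rep.map (by
    rw [RTree.range_comp_iso (range_map_of_new_eq hd) θ, range_map_of_new_eq hd', hdd])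
  have hz : z.rep.map ≫ ψ.hom = z'.rep.map := by
    refine RTree.hom_ext fun s => RTree.map_injective w'.rep.map ?_
    have e₁ := congrArg (fun k => k (z.rep.map s)) hψ
    have e₂ := congrArg (fun k => k s) h₁
    exact e₁.trans e₂
  have hzz : z = z' := by
    rw [← toComponent₁_rep z]
    exact rep₁_eq_of_arrow (nonempty_arrow_iff_iso.2 ⟨ψ, hz⟩) z.rep_length
  subst hzz
  have hψ' : ψ.hom = 𝟙 _ := RTree.hom_unique z.rep.map (hz.trans (Category.comp_id _).symm)
  have hww : w = w' := by
    rw [← toComponent₁_rep w]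
    refine rep₁_eq_of_arrow (nonempty_arrow_iff_iso.2 ⟨θ, ?_⟩) w.rep_length
    rw [← hψ, hψ', Category.id_comp]
  rw [hww]

theorem exists_swap (p : Pair T) : ∃ q : Pair T, p.Rel (-1) q := by
  let x := p.fst.rep.comp p.snd.rep
  have h2 : x.new.length = 2 := p.new_length
  let i : Fin x.new.length := ⟨0, by rw [h2]; decide⟩
  have hf : (x.face i).new.length = 1 := by
    have h₁ := x.len_face i
    have h₃ : (x.face i).old = x.old := rfl
    rw [len, len, h2, h₃] at h₁
    lia
  obtain ⟨φ⟩ := nonempty_arrow_rep₁ (x.face i) hf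
  obtain ⟨f, θ, hf', h₁, -, hs⟩ := exists_comp_of_face φ
  obtain ⟨χ⟩ := nonempty_arrow_rep₁ f hf'
  have hs' := (hs.map χ.θ.hom).trans (sperm_comp_new _ χ)
  have hi : (i : ℕ) + (x.new.length - 1) = 1 := (Nat.zero_add _).trans (by rw [h2])
  rw [sign_τ_of_new_length φ hf, sign_τ_of_new_length χ hf', hi, List.map_map] at hs'
  refine ⟨⟨_, f.toComponent₁ hf'⟩, θ ≪≫ χ.θ, ?_, hs'⟩
  refine (Category.assoc x.map θ.hom χ.θ.hom).symm.trans ?_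
  rw [h₁, Category.assoc, χ.map_eq]

end Pair

/-- The terms of a sum over pairs cancel. -/
theorem sum₁_sum₁_eq_zero {G : ∀ f : Extension T, f.new.length = 2 → A} (hG : Alternating₂ G) :
    sum₁ (fun f h => sum₁ fun f' h' => G (f.comp f') (comp_new_length h h')) = 0 := by
  have h : sum₁ (fun f h => sum₁ fun f' h' => G (f.comp f') (comp_new_length h h')) =
      ∑ p : Pair T, G (p.fst.rep.comp p.snd.rep) p.new_length :=
    (Fintype.sum_sigma (fun p : (Σ z : Component₁ T, Component₁ z.rep.tgt) =>
      G (p.1.rep.comp p.2.rep) (comp_new_length p.1.rep_length p.2.rep_length))).symm.trans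
      ((Pair.equivSigma T).sum_comp fun p : Pair T =>
        G (p.fst.rep.comp p.snd.rep) p.new_length)
  rw [h]
  choose σ hσ using Pair.exists_swap (T := T)
  refine Finset.sum_involution (fun p _ => σ p) (fun p _ => ?_) (fun p _ _ hp => ?_)
    (fun _ _ => Finset.mem_univ _) fun p _ => ?_
  · obtain ⟨θ, h₁, h₂⟩ := hσ p
    exact (congrArg (· + _) (hG _ _ _ _ θ h₁ h₂)).trans (neg_add_cancel _)
  · have h₁ := hσ p
    rw [hp] at h₁
    obtain ⟨θ, h₁, h₂⟩ := h₁
    have h₃ : θ.hom = 𝟙 _ := RTree.hom_unique (p.fst.rep.map ≫ p.snd.rep.map)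
      (h₁.trans (Category.comp_id _).symm)
    rw [h₃, show p.new.map (𝟙 p.snd.rep.tgt : p.snd.rep.tgt ⟶ p.snd.rep.tgt) = p.new from
      List.map_id _] at h₂
    exact absurd (h₂.unique p.new_nodup (SPerm.refl _)) (by decide)
  · have := (hσ p).trans (hσ (σ p))
    rw [show (-1 * -1 : ℤˣ) = 1 by decide] at this
    exact (Pair.eq_of_rel this).symm

end Sums

end Extension

/-! ## Coinvariants -/

section Coinvariants

variable {k : Type u} [CommRing k]

/-- Chain complexes indexed by trees, on which the isomorphisms of trees act. -/
structure IsoAction (k : Type u) [CommRing k] where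
  /-- the complexes -/
  obj : RTree → Ch k
  /-- the action -/
  map : ∀ {T T' : RTree}, (T ≅ T') → (obj T ⟶ obj T')
  map_refl : ∀ T, map (Iso.refl T) = 𝟙 (obj T)
  map_trans : ∀ {T T' T'' : RTree} (θ : T ≅ T') (θ' : T' ≅ T''),
    map (θ ≪≫ θ') = map θ ≫ map θ'

open Extension

/-- The modules `X S m` are the coinvariants of the sums of the modules `F(T)_n`, indexed by the
extensions `x = (α : S ⟶ T, d|e)`, with `m = n + ε (|d| + |e| + 1)`. -/
structure Coinv (F : IsoAction k) (ε : ℤ) (X : RTree → ℤ → ModuleCat.{u} k) where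
  /-- the inclusions -/
  ι : ∀ {S : RTree} (x : Extension S) (n m : ℤ), n + ε * (x.len + 1) = m →
    ((F.obj x.tgt).X n ⟶ X S m)
  /-- the coordinates -/
  π : ∀ {S : RTree} (x : Extension S) (n m : ℤ), n + ε * (x.len + 1) = m →
    (X S m ⟶ (F.obj x.tgt).X n)
  ι_arrow : ∀ {S : RTree} {x y : Extension S} (φ : Arrow x y) (n m : ℤ) (hx hy),
    ι x n m hx = φ.sign • (F.map φ.θ).f n ≫ ι y n m hy
  π_arrow : ∀ {S : RTree} {x y : Extension S} (φ : Arrow x y) (n m : ℤ) (hx hy),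
    π x n m hx ≫ (F.map φ.θ).f n = φ.sign • π y n m hy
  ι_π : ∀ {S : RTree} {x y : Extension S} (φ : Arrow x y) (n m : ℤ) (hx hy),
    ι x n m hx ≫ π y n m hy = φ.sign • (F.map φ.θ).f n
  ι_π_zero : ∀ {S : RTree} {x y : Extension S} (_ : ¬ Nonempty (Arrow x y)) (n n' m : ℤ) (hx hy),
    ι x n m hx ≫ π y n' m hy = 0
  total : ∀ (S : RTree) (m : ℤ),
    ∑ z : Component S, π z.rep (m - ε * (z.rep.len + 1)) m (by ring) ≫
      ι z.rep (m - ε * (z.rep.len + 1)) m (by ring) = 𝟙 (X S m)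

theorem IsoAction.map_arrow_trans (F : IsoAction k) {S : RTree} {x y z : Extension S} (φ :
    Arrow x y)
    (ψ : Arrow y z) (χ : Arrow x z) (n : ℤ) :
    (F.map χ.θ).f n = (F.map φ.θ).f n ≫ (F.map ψ.θ).f n := by
  obtain ⟨χ', h, -⟩ := φ.exists_trans ψ
  rw [χ.θ_eq χ', h, F.map_trans, HomologicalComplex.comp_f]

theorem Extension.Arrow.sign_trans {S : RTree} {x y z : Extension S} (φ : Arrow x y)
    (ψ : Arrow y z) (χ : Arrow x z) : χ.sign = φ.sign * ψ.sign := by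
  obtain ⟨χ', -, h⟩ := φ.exists_trans ψ
  rw [χ.sign_unique χ', h]

theorem Extension.Arrow.index_eq {S : RTree} {x y : Extension S} {ε n n' m : ℤ} (φ : Arrow x y)
    (h : n + ε * (x.len + 1) = m) (h' : n' + ε * (y.len + 1) = m) : n = n' := by
  rw [φ.len_eq] at h
  lia

namespace Coinv

variable {F : IsoAction k} {ε : ℤ} {X : RTree → ℤ → ModuleCat.{u} k}

/-- Coinvariants are recognised by their universal property. -/
theorem exists_of_desc
    (ι : ∀ {S : RTree} (x : Extension S) (n m : ℤ), n + ε * (x.len + 1) = m →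
      ((F.obj x.tgt).X n ⟶ X S m))
    (ι_arrow : ∀ {S : RTree} {x y : Extension S} (φ : Arrow x y) (n m : ℤ) (hx hy),
      ι x n m hx = φ.sign • (F.map φ.θ).f n ≫ ι y n m hy)
    (hom_ext : ∀ {S : RTree} {m : ℤ} {A : ModuleCat.{u} k} {f g : X S m ⟶ A},
      (∀ x n h, ι x n m h ≫ f = ι x n m h ≫ g) → f = g)
    (desc : ∀ {S : RTree} {m : ℤ} {A : ModuleCat.{u} k}
      (f : ∀ (x : Extension S) (n : ℤ), n + ε * (x.len + 1) = m → ((F.obj x.tgt).X n ⟶ A)),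
      (∀ x y (φ : Arrow x y) n hx hy, f x n hx = φ.sign • (F.map φ.θ).f n ≫ f y n hy) →
      ∃ g : X S m ⟶ A, ∀ x n h, ι x n m h ≫ g = f x n h) :
    ∃ C : Coinv F ε X, ∀ {S : RTree} (x : Extension S) n m h, C.ι x n m h = ι x n m h := by
  classical
  have hlen : ∀ {S : RTree} {x y : Extension S} {n n' m : ℤ}, Nonempty (Arrow x y) →
      n + ε * (x.len + 1) = m → n' + ε * (y.len + 1) = m → n = n' := by
    rintro S x y n n' m ⟨φ⟩ h h'
    rw [φ.len_eq] at h
    lia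
  have key : ∀ {S : RTree} (y : Extension S) (n m : ℤ) (hy : n + ε * (y.len + 1) = m),
      ∃ g : X S m ⟶ (F.obj y.tgt).X n,
        (∀ (x : Extension S) (φ : Arrow x y) hx,
          ι x n m hx ≫ g = φ.sign • (F.map φ.θ).f n) ∧
        ∀ (x : Extension S) n' hx, ¬ Nonempty (Arrow x y) → ι x n' m hx ≫ g = 0 := by
    intro S y n m hy
    obtain ⟨g, hg⟩ := desc (S := S) (m := m) (A := (F.obj y.tgt).X n)
      (fun x n' hx => if h : Nonempty (Arrow x y) then
        h.some.sign • (F.map h.some.θ).f n' ≫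
          eqToHom (congrArg (F.obj y.tgt).X (hlen h hx hy)) else 0) (by
      intro x x' φ n' hx hx'
      by_cases h : Nonempty (Arrow x y)
      · have h' : Nonempty (Arrow x' y) :=
          (arrow_equivalence S).trans ((arrow_equivalence S).symm ⟨φ⟩) h
        simp only [dif_pos h, dif_pos h']
        rw [φ.sign_trans h'.some h.some, F.map_arrow_trans φ h'.some h.some, Category.assoc,
          Linear.comp_units_smul, smul_smul]
      · have h' : ¬ Nonempty (Arrow x' y) := fun h' => h ((arrow_equivalence S).trans ⟨φ⟩ h')
        simp only [dif_neg h, dif_neg h', Limits.comp_zero, smul_zero])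
    refine ⟨g, fun x φ hx => ?_, fun x n' hx h => ?_⟩
    · have h : Nonempty (Arrow x y) := ⟨φ⟩
      rw [hg, dif_pos h, eqToHom_refl, Category.comp_id, φ.sign_unique h.some, φ.θ_eq h.some]
    · rw [hg, dif_neg h]
  choose π hπ hπ₀ using @key
  refine ⟨⟨ι, π, ι_arrow, ?_, fun φ n m hx hy => hπ _ _ _ _ _ φ _,
    fun h n n' m hx hy => hπ₀ _ _ _ _ _ _ _ h, ?_⟩, fun _ _ _ _ => rfl⟩
  · intro S x y φ n m hx hy
    refine hom_ext fun w n' hw => ?_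
    rw [Linear.comp_units_smul]
    by_cases h : Nonempty (Arrow w x)
    · obtain ⟨ψ⟩ := h
      obtain ⟨χ, -, -⟩ := ψ.exists_trans φ
      obtain rfl := hlen ⟨ψ⟩ hw hx
      rw [← Category.assoc, hπ _ _ _ _ _ ψ, hπ _ _ _ _ _ χ, ψ.sign_trans φ χ,
        F.map_arrow_trans ψ φ χ, Linear.units_smul_comp, smul_smul, mul_comm ψ.sign, ← mul_assoc,
        Int.units_mul_self, one_mul]
    · rw [← Category.assoc, hπ₀ _ _ _ _ _ _ _ h, hπ₀, Limits.zero_comp, smul_zero]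
      exact fun h' => h ((arrow_equivalence S).trans h' ((arrow_equivalence S).symm ⟨φ⟩))
  · intro S m
    refine hom_ext fun x n hx => ?_
    rw [Preadditive.comp_sum, Category.comp_id, Finset.sum_eq_single x.toComponent]
    · obtain ⟨φ⟩ := nonempty_arrow_rep x
      have h₀ : n + ε * (x.toComponent.rep.len + 1) = m := by rw [← φ.len_eq, hx]
      obtain rfl : n = m - ε * (x.toComponent.rep.len + 1) := by lia
      rw [← Category.assoc, hπ _ _ _ _ _ φ, Linear.units_smul_comp, ← ι_arrow]
    · intro z _ hz
      rw [← Category.assoc, hπ₀, Limits.zero_comp]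
      exact fun h => hz (rep_eq_of_arrow h).symm
    · exact fun h => (h (Finset.mem_univ _)).elim

variable (C : Coinv F ε X) {S : RTree}

theorem hom_ext {m : ℤ} {A : ModuleCat.{u} k} {f g : X S m ⟶ A}
    (h : ∀ x n hx, C.ι x n m hx ≫ f = C.ι x n m hx ≫ g) : f = g := by
  rw [← Category.id_comp f, ← Category.id_comp g, ← C.total, Preadditive.sum_comp,
    Preadditive.sum_comp]
  exact Finset.sum_congr rfl fun z _ => by rw [Category.assoc, Category.assoc, h]

theorem ext_π {m : ℤ} {A : ModuleCat.{u} k} {f g : A ⟶ X S m}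
    (h : ∀ x n hx, f ≫ C.π x n m hx = g ≫ C.π x n m hx) : f = g := by
  rw [← Category.comp_id f, ← Category.comp_id g, ← C.total, Preadditive.comp_sum,
    Preadditive.comp_sum]
  exact Finset.sum_congr rfl fun z _ => by rw [← Category.assoc, ← Category.assoc, h]

theorem ι_π_self (x : Extension S) (n m : ℤ) (h h') : C.ι x n m h ≫ C.π x n m h' = 𝟙 _ := by
  obtain ⟨φ, h₁, h₂⟩ := Arrow.exists_refl x
  rw [C.ι_π φ, h₁, h₂, F.map_refl, one_smul, HomologicalComplex.id_f]

/-- The map out of the coinvariants with given restrictions. -/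
noncomputable def desc {m : ℤ} {A : ModuleCat.{u} k}
    (f : ∀ (x : Extension S) (n : ℤ), n + ε * (x.len + 1) = m → ((F.obj x.tgt).X n ⟶ A)) :
    X S m ⟶ A :=
  ∑ z : Component S, C.π z.rep (m - ε * (z.rep.len + 1)) m (by ring) ≫
    f z.rep (m - ε * (z.rep.len + 1)) (by ring)

theorem ι_desc {m : ℤ} {A : ModuleCat.{u} k}
    (f : ∀ (x : Extension S) (n : ℤ), n + ε * (x.len + 1) = m → ((F.obj x.tgt).X n ⟶ A))
    (hf : ∀ x y (φ : Arrow x y) n hx hy, f x n hx = φ.sign • (F.map φ.θ).f n ≫ f y n hy)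
    (x : Extension S) (n : ℤ) (h) : C.ι x n m h ≫ C.desc f = f x n h := by
  rw [desc, Preadditive.comp_sum, Finset.sum_eq_single x.toComponent]
  · obtain ⟨φ⟩ := nonempty_arrow_rep x
    obtain rfl : n = m - ε * (x.toComponent.rep.len + 1) := φ.index_eq h (by ring)
    rw [← Category.assoc, C.ι_π φ, Linear.units_smul_comp, ← hf]
  · intro z _ hz
    rw [← Category.assoc, C.ι_π_zero, Limits.zero_comp]
    exact fun h => hz (rep_eq_of_arrow h).symm
  · exact fun h => (h (Finset.mem_univ _)).elim

/-- The map into the coinvariants with given coordinates. -/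
noncomputable def lift {m : ℤ} {A : ModuleCat.{u} k}
    (f : ∀ (x : Extension S) (n : ℤ), n + ε * (x.len + 1) = m → (A ⟶ (F.obj x.tgt).X n)) :
    A ⟶ X S m :=
  ∑ z : Component S, f z.rep (m - ε * (z.rep.len + 1)) (by ring) ≫
    C.ι z.rep (m - ε * (z.rep.len + 1)) m (by ring)

theorem lift_π {m : ℤ} {A : ModuleCat.{u} k}
    (f : ∀ (x : Extension S) (n : ℤ), n + ε * (x.len + 1) = m → (A ⟶ (F.obj x.tgt).X n))
    (hf : ∀ x y (φ : Arrow x y) n hx hy, f x n hx ≫ (F.map φ.θ).f n = φ.sign • f y n hy)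
    (x : Extension S) (n : ℤ) (h) : C.lift f ≫ C.π x n m h = f x n h := by
  rw [lift, Preadditive.sum_comp, Finset.sum_eq_single x.toComponent]
  · obtain ⟨φ⟩ := nonempty_arrow_rep x
    obtain ⟨ψ, -, -⟩ := φ.exists_symm
    obtain rfl : n = m - ε * (x.toComponent.rep.len + 1) := φ.index_eq h (by ring)
    rw [Category.assoc, C.ι_π ψ, Linear.comp_units_smul, hf _ _ ψ _ _ h, smul_smul,
      Int.units_mul_self, one_smul]
  · intro z _ hz
    rw [Category.assoc, C.ι_π_zero, Limits.comp_zero]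
    exact fun h => hz (rep_eq_of_arrow ((arrow_equivalence S).symm h)).symm
  · exact fun h => (h (Finset.mem_univ _)).elim

end Coinv

end Coinvariants

section Graded

variable {k : Type u} [CommRing k]

namespace GradedMap

variable {a b a' b' : ℤ} {K L N K' L' : Ch k}

/-- Change of the name of the degree. -/
def cast (h : a = b) (u : GradedMap a K L) : GradedMap b K L := ⟨fun p q e => u p q (by rw [h, e])⟩

theorem cast_tens_cast (h : a = a') (h' : b = b') (u : GradedMap a K L) (v : GradedMap b K' L')
    (n m : ℤ) (e) : (u.cast h).tens (v.cast h') n m e = u.tens v n m (by rw [h, h', e]) := by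
  subst h h'; rfl

theorem cast_tens (h : a = a') (u : GradedMap a K L) (v : GradedMap b K' L')
    (n m : ℤ) (e) : (u.cast h).tens v n m e = u.tens v n m (by rw [h, e]) := by
  subst h; rfl

theorem tens_cast (h : b = b') (u : GradedMap a K L) (v : GradedMap b K' L')
    (n m : ℤ) (e) : u.tens (v.cast h) n m e = u.tens v n m (by rw [h, e]) := by
  subst h; rfl

/-- A chain map as a graded map of degree zero. -/
def ofHom (h : a = 0) (f : K ⟶ L) : GradedMap a K L :=
  ⟨fun p q e => f.f p ≫ eqToHom (congrArg L.X (by lia))⟩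

theorem ofHom_apply (h : a = 0) (f : K ⟶ L) (p : ℤ) (e) : ofHom h f p p e = f.f p :=
  Category.comp_id _

theorem ofHom_tens_ofHom (h : a = 0) (h' : b = 0) (f : K ⟶ L) (g : K' ⟶ L') (n : ℤ) (e) :
    (ofHom h f).tens (ofHom h' g) n n e = (f ⊗ₘ g).f n := by
  subst h h'
  refine tensor_hom_ext fun p q hpq => ?_
  rw [tensorIncl_tens _ _ hpq (p' := p) (q' := q) (by lia) (by lia), tensorIncl_tensorHom,
    ofHom_apply, ofHom_apply, zero_mul, Int.negOnePow_zero, one_smul]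

theorem zero_tens (v : GradedMap b K' L') (n m : ℤ) (e) :
    (0 : GradedMap a K L).tens v n m e = 0 := by
  have := add_tens (0 : GradedMap a K L) 0 v n m e
  rwa [add_zero, left_eq_add] at this

theorem tens_zero (u : GradedMap a K L) (n m : ℤ) (e) :
    u.tens (0 : GradedMap b K' L') n m e = 0 := by
  have := tens_add u (0 : GradedMap b K' L') 0 n m e
  rwa [add_zero, left_eq_add] at this

end GradedMap

theorem tensorHom_sum {ι : Type*} (s : Finset ι) {A B A' B' : ModuleCat.{u} k} (f : A ⟶ B)
    (g : ι → (A' ⟶ B')) : (f ⊗ₘ ∑ i ∈ s, g i) = ∑ i ∈ s, (f ⊗ₘ g i) :=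
  map_sum (AddMonoidHom.mk' (fun g : A' ⟶ B' => f ⊗ₘ g)
    fun _ _ => MonoidalPreadditive.tensor_add _ _ _) g s

theorem sum_tensorHom {ι : Type*} (s : Finset ι) {A B A' B' : ModuleCat.{u} k} (f : ι → (A ⟶ B))
    (g : A' ⟶ B') : ((∑ i ∈ s, f i) ⊗ₘ g) = ∑ i ∈ s, (f i ⊗ₘ g) :=
  map_sum (AddMonoidHom.mk' (fun f : A ⟶ B => f ⊗ₘ g)
    fun _ _ => MonoidalPreadditive.add_tensor _ _ _) f s

end Graded

section Split

open Extension

variable {k : Type u} [CommRing k] {F : IsoAction k} {ε : ℤ} {C : RTree → Ch k}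

namespace Coinv

variable (M : Coinv F ε fun S m => (C S).X m) {S R U : RTree} {a : S.Edge}

/-- The inclusions, as graded maps. -/
def i (x : Extension S) : GradedMap (ε * (x.len + 1)) (F.obj x.tgt) (C S) :=
  ⟨fun n m h => M.ι x n m h⟩

/-- The coordinates, as graded maps. -/
def p (x : Extension S) : GradedMap (-(ε * (x.len + 1))) (C S) (F.obj x.tgt) :=
  ⟨fun m n h => M.π x n m (by lia)⟩

theorem i_arrow {x y : Extension S} (φ : Arrow x y) :
    M.i x = φ.sign • ((M.i y).pre (F.map φ.θ)).cast (by rw [φ.len_eq]) :=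
  GradedMap.hom_ext fun n m h => by
    rw [GradedMap.units_smul_apply]
    exact M.ι_arrow φ n m h _

theorem i_comp_p {x y : Extension S} (φ : Arrow x y) :
    (M.i x).comp (M.p y) = φ.sign • GradedMap.ofHom (by rw [φ.len_eq]; ring) (F.map φ.θ) :=
  GradedMap.hom_ext fun n n' h => by
    obtain rfl : n = n' := by rw [← h, φ.len_eq]; ring
    rw [GradedMap.units_smul_apply, GradedMap.ofHom_apply]
    exact M.ι_π φ n _ _ _

theorem i_comp_p_zero {x y : Extension S} (h : ¬ Nonempty (Arrow x y)) :
    (M.i x).comp (M.p y) = 0 := GradedMap.hom_ext fun _ _ _ => M.ι_π_zero h _ _ _ _ _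

theorem tens_total (m : ℤ) :
    ∑ z : Component S, ∑ w : Component R,
      ((ε * (w.rep.len + 1)) * (ε * (z.rep.len + 1))).negOnePow •
        (M.p z.rep).tens (M.p w.rep) m
            (m - (ε * (z.rep.len + 1) + ε * (w.rep.len + 1))) (by ring) ≫
          (M.i z.rep).tens (M.i w.rep) (m - (ε * (z.rep.len + 1) + ε * (w.rep.len + 1))) m
            (by ring) = 𝟙 ((C S ⊗ C R).X m) := by
  refine tensor_hom_ext fun p q hpq => ?_
  rw [Preadditive.comp_sum, Category.comp_id]
  have h : ∀ (x : Extension S) (y : Extension R), tensorIncl (C S) (C R) p q m hpq ≫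
      (((ε * (y.len + 1)) * (ε * (x.len + 1))).negOnePow •
        (M.p x).tens (M.p y) m (m - (ε * (x.len + 1) + ε * (y.len + 1))) (by ring) ≫
          (M.i x).tens (M.i y) (m - (ε * (x.len + 1) + ε * (y.len + 1))) m (by ring)) =
      ((M.π x (p - ε * (x.len + 1)) p (by ring) ≫ M.ι x (p - ε * (x.len + 1)) p (by ring)) ⊗ₘ
        (M.π y (q - ε * (y.len + 1)) q (by ring) ≫ M.ι y (q - ε * (y.len + 1)) q (by ring))) ≫
        tensorIncl (C S) (C R) p q m hpq := by
    intro x y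
    rw [GradedMap.tens_comp, smul_smul, ← Int.negOnePow_add, Linear.comp_units_smul,
      GradedMap.tensorIncl_tens _ _ hpq (p' := p) (q' := q) (by ring) (by ring), smul_smul,
      ← Int.negOnePow_add, show ε * (y.len + 1) * (ε * (x.len + 1)) +
        ε * (y.len + 1) * -(ε * (x.len + 1)) + (-(ε * (y.len + 1)) + ε * (y.len + 1)) * p = 0 by
        ring, Int.negOnePow_zero, one_smul]
    rfl
  simp only [Preadditive.comp_sum]
  simp only [h]
  simp only [← Preadditive.sum_comp, ← tensorHom_sum, ← sum_tensorHom]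
  rw [M.total, M.total, id_tensorHom_id, Category.id_comp]

theorem tens_ext_p {A : ModuleCat.{u} k} {m : ℤ} {f g : A ⟶ (C S ⊗ C R).X m}
    (h : ∀ (x : Extension S) (y : Extension R) n hn,
      f ≫ (M.p x).tens (M.p y) m n hn = g ≫ (M.p x).tens (M.p y) m n hn) : f = g := by
  rw [← Category.comp_id f, ← Category.comp_id g, ← M.tens_total]
  simp only [Preadditive.comp_sum, Linear.comp_units_smul]
  exact Finset.sum_congr rfl fun z _ => Finset.sum_congr rfl fun w _ => by
    rw [← Category.assoc, ← Category.assoc, h]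

theorem hom_ext_graft (g : RTree.Grafting S a R U) {m : ℤ} {A : ModuleCat.{u} k}
    {f f' : (C U).X m ⟶ A} (h : ∀ (xS : Extension S) (xR : Extension R) (x : Extension U)
      (_ : x.Degrafting g xS xR) n hn, M.ι x n m hn ≫ f = M.ι x n m hn ≫ f') : f = f' := by
  refine M.hom_ext fun x n hx => ?_
  obtain ⟨xS, xR, y, ⟨φ⟩, ⟨D⟩⟩ := exists_degrafting g x
  have hy : n + ε * (y.len + 1) = m := by rw [← φ.len_eq, hx]
  rw [M.ι_arrow φ n m hx hy, Linear.units_smul_comp, Linear.units_smul_comp, Category.assoc,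
    Category.assoc, h xS xR y D]

end Coinv

/-- Maps `F(S ∘_a R) ⟶ F(S) ⊗ F(R)` compatible with isomorphisms. -/
structure Splitting (F : IsoAction k) where
  /-- the maps -/
  t : ∀ {S : RTree} {a : S.Edge} {R T : RTree}, RTree.Grafting S a R T →
    (F.obj T ⟶ F.obj S ⊗ F.obj R)
  naturality : ∀ {S S' R R' T T' : RTree} {a : S.Edge} {a' : S'.Edge}
    (g : RTree.Grafting S a R T) (g' : RTree.Grafting S' a' R' T') (θS : S ≅ S') (θR : R ≅ R')
    (θ : T ≅ T'), g.Compatible g' θS.hom θR.hom θ.hom →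
    F.map θ ≫ t g' = t g ≫ (F.map θS ⊗ₘ F.map θR)

namespace Coinv

variable (M : Coinv F ε fun S m => (C S).X m) (t : Splitting F) (c : ℕ → ℕ → ℕ → ℕ → ℤˣ)
  {S R U : RTree} {a : S.Edge}

/-- The sign in a structure map. -/
def splitSign (xS : Extension S) (xR : Extension R) : ℤˣ :=
  c xS.old.length xS.new.length xR.old.length xR.new.length

/-- The structure map of the coinvariants, in degree `m`. -/
noncomputable def split (g : RTree.Grafting S a R U) (m : ℤ) : (C U).X m ⟶ (C S ⊗ C R).X m :=
  ∑ z : Component S, ∑ w : Component R, splitSign c z.rep w.rep •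
    M.π (graftPair g z.rep w.rep) (m - ε * ((graftPair g z.rep w.rep).len + 1)) m (by ring) ≫
      (t.t (graftPairD g z.rep w.rep).graft).f _ ≫ (M.i z.rep).tens (M.i w.rep) _ m (by
        rw [(graftPairD g z.rep w.rep).len_eq]; push_cast; ring)

variable {x x' : Extension U} {xS xS' : Extension S} {xR xR' : Extension R}
  {g : RTree.Grafting S a R U}

theorem _root_.Extension.Degrafting.index (D : x.Degrafting g xS xR) {n m : ℤ}
    (h : n + ε * (x.len + 1) = m) : n + (ε * (xS.len + 1) + ε * (xR.len + 1)) = m := by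
  rw [← h, D.len_eq]; push_cast; ring

theorem _root_.Extension.Degrafting.index' (D : x.Degrafting g xS xR) {n m : ℤ}
    (h : n + ε * (x.len + 1) = m) : m + (-(ε * (xS.len + 1)) + -(ε * (xR.len + 1))) = n := by
  rw [← h, D.len_eq]; push_cast; ring

theorem _root_.Splitting.arrow (D : x.Degrafting g xS xR) (D' : x'.Degrafting g xS' xR')
    (φ : Arrow x x') (φS : Arrow xS xS') (φR : Arrow xR xR') :
    F.map φ.θ ≫ t.t D'.graft = t.t D.graft ≫ (F.map φS.θ ⊗ₘ F.map φR.θ) ∧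
      φ.sign = φS.sign * φR.sign := by
  obtain ⟨φ', h, hs⟩ := D.exists_arrow D' φS φR
  rw [φ.sign_unique φ', φ.θ_eq φ', t.naturality _ _ φS.θ φR.θ φ'.θ h]
  exact ⟨rfl, hs⟩

theorem splitSign_eq (φS : Arrow xS xS') (φR : Arrow xR xR') :
    splitSign c xS xR = splitSign c xS' xR' := by
  rw [splitSign, splitSign, φS.old_length, φS.new_length, φR.old_length, φR.new_length]

theorem ι_split (D : x.Degrafting g xS xR) (n m : ℤ) (h : n + ε * (x.len + 1) = m) :
    M.ι x n m h ≫ M.split t c g m =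
      splitSign c xS xR • (t.t D.graft).f n ≫ (M.i xS).tens (M.i xR) n m (D.index h) := by
  rw [split, Preadditive.comp_sum, Finset.sum_eq_single xS.toComponent, Preadditive.comp_sum,
    Finset.sum_eq_single xR.toComponent]
  · obtain ⟨φS⟩ := nonempty_arrow_rep xS
    obtain ⟨φR⟩ := nonempty_arrow_rep xR
    have D' := graftPairD g xS.toComponent.rep xR.toComponent.rep
    obtain ⟨φ, -, -⟩ := D.exists_arrow (graftPairD g xS.toComponent.rep xR.toComponent.rep) φS φR
    obtain ⟨h₁, h₂⟩ := t.arrow D (graftPairD g xS.toComponent.rep xR.toComponent.rep) φ φS φR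
    have h₁' := congrArg (fun f => f.f n) h₁
    rw [HomologicalComplex.comp_f, HomologicalComplex.comp_f] at h₁'
    obtain rfl : n = m - ε * ((graftPair g xS.toComponent.rep xR.toComponent.rep).len + 1) :=
      φ.index_eq h (by ring)
    rw [Linear.comp_units_smul, ← Category.assoc, M.ι_π φ, Linear.units_smul_comp,
      reassoc_of% h₁', GradedMap.pre_tens, M.i_arrow φS, M.i_arrow φR,
      GradedMap.units_smul_tens, GradedMap.tens_units_smul, GradedMap.cast_tens_cast, h₂,
      splitSign_eq c φS φR, Linear.comp_units_smul, Linear.comp_units_smul, smul_smul φS.sign]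
  · intro w _ hw
    rw [Linear.comp_units_smul, ← Category.assoc, M.ι_π_zero, Limits.zero_comp, smul_zero]
    rw [D.nonempty_arrow_iff (graftPairD _ _ _)]
    exact fun h => hw (rep_eq_of_arrow h.2).symm
  · exact fun h => (h (Finset.mem_univ _)).elim
  · intro z _ hz
    rw [Preadditive.comp_sum]
    refine Finset.sum_eq_zero fun w _ => ?_
    rw [Linear.comp_units_smul, ← Category.assoc, M.ι_π_zero, Limits.zero_comp, smul_zero]
    rw [D.nonempty_arrow_iff (graftPairD _ _ _)]
    exact fun h => hz (rep_eq_of_arrow h.1).symm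
  · exact fun h => (h (Finset.mem_univ _)).elim

theorem split_π (D : x.Degrafting g xS xR) (n m : ℤ) (h : n + ε * (x.len + 1) = m) :
    M.split t c g m ≫ (M.p xS).tens (M.p xR) m n (D.index' h) =
      (splitSign c xS xR * ((ε * (xR.len + 1)) * (ε * (xS.len + 1))).negOnePow) •
        M.π x n m h ≫ (t.t D.graft).f n := by
  refine M.hom_ext_graft g fun yS yR y E n' hy => ?_
  rw [← Category.assoc, M.ι_split t c E, Linear.units_smul_comp, Category.assoc,
    GradedMap.tens_comp, Linear.comp_units_smul, Linear.comp_units_smul, smul_smul]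
  by_cases hA : Nonempty (Arrow y x)
  · obtain ⟨φ⟩ := hA
    obtain ⟨⟨φS⟩, ⟨φR⟩⟩ := (E.nonempty_arrow_iff D).1 ⟨φ⟩
    obtain ⟨h₁, h₂⟩ := t.arrow E D φ φS φR
    obtain rfl := φ.index_eq hy h
    have h₁' := congrArg (fun f => f.f n') h₁
    rw [HomologicalComplex.comp_f, HomologicalComplex.comp_f] at h₁'
    have hA : (-(ε * (xR.len + 1)) * (ε * (xS.len + 1))).negOnePow =
        (ε * (xR.len + 1) * (ε * (xS.len + 1))).negOnePow := by
      rw [neg_mul, Int.negOnePow_neg]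
    rw [M.i_comp_p φS, M.i_comp_p φR, GradedMap.units_smul_tens, GradedMap.tens_units_smul,
      GradedMap.ofHom_tens_ofHom, ← Category.assoc (M.ι y _ _ _), M.ι_π φ, Linear.units_smul_comp,
      h₁', h₂, splitSign_eq c φS φR, φS.len_eq, Linear.comp_units_smul, Linear.comp_units_smul,
      smul_smul, smul_smul, smul_smul, hA]
    congr 1
    ac_rfl
  · rw [← Category.assoc, M.ι_π_zero hA, Limits.zero_comp, smul_zero]
    rw [E.nonempty_arrow_iff D, not_and_or] at hA
    rcases hA with hA | hA
    · rw [M.i_comp_p_zero hA, GradedMap.zero_tens, Limits.comp_zero, smul_zero]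
    · rw [M.i_comp_p_zero hA, GradedMap.tens_zero, Limits.comp_zero, smul_zero]

end Coinv

end Split

/-! ## Iterated graftings -/

namespace RTree.Grafting

variable {S R Q T RQ SR : RTree} {a c : S.Edge} {b : R.Edge}

/-- Change of the name of the leaf. -/
def congr {a' : S.Edge} (h : a = a') (g : Grafting S a R T) : Grafting S a' R T :=
  ⟨g.inl, g.inr, h ▸ g.isMin, h ▸ g.ne_root, g.has_vertex, h ▸ g.glue, h ▸ g.range_inl,
    h ▸ g.range_inr⟩

/-- Transport along an isomorphism. -/
def mapIso {T' : RTree} (g : Grafting S a R T) (θ : T ≅ T') : Grafting S a R T' where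
  inl := g.inl.trans (Hom.toEmb θ.hom)
  inr := g.inr.trans (Hom.toEmb θ.hom)
  isMin := g.isMin
  ne_root := g.ne_root
  has_vertex := g.has_vertex
  glue := congrArg θ.hom g.glue
  range_inl := by
    ext e
    have h : e ∈ Set.range (g.inl.trans (Hom.toEmb θ.hom)) ↔ θ.inv e ∈ Set.range g.inl :=
      ⟨fun ⟨s, hs⟩ => ⟨s, by rw [← hs]; exact (iso_hom_inv_apply θ _).symm⟩,
        fun ⟨s, hs⟩ => ⟨s, (congrArg θ.hom hs).trans (iso_inv_hom_apply θ e)⟩⟩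
    rw [h, g.range_inl, ← iso_inv_hom_apply θ e, iso_hom_inv_apply]
    exact not_congr (Hom.toEmb θ.hom).lt_iff_lt.symm
  range_inr := by
    ext e
    have h : e ∈ Set.range (g.inr.trans (Hom.toEmb θ.hom)) ↔ θ.inv e ∈ Set.range g.inr :=
      ⟨fun ⟨s, hs⟩ => ⟨s, by rw [← hs]; exact (iso_hom_inv_apply θ _).symm⟩,
        fun ⟨s, hs⟩ => ⟨s, (congrArg θ.hom hs).trans (iso_inv_hom_apply θ e)⟩⟩
    rw [h, g.range_inr, ← iso_inv_hom_apply θ e, iso_hom_inv_apply]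
    exact (Hom.toEmb θ.hom).le_iff_le.symm

theorem exists_glue_embedding (g : Grafting S a R SR) (f : S.Edge ↪o T.Edge) (h : R.Edge ↪o T.Edge)
    (h₀ : f a = h R.rootEdge) (hf : ∀ s, ¬ f s < f a) :
    ∃ u : SR.Edge ↪o T.Edge, (∀ s, u (g.inl s) = f s) ∧ ∀ r, u (g.inr r) = h r := by
  classical
  let u : SR.Edge → T.Edge := fun e =>
    if h' : ∃ s, g.inl s = e then f h'.choose
    else h ((g.cover e).resolve_left h').choose
  have hl : ∀ s, u (g.inl s) = f s := fun s => by
    have h' : ∃ s', g.inl s' = g.inl s := ⟨s, rfl⟩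
    simp only [u, dif_pos h']
    rw [g.inl.injective h'.choose_spec]
  have hr : ∀ r, u (g.inr r) = h r := fun r => by
    by_cases hs : ∃ s', g.inl s' = g.inr r
    · obtain ⟨s, hs⟩ := hs
      rw [← hs, hl]
      obtain ⟨rfl, rfl⟩ := g.inl_eq_inr_iff.1 hs
      exact h₀
    · simp only [u, dif_neg hs]
      rw [g.inr.injective ((g.cover (g.inr r)).resolve_left hs).choose_spec]
  have hra : ∀ r, h r ≤ f a := fun r => by
    rw [h₀, h.le_iff_le]
    exact R.tree.le_root r
  have heq : ∀ s, f s ≤ f a → s = a := fun s hs => by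
    by_contra hne
    exact hf s (lt_of_le_of_ne hs (f.injective.ne hne))
  have hle : ∀ e e', u e ≤ u e' ↔ e ≤ e' := fun e e' => by
    rcases g.cover e with ⟨s, rfl⟩ | ⟨r, rfl⟩ <;> rcases g.cover e' with ⟨s', rfl⟩ | ⟨r', rfl⟩
    · rw [hl, hl, f.le_iff_le, g.inl.le_iff_le]
    · rw [hl, hr, g.inl_le_inr_iff]
      constructor
      · intro h'
        have hs := heq s (h'.trans (hra r'))
        refine ⟨hs, le_antisymm (R.tree.le_root _) ?_⟩
        rwa [hs, h₀, h.le_iff_le] at h'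
      · rintro ⟨rfl, rfl⟩
        exact h₀.le
    · rw [hl, hr, g.inr_le_inl_iff]
      constructor
      · intro h'
        rcases T.tree.comparable h' (hra r) with h'' | h''
        · exact (heq s' h'').symm.le
        · exact f.le_iff_le.1 h''
      · exact fun h' => (hra r).trans (f.le_iff_le.2 h')
    · rw [hr, hr, h.le_iff_le, g.inr.le_iff_le]
  exact ⟨⟨⟨u, fun e e' h' => le_antisymm ((hle _ _).1 h'.le) ((hle _ _).1 h'.ge)⟩, hle _ _⟩, hl, hr⟩

theorem exists_regraft_seq (g₁ : Grafting R b Q RQ) (g₂ : Grafting S a RQ T) :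
    ∃ (SR : RTree) (g₃ : Grafting S a R SR) (g₄ : Grafting SR (g₃.inr b) Q T),
      (∀ e, g₄.inl (g₃.inl e) = g₂.inl e) ∧ (∀ e, g₄.inl (g₃.inr e) = g₂.inr (g₁.inl e)) ∧
      (∀ e, g₄.inr e = g₂.inr (g₁.inr e)) := by
  have hR : ¬ IsMin R.rootEdge := fun h => g₁.ne_root (le_antisymm (R.tree.le_root _)
    (h (R.tree.le_root _)))
  obtain ⟨SR, ⟨g₃⟩⟩ := exists_grafting (S := S) (a := a) (R := R) g₂.isMin g₂.ne_root hR
  obtain ⟨u, hl, hr⟩ := g₃.exists_glue_embedding g₂.inl (g₁.inl.trans g₂.inr)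
    (by rw [g₂.glue, ← g₁.inl_root]; rfl) g₂.not_inl_lt
  refine ⟨SR, g₃, ⟨u, g₁.inr.trans g₂.inr, g₃.isMin_inr_iff.2 g₁.isMin, ?_, g₁.has_vertex, ?_, ?_,
    ?_⟩, hl, hr, fun _ => rfl⟩
  · rw [← g₃.inl_root]
    intro h
    exact g₃.ne_root (g₃.inl_eq_inr_iff.1 h.symm).1.symm
  · rw [hr]
    exact congrArg g₂.inr g₁.glue
  · rw [hr]
    change _ = {e | ¬ e < g₂.inr (g₁.inl b)}
    ext e
    constructor
    · rintro ⟨s, rfl⟩ h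
      rcases g₃.cover s with ⟨s, rfl⟩ | ⟨r, rfl⟩
      · rw [hl] at h
        obtain ⟨rfl, h'⟩ := g₂.inl_le_inr_iff.1 h.le
        rw [h', g₂.glue] at h
        exact lt_irrefl _ h
      · rw [hr] at h
        exact g₁.not_inl_lt r (g₂.inr.lt_iff_lt.1 h)
    · intro h
      rcases g₂.cover e with ⟨s, rfl⟩ | ⟨q, rfl⟩
      · exact ⟨g₃.inl s, hl s⟩
      · have h' : q ∈ Set.range g₁.inl := by
          rw [g₁.range_inl]
          exact fun h' => h (g₂.inr.lt_iff_lt.2 h')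
        obtain ⟨r, rfl⟩ := h'
        exact ⟨g₃.inr r, hr r⟩
  · rw [hr]
    change _ = {e | e ≤ g₂.inr (g₁.inl b)}
    ext e
    constructor
    · rintro ⟨q, rfl⟩
      exact g₂.inr.le_iff_le.2 (g₁.inr_le q)
    · intro h
      have h' : e ∈ Set.range g₂.inr := by
        rw [g₂.range_inr]
        exact le_trans h (g₂.inr_le _)
      obtain ⟨q, rfl⟩ := h'
      have h'' : q ∈ Set.range g₁.inr := by
        rw [g₁.range_inr]
        exact g₂.inr.le_iff_le.1 h
      obtain ⟨q, rfl⟩ := h''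
      exact ⟨q, rfl⟩

theorem exists_regraft_par (hac : a ≠ c) (g₁ : Grafting S a R SR)
    (g₂ : Grafting SR (g₁.inl c) Q T) :
    ∃ (SQ : RTree) (g₃ : Grafting S c Q SQ) (g₄ : Grafting SQ (g₃.inl a) R T),
      (∀ e, g₂.inl (g₁.inl e) = g₄.inl (g₃.inl e)) ∧ (∀ e, g₂.inl (g₁.inr e) = g₄.inr e) ∧
      (∀ e, g₂.inr e = g₄.inl (g₃.inr e)) := by
  have hc : IsMin c := (g₁.isMin_inl_iff.1 g₂.isMin).1
  have hc' : c ≠ S.rootEdge := fun h => g₂.ne_root (by rw [h, g₁.inl_root])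
  obtain ⟨SQ, ⟨g₃⟩⟩ := exists_grafting (S := S) (a := c) (R := Q) hc hc' g₂.has_vertex
  obtain ⟨u, hl, hr⟩ := g₃.exists_glue_embedding (g₁.inl.trans g₂.inl) g₂.inr g₂.glue
    fun s => g₂.not_inl_lt _
  refine ⟨SQ, g₃, ⟨u, g₁.inr.trans g₂.inl, g₃.isMin_inl_iff.2 ⟨g₁.isMin, hac⟩, ?_, g₁.has_vertex,
    ?_, ?_, ?_⟩, fun e => (hl e).symm, fun _ => rfl, fun e => (hr e).symm⟩
  · rw [← g₃.inl_root]
    exact g₃.inl.injective.ne g₁.ne_root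
  · rw [hl]
    exact congrArg g₂.inl g₁.glue
  · rw [hl]
    change _ = {e | ¬ e < g₂.inl (g₁.inl a)}
    ext e
    constructor
    · rintro ⟨s, rfl⟩ h
      rcases g₃.cover s with ⟨s, rfl⟩ | ⟨r, rfl⟩
      · rw [hl] at h
        exact g₁.not_inl_lt s (g₂.inl.lt_iff_lt.1 h)
      · rw [hr] at h
        have h' := g₁.inl.le_iff_le.1 (g₂.inr_le_inl_iff.1 h.le)
        exact hac (le_antisymm (g₁.isMin h') h')
    · intro h
      rcases g₂.cover e with ⟨s, rfl⟩ | ⟨q, rfl⟩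
      · have h' : s ∈ Set.range g₁.inl := by
          rw [g₁.range_inl]
          exact fun h' => h (g₂.inl.lt_iff_lt.2 h')
        obtain ⟨s, rfl⟩ := h'
        exact ⟨g₃.inl s, hl s⟩
      · exact ⟨g₃.inr q, hr q⟩
  · rw [hl]
    change _ = {e | e ≤ g₂.inl (g₁.inl a)}
    ext e
    constructor
    · rintro ⟨q, rfl⟩
      exact g₂.inl.le_iff_le.2 (g₁.inr_le q)
    · intro h
      rcases g₂.cover e with ⟨s, rfl⟩ | ⟨q, rfl⟩
      · have h' : s ∈ Set.range g₁.inr := by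
          rw [g₁.range_inr]
          exact g₂.inl.le_iff_le.1 h
        obtain ⟨r, rfl⟩ := h'
        exact ⟨r, rfl⟩
      · have h' := g₁.inl.le_iff_le.1 (g₂.inr_le_inl_iff.1 h)
        exact (hac (le_antisymm (g₁.isMin h') h')).elim

end RTree.Grafting

namespace Extension

section Regraft

variable {S R Q RQ SR SQ T : RTree} {a c : S.Edge} {b : R.Edge} {xS : Extension S}
  {xR : Extension R} {xQ : Extension Q} {x : Extension T}

theorem exists_regraft_seq {g₁ : RTree.Grafting R b Q RQ} {g₂ : RTree.Grafting S a RQ T}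
    {g₃ : RTree.Grafting S a R SR} {g₄ : RTree.Grafting SR (g₃.inr b) Q T}
    (h₁ : ∀ e, g₄.inl (g₃.inl e) = g₂.inl e) (h₂ : ∀ e, g₄.inl (g₃.inr e) = g₂.inr (g₁.inl e))
    (h₃ : ∀ e, g₄.inr e = g₂.inr (g₁.inr e)) {xRQ : Extension RQ}
    (D₁ : xRQ.Degrafting g₁ xR xQ) (D₂ : x.Degrafting g₂ xS xRQ) :
    ∃ (xSR : Extension SR) (D₃ : xSR.Degrafting g₃ xS xR) (x' : Extension T) (φ : Arrow x x')
      (D₄ : x'.Degrafting g₄ xSR xQ), φ.sign = (-1) ^ (1 + xS.old.length) ∧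
      (∀ e, D₄.graft.inl (D₃.graft.inl e) = φ.θ.hom (D₂.graft.inl e)) ∧
      (∀ e, D₄.graft.inl (D₃.graft.inr e) = φ.θ.hom (D₂.graft.inr (D₁.graft.inl e))) ∧
      (∀ e, D₄.graft.inr e = φ.θ.hom (D₂.graft.inr (D₁.graft.inr e))) := by
  obtain ⟨TSR, g₃', g₄', k₁, k₂, k₃⟩ := D₁.graft.exists_regraft_seq D₂.graft
  obtain ⟨α, hα⟩ := g₃.exists_glue g₃' xS.map xR.map rfl
  have hc : g₄.Compatible g₄' α xQ.map x.map := by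
    refine ⟨hα.inr b, fun e => ?_, fun e => ?_⟩
    · rcases g₃.cover e with ⟨s, rfl⟩ | ⟨r, rfl⟩
      · rw [h₁, D₂.compat.inl, ← k₁, hα.inl]
      · rw [h₂, D₂.compat.inr, D₁.compat.inl, ← k₂, hα.inr]
    · rw [h₃, D₂.compat.inr, D₁.compat.inr, k₃]
  let xSR := ofGraft (xS := xS) (xR := xR) g₃ g₃' α hα
  let g₅ : RTree.Grafting xSR.tgt (xSR.map (g₃.inr b)) xQ.tgt x.tgt := g₄'.congr (hα.inr b).symm
  have hc' : g₄.Compatible g₅ xSR.map xQ.map x.map := ⟨rfl, hc.inl, hc.inr⟩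
  have hold : SPerm x.old (ofGraft (xS := xSR) (xR := xQ) g₄ g₅ x.map hc').old
      ((-1) ^ (1 + xS.old.length)) := by
    have h := SPerm.middle (g₂.inr (g₁.inl b)) (g₂.inl a :: xS.old.map g₂.inl)
      ((xR.old.map g₁.inl).map g₂.inr ++ (xQ.old.map g₁.inr).map g₂.inr)
    rw [List.length_cons, List.length_map, add_comm] at h
    refine ((SPerm.of_eq ?_).trans (h.trans (SPerm.of_eq ?_))).cast (by rw [one_mul, mul_one])
    · rw [D₂.old_eq, D₁.old_eq, List.map_cons, List.map_append]
      rfl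
    · change _ = g₄.inl (g₃.inr b) :: ((g₃.inl a :: (xS.old.map g₃.inl ++ xR.old.map g₃.inr)).map
        g₄.inl ++ xQ.old.map g₄.inr)
      rw [List.map_cons, List.map_append, List.map_map, List.map_map, List.map_map, List.map_map,
        show (g₄.inl : SR.Edge → _) ∘ g₃.inl = g₂.inl from funext h₁,
        show (g₄.inl : SR.Edge → _) ∘ g₃.inr = g₂.inr ∘ g₁.inl from funext h₂,
        show (g₄.inr : Q.Edge → _) = g₂.inr ∘ g₁.inr from funext h₃, h₁, h₂]
      simp
  have hnew : (x.new.map (𝟙 x.tgt : x.tgt ⟶ x.tgt)) =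
      (ofGraft (xS := xSR) (xR := xQ) g₄ g₅ x.map hc').new := by
    refine (List.map_id x.new).trans ?_
    change _ = (xS.new.map g₃'.inl ++ xR.new.map g₃'.inr).map g₄'.inl ++ xQ.new.map g₄'.inr
    rw [D₂.new_eq, D₁.new_eq, List.map_append, List.map_append, List.map_map, List.map_map,
      List.map_map, List.map_map,
      show (g₄'.inl : TSR.Edge → _) ∘ g₃'.inl = D₂.graft.inl from funext k₁,
      show (g₄'.inl : TSR.Edge → _) ∘ g₃'.inr = D₂.graft.inr ∘ D₁.graft.inl from funext k₂,
      show (g₄'.inr : xQ.tgt.Edge → _) = D₂.graft.inr ∘ D₁.graft.inr from funext k₃,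
      List.append_assoc]
  obtain ⟨φ, hφ, hs⟩ := Arrow.exists_of_sperm (x := x)
    (y := ofGraft (xS := xSR) (xR := xQ) g₄ g₅ x.map hc') (Iso.refl _) (Category.comp_id _) hold
    (SPerm.of_eq hnew)
  refine ⟨xSR, degraftingOfGraft g₃ g₃' α hα, _, φ, degraftingOfGraft (xS := xSR) g₄ g₅ x.map hc',
    hs.trans (mul_one _), ?_, ?_, ?_⟩
  all_goals rw [hφ]
  exacts [k₁, k₂, k₃]

theorem exists_regraft_par (hac : a ≠ c) {g₁ : RTree.Grafting S a R SR}
    {g₂ : RTree.Grafting SR (g₁.inl c) Q T} {g₃ : RTree.Grafting S c Q SQ}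
    {g₄ : RTree.Grafting SQ (g₃.inl a) R T} (h₁ : ∀ e, g₂.inl (g₁.inl e) = g₄.inl (g₃.inl e))
    (h₂ : ∀ e, g₂.inl (g₁.inr e) = g₄.inr e) (h₃ : ∀ e, g₂.inr e = g₄.inl (g₃.inr e))
    {xSR : Extension SR} (D₁ : xSR.Degrafting g₁ xS xR) (D₂ : x.Degrafting g₂ xSR xQ) :
    ∃ (xSQ : Extension SQ) (D₃ : xSQ.Degrafting g₃ xS xQ) (x' : Extension T) (φ : Arrow x x')
      (D₄ : x'.Degrafting g₄ xSQ xR),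
      φ.sign = (-1) ^ (1 + xR.old.length * xQ.old.length + xR.new.length * xQ.new.length) ∧
      (∀ e, φ.θ.hom (D₂.graft.inl (D₁.graft.inl e)) = D₄.graft.inl (D₃.graft.inl e)) ∧
      (∀ e, φ.θ.hom (D₂.graft.inl (D₁.graft.inr e)) = D₄.graft.inr e) ∧
      (∀ e, φ.θ.hom (D₂.graft.inr e) = D₄.graft.inl (D₃.graft.inr e)) := by
  obtain ⟨TSQ, g₃', g₄', k₁, k₂, k₃⟩ := D₁.graft.exists_regraft_par
    ((RTree.map_injective xS.map).ne hac) (D₂.graft.congr (D₁.compat.inl c))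
  obtain ⟨α, hα⟩ := g₃.exists_glue g₃' xS.map xQ.map rfl
  replace k₁ : ∀ e, D₂.graft.inl (D₁.graft.inl e) = g₄'.inl (g₃'.inl e) := k₁
  replace k₂ : ∀ e, D₂.graft.inl (D₁.graft.inr e) = g₄'.inr e := k₂
  replace k₃ : ∀ e, D₂.graft.inr e = g₄'.inl (g₃'.inr e) := k₃
  have hc : g₄.Compatible g₄' α xR.map x.map := by
    refine ⟨hα.inl a, fun e => ?_, fun e => ?_⟩
    · rcases g₃.cover e with ⟨s, rfl⟩ | ⟨r, rfl⟩
      · rw [← h₁, D₂.compat.inl]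
        exact (congrArg D₂.graft.inl (D₁.compat.inl s)).trans
          ((k₁ _).trans (congrArg g₄'.inl (hα.inl s).symm))
      · rw [← h₃, D₂.compat.inr, k₃, hα.inr]
    · rw [← h₂, D₂.compat.inl]
      exact (congrArg D₂.graft.inl (D₁.compat.inr e)).trans (k₂ _)
  let xSQ := ofGraft (xS := xS) (xR := xQ) g₃ g₃' α hα
  let g₅ : RTree.Grafting xSQ.tgt (xSQ.map (g₃.inl a)) xR.tgt x.tgt := g₄'.congr (hα.inl a).symm
  have hc' : g₄.Compatible g₅ xSQ.map xR.map x.map := ⟨rfl, hc.inl, hc.inr⟩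
  have hold : SPerm x.old (ofGraft (xS := xSQ) (xR := xR) g₄ g₅ x.map hc').old
      ((-1) ^ (1 + xR.old.length * xQ.old.length)) := by
    have h := (SPerm.swap (g₂.inl (g₁.inl c)) (g₂.inl (g₁.inl a))
      ((xS.old.map g₁.inl).map g₂.inl ++ ((xR.old.map g₁.inr).map g₂.inl ++ xQ.old.map
          g₂.inr))).trans
      (((SPerm.append_comm ((xR.old.map g₁.inr).map g₂.inl) (xQ.old.map g₂.inr)).append_left
        ((xS.old.map g₁.inl).map g₂.inl)).cons (g₂.inl (g₁.inl c)) |>.cons (g₂.inl (g₁.inl a)))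
    rw [List.length_map, List.length_map, List.length_map, ← pow_succ', add_comm] at h
    refine ((SPerm.of_eq ?_).trans (h.trans (SPerm.of_eq ?_))).cast (by rw [one_mul, mul_one])
    · rw [D₂.old_eq, D₁.old_eq, List.map_cons, List.map_append, List.cons_append,
        List.append_assoc]
    · change _ = g₄.inl (g₃.inl a) :: ((g₃.inl c :: (xS.old.map g₃.inl ++ xQ.old.map g₃.inr)).map
        g₄.inl ++ xR.old.map g₄.inr)
      rw [List.map_cons, List.map_append, List.map_map, List.map_map, List.map_map, List.map_map,
        ← show (g₂.inl : SR.Edge → _) ∘ g₁.inl = g₄.inl ∘ g₃.inl from funext h₁,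
        ← show (g₂.inr : Q.Edge → _) = g₄.inl ∘ g₃.inr from funext h₃,
        ← show (g₂.inl : SR.Edge → _) ∘ g₁.inr = g₄.inr from funext h₂, ← h₁, ← h₁,
        List.cons_append, List.append_assoc]
  have hnew : SPerm (x.new.map (𝟙 x.tgt : x.tgt ⟶ x.tgt))
      (ofGraft (xS := xSQ) (xR := xR) g₄ g₅ x.map hc').new
      ((-1) ^ (xR.new.length * xQ.new.length)) := by
    have h := (SPerm.append_comm ((xR.new.map D₁.graft.inr).map D₂.graft.inl)
      (xQ.new.map D₂.graft.inr)).append_left ((xS.new.map D₁.graft.inl).map D₂.graft.inl)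
    rw [List.length_map, List.length_map, List.length_map] at h
    refine ((SPerm.of_eq ?_).trans (h.trans (SPerm.of_eq ?_))).cast (by rw [one_mul, mul_one])
    · refine (List.map_id x.new).trans ?_
      rw [D₂.new_eq, D₁.new_eq, List.map_append, List.append_assoc]
    · change _ = (xS.new.map g₃'.inl ++ xQ.new.map g₃'.inr).map g₄'.inl ++ xR.new.map g₄'.inr
      rw [List.map_append, List.map_map, List.map_map, List.map_map, List.map_map,
        ← show (D₂.graft.inl : xSR.tgt.Edge → _) ∘ D₁.graft.inl = g₄'.inl ∘ g₃'.inl from funext k₁,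
        ← show (D₂.graft.inr : xQ.tgt.Edge → _) = g₄'.inl ∘ g₃'.inr from funext k₃,
        ← show (D₂.graft.inl : xSR.tgt.Edge → _) ∘ D₁.graft.inr = g₄'.inr from funext k₂,
        List.append_assoc]
  obtain ⟨φ, hφ, hs⟩ := Arrow.exists_of_sperm (x := x)
    (y := ofGraft (xS := xSQ) (xR := xR) g₄ g₅ x.map hc') (Iso.refl _) (Category.comp_id _) hold
    hnew
  refine ⟨xSQ, degraftingOfGraft g₃ g₃' α hα, _, φ, degraftingOfGraft (xS := xSQ) g₄ g₅ x.map hc',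
    hs.trans (pow_add _ _ _).symm, ?_, ?_, ?_⟩
  all_goals rw [hφ]
  exacts [k₁, k₂, k₃]

end Regraft

end Extension

/-! ## Associativity of the structure maps of coinvariants -/

section Assoc

open Extension

variable {k : Type u} [CommRing k] {F : IsoAction k} {ε : ℤ} {C : RTree → Ch k}

theorem GradedMap.post_id {a : ℤ} {K L : Ch k} (u : GradedMap a K L) : u.post (𝟙 L) = u :=
  GradedMap.hom_ext fun _ _ _ => Category.comp_id _

theorem GradedMap.pre_id {a : ℤ} {K L : Ch k} (u : GradedMap a K L) :
    GradedMap.pre (𝟙 K) u = u :=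
  GradedMap.hom_ext fun _ _ _ => Category.id_comp _

theorem GradedMap.tens_assoc_swap {a b c : ℤ} {K L K' L' K'' L'' : Ch k} (u : GradedMap a K L)
    (v : GradedMap b K' L') (w : GradedMap c K'' L'') (n m : ℤ) (h : n + (a + b + c) = m) :
    (u.tens v).tens w n m h ≫ (α_ L L' L'').hom.f m ≫ (L ◁ koszulSwap L' L'').f m =
      (b * c).negOnePow • (α_ K K' K'').hom.f n ≫ (K ◁ koszulSwap K' K'').f n ≫
        u.tens (w.tens v) n m (by lia) := by
  have hs : (v.tens w).post (koszulSwap L' L'') =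
      (b * c).negOnePow • (GradedMap.pre (koszulSwap K' K'') (w.tens v)).cast (add_comm c b) :=
    GradedMap.hom_ext fun p q e => by
      rw [GradedMap.units_smul_apply]
      exact tens_koszulSwap v w p q e
  rw [← Category.assoc, tens_tens_associator, Category.assoc, ← id_tensorHom, tens_post, hs,
    tens_units_smul, tens_cast, Linear.comp_units_smul, ← id_tensorHom, pre_tens, post_id, pre_id]

theorem Int.negOnePow_odd_mul {ε : ℤ} (hε : Odd ε) (a : ℤ) :
    (ε * a).negOnePow = a.negOnePow := by
  rw [Int.negOnePow_eq_iff, Int.even_sub, Int.even_mul]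
  simp [Int.not_even_iff_odd.2 hε]

theorem Int.negOnePow_coe (n : ℕ) : (n : ℤ).negOnePow = (-1) ^ n := rfl

/-- The associativity axioms of structure maps. -/
structure Splitting.IsAssoc (t : Splitting F) : Prop where
  seq : ∀ {S R Q RQ SR T : RTree} {a : S.Edge} {b : R.Edge}
    (g₁ : RTree.Grafting R b Q RQ) (g₂ : RTree.Grafting S a RQ T)
    (g₃ : RTree.Grafting S a R SR) (g₄ : RTree.Grafting SR (g₃.inr b) Q T),
    (∀ e, g₄.inl (g₃.inl e) = g₂.inl e) → (∀ e, g₄.inl (g₃.inr e) = g₂.inr (g₁.inl e)) →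
    (∀ e, g₄.inr e = g₂.inr (g₁.inr e)) →
    t.t g₂ ≫ (F.obj S ◁ t.t g₁) = t.t g₄ ≫ (t.t g₃ ▷ F.obj Q) ≫ (α_ _ _ _).hom
  par : ∀ {S R Q SR SQ T : RTree} {a c : S.Edge}, a ≠ c →
    ∀ (g₁ : RTree.Grafting S a R SR) (g₂ : RTree.Grafting SR (g₁.inl c) Q T)
    (g₃ : RTree.Grafting S c Q SQ) (g₄ : RTree.Grafting SQ (g₃.inl a) R T),
    (∀ e, g₂.inl (g₁.inl e) = g₄.inl (g₃.inl e)) → (∀ e, g₂.inl (g₁.inr e) = g₄.inr e) →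
    (∀ e, g₂.inr e = g₄.inl (g₃.inr e)) →
    t.t g₂ ≫ (t.t g₁ ▷ F.obj Q) ≫ (α_ _ _ _).hom ≫
      (F.obj S ◁ koszulSwap (F.obj R) (F.obj Q)) =
    t.t g₄ ≫ (t.t g₃ ▷ F.obj R) ≫ (α_ _ _ _).hom

theorem Splitting.t_congr (t : Splitting F) {S R T : RTree} {a a' : S.Edge} (h : a = a')
    (g : RTree.Grafting S a R T) : t.t (g.congr h) = t.t g := by
  subst h; rfl

theorem Splitting.map_t_mapIso (t : Splitting F) {S R T T' : RTree} {a : S.Edge}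
    (g : RTree.Grafting S a R T) (θ : T ≅ T') : F.map θ ≫ t.t (g.mapIso θ) = t.t g := by
  rw [t.naturality g (g.mapIso θ) (Iso.refl S) (Iso.refl R) θ ⟨rfl, fun _ => rfl, fun _ => rfl⟩,
    F.map_refl, F.map_refl, id_tensorHom_id, Category.comp_id]

namespace Coinv

variable (M : Coinv F ε fun S m => (C S).X m) (t : Splitting F) (c : ℕ → ℕ → ℕ → ℕ → ℤˣ)
  {S R Q RQ SR SQ T U : RTree} {a : S.Edge} {b : R.Edge}

theorem i_post_split {g : RTree.Grafting S a R U} (f : C U ⟶ C S ⊗ C R)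
    (hf : ∀ m, f.f m = M.split t c g m) {x : Extension U} {xS : Extension S} {xR : Extension R}
    (D : x.Degrafting g xS xR) :
    (M.i x).post f = splitSign c xS xR • (GradedMap.pre (t.t D.graft)
      ((M.i xS).tens (M.i xR))).cast (by rw [D.len_eq]; push_cast; ring) :=
  GradedMap.hom_ext fun n m h => by
    rw [GradedMap.units_smul_apply]
    exact (congrArg (M.ι x n m h ≫ ·) (hf m)).trans (M.ι_split t c D n m h)

/-- The sign rule for the sequential axiom. -/
def SeqRule (c : ℕ → ℕ → ℕ → ℕ → ℤˣ) : Prop := ∀ dS eS dR eR dQ eQ : ℕ,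
  c dS eS (1 + dR + dQ) (eR + eQ) * c dR eR dQ eQ =
    (-1) ^ (1 + dS) * (c (1 + dS + dR) (eS + eR) dQ eQ * c dS eS dR eR)

/-- The sign rule for the parallel axiom. -/
def ParRule (c : ℕ → ℕ → ℕ → ℕ → ℤˣ) : Prop := ∀ dS eS dR eR dQ eQ : ℕ,
  c (1 + dS + dR) (eS + eR) dQ eQ * c dS eS dR eR * (-1) ^ ((dR + eR + 1) * (dQ + eQ + 1)) =
    (-1) ^ (1 + dR * dQ + eR * eQ) * (c (1 + dS + dQ) (eS + eQ) dR eR * c dS eS dQ eQ)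

theorem assoc_seq (ht : t.IsAssoc) (hc : SeqRule c)
    (Δ : ∀ {S : RTree} {a : S.Edge} {R T : RTree}, RTree.Grafting S a R T → (C T ⟶ C S ⊗ C R))
    (hΔ : ∀ {S : RTree} {a : S.Edge} {R T : RTree} (g : RTree.Grafting S a R T) m,
      (Δ g).f m = M.split t c g m)
    (g₁ : RTree.Grafting R b Q RQ) (g₂ : RTree.Grafting S a RQ T)
    (g₃ : RTree.Grafting S a R SR) (g₄ : RTree.Grafting SR (g₃.inr b) Q T)
    (h₁ : ∀ e, g₄.inl (g₃.inl e) = g₂.inl e) (h₂ : ∀ e, g₄.inl (g₃.inr e) = g₂.inr (g₁.inl e))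
    (h₃ : ∀ e, g₄.inr e = g₂.inr (g₁.inr e)) :
    Δ g₂ ≫ (C S ◁ Δ g₁) = Δ g₄ ≫ (Δ g₃ ▷ C Q) ≫ (α_ _ _ _).hom := by
  ext1 m
  refine M.hom_ext_graft g₂ fun xS xRQ₀ x₀ D₀ n hx₀ => ?_
  obtain ⟨xR, xQ, xRQ, ⟨φ₀⟩, ⟨D₁⟩⟩ := exists_degrafting g₁ xRQ₀
  obtain ⟨x, ⟨D₂⟩⟩ := exists_degrafting_of_pair g₂ xS xRQ
  obtain ⟨ψ₀, -, -⟩ := Arrow.exists_refl xS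
  obtain ⟨φ₁, -, -⟩ := D₀.exists_arrow D₂ ψ₀ φ₀
  have hx : n + ε * (x.len + 1) = m := by rw [← φ₁.len_eq, hx₀]
  rw [M.ι_arrow φ₁ n m hx₀ hx, Linear.units_smul_comp, Linear.units_smul_comp, Category.assoc,
    Category.assoc]
  congr 2
  obtain ⟨xSR, D₃, x', φ, D₄, hs, k₁, k₂, k₃⟩ := Extension.exists_regraft_seq h₁ h₂ h₃ D₁ D₂
  have hx' : n + ε * (x'.len + 1) = m := by rw [← φ.len_eq, hx]
  have key := ht.seq D₁.graft (D₂.graft.mapIso φ.θ) D₃.graft (D₄.graft.congr (D₃.compat.inr b))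
    k₁ k₂ k₃
  rw [t.t_congr] at key
  replace key := congrArg (F.map φ.θ ≫ ·) key
  simp only [← Category.assoc] at key
  rw [t.map_t_mapIso] at key
  replace key := congrArg (fun f => f.f n) key
  simp only [Category.assoc, HomologicalComplex.comp_f] at key
  have e₁ : M.ι x n m hx ≫ (Δ g₂ ≫ (C S ◁ Δ g₁)).f m =
      (splitSign c xS xRQ * splitSign c xR xQ) • (t.t D₂.graft).f n ≫
        (F.obj xS.tgt ◁ t.t D₁.graft).f n ≫
          (M.i xS).tens ((M.i xR).tens (M.i xQ)) n m (by
            rw [← D₂.index hx, D₁.len_eq]; push_cast; ring) := by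
    rw [HomologicalComplex.comp_f, hΔ, ← Category.assoc, M.ι_split t c D₂, Linear.units_smul_comp,
      Category.assoc, ← id_tensorHom, GradedMap.tens_post, M.i_post_split t c (Δ g₁) (hΔ g₁) D₁,
      GradedMap.tens_units_smul, GradedMap.tens_cast, Linear.comp_units_smul, smul_smul,
      ← id_tensorHom, GradedMap.pre_tens, GradedMap.post_id, GradedMap.pre_id]
  have e₂ : M.ι x' n m hx' ≫ (Δ g₄ ≫ (Δ g₃ ▷ C Q) ≫ (α_ _ _ _).hom).f m =
      (splitSign c xSR xQ * splitSign c xS xR) • (t.t D₄.graft).f n ≫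
        (t.t D₃.graft ▷ F.obj xQ.tgt).f n ≫ (α_ (F.obj xS.tgt) (F.obj xR.tgt)
            (F.obj xQ.tgt)).hom.f n ≫
          (M.i xS).tens ((M.i xR).tens (M.i xQ)) n m (by
            rw [← D₂.index hx, D₁.len_eq]; push_cast; ring) := by
    rw [HomologicalComplex.comp_f, HomologicalComplex.comp_f, hΔ, ← Category.assoc,
      M.ι_split t c D₄, Linear.units_smul_comp,
      Category.assoc, ← tensorHom_id, ← Category.assoc ((M.i xSR).tens _ _ _ _),
      GradedMap.tens_post, M.i_post_split t c (Δ g₃) (hΔ g₃) D₃,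
      GradedMap.units_smul_tens, GradedMap.cast_tens, Linear.units_smul_comp,
      Linear.comp_units_smul, smul_smul, GradedMap.post_id, ← GradedMap.tens_tens_associator,
      ← tensorHom_id, ← Category.assoc ((t.t D₃.graft ⊗ₘ _).f n), GradedMap.pre_tens,
      GradedMap.pre_id]
  rw [e₁, M.ι_arrow φ n m hx hx', Linear.units_smul_comp, Category.assoc, e₂,
    Linear.comp_units_smul, smul_smul, reassoc_of% key, hs]
  congr 1
  rw [splitSign, splitSign, splitSign, splitSign, D₁.old_length, D₁.new_length, D₃.old_length,
    D₃.new_length, hc]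

theorem assoc_par (ht : t.IsAssoc) (hε : Odd ε) (hc : ParRule c)
    (Δ : ∀ {S : RTree} {a : S.Edge} {R T : RTree}, RTree.Grafting S a R T → (C T ⟶ C S ⊗ C R))
    (hΔ : ∀ {S : RTree} {a : S.Edge} {R T : RTree} (g : RTree.Grafting S a R T) m,
      (Δ g).f m = M.split t c g m) {a a' : S.Edge} (hac : a ≠ a')
    (g₁ : RTree.Grafting S a R SR) (g₂ : RTree.Grafting SR (g₁.inl a') Q T)
    (g₃ : RTree.Grafting S a' Q SQ) (g₄ : RTree.Grafting SQ (g₃.inl a) R T)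
    (h₁ : ∀ e, g₂.inl (g₁.inl e) = g₄.inl (g₃.inl e)) (h₂ : ∀ e, g₂.inl (g₁.inr e) = g₄.inr e)
    (h₃ : ∀ e, g₂.inr e = g₄.inl (g₃.inr e)) :
    Δ g₂ ≫ (Δ g₁ ▷ C Q) ≫ (α_ _ _ _).hom ≫ (C S ◁ koszulSwap (C R) (C Q)) =
      Δ g₄ ≫ (Δ g₃ ▷ C R) ≫ (α_ _ _ _).hom := by
  ext1 m
  refine M.hom_ext_graft g₂ fun xSR₀ xQ x₀ D₀ n hx₀ => ?_
  obtain ⟨xS, xR, xSR, ⟨φ₀⟩, ⟨D₁⟩⟩ := exists_degrafting g₁ xSR₀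
  obtain ⟨x, ⟨D₂⟩⟩ := exists_degrafting_of_pair g₂ xSR xQ
  obtain ⟨ψ₀, -, -⟩ := Arrow.exists_refl xQ
  obtain ⟨φ₁, -, -⟩ := D₀.exists_arrow D₂ φ₀ ψ₀
  have hx : n + ε * (x.len + 1) = m := by rw [← φ₁.len_eq, hx₀]
  rw [M.ι_arrow φ₁ n m hx₀ hx, Linear.units_smul_comp, Linear.units_smul_comp, Category.assoc,
    Category.assoc]
  congr 2
  obtain ⟨xSQ, D₃, x', φ, D₄, hs, k₁, k₂, k₃⟩ := Extension.exists_regraft_par hac h₁ h₂ h₃ D₁ D₂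
  have hx' : n + ε * (x'.len + 1) = m := by rw [← φ.len_eq, hx]
  have key := ht.par ((RTree.map_injective xS.map).ne hac) D₁.graft
    ((D₂.graft.congr (D₁.compat.inl a')).mapIso φ.θ) D₃.graft (D₄.graft.congr (D₃.compat.inl a))
    k₁ k₂ k₃
  rw [t.t_congr] at key
  replace key := congrArg (F.map φ.θ ≫ ·) key
  simp only [← Category.assoc] at key
  rw [t.map_t_mapIso, t.t_congr] at key
  replace key := congrArg (fun f => f.f n) key
  simp only [Category.assoc, HomologicalComplex.comp_f] at key
  have e₁ : M.ι x n m hx ≫ (Δ g₂ ≫ (Δ g₁ ▷ C Q) ≫ (α_ _ _ _).hom ≫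
        (C S ◁ koszulSwap (C R) (C Q))).f m =
      (splitSign c xSR xQ * splitSign c xS xR *
          ((ε * (xR.len + 1)) * (ε * (xQ.len + 1))).negOnePow) • (t.t D₂.graft).f n ≫
        (t.t D₁.graft ▷ F.obj xQ.tgt).f n ≫ (α_ (F.obj xS.tgt) (F.obj xR.tgt)
            (F.obj xQ.tgt)).hom.f n ≫
          (F.obj xS.tgt ◁ koszulSwap (F.obj xR.tgt) (F.obj xQ.tgt)).f n ≫
          (M.i xS).tens ((M.i xQ).tens (M.i xR)) n m (by
            rw [← D₂.index hx, D₁.len_eq]; push_cast; ring) := by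
    rw [HomologicalComplex.comp_f, HomologicalComplex.comp_f, HomologicalComplex.comp_f, hΔ,
      ← Category.assoc, M.ι_split t c D₂, Linear.units_smul_comp,
      Category.assoc, ← tensorHom_id, ← Category.assoc ((M.i xSR).tens _ _ _ _),
      GradedMap.tens_post, M.i_post_split t c (Δ g₁) (hΔ g₁) D₁,
      GradedMap.units_smul_tens, GradedMap.cast_tens, Linear.units_smul_comp,
      Linear.comp_units_smul, smul_smul, GradedMap.post_id, ← GradedMap.pre_id (M.i xQ),
      ← GradedMap.pre_tens, Category.assoc, GradedMap.tens_assoc_swap, Linear.comp_units_smul,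
      Linear.comp_units_smul, smul_smul, GradedMap.pre_id, tensorHom_id]
  have e₂ : M.ι x' n m hx' ≫ (Δ g₄ ≫ (Δ g₃ ▷ C R) ≫ (α_ _ _ _).hom).f m =
      (splitSign c xSQ xR * splitSign c xS xQ) • (t.t D₄.graft).f n ≫
        (t.t D₃.graft ▷ F.obj xR.tgt).f n ≫ (α_ (F.obj xS.tgt) (F.obj xQ.tgt)
            (F.obj xR.tgt)).hom.f n ≫
          (M.i xS).tens ((M.i xQ).tens (M.i xR)) n m (by
            rw [← D₂.index hx, D₁.len_eq]; push_cast; ring) := by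
    rw [HomologicalComplex.comp_f, HomologicalComplex.comp_f, hΔ, ← Category.assoc,
      M.ι_split t c D₄, Linear.units_smul_comp,
      Category.assoc, ← tensorHom_id, ← Category.assoc ((M.i xSQ).tens _ _ _ _),
      GradedMap.tens_post, M.i_post_split t c (Δ g₃) (hΔ g₃) D₃,
      GradedMap.units_smul_tens, GradedMap.cast_tens, Linear.units_smul_comp,
      Linear.comp_units_smul, smul_smul, GradedMap.post_id, ← GradedMap.tens_tens_associator,
      ← tensorHom_id, ← Category.assoc ((t.t D₃.graft ⊗ₘ _).f n), GradedMap.pre_tens,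
      GradedMap.pre_id]
  rw [e₁, M.ι_arrow φ n m hx hx', Linear.units_smul_comp, Category.assoc, e₂,
    Linear.comp_units_smul, smul_smul, reassoc_of% key, hs]
  congr 1
  have hsgn : ((ε * ((xR.len : ℤ) + 1)) * (ε * (xQ.len + 1))).negOnePow =
      (-1) ^ ((xR.old.length + xR.new.length + 1) * (xQ.old.length + xQ.new.length + 1)) := by
    rw [mul_assoc, Int.negOnePow_odd_mul hε, mul_left_comm, Int.negOnePow_odd_mul hε,
      ← Int.negOnePow_coe]
    congr 1
  rw [hsgn, splitSign, splitSign, splitSign, splitSign, D₁.old_length, D₁.new_length,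
    D₃.old_length, D₃.new_length, hc]

end Coinv

end Assoc

/-! ## Quasi-isomorphisms of filtered complexes -/

section QuasiIsos

variable {k : Type u} [CommRing k]

/-- The mapping cone of `f` is acyclic, in terms of maps from projective modules. -/
def ConeExact {K L : Ch k} (f : K ⟶ L) : Prop :=
  ∀ (P : ModuleCat.{u} k) (_ : Projective P) (p q r t : ℤ) (_ : p + 1 = q) (_ : q + 1 = r)
    (_ : r + 1 = t) (c : P ⟶ K.X q) (d : P ⟶ L.X r), c ≫ K.d q p = 0 →
    c ≫ f.f q = d ≫ L.d r q →
    ∃ (c' : P ⟶ K.X r) (d' : P ⟶ L.X t), c' ≫ K.d r q = c ∧ c' ≫ f.f r - d = d' ≫ L.d t r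

theorem mono_homologyMap_iff {K L : Ch k} (f : K ⟶ L) {p q r : ℤ} (hp : p + 1 = q)
    (hq : q + 1 = r) : Mono (HomologicalComplex.homologyMap f q) ↔
      ∀ ⦃A : ModuleCat.{u} k⦄ (x₂ : A ⟶ K.X q) (_ : x₂ ≫ K.d q p = 0) (y₁ : A ⟶ L.X r)
          (_ : x₂ ≫ f.f q = y₁ ≫ L.d r q),
        ∃ (A' : ModuleCat.{u} k) (π : A' ⟶ A) (_ : Epi π) (x₁ : A' ⟶ K.X r),
          π ≫ x₂ = x₁ ≫ K.d r q :=
  HomologicalComplex.mono_homologyMap_iff_up_to_refinements f r q p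
    ((ComplexShape.down ℤ).prev_eq' hq) ((ComplexShape.down ℤ).next_eq' hp)

theorem epi_homologyMap_iff {K L : Ch k} (f : K ⟶ L) {p q r : ℤ} (hp : p + 1 = q)
    (hq : q + 1 = r) : Epi (HomologicalComplex.homologyMap f q) ↔
      ∀ ⦃A : ModuleCat.{u} k⦄ (y₂ : A ⟶ L.X q) (_ : y₂ ≫ L.d q p = 0),
        ∃ (A' : ModuleCat.{u} k) (π : A' ⟶ A) (_ : Epi π) (x₂ : A' ⟶ K.X q) (_ : x₂ ≫ K.d q p = 0)
          (y₁ : A' ⟶ L.X r), π ≫ y₂ = x₂ ≫ f.f q + y₁ ≫ L.d r q :=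
  HomologicalComplex.epi_homologyMap_iff_up_to_refinements f r q p
    ((ComplexShape.down ℤ).prev_eq' hq) ((ComplexShape.down ℤ).next_eq' hp)

theorem ConeExact.quasiIso {K L : Ch k} {f : K ⟶ L} (h : ConeExact f) : QuasiIso f := by
  rw [quasiIso_iff]
  intro q
  rw [quasiIsoAt_iff_isIso_homologyMap]
  have h₁ : Mono (HomologicalComplex.homologyMap f q) := by
    rw [mono_homologyMap_iff f (sub_add_cancel q 1) rfl]
    intro A x hx y hxy
    obtain ⟨c', d', h₁, -⟩ := h _ (Projective.projective_over A) (q - 1) q (q + 1) (q + 1 + 1)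
      (by ring) rfl rfl (Projective.π A ≫ x) (Projective.π A ≫ y)
      (by rw [Category.assoc, hx, Limits.comp_zero]) (by rw [Category.assoc, hxy, Category.assoc])
    exact ⟨_, Projective.π A, inferInstance, c', h₁.symm⟩
  have h₂ : Epi (HomologicalComplex.homologyMap f q) := by
    rw [epi_homologyMap_iff f (sub_add_cancel q 1) rfl]
    intro A y hy
    obtain ⟨c', d', h₁, h₂⟩ := h _ (Projective.projective_over A) (q - 2) (q - 1) q (q + 1)
      (by ring) (by ring) rfl 0 (Projective.π A ≫ y) Limits.zero_comp
      (by rw [Category.assoc, hy, Limits.comp_zero, Limits.zero_comp])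
    refine ⟨_, Projective.π A, inferInstance, c', h₁, - d', ?_⟩
    rw [Preadditive.neg_comp, ← h₂]
    abel
  exact isIso_of_mono_of_epi _

theorem coneExact_of_quasiIso {K L : Ch k} (f : K ⟶ L) [QuasiIso f] : ConeExact f := by
  intro P _ p q r t hp hq hr c d hc hcd
  have h₁ : Mono (HomologicalComplex.homologyMap f q) := inferInstance
  have h₂ : Epi (HomologicalComplex.homologyMap f r) := inferInstance
  rw [mono_homologyMap_iff f hp hq] at h₁
  rw [epi_homologyMap_iff f hq hr] at h₂
  obtain ⟨A, π, _, x, hx⟩ := h₁ c hc d hcd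
  have hs : Projective.factorThru (𝟙 P) π ≫ π = 𝟙 P := Projective.factorThru_comp _ _
  set σ := Projective.factorThru (𝟙 P) π
  have hx' : (σ ≫ x) ≫ K.d r q = c := by
    rw [Category.assoc, ← hx, ← Category.assoc, hs, Category.id_comp]
  obtain ⟨A', π', _, z, hz, y, hy⟩ := h₂ ((σ ≫ x) ≫ f.f r - d) (by
    rw [Preadditive.sub_comp, Category.assoc, f.comm, ← Category.assoc, hx', hcd, sub_self])
  have hs' : Projective.factorThru (𝟙 P) π' ≫ π' = 𝟙 P := Projective.factorThru_comp _ _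
  set σ' := Projective.factorThru (𝟙 P) π'
  refine ⟨σ ≫ x - σ' ≫ z, σ' ≫ y, ?_, ?_⟩
  · rw [Preadditive.sub_comp, hx', Category.assoc, hz, Limits.comp_zero, sub_zero]
  · have := congrArg (σ' ≫ ·) hy
    simp only [Preadditive.comp_add, ← Category.assoc] at this
    rw [hs', Category.id_comp, ← sub_eq_iff_eq_add'] at this
    rw [← this, Preadditive.sub_comp]
    abel

/-- The differential, as a graded map. -/
def HomologicalComplex.dMap (K : Ch k) : GradedMap (-1) K K := ⟨fun p q _ => K.d p q⟩

/-- A decomposition of a complex, as a graded module, into finitely many shifted complexes, such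
that the differential is triangular with respect to weights. -/
structure Triangular (C : Ch k) (I : Type) [Fintype I] (wt a : I → ℤ) (E : I → Ch k) where
  /-- the inclusions -/
  ι : ∀ i, GradedMap (a i) (E i) C
  /-- the projections -/
  π : ∀ i, GradedMap (-a i) C (E i)
  ι_π : ∀ i, (ι i).comp (π i) = GradedMap.ofHom (by ring) (𝟙 (E i))
  ι_π_ne : ∀ i j, i ≠ j → (ι i).comp (π j) = 0
  total : ∀ m, ∑ i, π i m (m - a i) (by ring) ≫ ι i (m - a i) m (by ring) = 𝟙 (C.X m)
  diag : ∀ i, (ι i).postD.comp (π i) = ((a i).negOnePow • (E i).dMap).cast (by ring)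
  entry : ∀ i j, i ≠ j → ¬ wt i < wt j → (ι i).postD.comp (π j) = 0

theorem GradedMap.comp_apply {a b : ℤ} {K L N : Ch k} (u : GradedMap a K L) (v : GradedMap b L N)
    {p q r : ℤ} (h : p + a = q) (h' : q + b = r) (h'') : u.comp v p r h'' = u p q h ≫ v q r h' := by
  subst h; rfl

namespace Triangular

variable {C : Ch k} {I : Type} [Fintype I] {wt a : I → ℤ} {E : I → Ch k}
  (A : Triangular C I wt a E) {P : ModuleCat.{u} k} {p q r t : ℤ}

theorem ι_π_self (i : I) (h : p + a i = q) (h' : q + -a i = p) :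
    A.ι i p q h ≫ A.π i q p h' = 𝟙 _ := by
  rw [← GradedMap.comp_apply _ _ h h' (by ring), A.ι_π, GradedMap.ofHom_apply]; rfl

theorem ι_π_self_assoc (i : I) (h : p + a i = q) (h' : q + -a i = p) {M : ModuleCat.{u} k}
    (w : _ ⟶ M) : A.ι i p q h ≫ A.π i q p h' ≫ w = w := by
  rw [← Category.assoc, ι_π_self, Category.id_comp]

theorem ι_π_of_ne {i j : I} (hij : i ≠ j) (h : p + a i = q) (h' : q + -a j = r) :
    A.ι i p q h ≫ A.π j q r h' = 0 := by
  rw [← GradedMap.comp_apply _ _ h h' (by lia), A.ι_π_ne i j hij]; rfl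

theorem ι_π_of_ne_assoc {i j : I} (hij : i ≠ j) (h : p + a i = q) (h' : q + -a j = r)
    {M : ModuleCat.{u} k} (w : _ ⟶ M) : A.ι i p q h ≫ A.π j q r h' ≫ w = 0 := by
  rw [← Category.assoc, A.ι_π_of_ne hij, Limits.zero_comp]

theorem d_diag (i : I) (h : p + a i = q) (h' : t + 1 = p) (h'' : r + -a i = t) :
    A.ι i p q h ≫ C.d q r ≫ A.π i r t h'' = (a i).negOnePow • (E i).d p t := by
  have e := congrArg (fun u => u p t (by lia)) (A.diag i)
  rw [GradedMap.comp_apply _ _ (q := r) (by lia) h'', GradedMap.postD_apply _ _ h,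
    Category.assoc] at e
  rw [e]
  exact GradedMap.units_smul_apply _ _ _ _ _

theorem d_entry {i j : I} (hij : i ≠ j) (hw : ¬ wt i < wt j) (h : p + a i = q) (h' : r + 1 = q)
    (h'' : r + -a j = t) : A.ι i p q h ≫ C.d q r ≫ A.π j r t h'' = 0 := by
  have e := congrArg (fun u => u p t (by lia)) (A.entry i j hij hw)
  rw [GradedMap.comp_apply _ _ (q := r) (by lia) h'', GradedMap.postD_apply _ _ h,
    Category.assoc] at e
  exact e

theorem sum_comp (c : P ⟶ C.X q) :
    ∑ i, (c ≫ A.π i q (q - a i) (by ring)) ≫ A.ι i (q - a i) q (by ring) = c := by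
  have := congrArg (c ≫ ·) (A.total q)
  rw [Preadditive.comp_sum, Category.comp_id] at this
  simpa only [Category.assoc] using this

theorem eq_zero {c : P ⟶ C.X q} (h : ∀ i t ht, c ≫ A.π i q t ht = 0) : c = 0 := by
  rw [← A.sum_comp c]
  exact Finset.sum_eq_zero fun i _ => by rw [h, Limits.zero_comp]

/-- The component of minimal weight of the differential. -/
theorem comp_d_π (c : P ⟶ C.X q) (s : I → Prop) (hc : ∀ i, s i → ∀ t ht, c ≫ A.π i q t ht = 0)
    (i : I) (hi : ∀ j, ¬ s j → wt i ≤ wt j) (hq : r + 1 = q) (hp : p + 1 = t) (h : q + -a i = t)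
    (h' : r + -a i = p) :
    c ≫ C.d q r ≫ A.π i r p h' = (a i).negOnePow • (c ≫ A.π i q t h) ≫ (E i).d t p := by
  conv_lhs => rw [← A.sum_comp c]
  obtain rfl : t = q - a i := by lia
  rw [Preadditive.sum_comp, Finset.sum_eq_single i]
  · rw [Category.assoc, A.d_diag i _ hp, Linear.comp_units_smul]
  · intro j _ hj
    by_cases hs : s j
    · rw [hc j hs, Limits.zero_comp, Limits.zero_comp]
    · rw [Category.assoc, A.d_entry hj (not_lt.2 (hi j hs)) _ hq, Limits.comp_zero]
  · exact fun h => (h (Finset.mem_univ _)).elim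

variable {D : Ch k} {E' : I → Ch k} (B : Triangular D I wt a E')

theorem coneExact (f : C ⟶ D) (s : I → ℤˣ) (φ : ∀ i, E i ⟶ E' i)
    (hf : ∀ i, (A.ι i).post f = s i • GradedMap.pre (φ i) (B.ι i))
    (hφ : ∀ i, ConeExact (φ i)) : ConeExact f := by
  classical
  have hf' : ∀ i {p q} h, A.ι i p q h ≫ f.f q = s i • (φ i).f p ≫ B.ι i p q h := by
    intro i p q h
    exact (congrArg (fun u => u p q h) (hf i)).trans (GradedMap.units_smul_apply _ _ _ _ _)
  have hf'' : ∀ i {p q} h, f.f q ≫ B.π i q p h = s i • A.π i q p h ≫ (φ i).f p := by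
    intro i p q h
    rw [← Category.id_comp (f.f q), ← A.total q, Preadditive.sum_comp, Preadditive.sum_comp,
      Finset.sum_eq_single i]
    · obtain rfl : p = q - a i := by lia
      rw [Category.assoc, Category.assoc, ← Category.assoc (A.ι i _ _ _), hf',
        Linear.units_smul_comp, Linear.comp_units_smul, Category.assoc, B.ι_π_self,
        Category.comp_id]
    · intro j _ hj
      rw [Category.assoc, Category.assoc, ← Category.assoc (A.ι j _ _ _), hf',
        Linear.units_smul_comp, Linear.comp_units_smul, Category.assoc, B.ι_π_of_ne hj,
        Limits.comp_zero, Limits.comp_zero, smul_zero]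
    · exact fun h => (h (Finset.mem_univ _)).elim
  intro P hP p q r t hp hq hr
  suffices H : ∀ (n : ℕ) (u : Finset I), uᶜ.card = n → (∀ i ∈ u, ∀ j ∉ u, wt i ≤ wt j) →
      ∀ (c : P ⟶ C.X q) (d : P ⟶ D.X r), c ≫ C.d q p = 0 → c ≫ f.f q = d ≫ D.d r q →
      (∀ i ∈ u, ∀ t ht, c ≫ A.π i q t ht = 0) → (∀ i ∈ u, ∀ t ht, d ≫ B.π i r t ht = 0) →
      ∃ (c' : P ⟶ C.X r) (d' : P ⟶ D.X t), c' ≫ C.d r q = c ∧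
        c' ≫ f.f r - d = d' ≫ D.d t r from
    fun c d hc hd => H _ ∅ rfl (fun i hi => absurd hi (Finset.notMem_empty i)) c d hc hd
      (fun i hi => absurd hi (Finset.notMem_empty i))
      (fun i hi => absurd hi (Finset.notMem_empty i))
  intro n
  induction n with
  | zero =>
    intro u hu _ c d _ _ hc hd
    rw [Finset.card_eq_zero, Finset.compl_eq_empty_iff] at hu
    subst hu
    rw [A.eq_zero (c := c) fun i => hc i (Finset.mem_univ i),
      B.eq_zero (c := d) fun i => hd i (Finset.mem_univ i)]
    exact ⟨0, 0, by simp, by simp⟩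
  | succ n ih =>
    intro u hu hw c d hc hcd hcu hdu
    obtain ⟨i, hi, hmin⟩ := Finset.exists_min_image uᶜ wt (Finset.card_pos.1 (by lia))
    have hiu : i ∉ u := Finset.mem_compl.1 hi
    have hmin' : ∀ j, j ∉ u → wt i ≤ wt j := fun j hj => hmin j (Finset.mem_compl.2 hj)
    have eA : (c ≫ A.π i q (q - a i) (by ring)) ≫ (E i).d (q - a i) (p - a i) = 0 := by
      have := A.comp_d_π c (· ∈ u) hcu i hmin' hp (p := p - a i) (t := q - a i) (by lia) (by ring)
        (by ring)
      rw [← Category.assoc, hc, Limits.zero_comp] at this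
      rw [← one_smul ℤˣ (_ ≫ (E i).d _ _), ← Int.units_mul_self (a i).negOnePow, mul_smul, ← this,
        smul_zero]
    have eB : ((a i).negOnePow * s i) • (c ≫ A.π i q (q - a i) (by ring)) ≫ (φ i).f (q - a i) =
        (d ≫ B.π i r (r - a i) (by ring)) ≫ (E' i).d (r - a i) (q - a i) := by
      have := B.comp_d_π d (· ∈ u) hdu i hmin' hq (p := q - a i) (t := r - a i) (by lia) (by ring)
        (by ring)
      rw [← Category.assoc, ← hcd, Category.assoc, hf'', Linear.comp_units_smul] at this
      rw [mul_smul, Category.assoc, this, smul_smul, Int.units_mul_self, one_smul]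
    obtain ⟨x, y, hx, hy⟩ := hφ i P hP (p - a i) (q - a i) (r - a i) (t - a i) (by lia) (by lia)
      (by lia) (((a i).negOnePow * s i) • (c ≫ A.π i q (q - a i) (by ring)))
      (d ≫ B.π i r (r - a i) (by ring)) (by rw [Linear.units_smul_comp, eA, smul_zero])
      (by rw [Linear.units_smul_comp, eB])
    let c₁ := s i • x ≫ A.ι i (r - a i) r (by ring)
    let d₁ := (a i).negOnePow • y ≫ B.ι i (t - a i) t (by ring)
    have hins : ∀ j ∈ insert i u, ∀ l ∉ insert i u, wt j ≤ wt l := by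
      intro j hj l hl
      rw [Finset.mem_insert, not_or] at hl
      rcases Finset.mem_insert.1 hj with rfl | hj
      · exact hmin' l hl.2
      · exact hw j hj l hl.2
    have hu' : (insert i u)ᶜ.card = n := by
      rw [Finset.card_compl, Finset.card_insert_of_notMem hiu]
      rw [Finset.card_compl] at hu
      lia
    have k₁ : (c - c₁ ≫ C.d r q) ≫ C.d q p = 0 := by
      rw [Preadditive.sub_comp, Category.assoc, C.d_comp_d, hc, Limits.comp_zero, sub_zero]
    have k₂ : (c - c₁ ≫ C.d r q) ≫ f.f q = (d - c₁ ≫ f.f r + d₁ ≫ D.d t r) ≫ D.d r q := by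
      rw [Preadditive.sub_comp, Preadditive.add_comp, Preadditive.sub_comp, Category.assoc,
        Category.assoc, Category.assoc, f.comm, D.d_comp_d, hcd, Limits.comp_zero, add_zero]
    have k₃ : ∀ j ∈ insert i u, ∀ l hl, (c - c₁ ≫ C.d r q) ≫ A.π j q l hl = 0 := by
      intro j hj l hl
      rw [Preadditive.sub_comp, Category.assoc, Linear.units_smul_comp, Category.assoc]
      rcases Finset.mem_insert.1 hj with rfl | hj
      · obtain rfl : l = q - a j := by lia
        rw [A.d_diag j _ (by lia), Linear.comp_units_smul, hx, smul_smul, smul_smul,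
          mul_assoc (s j), ← mul_assoc (a j).negOnePow, Int.units_mul_self, one_mul,
              Int.units_mul_self, one_smul, sub_self]
      · have hij : i ≠ j := fun h => hiu (h ▸ hj)
        rw [hcu j hj, A.d_entry hij (not_lt.2 (hw j hj i hiu)) _ hq, Limits.comp_zero, smul_zero,
          sub_zero]
    have k₄ : ∀ j ∈ insert i u, ∀ l hl, (d - c₁ ≫ f.f r + d₁ ≫ D.d t r) ≫ B.π j r l hl = 0 := by
      intro j hj l hl
      rw [Preadditive.add_comp, Preadditive.sub_comp, Category.assoc, Category.assoc,
        hf'', Linear.comp_units_smul, Linear.units_smul_comp, Linear.units_smul_comp,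
        Category.assoc, Category.assoc]
      rcases Finset.mem_insert.1 hj with rfl | hj
      · obtain rfl : l = r - a j := by lia
        rw [B.d_diag j _ (by lia), A.ι_π_self_assoc, smul_smul, Int.units_mul_self, one_smul,
          Linear.comp_units_smul, smul_smul, Int.units_mul_self, one_smul, ← hy]
        abel
      · have hij : i ≠ j := fun h => hiu (h ▸ hj)
        rw [hdu j hj, B.d_entry hij (not_lt.2 (hw j hj i hiu)) _ hr, A.ι_π_of_ne_assoc hij,
          Limits.comp_zero, Limits.comp_zero, smul_zero, smul_zero, smul_zero,
          sub_zero, add_zero]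
    obtain ⟨c₂, d₂, h₁, h₂⟩ := ih (insert i u) hu' hins (c - c₁ ≫ C.d r q)
      (d - c₁ ≫ f.f r + d₁ ≫ D.d t r) k₁ k₂ k₃ k₄
    refine ⟨c₁ + c₂, d₂ + d₁, ?_, ?_⟩
    · rw [Preadditive.add_comp, h₁]; abel
    · rw [Preadditive.add_comp, Preadditive.add_comp, ← h₂]; abel

section Tens

variable {K K' L L' N N' : Ch k}

theorem _root_.sum_tensorHom_sum {I J : Type} [Fintype I] [Fintype J] {X Y X' Y' : ModuleCat.{u} k}
    (f : I → (X ⟶ Y)) (g : J → (X' ⟶ Y')) :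
    (∑ i, f i) ⊗ₘ (∑ j, g j) = ∑ i : I × J, f i.1 ⊗ₘ g i.2 := by
  rw [Fintype.sum_prod_type, sum_tensorHom]
  exact Finset.sum_congr rfl fun _ _ => tensorHom_sum _ _ _

theorem _root_.GradedMap.tens_d_tens {a b a' b' : ℤ} (u : GradedMap a K L)
    (v : GradedMap b K' L') (u' : GradedMap a' L N) (v' : GradedMap b' L' N') (n m r t : ℤ)
    (h : n + (a + b) = m) (h' : r + 1 = m) (h'' : r + (a' + b') = t) :
    u.tens v n m h ≫ (L ⊗ L').d m r ≫ u'.tens v' r t h'' =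
      (b' * (a - 1)).negOnePow • (u.postD.comp u').tens (v.comp v') n t (by lia) +
      (a + b' * a).negOnePow • (u.comp u').tens (v.postD.comp v') n t (by lia) := by
  rw [← Category.assoc, GradedMap.tens_d _ _ _ _ _ _ h', Preadditive.add_comp,
    Linear.units_smul_comp, GradedMap.tens_comp, GradedMap.tens_comp, smul_smul,
    ← Int.negOnePow_add]

theorem _root_.GradedMap.dMap_tensor {a b : ℤ} (ha : a = 0) (hb : b = 0) (n m : ℤ)
    (h : n + (a - 1 + b) = m) :
    (GradedMap.ofHom ha (𝟙 K)).preD.tens (GradedMap.ofHom hb (𝟙 L)) n m h +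
      (GradedMap.ofHom ha (𝟙 K)).tens (GradedMap.ofHom hb (𝟙 L)).preD n m (by lia) =
      (K ⊗ L).d n m := by
  subst hb
  have := GradedMap.d_tens (GradedMap.ofHom ha (𝟙 K)) (GradedMap.ofHom rfl (𝟙 L)) n m m (by lia)
    (by lia)
  rw [Int.negOnePow_zero, one_smul] at this
  rw [← this, GradedMap.ofHom_tens_ofHom, id_tensorHom_id, HomologicalComplex.id_f,
    Category.comp_id]

theorem _root_.GradedMap.preD_ofHom_id {a : ℤ} (ha : a = 0) :
    (GradedMap.ofHom ha (𝟙 K)).preD = K.dMap.cast (by lia) :=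
  GradedMap.hom_ext fun p q h => by
    obtain rfl : q = p - 1 := by lia
    exact (congrArg (_ ≫ ·) (GradedMap.ofHom_apply ha (𝟙 K) _ _)).trans (Category.comp_id _)

variable {I J : Type} [Fintype I] [Fintype J] {wt a : I → ℤ} {wt' a' : J → ℤ} {E : I → Ch k}
  {E' : J → Ch k} (A : Triangular K I wt a E) (B : Triangular L J wt' a' E')

/-- The tensor product of decompositions. -/
noncomputable def tens : Triangular (K ⊗ L) (I × J) (fun i => wt i.1 + wt' i.2) (fun i =>
    a i.1 + a' i.2)
    (fun i => E i.1 ⊗ E' i.2) where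
  ι i := (A.ι i.1).tens (B.ι i.2)
  π i := (a' i.2 * a i.1).negOnePow • ((A.π i.1).tens (B.π i.2)).cast (by ring)
  ι_π i := GradedMap.hom_ext fun p q h => by
    obtain rfl : p = q := by lia
    rw [GradedMap.comp_apply _ _ rfl (by lia), GradedMap.units_smul_apply, Linear.comp_units_smul]
    refine (congrArg _ (GradedMap.tens_comp (A.ι i.1) (B.ι i.2) (A.π i.1) (B.π i.2) p _ p rfl
      (by lia))).trans ?_
    rw [A.ι_π, B.ι_π, GradedMap.ofHom_tens_ofHom, id_tensorHom_id, smul_smul, ← Int.negOnePow_add,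
      neg_mul, add_neg_cancel, Int.negOnePow_zero, one_smul, GradedMap.ofHom_apply]
  ι_π_ne i j hij := GradedMap.hom_ext fun p q h => by
    rw [GradedMap.comp_apply _ _ rfl (by lia), GradedMap.units_smul_apply, Linear.comp_units_smul]
    refine (congrArg _ (GradedMap.tens_comp (A.ι i.1) (B.ι i.2) (A.π j.1) (B.π j.2) p _ q rfl
      (by lia))).trans ?_
    rw [Ne, Prod.ext_iff, not_and_or] at hij
    rcases hij with hij | hij
    · rw [A.ι_π_ne _ _ hij, GradedMap.zero_tens, smul_zero, smul_zero]; rfl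
    · rw [B.ι_π_ne _ _ hij, GradedMap.tens_zero, smul_zero, smul_zero]; rfl
  total m := by
    refine tensor_hom_ext fun p q hpq => ?_
    have h : ∀ i : I × J, tensorIncl K L p q m hpq ≫
        ((a' i.2 * a i.1).negOnePow • ((A.π i.1).tens (B.π i.2)).cast
          (show -a i.1 + -a' i.2 = -(a i.1 + a' i.2) by ring)) m
            (m - (a i.1 + a' i.2)) (by ring) ≫
          (A.ι i.1).tens (B.ι i.2) (m - (a i.1 + a' i.2)) m (by ring) =
        ((A.π i.1 p (p - a i.1) (by ring) ≫ A.ι i.1 (p - a i.1) p (by ring)) ⊗ₘ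
          (B.π i.2 q (q - a' i.2) (by ring) ≫ B.ι i.2 (q - a' i.2) q (by ring))) ≫
          tensorIncl K L p q m hpq := by
      intro i
      rw [GradedMap.units_smul_apply, Linear.units_smul_comp]
      refine (congrArg (fun f => tensorIncl K L p q m hpq ≫ (_ • f))
        (GradedMap.tens_comp (A.π i.1) (B.π i.2) (A.ι i.1) (B.ι i.2) m _ m (by ring)
        (by ring))).trans ?_
      rw [smul_smul, ← Int.negOnePow_add, Linear.comp_units_smul,
        GradedMap.tensorIncl_tens _ _ hpq (p' := p) (q' := q) (by ring) (by ring), smul_smul,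
        ← Int.negOnePow_add, show a' i.2 * a i.1 + a' i.2 * -a i.1 + (-a' i.2 + a' i.2) * p = 0 by
          ring, Int.negOnePow_zero, one_smul]
      rw [GradedMap.comp_apply _ _ (q := p - a i.1) (by ring) (by ring),
        GradedMap.comp_apply _ _ (q := q - a' i.2) (by ring) (by ring)]
    rw [Preadditive.comp_sum, Category.comp_id, Finset.sum_congr rfl fun i _ => h i,
      ← Preadditive.sum_comp, ← sum_tensorHom_sum
        (fun i => A.π i p (p - a i) (by ring) ≫ A.ι i (p - a i) p (by ring))
        (fun i => B.π i q (q - a' i) (by ring) ≫ B.ι i (q - a' i) q (by ring)), A.total, B.total,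
            id_tensorHom_id, Category.id_comp]
  diag i := GradedMap.hom_ext fun p q h => by
    rw [GradedMap.comp_apply _ _ (q := p + (a i.1 + a' i.2) - 1) (by lia) (by lia),
      GradedMap.postD_apply _ _ rfl, GradedMap.units_smul_apply, Linear.comp_units_smul,
      Category.assoc]
    refine (congrArg _ (GradedMap.tens_d_tens (A.ι i.1) (B.ι i.2) (A.π i.1) (B.π i.2) p _ _ q rfl
      (by lia) (by lia))).trans ?_
    rw [A.ι_π, B.ι_π, A.diag, B.diag, GradedMap.cast_tens, GradedMap.tens_cast,
      GradedMap.units_smul_tens, GradedMap.tens_units_smul, smul_smul, smul_smul, smul_add,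
      smul_smul, smul_smul, ← Int.negOnePow_add, ← Int.negOnePow_add, ← Int.negOnePow_add,
      ← Int.negOnePow_add]
    have e₁ : (a' i.2 * a i.1 + (-a' i.2 * (a i.1 - 1) + a i.1)).negOnePow =
        (a i.1 + a' i.2).negOnePow := by congr 1; ring
    have e₂ : (a' i.2 * a i.1 + (a i.1 + -a' i.2 * a i.1 + a' i.2)).negOnePow =
        (a i.1 + a' i.2).negOnePow := by congr 1; ring
    rw [e₁, e₂, ← smul_add]
    refine Eq.trans (congrArg _ ?_) (GradedMap.units_smul_apply _ _ _ _ _).symm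
    refine Eq.trans ?_ (GradedMap.dMap_tensor (show a i.1 + -a i.1 = 0 by ring)
      (show a' i.2 + -a' i.2 = 0 by ring) p q (by lia))
    rw [GradedMap.preD_ofHom_id, GradedMap.preD_ofHom_id, GradedMap.cast_tens, GradedMap.tens_cast]
  entry i j hij hw := GradedMap.hom_ext fun p q h => by
    rw [GradedMap.comp_apply _ _ (q := p + (a i.1 + a' i.2) - 1) (by lia) (by lia),
      GradedMap.postD_apply _ _ rfl, GradedMap.units_smul_apply, Linear.comp_units_smul,
      Category.assoc]
    refine (congrArg _ (GradedMap.tens_d_tens (A.ι i.1) (B.ι i.2) (A.π j.1) (B.π j.2) p _ _ q rfl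
      (by lia) (by lia))).trans ?_
    by_cases h₁ : i.1 = j.1
    · have h₂ : i.2 ≠ j.2 := fun h₂ => hij (Prod.ext h₁ h₂)
      rw [B.ι_π_ne _ _ h₂, B.entry _ _ h₂ (fun h => hw (by rw [h₁]; lia)), GradedMap.tens_zero,
        GradedMap.tens_zero, smul_zero, smul_zero, add_zero, smul_zero]
      rfl
    · by_cases h₂ : i.2 = j.2
      · rw [A.ι_π_ne _ _ h₁, A.entry _ _ h₁ (fun h => hw (by rw [h₂]; lia)), GradedMap.zero_tens,
          GradedMap.zero_tens, smul_zero, smul_zero, add_zero, smul_zero]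
        rfl
      · rw [B.ι_π_ne _ _ h₂, A.ι_π_ne _ _ h₁, GradedMap.tens_zero, GradedMap.zero_tens,
          smul_zero, smul_zero, add_zero, smul_zero]
        rfl

end Tens

end Triangular

end QuasiIsos

section SplitQuasiIso

open Extension

variable {k : Type u} [CommRing k] {F : IsoAction k} {ε : ℤ} {C : RTree → Ch k}

namespace Coinv

/-- The differential is, up to terms that change the codimension in a fixed direction, the
differential of the summands. -/
structure IsTriangular (M : Coinv F ε fun S m => (C S).X m) (δ : ℤ) : Prop where
  diag : ∀ {S : RTree} (x : Extension S) (p q r t : ℤ) (h : p + ε * (x.len + 1) = q)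
    (_ : r + 1 = q) (h' : t + ε * (x.len + 1) = r),
    M.ι x p q h ≫ (C S).d q r ≫ M.π x t r h' =
      (ε * (x.len + 1)).negOnePow • (F.obj x.tgt).d p t
  entry : ∀ {S : RTree} (x y : Extension S), ¬ Nonempty (Arrow x y) →
    ¬ δ * x.new.length < δ * y.new.length → ∀ (p q r t : ℤ) (h : p + ε * (x.len + 1) = q)
    (_ : r + 1 = q) (h' : t + ε * (y.len + 1) = r),
    M.ι x p q h ≫ (C S).d q r ≫ M.π y t r h' = 0

variable {M : Coinv F ε fun S m => (C S).X m} {δ : ℤ} {S R U : RTree} {a : S.Edge}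

/-- The decomposition of the coinvariants given by representatives of the classes of extensions. -/
def IsTriangular.triangular (hM : M.IsTriangular δ) {I : Type} [Fintype I] (x : I → Extension S)
    (hx : ∀ i j, Nonempty (Arrow (x i) (x j)) → i = j) (hx' : ∀ y, ∃ i, Nonempty (Arrow y (x i)))
    (wt b : I → ℤ) (hwt : ∀ i, wt i = δ * (x i).new.length) (hb : ∀ i, b i = ε * ((x i).len + 1)) :
    Triangular (C S) I wt b fun i => F.obj (x i).tgt where
  ι i := (M.i (x i)).cast (hb i).symm
  π i := (M.p (x i)).cast (by rw [hb])
  ι_π i := GradedMap.hom_ext fun p q h => by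
    obtain rfl : p = q := by lia
    rw [GradedMap.ofHom_apply]
    exact M.ι_π_self _ _ _ _ _
  ι_π_ne i j hij := GradedMap.hom_ext fun p q h => M.ι_π_zero (fun h => hij (hx i j h)) _ _ _ _ _
  total m := by
    classical
    refine M.hom_ext fun y n hy => ?_
    obtain ⟨i, ⟨φ⟩⟩ := hx' y
    rw [Preadditive.comp_sum, Category.comp_id, Finset.sum_eq_single i]
    · have h₀ : n + ε * ((x i).len + 1) = m := by rw [← φ.len_eq, hy]
      obtain rfl : n = m - b i := by rw [hb]; lia
      rw [← Category.assoc]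
      refine (congrArg (· ≫ _) (M.ι_π φ (m - b i) m hy h₀)).trans ?_
      rw [Linear.units_smul_comp]
      exact (M.ι_arrow φ _ _ _ _).symm
    · intro j _ hj
      rw [← Category.assoc]
      refine (congrArg (· ≫ _) (M.ι_π_zero ?_ n (m - b j) m hy (by rw [hb]; lia))).trans
        Limits.zero_comp
      exact fun h => hj (hx j i ((arrow_equivalence S).trans ((arrow_equivalence S).symm h) ⟨φ⟩))
    · exact fun h => (h (Finset.mem_univ _)).elim
  diag i := GradedMap.hom_ext fun p q h => by
    rw [GradedMap.comp_apply _ _ (q := p + b i - 1) (by lia) (by lia),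
      GradedMap.postD_apply _ _ rfl, Category.assoc]
    refine (hM.diag (x i) _ _ _ _ (by rw [hb]) (by lia) (by rw [← hb]; lia)).trans ?_
    rw [← hb]
    exact (GradedMap.units_smul_apply (b i).negOnePow (F.obj (x i).tgt).dMap p q (by lia)).symm
  entry i j hij hw := GradedMap.hom_ext fun p q h => by
    rw [GradedMap.comp_apply _ _ (q := p + b i - 1) (by lia) (by lia),
      GradedMap.postD_apply _ _ rfl, Category.assoc]
    exact hM.entry (x i) (x j) (fun h => hij (hx i j h)) (by rw [← hwt, ← hwt]; exact hw) _ _ _ _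
      (by rw [hb]) (by lia) (by rw [← hb]; lia)

theorem IsTriangular.quasiIso (hM : M.IsTriangular δ) {t : Splitting F} {c : ℕ → ℕ → ℕ → ℕ → ℤˣ}
    (ht : ∀ {S R T : RTree} {a : S.Edge} (g : RTree.Grafting S a R T), QuasiIso (t.t g))
    (g : RTree.Grafting S a R U) (Δ : C U ⟶ C S ⊗ C R) (hΔ : ∀ m, Δ.f m = M.split t c g m) :
    QuasiIso Δ := by
  have hrep : ∀ {T : RTree} (z w : Component T), Nonempty (Arrow z.rep w.rep) → z = w :=
    fun z w h => (toComponent_rep z).symm.trans (rep_eq_of_arrow h)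
  let A := hM.triangular (fun z : Component S × Component R => graftPair g z.1.rep z.2.rep)
    (fun z w h => by
      have := ((graftPairD _ _ _).nonempty_arrow_iff (graftPairD _ _ _)).1 h
      exact Prod.ext (hrep _ _ this.1) (hrep _ _ this.2))
    (fun y => by
      obtain ⟨yS, yR, y', ⟨φ⟩, ⟨D⟩⟩ := exists_degrafting g y
      exact ⟨(yS.toComponent, yR.toComponent), (arrow_equivalence _).trans ⟨φ⟩
        ((D.nonempty_arrow_iff (graftPairD _ _ _)).2
          ⟨nonempty_arrow_rep yS, nonempty_arrow_rep yR⟩)⟩)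
    (fun z => δ * z.1.rep.new.length + δ * z.2.rep.new.length)
    (fun z => ε * (z.1.rep.len + 1) + ε * (z.2.rep.len + 1))
    (fun z => by rw [(graftPairD _ _ _).new_length]; push_cast; ring)
    (fun z => by rw [(graftPairD _ _ _).len_eq]; push_cast; ring)
  let B := (hM.triangular (fun z : Component S => z.rep) hrep
    (fun y => ⟨_, nonempty_arrow_rep y⟩) _ _ (fun _ => rfl) (fun _ => rfl)).tens
      (hM.triangular (fun z : Component R => z.rep) hrep
        (fun y => ⟨_, nonempty_arrow_rep y⟩) _ _ (fun _ => rfl) (fun _ => rfl))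
  refine (A.coneExact B Δ (fun z => splitSign c z.1.rep z.2.rep)
    (fun z => t.t (graftPairD g z.1.rep z.2.rep).graft) (fun z => ?_) fun z => ?_).quasiIso
  · refine GradedMap.hom_ext fun n m h => ?_
    rw [GradedMap.units_smul_apply]
    exact (congrArg (_ ≫ ·) (hΔ m)).trans (M.ι_split t c (graftPairD g z.1.rep z.2.rep) n m _)
  · have := ht (graftPairD g z.1.rep z.2.rep).graft
    exact coneExact_of_quasiIso (t.t (graftPairD g z.1.rep z.2.rep).graft)

end Coinv

end SplitQuasiIso

namespace Extension

/-! ### Composition of extensions -/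

section Composition

variable {S : RTree}

theorem exists_arrow_comp_comp {x y : Extension S} {f : Extension x.tgt} {g : Extension y.tgt}
    (θ : x.tgt ≅ y.tgt) (ψ : f.tgt ≅ g.tgt) (h : x.map ≫ θ.hom = y.map)
    (h' : f.map ≫ ψ.hom = θ.hom ≫ g.map) {s t u : ℤˣ} (hs : SPerm x.old y.old s)
    (ht : SPerm (x.new.map θ.hom) y.new t) (hu : SPerm (f.new.map ψ.hom) g.new u) :
    ∃ φ : Arrow (x.comp f) (y.comp g), φ.θ = ψ ∧ φ.sign = s * (t * u) := by
  refine Arrow.exists_of_sperm (x := x.comp f) (y := y.comp g) ψ ?_ hs ?_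
  · change (x.map ≫ f.map) ≫ ψ.hom = y.map ≫ g.map
    rw [Category.assoc, h', ← h, Category.assoc]
  · change SPerm ((x.new.map f.map ++ f.new).map ψ.hom) (y.new.map g.map ++ g.new) _
    rw [List.map_append, List.map_map, show (ψ.hom : f.tgt.Edge → _) ∘ f.map = g.map ∘ θ.hom from
      funext fun e => congrArg (fun k => k e) h', ← List.map_map]
    exact (ht.map g.map).append hu

theorem exists_arrow_comp_assoc (x : Extension S) (f : Extension x.tgt) (g : Extension f.tgt) :
    ∃ φ : Arrow ((x.comp f).comp g) (x.comp (f.comp g)), φ.θ = Iso.refl g.tgt ∧ φ.sign = 1 := by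
  refine (Arrow.exists_of_sperm (x := (x.comp f).comp g) (y := x.comp (f.comp g))
    (Iso.refl g.tgt) ?_ (SPerm.refl x.old) (t := 1) (SPerm.of_eq ?_))
  · exact Category.comp_id _
  · refine (List.map_id _).trans ?_
    change (x.new.map f.map ++ f.new).map g.map ++ g.new =
      x.new.map (f.map ≫ g.map) ++ (f.new.map g.map ++ g.new)
    rw [List.map_append, List.map_map, List.append_assoc]
    rfl

theorem exists_arrow_comp_precompIso {x y : Extension S} (φ : Arrow x y) (f : Extension y.tgt) :
    ∃ ψ : Arrow (x.comp (precompIso φ.θ f)) (y.comp f),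
      ψ.θ = Iso.refl f.tgt ∧ ψ.sign = φ.sign := by
  obtain ⟨ψ, h, h'⟩ := exists_arrow_comp_comp (x := x) (y := y) (f := precompIso φ.θ f) (g := f)
    φ.θ (Iso.refl f.tgt) φ.map_eq (Category.comp_id _) φ.sperm_old φ.sperm_new (u := 1)
    (SPerm.of_eq (List.map_id f.new))
  exact ⟨ψ, h, h'.trans (by rw [mul_one]; rfl)⟩

theorem exists_arrow_comp_of_new_eq_nil (x : Extension S) (f : Extension x.tgt) (hf : f.new = []) :
    ∃ (φ : Arrow x (x.comp f)), φ.θ.hom = f.map ∧ φ.sign = 1 := by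
  obtain ⟨θ, hθ⟩ := f.exists_iso_of_new_eq_nil hf
  obtain ⟨φ, h, h'⟩ := Arrow.exists_of_sperm (x := x) (y := x.comp f) θ
    (by rw [hθ]; rfl) (SPerm.refl x.old) (t := 1) (SPerm.of_eq (by
      rw [hθ]
      change _ = x.new.map f.map ++ f.new
      rw [hf, List.append_nil]; rfl))
  exact ⟨φ, by rw [h, hθ], by rw [h', one_mul]⟩

theorem exists_sperm_top (E : Extension S) (y : Extension E.tgt) :
    ∃ s, SPerm E.top.old y.old s :=
  SPerm.exists_of_perm (E.top.old_enum.perm y.old_enum)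

/-- The sign of the permutation comparing the enumeration of the inner edges of `E.tgt` by the old
and the new edges of `E` with the enumeration that is part of `y`. -/
noncomputable def topSign (E : Extension S) (y : Extension E.tgt) : ℤˣ :=
    (exists_sperm_top E y).choose

theorem sperm_topSign (E : Extension S) (y : Extension E.tgt) :
    SPerm E.top.old y.old (topSign E y) := (exists_sperm_top E y).choose_spec

theorem topSign_eq {E : Extension S} {y : Extension E.tgt} {s : ℤˣ} (h : SPerm E.top.old y.old s) :
    topSign E y = s := (sperm_topSign E y).unique E.top.old_enum.1 h

theorem length_top (E : Extension S) (y : Extension E.tgt) : y.old.length = E.len := by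
  rw [← (sperm_topSign E y).perm.length_eq, ← E.len_top]
  exact (Nat.add_zero _).symm

theorem len_comp_of_top (E : Extension S) (y : Extension E.tgt) : (E.comp y).len = y.len := by
  rw [len_comp, ← length_top E y]; rfl

theorem exists_arrow_comp_top {E E' : Extension S} {y : Extension E.tgt} {y' : Extension E'.tgt}
    (θ : E.tgt ≅ E'.tgt) (ψ : y.tgt ≅ y'.tgt) (h : E.map ≫ θ.hom = E'.map)
    (h' : y.map ≫ ψ.hom = θ.hom ≫ y'.map) {s u : ℤˣ}
    (hs : SPerm (y.old.map θ.hom) y'.old s) (hu : SPerm (y.new.map ψ.hom) y'.new u) :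
    ∃ φ : Arrow (E.comp y) (E'.comp y'), φ.θ = ψ ∧
      topSign E y * (s * u) = φ.sign * topSign E' y' := by
  obtain ⟨a, ha⟩ := SPerm.exists_of_perm (E.old_enum.perm E'.old_enum)
  obtain ⟨b, hb⟩ := SPerm.exists_of_perm ((map_new_enum θ h).perm E'.new_enum)
  obtain ⟨φ, h₁, h₂⟩ := exists_arrow_comp_comp θ ψ h h' ha hb hu
  refine ⟨φ, h₁, ?_⟩
  have e₁ := ((sperm_topSign E y).map θ.hom).trans hs
  have e₂ : SPerm (E.top.old.map θ.hom) E'.top.old (a * b) := by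
    change SPerm ((E.old.map E.map ++ E.new).map θ.hom) (E'.old.map E'.map ++ E'.new) _
    rw [List.map_append, List.map_map, show (θ.hom : E.tgt.Edge → _) ∘ E.map = E'.map from
      funext fun e => congrArg (fun k => k e) h]
    exact (ha.map E'.map).append hb
  have e₃ := e₁.unique (E.top.old_enum.1.map (RTree.map_injective θ.hom))
    (e₂.trans (sperm_topSign E' y'))
  rw [← mul_assoc, e₃, h₂]
  ac_rfl

theorem topSign_comp (E : Extension S) (f : Extension E.tgt) (y : Extension f.tgt)
    (hf : f.old = E.top.old) : topSign (E.comp f) y = topSign f y := by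
  refine topSign_eq ((SPerm.of_eq ?_).trans (sperm_topSign f y) |>.cast (one_mul _))
  change E.old.map (E.map ≫ f.map) ++ (E.new.map f.map ++ f.new) = f.old.map f.map ++ f.new
  rw [hf]
  change _ = (E.old.map E.map ++ E.new).map f.map ++ f.new
  rw [List.map_append, List.map_map, List.append_assoc]
  rfl

end Composition

end Extension

/-! ## The bar construction -/

open Extension

section BarConstruction

variable {k : Type u} [CommRing k]

/-- The action of isomorphisms of trees on a presheaf. -/
abbrev LinearPreoperad.action (M : LinearPreoperad k) : IsoAction k where
  obj T := M.pre.obj (op T)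
  map θ := M.pre.map θ.inv.op
  map_refl T := M.pre.map_id _
  map_trans θ θ' := by
    rw [← M.pre.map_comp, ← op_comp]; rfl

variable {M : LinearPreoperad k} {X : RTree → ℤ → ModuleCat.{u} k} (C : Coinv M.action 1 X)

namespace Coinv

/-- The coordinate at `x`, followed by restriction along a morphism. -/
def πm {S : RTree} (x : Extension S) {W : RTree} (g : W ⟶ x.tgt) (n m : ℤ)
    (h : n + 1 * (x.len + 1) = m) : X S m ⟶ (M.pre.obj (op W)).X n :=
  C.π x n m h ≫ (M.pre.map g.op).f n

variable {S : RTree} {x y : Extension S} {W W' : RTree} {n m : ℤ}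

theorem πm_map (g : W ⟶ x.tgt) (g' : W' ⟶ W) (h : n + 1 * (x.len + 1) = m) :
    C.πm x g n m h ≫ (M.pre.map g'.op).f n = C.πm x (g' ≫ g) n m h := by
  rw [πm, πm, Category.assoc, op_comp, M.pre.map_comp, HomologicalComplex.comp_f]

theorem πm_arrow (φ : Arrow x y) (g : W ⟶ x.tgt) (g' : W ⟶ y.tgt) (hg : g ≫ φ.θ.hom = g')
    (h : n + 1 * (x.len + 1) = m) (h' : n + 1 * (y.len + 1) = m) :
    C.πm x g n m h = φ.sign • C.πm y g' n m h' := by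
  have e : g = g' ≫ φ.θ.inv := by rw [← hg, Category.assoc, Iso.hom_inv_id, Category.comp_id]
  rw [e, ← πm_map (x := x), πm, πm]
  have := C.π_arrow φ n m h h'
  change C.π x n m h ≫ (M.pre.map φ.θ.inv.op).f n = _ at this
  rw [this, Linear.units_smul_comp]

theorem π_eq_πm (h : n + 1 * (x.len + 1) = m) : C.π x n m h = C.πm x (𝟙 x.tgt) n m h := by
  rw [πm, op_id, M.pre.map_id]
  exact (Category.comp_id _).symm

/-- The sum in the differential of the bar construction. -/
noncomputable def πSum (x : Extension S) (g : W ⟶ x.tgt) (n m : ℤ)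
    (h : n + 1 * (x.len + 1) + 1 = m) : X S m ⟶ (M.pre.obj (op W)).X n :=
  sum₁ fun (f : Extension x.tgt) hf => C.πm (x.comp f) (g ≫ f.map) n m
    (by rw [len_comp, hf]; push_cast; lia)

theorem πSum_map (g : W ⟶ x.tgt) (g' : W' ⟶ W) (h : n + 1 * (x.len + 1) + 1 = m) :
    C.πSum x g n m h ≫ (M.pre.map g'.op).f n = C.πSum x (g' ≫ g) n m h := by
  refine (map_sum₁ (Preadditive.rightComp (X S m) ((M.pre.map g'.op).f n)) _).trans
    (sum₁_congr fun f hf => ?_)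
  exact C.πm_map (x := x.comp f) _ _ _

theorem invariant_πm (x : Extension S) (g : W ⟶ x.tgt) (n m : ℤ)
    (h : n + 1 * (x.len + 1) + 1 = m) : Invariant₁ fun (f : Extension x.tgt) hf =>
    C.πm (x.comp f) (g ≫ f.map) n m (by rw [len_comp, hf]; push_cast; lia) := by
  rintro f f' hf hf' ⟨φ⟩
  obtain ⟨ψ, h₁, h₂⟩ := exists_arrow_comp x φ
  refine (C.πm_arrow ψ _ (g ≫ f'.map) ?_ _ _).trans
    (by rw [h₂, sign_τ_of_new_length φ hf, one_smul])
  rw [h₁]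
  exact (Category.assoc _ _ _).trans (congrArg _ φ.map_eq)

theorem πSum_arrow (φ : Arrow x y) (g : W ⟶ x.tgt) (g' : W ⟶ y.tgt) (hg : g ≫ φ.θ.hom = g')
    (h : n + 1 * (x.len + 1) + 1 = m) (h' : n + 1 * (y.len + 1) + 1 = m) :
    C.πSum x g n m h = φ.sign • C.πSum y g' n m h' := by
  refine (sum₁_precompIso (C.invariant_πm x g n m h) φ.θ).trans ?_
  refine Eq.trans (sum₁_congr fun f hf => ?_)
    (map_sum₁ (DistribSMul.toAddMonoidHom _ φ.sign) _).symm
  obtain ⟨ψ, h₁, h₂⟩ := exists_arrow_comp_precompIso φ f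
  refine (C.πm_arrow ψ _ (g' ≫ f.map) ?_ _ _).trans (congrArg (· • _) h₂)
  rw [h₁, ← hg]
  exact (Category.comp_id _).trans (Category.assoc _ _ _).symm

/-- The differential of the bar construction. -/
noncomputable def barD (S : RTree) (m m' : ℤ) : X S m ⟶ X S m' :=
  if h : m' + 1 = m then C.lift fun x n hn => (x.len : ℤ).negOnePow •
    (C.πSum x (𝟙 _) n m (by lia) - C.π x (n + 1) m (by lia) ≫ (M.pre.obj (op x.tgt)).d (n + 1) n)
  else 0

theorem barD_π (x : Extension S) (n m m' : ℤ) (h : m' + 1 = m) (hn : n + 1 * (x.len + 1) = m') :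
    C.barD S m m' ≫ C.π x n m' hn = (x.len : ℤ).negOnePow •
      (C.πSum x (𝟙 _) n m (by lia) -
        C.π x (n + 1) m (by lia) ≫ (M.pre.obj (op x.tgt)).d (n + 1) n) := by
  rw [barD, dif_pos h]
  refine C.lift_π _ (fun x y φ n hx hy => ?_) x n hn
  have e₁ := C.πSum_map (𝟙 _) φ.θ.inv (show n + 1 * (x.len + 1) + 1 = m by lia)
  have e₂ := C.πSum_arrow φ (φ.θ.inv ≫ 𝟙 _) (𝟙 _) (by rw [Category.comp_id, Iso.inv_hom_id])
    (show n + 1 * (x.len + 1) + 1 = m by lia) (by lia)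
  have e₃ := C.π_arrow φ (n + 1) m (by lia) (by lia)
  change _ ≫ (M.pre.map φ.θ.inv.op).f (n + 1) = _ at e₃
  change _ ≫ (M.pre.map φ.θ.inv.op).f n = _
  rw [Linear.units_smul_comp, Preadditive.sub_comp, e₁, e₂, Category.assoc,
    ← (M.pre.map φ.θ.inv.op).comm, reassoc_of% e₃, Linear.units_smul_comp, ← smul_sub,
    φ.len_eq, smul_smul, smul_smul, mul_comm]

theorem barD_πm (x : Extension S) (g : W ⟶ x.tgt) (n n' m m' : ℤ) (h : m' + 1 = m)
    (hn : n + 1 * (x.len + 1) = m') (hn' : n + 1 = n') :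
    C.barD S m m' ≫ C.πm x g n m' hn = (x.len : ℤ).negOnePow •
      (C.πSum x g n m (by lia) -
        C.πm x g n' m (by lia) ≫ (M.pre.obj (op W)).d n' n) := by
  subst hn'
  rw [πm, ← Category.assoc, C.barD_π x n m m' h, Linear.units_smul_comp, Preadditive.sub_comp,
    C.πSum_map, Category.comp_id, Category.assoc, ← (M.pre.map g.op).comm, ← Category.assoc]
  rfl

theorem alternating_πm (x : Extension S) (g : W ⟶ x.tgt) (n m : ℤ)
    (h : n + 1 * (x.len + 1) + 2 = m) : Alternating₂ fun (f : Extension x.tgt) hf =>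
    C.πm (x.comp f) (g ≫ f.map) n m (by rw [len_comp, hf]; push_cast; lia) := by
  intro f f' hf hf' θ hθ hs
  obtain ⟨ψ, h₁, h₂⟩ := exists_arrow_comp_comp (x := x) (y := x) (f := f) (g := f') (Iso.refl _) θ
    (Category.comp_id _) (hθ.trans (Category.id_comp _).symm) (SPerm.refl _)
    (SPerm.of_eq (List.map_id _)) hs
  refine (C.πm_arrow ψ _ (g ≫ f'.map) ?_ _ _).trans
    (by rw [h₂, one_mul, one_mul, Units.neg_smul, one_smul])
  rw [h₁, ← hθ]
  exact Category.assoc _ _ _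

theorem barD_πSum (x : Extension S) (g : W ⟶ x.tgt) (n n' m m' : ℤ) (h : m' + 1 = m)
    (hn : n + 1 * (x.len + 1) + 1 = m') (hn' : n + 1 = n') :
    C.barD S m m' ≫ C.πSum x g n m' hn = (x.len : ℤ).negOnePow •
      C.πSum x g n' m (by lia) ≫ (M.pre.obj (op W)).d n' n := by
  have e₁ : C.barD S m m' ≫ C.πSum x g n m' hn = sum₁ fun (f : Extension x.tgt) hf =>
      ((x.len : ℤ) + 1).negOnePow • (C.πSum (x.comp f) (g ≫ f.map) n m
        (by rw [len_comp, hf]; push_cast; lia) - C.πm (x.comp f) (g ≫ f.map) n' m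
        (by rw [len_comp, hf]; push_cast; lia) ≫ (M.pre.obj (op W)).d n' n) := by
    refine (map_sum₁ (Preadditive.leftComp ((M.pre.obj (op W)).X n) (C.barD S m m'))
        _).trans (sum₁_congr fun f hf => ?_)
    refine (C.barD_πm (x.comp f) (g ≫ f.map) n n' m m' h _ hn').trans ?_
    exact congrArg (· • _) (by rw [len_comp, hf]; rfl)
  have e₂ : sum₁ (fun (f : Extension x.tgt) hf => C.πSum (x.comp f) (g ≫ f.map) n m
      (by rw [len_comp, hf]; push_cast; lia)) = 0 := by
    refine Eq.trans (sum₁_congr fun f hf => sum₁_congr fun f' hf' => ?_)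
      (sum₁_sum₁_eq_zero (C.alternating_πm x g n m (by lia)))
    obtain ⟨ψ, h₁, h₂⟩ := exists_arrow_comp_assoc x f f'
    refine (C.πm_arrow ψ _ (g ≫ f.map ≫ f'.map) ?_ _ _).trans (by rw [h₂, one_smul]; rfl)
    rw [h₁]
    exact (Category.comp_id _).trans (Category.assoc _ _ _)
  have e₃ : C.πSum x g n' m (by lia) ≫ (M.pre.obj (op W)).d n' n =
      sum₁ fun (f : Extension x.tgt) hf => C.πm (x.comp f) (g ≫ f.map) n' m
        (by rw [len_comp, hf]; push_cast; lia) ≫ (M.pre.obj (op W)).d n' n :=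
    map_sum₁ (Preadditive.rightComp (X S m) ((M.pre.obj (op W)).d n' n)) _
  rw [e₁, e₃]
  refine (map_sum₁ (DistribSMul.toAddMonoidHom _ ((x.len : ℤ) + 1).negOnePow) _).symm.trans ?_
  rw [DistribSMul.toAddMonoidHom_apply, show sum₁ (fun (f : Extension x.tgt) hf => C.πSum (x.comp f)
      (g ≫ f.map) n m
        (by rw [len_comp, hf]; push_cast; lia) - C.πm (x.comp f) (g ≫ f.map) n' m
        (by rw [len_comp, hf]; push_cast; lia) ≫ (M.pre.obj (op W)).d n' n) =
      sum₁ (fun (f : Extension x.tgt) hf => C.πSum (x.comp f) (g ≫ f.map) n m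
        (by rw [len_comp, hf]; push_cast; lia)) - sum₁ (fun (f : Extension x.tgt) hf =>
          C.πm (x.comp f) (g ≫ f.map) n' m (by rw [len_comp, hf]; push_cast; lia) ≫
          (M.pre.obj (op W)).d n' n) from Finset.sum_sub_distrib _ _, e₂, zero_sub, smul_neg,
    Int.negOnePow_succ, Units.neg_smul, neg_neg]

theorem barD_barD (S : RTree) (m m' m'' : ℤ) (h : m' + 1 = m) (h' : m'' + 1 = m') :
    C.barD S m m' ≫ C.barD S m' m'' = 0 := by
  refine C.ext_π fun x n hn => ?_
  rw [Limits.zero_comp, Category.assoc, C.π_eq_πm, C.barD_πm x _ n (n + 1) m' m'' h' hn rfl,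
    Linear.comp_units_smul, Preadditive.comp_sub, C.barD_πSum x _ n (n + 1) m m' h _ rfl,
    ← Category.assoc (C.barD S m m'), C.barD_πm x _ (n + 1) (n + 1 + 1) m m' h (by lia) rfl,
    Linear.units_smul_comp, ← smul_sub, Preadditive.sub_comp, Category.assoc,
    HomologicalComplex.d_comp_d, Limits.comp_zero, sub_zero, sub_self, smul_zero, smul_zero]

end Coinv

end BarConstruction

open Extension

section BarFunctor

variable {k : Type u} [CommRing k] {M : LinearPreoperad k} {X : RTree → ℤ → ModuleCat.{u} k}
  (C : Coinv M.action 1 X)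

theorem Int.units_mul_eq_mul_swap {a b c d : ℤˣ} (h : a * b = c * d) : a * c = b * d := by
  have hb := Int.units_mul_self b
  have hc := Int.units_mul_self c
  calc a * c = (a * b) * (b * c) := by rw [mul_assoc, ← mul_assoc b, hb, one_mul]
    _ = b * d := by rw [h, mul_comm b c, mul_comm c d, mul_assoc, ← mul_assoc c, hc, one_mul,
      mul_comm]

namespace Coinv

variable {S S' S'' : RTree} {W : RTree} {n m m' : ℤ}

/-- The covariant functoriality of the bar construction. -/
noncomputable def barMap (γ : S ⟶ S') (m : ℤ) : X S m ⟶ X S' m :=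
  C.lift fun y n h => topSign (ofHom γ) y • C.π ((ofHom γ).comp y) n m
    (by rw [len_comp_of_top, h])

theorem barMap_π (γ : S ⟶ S') (y : Extension S') (h : n + 1 * (y.len + 1) = m) :
    C.barMap γ m ≫ C.π y n m h = topSign (ofHom γ) y • C.π ((ofHom γ).comp y) n m
      (by rw [len_comp_of_top, h]) := by
  refine C.lift_π _ (fun y y' φ n hy hy' => ?_) y n h
  obtain ⟨χ, h₁, h₂⟩ := exists_arrow_comp_top (E := ofHom γ) (E' := ofHom γ) (y := y) (y' := y')
    (Iso.refl _) φ.θ (Category.comp_id _) (φ.map_eq.trans (Category.id_comp _).symm)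
    ((SPerm.of_eq (List.map_id _)).trans φ.sperm_old) φ.sperm_new
  rw [one_mul] at h₂
  have e := C.πm_arrow χ φ.θ.inv (𝟙 _) (by rw [h₁]; exact φ.θ.inv_hom_id)
    (show n + 1 * (_ + 1) = m by rw [len_comp_of_top, hy]) (by rw [len_comp_of_top, hy'])
  refine (Linear.units_smul_comp _ _ _).trans ?_
  refine (congrArg (_ • ·) (e.trans (congrArg (_ • ·) (C.π_eq_πm _).symm))).trans ?_
  refine (smul_smul _ _ _).trans ((congrArg (· • _) ?_).trans (smul_smul _ _ _).symm)
  exact Int.units_mul_eq_mul_swap h₂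

theorem barMap_πm (E : Extension S) (y : Extension E.tgt) (g : W ⟶ y.tgt)
    (h : n + 1 * (y.len + 1) = m) :
    C.barMap E.map m ≫ C.πm y g n m h = topSign E y • C.πm (E.comp y) g n m
      (by rw [len_comp_of_top, h]) := by
  rw [πm, ← Category.assoc, barMap_π]
  obtain ⟨χ, h₁, h₂⟩ := exists_arrow_comp_top (E := ofHom E.map) (E' := E) (y := y) (y' := y)
    (Iso.refl _) (Iso.refl _) (Category.comp_id _) (Category.comp_id _)
    (SPerm.of_eq (List.map_id _)) (SPerm.of_eq (List.map_id _))
  rw [one_mul, mul_one] at h₂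
  have e := C.πm_arrow χ g g (by rw [h₁]; exact Category.comp_id _)
    (show n + 1 * (_ + 1) = m by rw [len_comp_of_top, h]) (by rw [len_comp_of_top, h])
  refine (Linear.units_smul_comp _ _ _).trans ((congrArg (_ • ·) e).trans ?_)
  rw [smul_smul, h₂, mul_right_comm, Int.units_mul_self, one_mul]

theorem barMap_πm' (γ : S ⟶ S') (y : Extension S') (g : W ⟶ y.tgt)
    (h : n + 1 * (y.len + 1) = m) :
    C.barMap γ m ≫ C.πm y g n m h = topSign (ofHom γ) y • C.πm ((ofHom γ).comp y) g n m
      (by rw [len_comp_of_top, h]) := C.barMap_πm (ofHom γ) y g h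

theorem barMap_πSum (E : Extension S) (y : Extension E.tgt) (g : W ⟶ y.tgt)
    (h : n + 1 * (y.len + 1) + 1 = m) :
    C.barMap E.map m ≫ C.πSum y g n m h = topSign E y • C.πSum (E.comp y) g n m
      (by rw [len_comp_of_top, h]) := by
  refine (map_sum₁ (Preadditive.leftComp ((M.pre.obj (op W)).X n) (C.barMap E.map m)) _).trans ?_
  refine Eq.trans (sum₁_congr fun f hf => ?_)
    (map_sum₁ (DistribSMul.toAddMonoidHom _ (topSign E y)) _).symm
  refine (C.barMap_πm E (y.comp f) (g ≫ f.map) _).trans ?_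
  obtain ⟨χ, h₁, h₂⟩ := exists_arrow_comp_assoc E y f
  have e := C.πm_arrow χ (g ≫ f.map) (g ≫ f.map) (by rw [h₁]; exact Category.comp_id _)
    (n := n) (m := m) (by
      rw [χ.len_eq, len_comp_of_top, len_comp, hf]; push_cast; lia)
    (by rw [len_comp_of_top, len_comp, hf]; push_cast; lia)
  rw [h₂, one_smul] at e
  exact congrArg₂ (· • ·) (topSign_eq (sperm_topSign E y)) e.symm

theorem barMap_id (S : RTree) (m : ℤ) : C.barMap (𝟙 S) m = 𝟙 _ := by
  refine C.ext_π fun y n h => ?_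
  rw [Category.id_comp, C.π_eq_πm, C.barMap_πm']
  have hE := new_ofHom_id S
  obtain ⟨χ, h₁, h₂⟩ := Arrow.exists_of_sperm (x := (ofHom (𝟙 S)).comp y) (y := y) (Iso.refl y.tgt)
    ((Category.comp_id _).trans (Category.id_comp _)) (s := topSign (ofHom (𝟙 S)) y) (t := 1) (by
      refine ((SPerm.of_eq ?_).trans (sperm_topSign (ofHom (𝟙 S)) y)).cast (one_mul _)
      change _ = (ofHom (𝟙 S)).old.map (𝟙 S : S ⟶ S) ++ (ofHom (𝟙 S)).new
      rw [hE, List.append_nil]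
      exact (List.map_id _).symm) (SPerm.of_eq (by
      refine (List.map_id _).trans ?_
      change (ofHom (𝟙 S)).new.map y.map ++ y.new = y.new
      rw [hE]; rfl))
  have e := C.πm_arrow χ (𝟙 _) (𝟙 _) (by rw [h₁]; exact Category.comp_id _)
    (n := n) (m := m) (by rw [len_comp_of_top, h]) h
  rw [h₂, mul_one] at e
  exact (congrArg (_ • ·) e).trans ((smul_smul _ _ _).trans
    ((congrArg (· • _) (Int.units_mul_self _)).trans (one_smul _ _)))

theorem barMap_comp (γ : S ⟶ S') (γ' : S' ⟶ S'') (m : ℤ) :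
    C.barMap (γ ≫ γ') m = C.barMap γ m ≫ C.barMap γ' m := by
  refine C.ext_π fun y n h => ?_
  let E := ofHom γ
  let f : Extension S' := setOld (ofHom γ') E.top.old ((ofHom γ').old_enum.perm E.top.old_enum)
  have e₁ := C.barMap_πm f y (𝟙 y.tgt) h
  have e₂ := C.barMap_πm E (f.comp y) (𝟙 y.tgt) (n := n) (m := m) (by rw [len_comp_of_top, h])
  have e₃ := C.barMap_πm (E.comp f) y (𝟙 y.tgt) h
  have hs : topSign E (f.comp y) = 1 := topSign_eq (SPerm.refl _)
  obtain ⟨χ, h₁, h₂⟩ := exists_arrow_comp_assoc E f y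
  have e₄ := C.πm_arrow χ (𝟙 _) (𝟙 _) (by rw [h₁]; exact Category.comp_id _)
    (n := n) (m := m) (by rw [χ.len_eq, len_comp_of_top, len_comp_of_top, h])
    (by rw [len_comp_of_top, len_comp_of_top, h])
  rw [C.π_eq_πm, Category.assoc]
  refine e₃.trans (Eq.trans ?_ (congrArg (_ ≫ ·) e₁).symm)
  rw [Linear.comp_units_smul]
  refine Eq.trans ?_ (congrArg (_ • ·) e₂).symm
  rw [topSign_comp E f y rfl, hs, one_smul]
  exact congrArg (_ • ·) (e₄.trans (by rw [h₂, one_smul]; rfl))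

theorem barMap_barD (γ : S ⟶ S') (m m' : ℤ) :
    C.barMap γ m ≫ C.barD S' m m' = C.barD S m m' ≫ C.barMap γ m' := by
  by_cases hm : m' + 1 = m
  · refine C.ext_π fun y n h => ?_
    have h' : n + 1 * (((ofHom γ).comp y).len + 1) = m' := by rw [len_comp_of_top, h]
    have e₁ := C.barMap_πSum (ofHom γ) y (𝟙 y.tgt) (n := n) (m := m) (by lia)
    have e₂ := C.barMap_πm (ofHom γ) y (𝟙 y.tgt) (n := n + 1) (m := m) (by lia)
    have e₃ := C.barD_πm ((ofHom γ).comp y) (𝟙 y.tgt) n _ m m' hm h' rfl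
    rw [Category.assoc, Category.assoc, C.π_eq_πm, C.barMap_πm', C.barD_πm y _ n _ m m' hm h rfl,
      Linear.comp_units_smul, Linear.comp_units_smul, Preadditive.comp_sub, ← Category.assoc]
    refine Eq.trans (congrArg (_ • ·) (congrArg₂ (· - ·) e₁ (congrArg (· ≫ _) e₂)))
      (Eq.trans ?_ (congrArg (_ • ·) e₃).symm)
    rw [Linear.units_smul_comp, ← smul_sub]
    refine (smul_comm _ _ _).trans (congrArg (_ • ·) (congrArg (· • _) ?_))
    rw [len_comp_of_top]
  · rw [barD, barD, dif_neg hm, dif_neg hm, Limits.comp_zero, Limits.zero_comp]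

/-- The bar construction, as a functor to complexes. -/
noncomputable def barFunctor : RTree ⥤ Ch k where
  obj S :=
    { X := X S
      d := C.barD S
      shape := fun _ _ h => dif_neg h
      d_comp_d' := fun i j l h h' => C.barD_barD S i j l h h' }
  map γ :=
    { f := C.barMap γ
      comm' := fun i j _ => C.barMap_barD γ i j }
  map_id S := HomologicalComplex.hom_ext _ _ fun m => C.barMap_id S m
  map_comp γ γ' := HomologicalComplex.hom_ext _ _ fun m => C.barMap_comp γ γ' m

/-- The coinvariants, as modules of chains of the bar construction. -/
def barCoinv : Coinv M.action 1 fun S m => (C.barFunctor.obj S).X m := C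

end Coinv

end BarFunctor

open Extension

section BarFormulas

variable {k : Type u} [CommRing k]

namespace Coinv

variable {M : LinearPreoperad k} {X : RTree → ℤ → ModuleCat.{u} k}
  (C : Coinv M.action 1 X) {S S' : RTree} {x y : Extension S} {W : RTree} {n n' m m' : ℤ}

theorem ι_πm (φ : Arrow x y) (g : W ⟶ y.tgt) (g' : W ⟶ x.tgt) (hg : g' ≫ φ.θ.hom = g)
    (h : n + 1 * (x.len + 1) = m) (h' : n + 1 * (y.len + 1) = m) :
    C.ι x n m h ≫ C.πm y g n m h' = φ.sign • (M.pre.map g'.op).f n := by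
  have e : g' = g ≫ φ.θ.inv := by rw [← hg, Category.assoc, Iso.hom_inv_id, Category.comp_id]
  rw [πm, ← Category.assoc, C.ι_π φ, Linear.units_smul_comp, e, op_comp, M.pre.map_comp,
    HomologicalComplex.comp_f]

theorem ι_πm_zero (hxy : ¬ Nonempty (Arrow x y)) (g : W ⟶ y.tgt)
    (h : n + 1 * (x.len + 1) = m) (h' : n' + 1 * (y.len + 1) = m) :
    C.ι x n m h ≫ C.πm y g n' m h' = 0 := by
  rw [πm, ← Category.assoc, C.ι_π_zero hxy, Limits.zero_comp]

theorem ι_πSum_zero (g : W ⟶ y.tgt)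
    (hxy : ∀ (f : Extension y.tgt) (θ : x.tgt ≅ f.tgt), f.new.length = 1 →
      x.map ≫ θ.hom ≠ y.map ≫ f.map)
    (h : n + 1 * (x.len + 1) = m) (h' : n' + 1 * (y.len + 1) + 1 = m) :
    C.ι x n m h ≫ C.πSum y g n' m h' = 0 := by
  refine (map_sum₁ (Preadditive.leftComp ((M.pre.obj (op W)).X n') (C.ι x n m h)) _).trans
    (sum₁_eq_zero fun f hf => C.ι_πm_zero (y := y.comp f) ?_ (g ≫ f.map) _ _)
  rintro ⟨φ⟩
  exact hxy f φ.θ hf φ.map_eq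

theorem ι_πSum {i : Fin x.new.length} (φ : Arrow (x.face i) y) (g : W ⟶ y.tgt)
    (g' : W ⟶ (x.face i).tgt) (hg : g' ≫ φ.θ.hom = g)
    (h : n + 1 * (x.len + 1) = m) (h' : n + 1 * (y.len + 1) + 1 = m) :
    C.ι x n m h ≫ C.πSum y g n m h' = ((-1) ^ ((i : ℕ) + (x.new.length - 1)) * φ.sign) •
      (M.pre.map (g' ≫ x.tgt.face (x.get_inner i)).op).f n := by
  obtain ⟨f, θ, hf, h₁, h₂, hs⟩ := exists_comp_of_face φ
  obtain ⟨χ, h₃, h₄⟩ := Arrow.exists_of_sperm (x := x) (y := y.comp f) θ h₁ φ.sperm_old hs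
  refine (map_sum₁ (Preadditive.leftComp ((M.pre.obj (op W)).X n) (C.ι x n m h)) _).trans ?_
  refine (sum₁_eq_single (fun f₁ f₂ hf₁ hf₂ hf => congrArg (_ ≫ ·)
    (C.invariant_πm y g n m h' f₁ f₂ hf₁ hf₂ hf)) f hf fun f' hf' hf'' =>
    C.ι_πm_zero (y := y.comp f') (fun h => hf'' ?_) (g ≫ f'.map) _ _).trans ?_
  · obtain ⟨φ'⟩ := h
    exact nonempty_arrow_of_comp ((arrow_equivalence S).trans ((arrow_equivalence S).symm ⟨φ'⟩) ⟨χ⟩)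
  · refine (C.ι_πm χ (g ≫ f.map) (g' ≫ x.tgt.face (x.get_inner i)) ?_ h _).trans
      (congrArg (· • _) ?_)
    · rw [h₃]
      refine (Category.assoc _ _ _).trans ((congrArg (g' ≫ ·) h₂).trans ?_)
      rw [← hg]
      exact (Category.assoc _ _ _).symm
    · rw [h₄, Arrow.sign]
      exact mul_left_comm _ _ _

theorem _root_.smul_comp_comp {A B D E : ModuleCat.{u} k} (s : ℤˣ) (f : A ⟶ B) (g : B ⟶ D)
    (h : D ⟶ E) : (s • (f ≫ g)) ≫ h = s • (f ≫ g ≫ h) := by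
  rw [Linear.units_smul_comp, Category.assoc]

theorem _root_.smul_comp_zero {A B D : ModuleCat.{u} k} (s : ℤˣ) (f : A ⟶ B) {g : B ⟶ D}
    (hg : g = 0) : s • (f ≫ g) = 0 := by
  rw [hg, Limits.comp_zero, smul_zero]

theorem ι_barD (x : Extension S) (n n₁ m m' : ℤ) (hm : m' + 1 = m) (hn : n₁ + 1 = n)
    (h : n + 1 * (x.len + 1) = m) :
    C.ι x n m h ≫ C.barD S m m' =
      ∑ i : Fin x.new.length, Int.negOnePow (x.old.length + (i : ℕ)) •
        ((M.pre.map (x.tgt.face (x.get_inner i)).op).f n ≫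
          C.ι (x.face i) n m' (by have := x.len_face i; lia))
      + Int.negOnePow (x.old.length + x.new.length + 1) •
        ((M.pre.obj (op x.tgt)).d n n₁ ≫ C.ι x n₁ m' (by lia)) := by
  subst hn
  refine C.ext_π fun y n' hy => ?_
  rw [Category.assoc, C.barD_π y n' m m' hm hy, Linear.comp_units_smul, Preadditive.comp_sub,
    Preadditive.add_comp, Preadditive.sum_comp]
  by_cases h₁ : ∃ i, Nonempty (Arrow (x.face i) y)
  · obtain ⟨i, ⟨φ⟩⟩ := h₁
    have hl := φ.len_eq
    have hl' := x.len_face i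
    obtain rfl : n' = n₁ + 1 := by lia
    have hxy : ¬ Nonempty (Arrow x y) := fun ⟨ψ⟩ => by have := ψ.len_eq; lia
    rw [C.ι_πSum φ (𝟙 _) φ.θ.inv (Iso.inv_hom_id _), ← Category.assoc, C.ι_π_zero hxy,
      Limits.zero_comp, sub_zero, Linear.units_smul_comp, Category.assoc, C.ι_π_zero hxy,
      Limits.comp_zero, smul_zero, add_zero, Finset.sum_eq_single i]
    · have e := C.ι_π φ (n₁ + 1) m' (by lia) hy
      refine Eq.trans ?_ (smul_comp_comp _ _ _ _).symm
      refine Eq.trans ?_ (congrArg (fun f => _ • (_ ≫ f)) e).symm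
      refine Eq.trans ?_ (congrArg (_ • ·) (Linear.comp_units_smul _ _ _)).symm
      refine (smul_smul _ _ _).trans (Eq.trans ?_ (smul_smul _ _ _).symm)
      rw [← mul_assoc]
      refine congrArg₂ (fun (s : ℤˣ) f => (s * φ.sign) • f) ?_ ?_
      · have hi := i.2
        rw [← Int.negOnePow_coe, ← Int.negOnePow_add, Int.negOnePow_eq_iff]
        have hx : x.len = x.old.length + x.new.length := rfl
        exact ⟨(x.new.length - 1 : ℤ), by lia⟩
      · exact congrArg (fun f => HomologicalComplex.Hom.f f (n₁ + 1))
          (M.pre.map_comp (x.tgt.face (x.get_inner i)).op φ.θ.inv.op)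
    · intro j _ hj
      refine (smul_comp_comp _ _ _ _).trans (smul_comp_zero _ _ (C.ι_π_zero ?_ _ _ _ _ _))
      exact fun h => hj (x.face_eq_of_arrow
        ((arrow_equivalence S).trans h ((arrow_equivalence S).symm ⟨φ⟩)))
    · exact fun h => (h (Finset.mem_univ _)).elim
  · rw [C.ι_πSum_zero (𝟙 _) fun f θ hf hθ => h₁ (exists_face_of_comp hf θ hθ), zero_sub, smul_neg,
      Finset.sum_eq_zero, zero_add, Linear.units_smul_comp, Category.assoc]
    · by_cases hxy : Nonempty (Arrow x y)
      · obtain ⟨φ⟩ := hxy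
        obtain rfl : n' = n₁ := by have := φ.len_eq; lia
        have e := C.ι_π φ n' m' (by lia) hy
        have e' := C.ι_π φ (n' + 1) m h (by have := φ.len_eq; lia)
        rw [e, ← Category.assoc, e', Linear.comp_units_smul, Linear.units_smul_comp,
          (M.action.map φ.θ).comm, Int.negOnePow_succ, Units.neg_smul, ← φ.len_eq]
        rfl
      · rw [C.ι_π_zero hxy, ← Category.assoc, C.ι_π_zero hxy, Limits.zero_comp, Limits.comp_zero,
          smul_zero, smul_zero, neg_zero]
    · intro i _
      exact (smul_comp_comp _ _ _ _).trans
        (smul_comp_zero _ _ (C.ι_π_zero (fun h => h₁ ⟨i, h⟩) _ _ _ _ _))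

theorem ι_barMap (E : Extension S) (z : Extension E.tgt) (h : n + 1 * (z.len + 1) = m) :
    C.ι (E.comp z) n m (by rw [len_comp_of_top, h]) ≫ C.barMap E.map m =
      topSign E z • C.ι z n m h := by
  refine C.ext_π fun y n' hy => ?_
  rw [Category.assoc, C.π_eq_πm, C.barMap_πm, Linear.comp_units_smul]
  refine Eq.trans ?_ (Linear.units_smul_comp _ _ _).symm
  by_cases hzy : Nonempty (Arrow z y)
  · obtain ⟨φ⟩ := hzy
    obtain rfl := φ.index_eq h hy
    obtain ⟨χ, h₁, h₂⟩ := exists_arrow_comp_top (E := E) (E' := E) (y := z) (y' := y)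
      (Iso.refl _) φ.θ (Category.comp_id _) (φ.map_eq.trans (Category.id_comp _).symm)
      ((SPerm.of_eq (List.map_id _)).trans φ.sperm_old) φ.sperm_new
    rw [one_mul] at h₂
    have e := C.ι_πm χ (𝟙 y.tgt) φ.θ.inv (by rw [h₁]; exact φ.θ.inv_hom_id)
      (show n + 1 * (_ + 1) = m by rw [len_comp_of_top, h]) (by rw [len_comp_of_top, hy])
    refine (congrArg (_ • ·) e).trans ?_
    refine Eq.trans ?_ (congrArg (_ • ·) (C.ι_πm φ (𝟙 y.tgt) φ.θ.inv φ.θ.inv_hom_id h hy)).symm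
    refine (smul_smul _ _ _).trans (Eq.trans (congrArg (· • _) ?_) (smul_smul _ _ _).symm)
    exact (mul_comm _ _).trans h₂.symm
  · refine ((congrArg (_ • ·) (C.ι_πm_zero (y := E.comp y)
      (fun h => hzy (nonempty_arrow_of_comp h)) (𝟙 y.tgt) _ _)).trans (smul_zero _)).trans ?_
    exact ((congrArg (_ • ·) (C.ι_πm_zero hzy (𝟙 y.tgt) _ _)).trans (smul_zero _)).symm

theorem ι_barMap_zero (γ : S ⟶ S') (x : Extension S) (h : n + 1 * (x.len + 1) = m)
    (hx : ¬ ∃ β : S' ⟶ x.tgt, γ ≫ β = x.map) : C.ι x n m h ≫ C.barMap γ m = 0 := by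
  refine C.ext_π fun y n' hy => ?_
  rw [Category.assoc, C.π_eq_πm, C.barMap_πm', Linear.comp_units_smul, Limits.zero_comp]
  refine (congrArg (_ • ·) (C.ι_πm_zero (y := (ofHom γ).comp y) (fun h => hx ?_) (𝟙 y.tgt)
      _ _)).trans (smul_zero _)
  obtain ⟨φ⟩ := h
  refine ⟨y.map ≫ φ.θ.inv, ?_⟩
  have := φ.map_eq
  exact (Category.assoc _ _ _).symm.trans ((Iso.comp_inv_eq φ.θ).2 this.symm)

end Coinv

/-- The bar construction as coinvariants. -/
theorem LinearPreoperad.exists_barCoinv (M : LinearPreoperad k) :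
    ∃ C : Coinv M.action 1 (barX M.pre), ∀ {S : RTree} (x : Extension S) n m h,
      C.ι x n m h = barι M.pre x n m (by lia) := by
  classical
  refine Coinv.exists_of_desc (ε := 1) (F := M.action) (fun x n m h => barι M.pre x n m (by lia))
      ?_ ?_ ?_
  · intro S x y φ n m hx hy
    refine ModuleCat.hom_ext (LinearMap.ext fun v => ?_)
    have e : (M.pre.map φ.θ.hom.op).f n ((M.pre.map φ.θ.inv.op).f n v) = v := by
      rw [← ModuleCat.comp_apply, ← HomologicalComplex.comp_f, ← M.pre.map_comp, ← op_comp,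
        Iso.hom_inv_id, op_id, M.pre.map_id]
      rfl
    have := (Submodule.Quotient.eq (Submodule.span k (barRelations M.pre S m))).2
      (Submodule.subset_span ⟨x, y, φ, n, by lia, by lia, (M.pre.map φ.θ.inv.op).f n v, rfl⟩)
    rw [e] at this
    refine this.trans ?_
    change (Submodule.mkQ (Submodule.span k (barRelations M.pre S m))) _ = _
    rw [map_zsmul]
    rfl
  · intro S m A f g h
    refine ModuleCat.hom_ext (Submodule.linearMap_qext _ (DirectSum.linearMap_ext k fun i => ?_))
    exact congrArg ModuleCat.Hom.hom (h i.1 i.2.1 (by have := i.2.2; lia))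
  · intro S m A f hf
    let G : (⨁ i : BarIndex S m, (M.pre.obj (op i.1.tgt)).X i.2.1) →ₗ[k] A :=
      DirectSum.toModule k (BarIndex S m) A fun i => (f i.1 i.2.1 (by have := i.2.2; lia)).hom
    have hG : ∀ (x : Extension S) (n : ℤ) (h : x.len + (n + 1) = m) v,
        G (DirectSum.lof k (BarIndex S m) (fun i => (M.pre.obj (op i.1.tgt)).X i.2.1)
          ⟨x, n, h⟩ v) = f x n (by lia) v := fun x n h v => DirectSum.toModule_lof k _ _
    refine ⟨ModuleCat.ofHom (Submodule.liftQ _ G (Submodule.span_le.2 ?_)), fun x n h => ?_⟩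
    · rintro _ ⟨x, y, φ, n, hx, hy, v, rfl⟩
      have e : (M.pre.map φ.θ.inv.op).f n ((M.pre.map φ.θ.hom.op).f n v) = v := by
        rw [← ModuleCat.comp_apply, ← HomologicalComplex.comp_f, ← M.pre.map_comp, ← op_comp,
          Iso.inv_hom_id, op_id, M.pre.map_id]
        rfl
      have e' := hf x y φ n (by lia) (by lia)
      rw [SetLike.mem_coe, LinearMap.mem_ker, map_sub, map_zsmul, hG, hG, e']
      change φ.sign • (f y n _) ((M.pre.map φ.θ.inv.op).f n _) - _ = 0
      rw [e]
      exact sub_self _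
    · refine ModuleCat.hom_ext (LinearMap.ext fun v => ?_)
      exact hG x n (by lia) v

end BarFormulas

open Extension

section BarSplitting

variable {k : Type u} [CommRing k]

/-- The structure maps of a preoperad. -/
abbrev LinearPreoperad.splitting (M : LinearPreoperad k) : Splitting M.action where
  t := M.θ
  naturality g g' θS θR θ h := M.naturality g' g θS.inv θR.inv θ.inv
    ⟨by rw [← h.map_leaf, RTree.iso_hom_inv_apply],
      fun e => by
        have := h.inl (θS.inv e)
        rw [RTree.iso_inv_hom_apply] at this
        rw [← this, RTree.iso_hom_inv_apply],
      fun e => by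
        have := h.inr (θR.inv e)
        rw [RTree.iso_inv_hom_apply] at this
        rw [← this, RTree.iso_hom_inv_apply]⟩

theorem LinearPreoperad.splitting_isAssoc (M : LinearPreoperad k) : M.splitting.IsAssoc :=
  ⟨M.assoc_seq, M.assoc_par⟩

/-- The sign in the structure maps of the bar construction. -/
def barSign (dS eS dR _ : ℕ) : ℤˣ := (-1) ^ (1 + dS + eS + eS * dR)

theorem seqRule_barSign : Coinv.SeqRule barSign := fun dS eS dR eR dQ eQ => by
  simp only [barSign, ← pow_add]
  exact Int.negOnePow_coe _ ▸ Int.negOnePow_coe _ ▸ (Int.negOnePow_eq_iff _ _).2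
    ⟨-(1 + dS : ℤ), by push_cast; ring⟩

theorem parRule_barSign : Coinv.ParRule barSign := fun dS eS dR eR dQ eQ => by
  simp only [barSign, ← pow_add]
  exact Int.negOnePow_coe _ ▸ Int.negOnePow_coe _ ▸ (Int.negOnePow_eq_iff _ _).2
    ⟨dR + eR + eR * dQ, by push_cast; ring⟩

namespace Coinv

variable {M : LinearPreoperad k} {C : RTree → Ch k}
  (B : Coinv M.action 1 fun S m => (C S).X m) {S R U W W' WS WR : RTree} {a : S.Edge}
  {aW : WS.Edge} {x y : Extension S}

/-- The coordinate at `x`, followed by restriction along a morphism, as a graded map. -/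
def pm (x : Extension S) (u : W ⟶ x.tgt) :
    GradedMap (-(1 * (x.len + 1))) (C S) (M.pre.obj (op W)) :=
  (B.p x).post (M.pre.map u.op)

theorem pm_id (x : Extension S) : B.pm x (𝟙 _) = B.p x := by
  rw [pm, op_id, M.pre.map_id]
  exact GradedMap.post_id _

theorem pm_arrow (φ : Arrow x y) (u : W ⟶ x.tgt) (u' : W ⟶ y.tgt) (h : u ≫ φ.θ.hom = u') :
    B.pm x u = φ.sign • (B.pm y u').cast (by rw [φ.len_eq]) :=
  GradedMap.hom_ext fun p q hq => by
    rw [GradedMap.units_smul_apply]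
    exact B.πm_arrow φ u u' h _ _

variable {xS : Extension S} {xR : Extension R} {x : Extension U} {g : RTree.Grafting S a R U}

/-- The sign of the coordinate at a pair in the structure maps. -/
def barPairSign (xS : Extension S) (xR : Extension R) : ℤˣ :=
  splitSign barSign xS xR * ((1 * (xR.len + 1)) * (1 * (xS.len + 1)) : ℤ).negOnePow

theorem split_pm (D : x.Degrafting g xS xR) (gW : RTree.Grafting WS aW WR W) {uS : WS ⟶ xS.tgt}
    {uR : WR ⟶ xR.tgt} {u : W ⟶ x.tgt} (hu : gW.Compatible D.graft uS uR u) (n m : ℤ)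
    (h : n + 1 * (x.len + 1) = m) :
    B.split M.splitting barSign g m ≫ (B.pm xS uS).tens (B.pm xR uR) m n (D.index' h) =
      barPairSign xS xR • B.πm x u n m h ≫ (M.θ gW).f n := by
  rw [pm, pm, ← GradedMap.tens_post, ← Category.assoc, B.split_π _ _ D n m h,
    Linear.units_smul_comp, Category.assoc, ← HomologicalComplex.comp_f]
  change _ • _ ≫ (M.θ D.graft ≫ _).f n = _
  rw [← M.naturality gW D.graft uS uR u hu, HomologicalComplex.comp_f, πm, Category.assoc]
  rfl

/-- The sum in the differential of the bar construction, as a graded map. -/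
noncomputable def pSum (x : Extension S) (u : W ⟶ x.tgt) :
    GradedMap (-(1 * (x.len + 1)) - 1) (C S) (M.pre.obj (op W)) :=
  sum₁ fun (f : Extension x.tgt) hf => (B.pm (x.comp f) (u ≫ f.map)).cast
    (by rw [len_comp, hf]; push_cast; ring)

theorem pSum_apply (x : Extension S) (u : W ⟶ x.tgt) (n m : ℤ) (h) (h') :
    B.pSum x u m n h = B.πSum x u n m h' :=
  map_sum₁ (AddMonoidHom.mk' (fun v : GradedMap (-(1 * (x.len + 1)) - 1) (C S)
    (M.pre.obj (op W)) => v m n h) fun _ _ => rfl) _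

theorem pm_comp_of_new_eq_nil (x : Extension S) (f : Extension x.tgt) (hf : f.new = []) :
    B.pm x (𝟙 _) = (B.pm (x.comp f) f.map).cast (by rw [len_comp, hf]; rfl) := by
  obtain ⟨φ, h₁, h₂⟩ := exists_arrow_comp_of_new_eq_nil x f hf
  have := B.pm_arrow φ (𝟙 _) f.map (by rw [h₁]; exact Category.id_comp _)
  rwa [h₂, one_smul] at this

theorem _root_.Extension.len_setNew (x : Extension S) {l : List x.tgt.Edge} (h : x.new.Perm l) :
    (x.setNew l h).len = x.len := congrArg (_ + ·) h.length_eq.symm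

theorem _root_.Extension.index_setNew {x : Extension S} {l : List x.tgt.Edge} (h : x.new.Perm l)
    {ε n m : ℤ} (e : n + ε * (x.len + 1) = m) : n + ε * ((x.setNew l h).len + 1) = m := by
  rw [len_setNew, e]

theorem _root_.Extension.length_new_comp (x : Extension S) (f : Extension x.tgt) :
    (x.comp f).new.length = x.new.length + f.new.length :=
  List.length_append.trans (congrArg (· + _) (List.length_map _))

theorem split_pm_comp (D : x.Degrafting g xS xR) {f : Extension x.tgt} {fS : Extension xS.tgt}
    {fR : Extension xR.tgt} (E : f.Degrafting D.graft fS fR) (n m : ℤ)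
    (h : n + 1 * ((x.comp f).len + 1) = m) :
    B.split M.splitting barSign g m ≫
      (B.pm (xS.comp fS) fS.map).tens (B.pm (xR.comp fR) fR.map) m n
        ((D.comp E).index' (n := n) (m := m) (index_setNew (D.sperm_compNew E).perm h)) =
      (barPairSign (xS.comp fS) (xR.comp fR) * (-1) ^ (xR.new.length * fS.new.length)) •
        B.πm (x.comp f) f.map n m h ≫ (M.θ D.graft).f n := by
  refine (B.split_pm (D.comp E) D.graft (u := f.map) E.compat n m
    (index_setNew (D.sperm_compNew E).perm h)).trans ?_
  obtain ⟨φ, h₁, h₂⟩ := exists_arrow_setNew (x.comp f) (D.sperm_compNew E)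
  have := B.πm_arrow φ f.map f.map (by rw [h₁]; exact Category.comp_id _) (n := n) (m := m) h
    (index_setNew (D.sperm_compNew E).perm h)
  rw [this, h₂, Linear.units_smul_comp, smul_smul]
  exact congrArg (· • _) (by rw [mul_assoc, Int.units_mul_self, mul_one])

theorem barPairSign_comp_left {fS : Extension xS.tgt} {fR : Extension xR.tgt}
    (hS : fS.new.length = 1) (hR : fR.new = []) :
    barPairSign (xS.comp fS) (xR.comp fR) * (-1) ^ (xR.new.length * fS.new.length) =
      barPairSign xS xR := by
  have h₁ : (xS.comp fS).new.length = xS.new.length + 1 := by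
    rw [length_new_comp, hS]
  have h₂ : (xS.comp fS).len = xS.old.length + xS.new.length + 1 := by rw [len_comp, hS]; rfl
  have h₃ : (xR.comp fR).len = xR.old.length + xR.new.length := by rw [len_comp, hR]; rfl
  have h₄ : (xS.comp fS).old.length = xS.old.length := rfl
  have h₅ : (xR.comp fR).old.length = xR.old.length := rfl
  rw [barPairSign, barPairSign, splitSign, splitSign, barSign, barSign, h₁, h₂, h₃, h₄, h₅, hS,
    len, len, ← Int.negOnePow_coe, ← Int.negOnePow_coe, ← Int.negOnePow_coe, ← Int.negOnePow_add,
    ← Int.negOnePow_add, ← Int.negOnePow_add, Int.negOnePow_eq_iff]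
  exact ⟨1 + xR.old.length + xR.new.length, by push_cast; ring⟩

theorem barPairSign_comp_right {fS : Extension xS.tgt} {fR : Extension xR.tgt}
    (hS : fS.new = []) (hR : fR.new.length = 1) :
    barPairSign (xS.comp fS) (xR.comp fR) * (-1) ^ (xR.new.length * fS.new.length) =
      barPairSign xS xR * (-(1 * (xS.len + 1)) : ℤ).negOnePow := by
  have h₁ : (xS.comp fS).new.length = xS.new.length := by
    rw [length_new_comp, hS]; rfl
  have h₂ : (xR.comp fR).len = xR.old.length + xR.new.length + 1 := by rw [len_comp, hR]; rfl
  have h₃ : (xS.comp fS).len = xS.old.length + xS.new.length := by rw [len_comp, hS]; rfl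
  have h₄ : (xS.comp fS).old.length = xS.old.length := rfl
  have h₅ : (xR.comp fR).old.length = xR.old.length := rfl
  rw [barPairSign, barPairSign, splitSign, splitSign, barSign, barSign, h₁, h₂, h₃, h₄, h₅, hS,
      List.length_nil, mul_zero, pow_zero, mul_one,
    len, len, ← Int.negOnePow_coe, ← Int.negOnePow_add,
    ← Int.negOnePow_add, ← Int.negOnePow_add, Int.negOnePow_eq_iff]
  exact ⟨1 + xS.old.length + xS.new.length, by push_cast; ring⟩

theorem split_pSum_tens (D : x.Degrafting g xS xR) (n m : ℤ) (h : n + 1 * (x.len + 1) + 1 = m) :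
    B.split M.splitting barSign g m ≫
      (B.pSum xS (𝟙 _)).tens (B.pm xR (𝟙 _)) m n (by rw [← h, D.len_eq]; push_cast; ring) =
      sum₁ fun f hf => barPairSign xS xR •
        (B.πm (x.comp (graftPair D.graft f (ofHom (𝟙 _))))
          (𝟙 _ ≫ (graftPair D.graft f (ofHom (𝟙 _))).map) n m (by
            rw [len_comp, (graftPairD _ _ _).new_length, hf, new_ofHom_id, ← h]
            push_cast [List.length_nil]; ring) ≫ (M.θ D.graft).f n) := by
  refine (map_sum₁ (AddMonoidHom.mk' (fun w => B.split M.splitting barSign g m ≫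
    GradedMap.tens w (B.pm xR (𝟙 _)) m n (by rw [← h, D.len_eq]; push_cast; ring))
    fun w w' => by rw [GradedMap.add_tens, Preadditive.comp_add]) _).trans
    (sum₁_congr fun f hf => ?_)
  have e := B.split_pm_comp D (graftPairD D.graft f (ofHom (𝟙 xR.tgt))) n m (by
    rw [len_comp, (graftPairD _ _ _).new_length, hf, new_ofHom_id, ← h]
    push_cast [List.length_nil]; ring)
  refine Eq.trans ?_ (e.trans (congrArg₂ (fun (s : ℤˣ) w => s • w)
    (barPairSign_comp_left hf (new_ofHom_id _)) ?_))
  · rw [B.pm_comp_of_new_eq_nil xR _ (new_ofHom_id _)]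
    exact congrArg (_ ≫ ·) (GradedMap.cast_tens_cast _ _ _ _ _ _ _)
  · exact congrArg (fun w => B.πm _ w n m _ ≫ _) (Category.id_comp _).symm

theorem split_tens_pSum (D : x.Degrafting g xS xR) (n m : ℤ) (h : n + 1 * (x.len + 1) + 1 = m) :
    B.split M.splitting barSign g m ≫
      (B.pm xS (𝟙 _)).tens (B.pSum xR (𝟙 _)) m n (by rw [← h, D.len_eq]; push_cast; ring) =
      sum₁ fun f hf => (barPairSign xS xR * (-(1 * (xS.len + 1)) : ℤ).negOnePow) •
        (B.πm (x.comp (graftPair D.graft (ofHom (𝟙 _)) f))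
          (𝟙 _ ≫ (graftPair D.graft (ofHom (𝟙 _)) f).map) n m (by
            rw [len_comp, (graftPairD _ _ _).new_length, hf, new_ofHom_id, ← h]
            push_cast [List.length_nil]; ring) ≫ (M.θ D.graft).f n) := by
  refine (map_sum₁ (AddMonoidHom.mk' (fun w => B.split M.splitting barSign g m ≫
    (B.pm xS (𝟙 _)).tens w m n (by rw [← h, D.len_eq]; push_cast; ring))
    fun w w' => by rw [GradedMap.tens_add, Preadditive.comp_add]) _).trans
    (sum₁_congr fun f hf => ?_)
  have e := B.split_pm_comp D (graftPairD D.graft (ofHom (𝟙 xS.tgt)) f) n m (by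
    rw [len_comp, (graftPairD _ _ _).new_length, hf, new_ofHom_id, ← h]
    push_cast [List.length_nil]; ring)
  refine Eq.trans ?_ (e.trans (congrArg₂ (fun (s : ℤˣ) w => s • w)
    (barPairSign_comp_right (new_ofHom_id _) hf) ?_))
  · rw [B.pm_comp_of_new_eq_nil xS _ (new_ofHom_id _)]
    exact congrArg (_ ≫ ·) (GradedMap.cast_tens_cast _ _ _ _ _ _ _)
  · exact congrArg (fun w => B.πm _ w n m _ ≫ _) (Category.id_comp _).symm

end Coinv

namespace Coinv

variable {M : LinearPreoperad k} {X : RTree → ℤ → ModuleCat.{u} k}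
  (B : Coinv M.action 1 X) {S R U : RTree} {a : S.Edge}

theorem _root_.GradedMap.sub_apply {a : ℤ} {K L : Ch k} (u v : GradedMap a K L) (p q : ℤ) (h) :
    (u - v) p q h = u p q h - v p q h := by
  rw [sub_eq_add_neg, sub_eq_add_neg]; rfl

theorem _root_.GradedMap.sub_tens {a b : ℤ} {K L K' L' : Ch k} (u u' : GradedMap a K L)
    (v : GradedMap b K' L') (n m : ℤ) (h) :
    (u - u').tens v n m h = u.tens v n m h - u'.tens v n m h :=
  eq_sub_of_add_eq (by rw [← GradedMap.add_tens, sub_add_cancel])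

theorem _root_.GradedMap.tens_sub {a b : ℤ} {K L K' L' : Ch k} (u : GradedMap a K L)
    (v v' : GradedMap b K' L') (n m : ℤ) (h) :
    u.tens (v - v') n m h = u.tens v n m h - u.tens v' n m h :=
  eq_sub_of_add_eq (by rw [← GradedMap.tens_add, sub_add_cancel])

theorem preD_pm {W : RTree} (x : Extension S) (u : W ⟶ x.tgt) :
    (B.barCoinv.pm x u).preD = (x.len : ℤ).negOnePow •
      (B.barCoinv.pSum x u - (B.barCoinv.pm x u).postD) :=
  GradedMap.hom_ext fun p q h => by
    rw [GradedMap.units_smul_apply, GradedMap.sub_apply,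
      B.barCoinv.pSum_apply x u q p h (by lia),
      (B.barCoinv.pm x u).postD_apply h (r := q + 1) (by lia)]
    exact B.barD_πm x u q (q + 1) p (p - 1) (by lia) (by lia) rfl

/-- The structure maps of the bar construction. -/
noncomputable def barΔf (g : RTree.Grafting S a R U) (m : ℤ) :
    (B.barFunctor.obj U).X m ⟶ (B.barFunctor.obj S ⊗ B.barFunctor.obj R).X m :=
  B.barCoinv.split M.splitting barSign g m

theorem _root_.split_d_combine {A : Type*} [AddCommGroup A] {b lS lR lx a s : ℤˣ}
    {G G' P P' Q : A} (h : P + a • P' = s • Q) (h₁ : b * lS = lx) (h₂ : lR = lx * a) :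
    b • lS • (s • G - P) + lR • ((s * a) • G' - P') = s • lx • ((G + G') - Q) := by
  have e : P = s • Q - a • P' := eq_sub_of_add_eq h
  have ha := Int.units_mul_self a
  rw [smul_smul, h₁, h₂, e]
  simp only [smul_sub, smul_add, smul_smul]
  rw [show lx * a * (s * a) = lx * s * (a * a) by ac_rfl, ha, mul_one, mul_comm s lx]
  abel

theorem _root_.smul_sum₁_comp {T : RTree} {A B D : ModuleCat.{u} k} (s : ℤˣ)
    (G : ∀ f : Extension T, f.new.length = 1 → (A ⟶ B)) (v : B ⟶ D) :
    sum₁ (fun f h => s • (G f h ≫ v)) = s • (sum₁ G ≫ v) := by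
  refine (map_sum₁ (DistribSMul.toAddMonoidHom _ s) _).symm.trans ?_
  exact congrArg (s • ·) (map_sum₁ (Preadditive.rightComp A v) _).symm

theorem barΔf_d (g : RTree.Grafting S a R U) (m m' : ℤ) (hm : m' + 1 = m) :
    B.barΔf g m ≫ (B.barFunctor.obj S ⊗ B.barFunctor.obj R).d m m' =
      (B.barFunctor.obj U).d m m' ≫ B.barΔf g m' := by
  refine B.barCoinv.tens_ext_p fun xS xR n hn => ?_
  let x := graftPair g xS xR
  let D : x.Degrafting g xS xR := graftPairD g xS xR
  have hx : n + 1 * (x.len + 1) = m' := by rw [D.len_eq]; push_cast; lia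
  have hb : n + 1 + 1 * (x.len + 1) = m := by lia
  have e₁ := B.barCoinv.split_pm D D.graft D.graft.compatible_id (n + 1) m hb
  have e₂ := B.barCoinv.split_pSum_tens D n m (by lia)
  have e₃ := B.barCoinv.split_tens_pSum D n m (by lia)
  rw [smul_sum₁_comp] at e₂ e₃
  have e₄ := GradedMap.tens_d (B.barCoinv.pm xS (𝟙 _)) (B.barCoinv.pm xR (𝟙 _)) m (n + 1) n
    (D.index' hb) rfl
  have e₅ := congrArg (B.barΔf g m ≫ ·) e₄
  rw [Preadditive.comp_add, Linear.comp_units_smul, ← Category.assoc] at e₅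
  have e₆ := (congrArg (· ≫ _) e₁).symm.trans e₅
  rw [Linear.units_smul_comp, Category.assoc] at e₆
  refine (Category.assoc _ _ _).trans (Eq.trans ?_ (Category.assoc _ _ _).symm)
  rw [← pm_id, ← pm_id, GradedMap.d_tens _ _ m m' n hn hm, preD_pm, preD_pm,
    GradedMap.units_smul_tens, GradedMap.tens_units_smul, GradedMap.sub_tens, GradedMap.tens_sub,
    Preadditive.comp_add, Linear.comp_units_smul, Linear.comp_units_smul, Linear.comp_units_smul,
    Preadditive.comp_sub, Preadditive.comp_sub]
  refine (congrArg₂ (fun u v => _ • _ • (u - _) + _ • (v - _)) e₂ e₃).trans ?_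
  refine (split_d_combine (lx := (x.len : ℤ).negOnePow) e₆.symm ?_ ?_).trans ?_
  · rw [D.len_eq, ← Int.negOnePow_add, Int.negOnePow_eq_iff]
    exact ⟨-(xR.len + 1), by push_cast; ring⟩
  · rw [D.len_eq, ← Int.negOnePow_add, Int.negOnePow_eq_iff]
    exact ⟨0, by push_cast; ring⟩
  have e₇ := B.barCoinv.split_pm D D.graft D.graft.compatible_id n m' hx
  refine Eq.trans ?_ (congrArg (_ ≫ ·) e₇).symm
  rw [Linear.comp_units_smul, ← Category.assoc]
  refine congrArg (_ • ·) (Eq.trans ?_ (congrArg (· ≫ _) (B.barD_πm x (𝟙 _) n (n + 1)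
      m m' hm hx rfl)).symm)
  rw [Linear.units_smul_comp]
  refine congrArg (_ • ·) ?_
  refine Eq.trans ?_ (Preadditive.sub_comp _ _ _).symm
  refine congrArg₂ (· - ·) ((Preadditive.add_comp _ _ _ _ _ _).symm.trans (congrArg (· ≫ _)
    (sum₁_graft D.graft (B.invariant_πm x (𝟙 _) n m (by lia))).symm)) ?_
  exact (congrArg (_ ≫ ·) ((M.θ D.graft).comm (n + 1) n)).trans (Category.assoc _ _ _).symm

/-- The structure maps of the bar construction. -/
noncomputable def barΔ (g : RTree.Grafting S a R U) :
    B.barFunctor.obj U ⟶ B.barFunctor.obj S ⊗ B.barFunctor.obj R where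
  f := B.barΔf g
  comm' m m' hm := B.barΔf_d g m m' hm

end Coinv

end BarSplitting

open Extension

namespace Extension

theorem Degrafting.topSign_eq {S R U : RTree} {a : S.Edge} {g : RTree.Grafting S a R U}
    {x : Extension U} {xS : Extension S} {xR : Extension R} (D : x.Degrafting g xS xR)
    {y : Extension x.tgt} {yS : Extension xS.tgt} {yR : Extension xR.tgt}
    (E : y.Degrafting D.graft yS yR) :
    topSign x y = (-1) ^ (xR.old.length * xS.new.length) * (topSign xS yS * topSign xR yR) := by
  refine Extension.topSign_eq (D.sperm_topOld.trans ?_)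
  rw [E.old_eq]
  exact (((sperm_topSign xS yS).map _).append ((sperm_topSign xR yR).map _)).cons _

end Extension

section BarPrecooperad

variable {k : Type u} [CommRing k]

namespace Coinv

variable {M : LinearPreoperad k} {X : RTree → ℤ → ModuleCat.{u} k} (B : Coinv M.action 1 X)
  {S R U : RTree} {a : S.Edge}

theorem pre_barMap_pm (E : Extension S) (y : Extension E.tgt) :
    GradedMap.pre (B.barFunctor.map E.map) (B.barCoinv.pm y (𝟙 _)) =
      topSign E y • (B.barCoinv.pm (W := y.tgt) (E.comp y) (𝟙 y.tgt)).cast (by rw [len_comp_of_top])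
          :=
  GradedMap.hom_ext fun p q h => by
    rw [GradedMap.units_smul_apply]
    exact B.barMap_πm E y (𝟙 _) (by lia)

variable {xS : Extension S} {xR : Extension R} {x : Extension U} {g : RTree.Grafting S a R U}

theorem barPairSign_top (D : x.Degrafting g xS xR) {y : Extension x.tgt} {yS : Extension xS.tgt}
    {yR : Extension xR.tgt} (E : y.Degrafting D.graft yS yR) :
    barPairSign yS yR * topSign x y = topSign xS yS * topSign xR yR *
      (barPairSign (xS.comp yS) (xR.comp yR) * (-1) ^ (xR.new.length * yS.new.length)) := by
  have h : barPairSign yS yR * (-1) ^ (xR.old.length * xS.new.length) =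
      barPairSign (xS.comp yS) (xR.comp yR) * (-1) ^ (xR.new.length * yS.new.length) := by
    have h₁ : (xS.comp yS).old.length = xS.old.length := rfl
    have h₂ : (xR.comp yR).old.length = xR.old.length := rfl
    rw [barPairSign, barPairSign, splitSign, splitSign, barSign, barSign, len_comp_of_top,
      len_comp_of_top, h₁, h₂, length_new_comp, length_top, length_top, len, len,
      ← Int.negOnePow_coe, ← Int.negOnePow_coe, ← Int.negOnePow_coe, ← Int.negOnePow_coe,
      ← Int.negOnePow_add, ← Int.negOnePow_add, ← Int.negOnePow_add, ← Int.negOnePow_add]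
    congr 1
    push_cast
    ring
  rw [D.topSign_eq E, ← mul_assoc, h, mul_comm]

theorem barMap_barΔf (D : x.Degrafting g xS xR) (m : ℤ) :
    (B.barFunctor.map x.map).f m ≫ B.barΔf D.graft m =
      B.barΔf g m ≫ (B.barFunctor.map xS.map ⊗ₘ B.barFunctor.map xR.map).f m := by
  refine B.barCoinv.tens_ext_p fun yS yR n hn => ?_
  let y := graftPair D.graft yS yR
  let E : y.Degrafting D.graft yS yR := graftPairD D.graft yS yR
  have hy : n + 1 * (y.len + 1) = m := by rw [E.len_eq]; push_cast; lia
  have hy' : n + 1 * ((x.comp y).len + 1) = m := by rw [len_comp_of_top, hy]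
  have e₁ := B.barCoinv.split_pm E E.graft E.graft.compatible_id n m hy
  have e₂ := B.barCoinv.split_pm (D.comp E) E.graft E.graft.compatible_id n m
    (index_setNew (D.sperm_compNew E).perm hy')
  obtain ⟨φ, h₁, h₂⟩ := exists_arrow_setNew (x.comp y) (D.sperm_compNew E)
  have e₃ : B.barCoinv.πm (W := y.tgt) (x.comp y) (𝟙 y.tgt) n m hy' =
      ((-1) ^ (xR.new.length * yS.new.length) : ℤˣ) • B.barCoinv.πm (W := y.tgt)
        ((x.comp y).setNew (D.compNew E) (D.sperm_compNew E).perm) (𝟙 y.tgt) n m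
          (index_setNew (D.sperm_compNew E).perm hy') :=
    (B.barCoinv.πm_arrow φ (𝟙 _) (𝟙 _) (by rw [h₁]; exact Category.comp_id _) _ _).trans
      (congrArg (· • _) h₂)
  have e₄ : (B.barFunctor.map x.map).f m ≫ B.barCoinv.πm y (𝟙 y.tgt) n m hy =
      topSign x y • B.barCoinv.πm (W := y.tgt) (x.comp y) (𝟙 y.tgt) n m hy' :=
    B.barMap_πm x y (𝟙 _) hy
  rw [← pm_id, ← pm_id]
  refine (Category.assoc _ _ _).trans (Eq.trans ?_ (Category.assoc _ _ _).symm)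
  have e₅ : (GradedMap.pre (B.barFunctor.map xS.map) (B.barCoinv.pm yS (𝟙 _))).tens
      (GradedMap.pre (B.barFunctor.map xR.map) (B.barCoinv.pm yR (𝟙 _))) m n hn =
      (topSign xS yS * topSign xR yR) • (B.barCoinv.pm (W := yS.tgt) (xS.comp yS) (𝟙 yS.tgt)).tens
        (B.barCoinv.pm (W := yR.tgt) (xR.comp yR) (𝟙 yR.tgt)) m n
        (by rw [len_comp_of_top, len_comp_of_top, hn]) := by
    rw [pre_barMap_pm, pre_barMap_pm, GradedMap.units_smul_tens, GradedMap.tens_units_smul,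
      smul_smul, GradedMap.cast_tens_cast]
  rw [GradedMap.pre_tens, e₅, Linear.comp_units_smul]
  refine (congrArg (_ ≫ ·) e₁).trans (Eq.trans ?_ (congrArg (_ • ·) e₂).symm)
  rw [Linear.comp_units_smul]
  refine (congrArg (_ • ·) ((Category.assoc _ _ _).symm.trans
    (congrArg (· ≫ _) (e₄.trans (congrArg (_ • ·) e₃))))).trans ?_
  rw [smul_smul, Linear.units_smul_comp, smul_smul, smul_smul]
  refine congrArg (· • _) ?_
  rw [← mul_assoc, barPairSign_top D E, ← mul_assoc, mul_assoc (_ * _ * _), Int.units_mul_self,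
    mul_one]

/-- The bar construction of a preoperad. -/
noncomputable def barPrecooperad : LinearPrecooperad k where
  cop := B.barFunctor
  Δ := B.barΔ
  naturality {S S' R R' T T' a a'} g g' β γ δ h := by
    obtain rfl := h.map_leaf
    ext1 m
    exact B.barMap_barΔf (degraftingOfGraft (xS := ofHom β) (xR := ofHom γ) g g' δ h) m
  assoc_seq := B.barCoinv.assoc_seq M.splitting barSign M.splitting_isAssoc seqRule_barSign B.barΔ
    fun _ _ => rfl
  assoc_par := B.barCoinv.assoc_par M.splitting barSign M.splitting_isAssoc odd_one parRule_barSign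
    B.barΔ fun _ _ => rfl

theorem _root_.Extension.new_length_of_iso {S : RTree} {x y : Extension S} {f : Extension y.tgt}
    (hf : f.new.length = 1) (θ : x.tgt ≅ f.tgt) (h : x.map ≫ θ.hom = y.map ≫ f.map) :
    x.new.length = y.new.length + 1 := by
  obtain ⟨φ⟩ := nonempty_arrow_iff_iso (x := x) (y := y.comp f) |>.2 ⟨θ, h⟩
  rw [φ.new_length, length_new_comp, hf]

theorem isTriangular_bar : B.barCoinv.IsTriangular (-1) where
  diag x p q r t h hq h' := by
    obtain rfl : p = t + 1 := by lia
    refine (congrArg (B.ι x (t + 1) q h ≫ ·) (B.barD_π x t q r hq h')).trans ?_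
    rw [Linear.comp_units_smul, Preadditive.comp_sub, B.ι_πSum_zero _ fun f θ hf hθ => ?_,
      ← Category.assoc, B.ι_π_self, Category.id_comp, zero_sub, smul_neg, one_mul,
      Int.negOnePow_succ, Units.neg_smul]
    have := new_length_of_iso hf θ hθ
    lia
  entry x y hxy hw p q r t h hq h' := by
    refine (congrArg (B.ι x p q h ≫ ·) (B.barD_π y t q r hq h')).trans ?_
    rw [Linear.comp_units_smul, Preadditive.comp_sub, B.ι_πSum_zero _ fun f θ hf hθ => ?_,
      ← Category.assoc, B.ι_π_zero hxy, Limits.zero_comp, sub_zero, smul_zero]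
    have := new_length_of_iso hf θ hθ
    lia

theorem quasiIso_barΔ (hM : M.IsInftyOperad) (g : RTree.Grafting S a R U) :
    QuasiIso (B.barΔ g) :=
  B.isTriangular_bar.quasiIso (t := M.splitting) (c := barSign) hM g (B.barΔ g) fun _ => rfl

end Coinv

end BarPrecooperad

open Extension

section BarHom

variable {k : Type u} [CommRing k]

theorem tensorIncl_desc {K L : Ch k} {m : ℤ} {Z : ModuleCat.{u} k}
    (f : ∀ p q, p + q = m → (K.X p ⊗ L.X q ⟶ Z)) {p q : ℤ} (h : p + q = m) :
    tensorIncl K L p q m h ≫ (HomologicalComplex.mapBifunctorDesc f : (K ⊗ L).X m ⟶ Z) =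
      f p q h := by
  change HomologicalComplex.ιTensorObj K L p q m h ≫ HomologicalComplex.mapBifunctorDesc f = _
  rw [HomologicalComplex.ι_mapBifunctorDesc]

namespace Coinv

variable {M N P : LinearPreoperad k} {X X' X'' : RTree → ℤ → ModuleCat.{u} k}
  (C : Coinv M.action 1 X) (C' : Coinv N.action 1 X') (C'' : Coinv P.action 1 X'') (f : M ⟶ N)
  (f' : N ⟶ P) {S S' R U W : RTree} {a : S.Edge} {n m m' : ℤ}

theorem _root_.LinearPreoperad.Hom.naturality_f {T T' : RTree} (β : T ⟶ T') (n : ℤ) :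
    (M.pre.map β.op).f n ≫ (f.nat.app (op T)).f n =
      (f.nat.app (op T')).f n ≫ (N.pre.map β.op).f n := by
  rw [← HomologicalComplex.comp_f, f.nat.naturality, HomologicalComplex.comp_f]

/-- The map of bar constructions induced by a morphism of preoperads. -/
noncomputable def barHomf (S : RTree) (m : ℤ) : X S m ⟶ X' S m :=
  C'.lift fun x n h => C.π x n m h ≫ (f.nat.app (op x.tgt)).f n

theorem barHomf_π (x : Extension S) (h : n + 1 * (x.len + 1) = m) :
    C.barHomf C' f S m ≫ C'.π x n m h = C.π x n m h ≫ (f.nat.app (op x.tgt)).f n := by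
  refine C'.lift_π _ (fun x y φ n hx hy => ?_) x n h
  have e := C.π_arrow φ n m hx hy
  change _ ≫ (M.pre.map φ.θ.inv.op).f n = _ at e
  change _ ≫ (N.pre.map φ.θ.inv.op).f n = _
  rw [Category.assoc, ← LinearPreoperad.Hom.naturality_f, ← Category.assoc, e,
    Linear.units_smul_comp]

theorem barHomf_πm (x : Extension S) (g : W ⟶ x.tgt) (h : n + 1 * (x.len + 1) = m) :
    C.barHomf C' f S m ≫ C'.πm x g n m h = C.πm x g n m h ≫ (f.nat.app (op W)).f n := by
  rw [πm, ← Category.assoc, barHomf_π, Category.assoc, ← LinearPreoperad.Hom.naturality_f,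
    ← Category.assoc, πm]

theorem barHomf_πSum (x : Extension S) (g : W ⟶ x.tgt) (h : n + 1 * (x.len + 1) + 1 = m) :
    C.barHomf C' f S m ≫ C'.πSum x g n m h = C.πSum x g n m h ≫ (f.nat.app (op W)).f n := by
  refine (map_sum₁ (Preadditive.leftComp _ (C.barHomf C' f S m)) _).trans
    (Eq.trans (sum₁_congr fun z hz => ?_)
      (map_sum₁ (Preadditive.rightComp _ ((f.nat.app (op W)).f n)) _).symm)
  exact C.barHomf_πm C' f (x.comp z) (g ≫ z.map) _

theorem barHomf_barD (S : RTree) (hm : m' + 1 = m) :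
    C.barHomf C' f S m ≫ C'.barD S m m' = C.barD S m m' ≫ C.barHomf C' f S m' := by
  refine C'.ext_π fun x n h => ?_
  rw [Category.assoc, C'.barD_π x n m m' hm h, Linear.comp_units_smul, Preadditive.comp_sub,
    barHomf_πSum, ← Category.assoc (C.barHomf C' f S m), barHomf_π, Category.assoc, Category.assoc,
    barHomf_π, ← Category.assoc (C.barD S m m'), C.barD_π x n m m' hm h, Linear.units_smul_comp,
    Preadditive.sub_comp, Category.assoc, HomologicalComplex.Hom.comm]

theorem barHomf_barMap (γ : S ⟶ S') (m : ℤ) :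
    C.barHomf C' f S m ≫ C'.barMap γ m = C.barMap γ m ≫ C.barHomf C' f S' m := by
  refine C'.ext_π fun x n h => ?_
  rw [Category.assoc, Category.assoc, barHomf_π, ← Category.assoc (C.barMap γ m), C'.barMap_π,
    C.barMap_π]
  exact (Linear.comp_units_smul _ _ _).trans ((congrArg (_ • ·)
    (C.barHomf_π C' f ((ofHom γ).comp x) _)).trans (Linear.units_smul_comp _ _ _).symm)

theorem ι_barHomf (x : Extension S) (h : n + 1 * (x.len + 1) = m) :
    C.ι x n m h ≫ C.barHomf C' f S m = (f.nat.app (op x.tgt)).f n ≫ C'.ι x n m h := by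
  refine C'.ext_π fun y n' hy => ?_
  rw [Category.assoc, Category.assoc, barHomf_π, ← Category.assoc]
  by_cases hxy : Nonempty (Arrow x y)
  · obtain ⟨φ⟩ := hxy
    obtain rfl := φ.index_eq h hy
    rw [C.ι_π φ, C'.ι_π φ, Linear.units_smul_comp, Linear.comp_units_smul]
    exact congrArg (_ • ·) (LinearPreoperad.Hom.naturality_f f _ _)
  · rw [C.ι_π_zero hxy, C'.ι_π_zero hxy, Limits.zero_comp, Limits.comp_zero]

/-- The map of complexes induced by a morphism of preoperads. -/
noncomputable def barHomNat : C.barFunctor ⟶ C'.barFunctor where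
  app S :=
    { f := C.barHomf C' f S
      comm' := fun _ _ h => C.barHomf_barD C' f S h }
  naturality _ _ γ := HomologicalComplex.hom_ext _ _ fun m => (C.barHomf_barMap C' f γ m).symm

theorem pre_barHomf_p (x : Extension S) :
    GradedMap.pre ((C.barHomNat C' f).app S) (C'.barCoinv.p x) =
      (C.barCoinv.p x).post (f.nat.app (op x.tgt)) :=
  GradedMap.hom_ext fun _ _ _ => C.barHomf_π C' f x _

theorem barΔ_barHomf (g : RTree.Grafting S a R U) (m : ℤ) :
    C.barΔf g m ≫ ((C.barHomNat C' f).app S ⊗ₘ (C.barHomNat C' f).app R).f m =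
      ((C.barHomNat C' f).app U).f m ≫ C'.barΔf g m := by
  refine C'.barCoinv.tens_ext_p fun xS xR n hn => ?_
  let x := graftPair g xS xR
  let D : x.Degrafting g xS xR := graftPairD g xS xR
  have hx : n + 1 * (x.len + 1) = m := by rw [D.len_eq]; push_cast; lia
  refine (Category.assoc _ _ _).trans (Eq.trans ?_ (Category.assoc _ _ _).symm)
  rw [GradedMap.pre_tens, pre_barHomf_p, pre_barHomf_p, ← GradedMap.tens_post]
  refine (Category.assoc _ _ _).symm.trans ((congrArg (· ≫ _)
    (C.barCoinv.split_π M.splitting barSign D n m hx)).trans (Eq.trans ?_ (congrArg (_ ≫ ·)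
    (C'.barCoinv.split_π N.splitting barSign D n m hx)).symm))
  rw [Linear.units_smul_comp, Linear.comp_units_smul]
  refine congrArg (_ • ·) ?_
  have e : C.barHomf C' f U m ≫ C'.π x n m hx = _ := C.barHomf_π C' f x hx
  refine (Category.assoc _ _ _).trans (Eq.trans ?_ ((congrArg (· ≫ _) e).symm.trans
    (Category.assoc _ _ _)))
  rw [Category.assoc, ← HomologicalComplex.comp_f]
  exact congrArg (fun u => _ ≫ HomologicalComplex.Hom.f u n) (f.comm D.graft)

/-- The map of bar constructions induced by a morphism of preoperads. -/
noncomputable def barHom : C.barPrecooperad ⟶ C'.barPrecooperad where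
  nat := C.barHomNat C' f
  comm g := HomologicalComplex.hom_ext _ _ fun m => C.barΔ_barHomf C' f g m

theorem barHomf_id (S : RTree) (m : ℤ) : C.barHomf C (𝟙 M) S m = 𝟙 _ :=
  C.ext_π fun x n h => by
    rw [barHomf_π, Category.id_comp]
    exact Category.comp_id _

theorem barHomf_comp (S : RTree) (m : ℤ) :
    C.barHomf C'' (f ≫ f') S m = C.barHomf C' f S m ≫ C'.barHomf C'' f' S m :=
  C''.ext_π fun x n h => by
    rw [barHomf_π, Category.assoc, barHomf_π, ← Category.assoc, barHomf_π, Category.assoc]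
    rfl

theorem barHom_id : C.barHom C (𝟙 M) = 𝟙 _ :=
  LinearPrecooperad.Hom.ext (NatTrans.ext (funext fun S =>
    HomologicalComplex.hom_ext _ _ fun m => C.barHomf_id S m))

theorem barHom_comp : C.barHom C'' (f ≫ f') = C.barHom C' f ≫ C'.barHom C'' f' :=
  LinearPrecooperad.Hom.ext (NatTrans.ext (funext fun S =>
    HomologicalComplex.hom_ext _ _ fun m => C.barHomf_comp C' C'' f f' S m))

end Coinv

/-- The coinvariants that define the bar construction. -/
noncomputable def LinearPreoperad.barC (M : LinearPreoperad k) : Coinv M.action 1 (barX M.pre) :=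
  M.exists_barCoinv.choose

theorem LinearPreoperad.barC_ι (M : LinearPreoperad k) {S : RTree} (x : Extension S) (n m : ℤ) (h) :
    M.barC.ι x n m h = barι M.pre x n m (by lia) := M.exists_barCoinv.choose_spec x n m h

variable (k) in
/-- The bar construction, from `∞`-operads to `∞`-cooperads. -/
noncomputable def barInfty : LinearInftyOperad k ⥤ LinearInftyCooperad k where
  obj M := ⟨M.obj.barC.barPrecooperad, M.obj.barC.quasiIso_barΔ M.property⟩
  map f := ⟨Coinv.barHom _ _ f.hom⟩
  map_id M := by
    ext1
    exact M.obj.barC.barHom_id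
  map_comp f f' := by
    ext1
    exact Coinv.barHom_comp _ _ _ _ _

/-- The identification of the bar construction with the coinvariants. -/
noncomputable def LinearPreoperad.barIso (M : LinearPreoperad k) :
    BarIso M M.barC.barPrecooperad := fun S m => Iso.refl (barX M.pre S m)

theorem LinearPreoperad.barIso_ι (M : LinearPreoperad k) {S : RTree} (x : Extension S) (n m : ℤ)
    (h) : M.barIso.ι x n m h = M.barC.ι x n m (by lia) := by
  rw [barC_ι]
  exact Category.comp_id _

theorem Extension.enumerates_of_append {S S' : RTree} (γ : S ⟶ S') {d : List S.Edge}
    {e : List S'.Edge} (h : Enumerates d {c | S.IsInner c})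
    (h' : Enumerates (d.map γ ++ e) {c | S'.IsInner c}) :
    Enumerates e {c | S'.IsInner c ∧ c ∉ Set.range γ} := by
  obtain ⟨-, h₁, h₂⟩ := List.nodup_append'.1 h'.1
  refine ⟨h₁, fun c => ⟨fun hc => ⟨(h'.2 c).1 (List.mem_append_right _ hc), ?_⟩, fun hc => ?_⟩⟩
  · rintro ⟨s, rfl⟩
    refine h₂ (List.mem_map_of_mem ((h.2 s).2 ?_)) hc
    exact (RTree.isInner_map_iff γ s).1 ((h'.2 _).1 (List.mem_append_right _ hc))
  · rcases List.mem_append.1 ((h'.2 c).2 hc.1) with h₃ | h₃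
    · obtain ⟨s, -, rfl⟩ := List.mem_map.1 h₃
      exact (hc.2 ⟨s, rfl⟩).elim
    · exact h₃

theorem LinearPreoperad.isBar_barIso (M : LinearPreoperad k) : M.barIso.IsBar where
  d_eq x n m h := by
    have e := M.barC.ι_barD x n (n - 1) m (m - 1) (by lia) (by lia) (by lia)
    simp only [barIso_ι]
    exact e
  map_eq_zero γ x n m h hx := by
    rw [barIso_ι]
    exact M.barC.ι_barMap_zero γ x _ hx
  map_eq {S S' T} γ β d e' e'' h₁ h₂ h₃ h₄ n m h h' := by
    let E : Extension S := ⟨S', γ, d, e', h₁, enumerates_of_append γ h₁ h₃⟩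
    let z : Extension S' := ⟨T, β, d.map γ ++ e', e'', h₃, h₄⟩
    have e := M.barC.ι_barMap E z (n := n) (m := m) (by lia)
    rw [topSign_eq (E := E) (y := z) (SPerm.refl _), one_smul] at e
    rw [barIso_ι, barIso_ι]
    exact e
  comul_eq {S a R U} g x xS xR D n m h := by
    have e := M.barC.barCoinv.ι_split M.splitting barSign D n m (by lia)
    simp only [barIso_ι]
    refine e.trans ?_
    rw [← Linear.comp_units_smul]
    refine congrArg (_ ≫ ·) (tensor_hom_ext fun p q hpq => ?_)
    rw [Linear.comp_units_smul, GradedMap.tensorIncl_tens _ _ hpq (p' := xS.len + (p + 1))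
      (q' := xR.len + (q + 1)) (by lia) (by lia)]
    refine Eq.trans ?_ (tensorIncl_desc _ hpq).symm
    refine (smul_smul _ _ _).trans (congrArg (· • _) ?_)
    rw [Coinv.splitSign, barSign, ← Int.negOnePow_coe, ← Int.negOnePow_add, Int.negOnePow_eq_iff]
    exact ⟨-(xR.old.length + xR.new.length), by rw [len]; push_cast; ring⟩

end BarHom

open Extension

/-! ## The cobar construction -/

section CobarConstruction

variable {k : Type u} [CommRing k]

/-- The action of isomorphisms of trees on a functor. -/
abbrev LinearPrecooperad.action (Y : LinearPrecooperad k) : IsoAction k where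
  obj T := Y.cop.obj T
  map θ := Y.cop.map θ.hom
  map_refl _ := Y.cop.map_id _
  map_trans _ _ := Y.cop.map_comp _ _

variable {Y : LinearPrecooperad k} {X : RTree → ℤ → ModuleCat.{u} k} (C : Coinv Y.action (-1) X)

theorem sum₁_sub {A : Type*} [AddCommGroup A] {T : RTree}
    (G G' : ∀ f : Extension T, f.new.length = 1 → A) :
    sum₁ (fun f h => G f h - G' f h) = sum₁ G - sum₁ G' := Finset.sum_sub_distrib _ _

theorem smul_sum₁ {A : Type*} [AddCommGroup A] {T : RTree} (s : ℤˣ)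
    (G : ∀ f : Extension T, f.new.length = 1 → A) :
    s • sum₁ G = sum₁ fun f h => s • G f h := map_sum₁ (DistribSMul.toAddMonoidHom _ s) _

namespace Coinv

/-- A morphism, followed by the inclusion at `x`. -/
def ιm {S : RTree} (x : Extension S) {W : RTree} (g : W ⟶ x.tgt) (n m : ℤ)
    (h : n + -1 * (x.len + 1) = m) : (Y.cop.obj W).X n ⟶ X S m :=
  (Y.cop.map g).f n ≫ C.ι x n m h

variable {S S' S'' : RTree} {x y : Extension S} {W W' : RTree} {n n' m m' : ℤ}

theorem map_ιm (g : W ⟶ x.tgt) (g' : W' ⟶ W) (h : n + -1 * (x.len + 1) = m) :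
    (Y.cop.map g').f n ≫ C.ιm x g n m h = C.ιm x (g' ≫ g) n m h := by
  rw [ιm, ιm, ← Category.assoc, Y.cop.map_comp, HomologicalComplex.comp_f]

theorem ιm_arrow (φ : Arrow x y) (g : W ⟶ x.tgt) (g' : W ⟶ y.tgt) (hg : g ≫ φ.θ.hom = g')
    (h : n + -1 * (x.len + 1) = m) (h' : n + -1 * (y.len + 1) = m) :
    C.ιm x g n m h = φ.sign • C.ιm y g' n m h' := by
  rw [ιm, C.ι_arrow φ n m h h', Linear.comp_units_smul, ← hg, ← map_ιm]
  rfl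

theorem ι_eq_ιm (h : n + -1 * (x.len + 1) = m) : C.ι x n m h = C.ιm x (𝟙 x.tgt) n m h := by
  rw [ιm, Y.cop.map_id]
  exact (Category.id_comp _).symm

/-- The sum in the differential of the cobar construction. -/
noncomputable def ιSum (x : Extension S) (g : W ⟶ x.tgt) (n m : ℤ)
    (h : n + -1 * (x.len + 1) = m + 1) : (Y.cop.obj W).X n ⟶ X S m :=
  sum₁ fun (f : Extension x.tgt) hf => C.ιm (x.comp f) (g ≫ f.map) n m
    (by rw [len_comp, hf]; push_cast; lia)

theorem map_ιSum (g : W ⟶ x.tgt) (g' : W' ⟶ W) (h : n + -1 * (x.len + 1) = m + 1) :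
    (Y.cop.map g').f n ≫ C.ιSum x g n m h = C.ιSum x (g' ≫ g) n m h := by
  refine (map_sum₁ (Preadditive.leftComp (X S m) ((Y.cop.map g').f n)) _).trans
    (sum₁_congr fun f hf => ?_)
  exact C.map_ιm (x := x.comp f) _ _ _

theorem invariant_ιm (x : Extension S) (g : W ⟶ x.tgt) (n m : ℤ)
    (h : n + -1 * (x.len + 1) = m + 1) : Invariant₁ fun (f : Extension x.tgt) hf =>
    C.ιm (x.comp f) (g ≫ f.map) n m (by rw [len_comp, hf]; push_cast; lia) := by
  rintro f f' hf hf' ⟨φ⟩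
  obtain ⟨ψ, h₁, h₂⟩ := exists_arrow_comp x φ
  refine (C.ιm_arrow ψ _ (g ≫ f'.map) ?_ _ _).trans
    (by rw [h₂, sign_τ_of_new_length φ hf, one_smul])
  rw [h₁]
  exact (Category.assoc _ _ _).trans (congrArg _ φ.map_eq)

theorem ιSum_arrow (φ : Arrow x y) (g : W ⟶ x.tgt) (g' : W ⟶ y.tgt) (hg : g ≫ φ.θ.hom = g')
    (h : n + -1 * (x.len + 1) = m + 1) (h' : n + -1 * (y.len + 1) = m + 1) :
    C.ιSum x g n m h = φ.sign • C.ιSum y g' n m h' := by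
  refine (sum₁_precompIso (C.invariant_ιm x g n m h) φ.θ).trans ?_
  refine Eq.trans (sum₁_congr fun f hf => ?_)
    (map_sum₁ (DistribSMul.toAddMonoidHom _ φ.sign) _).symm
  obtain ⟨ψ, h₁, h₂⟩ := exists_arrow_comp_precompIso φ f
  refine (C.ιm_arrow ψ _ (g' ≫ f.map) ?_ _ _).trans (congrArg (· • _) h₂)
  rw [h₁, ← hg]
  exact (Category.comp_id _).trans (Category.assoc _ _ _).symm

/-- The differential of the cobar construction. -/
noncomputable def cobarD (S : RTree) (m m' : ℤ) : X S m ⟶ X S m' :=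
  if h : m' + 1 = m then C.desc fun x n hn => C.ιSum x (𝟙 _) n m' (by lia) -
    (x.len : ℤ).negOnePow • (Y.cop.obj x.tgt).d n (n - 1) ≫ C.ι x (n - 1) m' (by lia)
  else 0

theorem ι_cobarD (x : Extension S) (n n' m m' : ℤ) (h : m' + 1 = m) (hn' : n' + 1 = n)
    (hn : n + -1 * (x.len + 1) = m) :
    C.ι x n m hn ≫ C.cobarD S m m' = C.ιSum x (𝟙 _) n m' (by lia) -
      (x.len : ℤ).negOnePow • (Y.cop.obj x.tgt).d n n' ≫ C.ι x n' m' (by lia) := by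
  obtain rfl : n' = n - 1 := by lia
  rw [cobarD, dif_pos h]
  refine C.ι_desc _ (fun x y φ n hx hy => ?_) x n hn
  have e₁ := C.map_ιSum (𝟙 _) φ.θ.hom (show n + -1 * (y.len + 1) = m' + 1 by lia)
  have e₂ := C.ιSum_arrow φ (𝟙 _) (φ.θ.hom ≫ 𝟙 _) (by rw [Category.comp_id, Category.id_comp])
    (show n + -1 * (x.len + 1) = m' + 1 by lia) (by lia)
  have e₃ := C.ι_arrow φ (n - 1) m' (by lia) (by lia)
  rw [Preadditive.comp_sub, e₁, e₂, smul_sub, e₃, Linear.comp_units_smul, Linear.comp_units_smul,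
    φ.len_eq, smul_comm φ.sign, ← Category.assoc, ← Category.assoc,
    ← HomologicalComplex.Hom.comm]

theorem ιm_cobarD (x : Extension S) (g : W ⟶ x.tgt) (n n' m m' : ℤ) (h : m' + 1 = m)
    (hn : n + -1 * (x.len + 1) = m) (hn' : n' + 1 = n) :
    C.ιm x g n m hn ≫ C.cobarD S m m' = C.ιSum x g n m' (by lia) -
      (x.len : ℤ).negOnePow • (Y.cop.obj W).d n n' ≫ C.ιm x g n' m' (by lia) := by
  rw [ιm, Category.assoc, C.ι_cobarD x n n' m m' h hn', Preadditive.comp_sub,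
    C.map_ιSum, Category.comp_id, Linear.comp_units_smul, ← Category.assoc,
    (Y.cop.map g).comm, Category.assoc]
  rfl

theorem alternating_ιm (x : Extension S) (g : W ⟶ x.tgt) (n m : ℤ)
    (h : n + -1 * (x.len + 1) = m + 2) : Alternating₂ fun (f : Extension x.tgt) hf =>
    C.ιm (x.comp f) (g ≫ f.map) n m (by rw [len_comp, hf]; push_cast; lia) := by
  intro f f' hf hf' θ hθ hs
  obtain ⟨ψ, h₁, h₂⟩ := exists_arrow_comp_comp (x := x) (y := x) (f := f) (g := f') (Iso.refl _) θ
    (Category.comp_id _) (hθ.trans (Category.id_comp _).symm) (SPerm.refl _)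
    (SPerm.of_eq (List.map_id _)) hs
  refine (C.ιm_arrow ψ _ (g ≫ f'.map) ?_ _ _).trans
    (by rw [h₂, one_mul, one_mul, Units.neg_smul, one_smul])
  rw [h₁, ← hθ]
  exact Category.assoc _ _ _

theorem ιSum_cobarD (x : Extension S) (g : W ⟶ x.tgt) (n n' m m' : ℤ) (h : m' + 1 = m)
    (hn : n + -1 * (x.len + 1) = m + 1) (hn' : n' + 1 = n) :
    C.ιSum x g n m hn ≫ C.cobarD S m m' = (x.len : ℤ).negOnePow •
      (Y.cop.obj W).d n n' ≫ C.ιSum x g n' m' (by lia) := by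
  have e₁ : C.ιSum x g n m hn ≫ C.cobarD S m m' = sum₁ fun (f : Extension x.tgt) hf =>
      C.ιSum (x.comp f) (g ≫ f.map) n m' (by rw [len_comp, hf]; push_cast; lia) -
        ((x.len : ℤ) + 1).negOnePow • (Y.cop.obj W).d n n' ≫ C.ιm (x.comp f) (g ≫ f.map) n' m'
        (by rw [len_comp, hf]; push_cast; lia) := by
    refine (map_sum₁ (Preadditive.rightComp ((Y.cop.obj W).X n) (C.cobarD S m m')) _).trans
      (sum₁_congr fun f hf => ?_)
    refine (C.ιm_cobarD (x.comp f) (g ≫ f.map) n n' m m' h _ hn').trans ?_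
    exact congrArg (fun w : ℤˣ => _ - w • _) (congrArg (fun l : ℕ => (l : ℤ).negOnePow)
      ((len_comp _ _).trans (congrArg (_ + ·) hf)))
  have e₂ : sum₁ (fun (f : Extension x.tgt) hf => C.ιSum (x.comp f) (g ≫ f.map) n m'
      (by rw [len_comp, hf]; push_cast; lia)) = 0 := by
    refine Eq.trans (sum₁_congr fun f hf => sum₁_congr fun f' hf' => ?_)
      (sum₁_sum₁_eq_zero (C.alternating_ιm x g n m' (by lia)))
    obtain ⟨ψ, h₁, h₂⟩ := exists_arrow_comp_assoc x f f'
    refine (C.ιm_arrow ψ _ (g ≫ f.map ≫ f'.map) ?_ _ _).trans (by rw [h₂, one_smul]; rfl)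
    rw [h₁]
    exact (Category.comp_id _).trans (Category.assoc _ _ _)
  have e₃ : (Y.cop.obj W).d n n' ≫ C.ιSum x g n' m' (by lia) =
      sum₁ fun (f : Extension x.tgt) hf => (Y.cop.obj W).d n n' ≫
        C.ιm (x.comp f) (g ≫ f.map) n' m' (by rw [len_comp, hf]; push_cast; lia) :=
    map_sum₁ (Preadditive.leftComp (X S m') ((Y.cop.obj W).d n n')) _
  rw [e₁, e₃]
  rw [sum₁_sub, e₂, zero_sub, ← smul_sum₁, Int.negOnePow_succ, Units.neg_smul, neg_neg]

theorem cobarD_cobarD (S : RTree) (m m' m'' : ℤ) (h : m' + 1 = m) (h' : m'' + 1 = m') :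
    C.cobarD S m m' ≫ C.cobarD S m' m'' = 0 := by
  refine C.hom_ext fun x n hn => ?_
  rw [Limits.comp_zero, ← Category.assoc, C.ι_eq_ιm, C.ιm_cobarD x _ n (n - 1) m m' h hn (by lia),
    Preadditive.sub_comp, Linear.units_smul_comp, Category.assoc,
    C.ιm_cobarD x _ (n - 1) (n - 1 - 1) m' m'' h' (by lia) (by lia),
    C.ιSum_cobarD x _ n (n - 1) m' m'' h' _ (by lia), Preadditive.comp_sub,
    Linear.comp_units_smul, ← Category.assoc ((Y.cop.obj x.tgt).d n (n - 1)),
    HomologicalComplex.d_comp_d, Limits.zero_comp, smul_zero, sub_zero, sub_self]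

/-- The contravariant functoriality of the cobar construction. -/
noncomputable def cobarMap (γ : S ⟶ S') (m : ℤ) : X S' m ⟶ X S m :=
  C.desc fun y n h => topSign (ofHom γ) y • C.ι ((ofHom γ).comp y) n m
    (by rw [len_comp_of_top, h])

theorem ι_cobarMap' (γ : S ⟶ S') (y : Extension S') (h : n + -1 * (y.len + 1) = m) :
    C.ι y n m h ≫ C.cobarMap γ m = topSign (ofHom γ) y • C.ι ((ofHom γ).comp y) n m
      (by rw [len_comp_of_top, h]) := by
  refine C.ι_desc _ (fun y y' φ n hy hy' => ?_) y n h
  obtain ⟨χ, h₁, h₂⟩ := exists_arrow_comp_top (E := ofHom γ) (E' := ofHom γ) (y := y) (y' := y')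
    (Iso.refl _) φ.θ (Category.comp_id _) (φ.map_eq.trans (Category.id_comp _).symm)
    ((SPerm.of_eq (List.map_id _)).trans φ.sperm_old) φ.sperm_new
  rw [one_mul] at h₂
  have e := C.ιm_arrow χ (𝟙 y.tgt) φ.θ.hom (by rw [h₁]; exact Category.id_comp _)
    (show n + -1 * (_ + 1) = m by rw [len_comp_of_top, hy]) (by rw [len_comp_of_top, hy'])
  refine (congrArg (_ • ·) ((C.ι_eq_ιm (x := (ofHom γ).comp y) _).trans e)).trans ?_
  refine (smul_smul _ _ _).trans ((congrArg (· • _) ?_).trans (smul_smul _ _ _).symm) |>.trans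
    (congrArg (_ • ·) (Linear.comp_units_smul _ _ _).symm)
  exact Int.units_mul_eq_mul_swap h₂

theorem ιm_cobarMap (E : Extension S) (y : Extension E.tgt) (g : W ⟶ y.tgt)
    (h : n + -1 * (y.len + 1) = m) :
    C.ιm y g n m h ≫ C.cobarMap E.map m = topSign E y • C.ιm (E.comp y) g n m
      (by rw [len_comp_of_top, h]) := by
  rw [ιm, Category.assoc, ι_cobarMap']
  obtain ⟨χ, h₁, h₂⟩ := exists_arrow_comp_top (E := ofHom E.map) (E' := E) (y := y) (y' := y)
    (Iso.refl _) (Iso.refl _) (Category.comp_id _) (Category.comp_id _)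
    (SPerm.of_eq (List.map_id _)) (SPerm.of_eq (List.map_id _))
  rw [one_mul, mul_one] at h₂
  have e := C.ιm_arrow χ g g (by rw [h₁]; exact Category.comp_id _)
    (show n + -1 * (_ + 1) = m by rw [len_comp_of_top, h]) (by rw [len_comp_of_top, h])
  refine (Linear.comp_units_smul _ _ _).trans ((congrArg (_ • ·) e).trans ?_)
  rw [smul_smul, h₂, mul_right_comm, Int.units_mul_self, one_mul]

theorem ιm_cobarMap' (γ : S ⟶ S') (y : Extension S') (g : W ⟶ y.tgt)
    (h : n + -1 * (y.len + 1) = m) :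
    C.ιm y g n m h ≫ C.cobarMap γ m = topSign (ofHom γ) y • C.ιm ((ofHom γ).comp y) g n m
      (by rw [len_comp_of_top, h]) := C.ιm_cobarMap (ofHom γ) y g h

theorem ιSum_cobarMap (E : Extension S) (y : Extension E.tgt) (g : W ⟶ y.tgt)
    (h : n + -1 * (y.len + 1) = m + 1) :
    C.ιSum y g n m h ≫ C.cobarMap E.map m = topSign E y • C.ιSum (E.comp y) g n m
      (by rw [len_comp_of_top, h]) := by
  refine (map_sum₁ (Preadditive.rightComp ((Y.cop.obj W).X n) (C.cobarMap E.map m)) _).trans ?_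
  refine Eq.trans (sum₁_congr fun f hf => ?_) (smul_sum₁ (topSign E y) _).symm
  refine (C.ιm_cobarMap E (y.comp f) (g ≫ f.map) _).trans ?_
  obtain ⟨χ, h₁, h₂⟩ := exists_arrow_comp_assoc E y f
  have e := C.ιm_arrow χ (g ≫ f.map) (g ≫ f.map) (by rw [h₁]; exact Category.comp_id _)
    (n := n) (m := m) (by
      rw [χ.len_eq, len_comp_of_top, len_comp, hf]; push_cast; lia)
    (by rw [len_comp_of_top, len_comp, hf]; push_cast; lia)
  rw [h₂, one_smul] at e
  exact congrArg₂ (· • ·) (topSign_eq (sperm_topSign E y)) e.symm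

theorem cobarMap_id (S : RTree) (m : ℤ) : C.cobarMap (𝟙 S) m = 𝟙 _ := by
  refine C.hom_ext fun y n h => ?_
  rw [Category.comp_id, C.ι_eq_ιm, C.ιm_cobarMap']
  have hE := new_ofHom_id S
  obtain ⟨χ, h₁, h₂⟩ := Arrow.exists_of_sperm (x := (ofHom (𝟙 S)).comp y) (y := y) (Iso.refl y.tgt)
    ((Category.comp_id _).trans (Category.id_comp _)) (s := topSign (ofHom (𝟙 S)) y) (t := 1) (by
      refine ((SPerm.of_eq ?_).trans (sperm_topSign (ofHom (𝟙 S)) y)).cast (one_mul _)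
      change _ = (ofHom (𝟙 S)).old.map (𝟙 S : S ⟶ S) ++ (ofHom (𝟙 S)).new
      rw [hE, List.append_nil]
      exact (List.map_id _).symm) (SPerm.of_eq (by
      refine (List.map_id _).trans ?_
      change (ofHom (𝟙 S)).new.map y.map ++ y.new = y.new
      rw [hE]; rfl))
  have e := C.ιm_arrow χ (𝟙 _) (𝟙 _) (by rw [h₁]; exact Category.comp_id _)
    (n := n) (m := m) (by rw [len_comp_of_top, h]) h
  rw [h₂, mul_one] at e
  exact (congrArg (_ • ·) e).trans ((smul_smul _ _ _).trans
    ((congrArg (· • _) (Int.units_mul_self _)).trans (one_smul _ _)))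

theorem cobarMap_comp (γ : S ⟶ S') (γ' : S' ⟶ S'') (m : ℤ) :
    C.cobarMap (γ ≫ γ') m = C.cobarMap γ' m ≫ C.cobarMap γ m := by
  refine C.hom_ext fun y n h => ?_
  let E := ofHom γ
  let f : Extension S' := setOld (ofHom γ') E.top.old ((ofHom γ').old_enum.perm E.top.old_enum)
  have e₁ := C.ιm_cobarMap f y (𝟙 y.tgt) h
  have e₂ := C.ιm_cobarMap E (f.comp y) (𝟙 y.tgt) (n := n) (m := m) (by rw [len_comp_of_top, h])
  have e₃ := C.ιm_cobarMap (E.comp f) y (𝟙 y.tgt) h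
  have hs : topSign E (f.comp y) = 1 := topSign_eq (SPerm.refl _)
  obtain ⟨χ, h₁, h₂⟩ := exists_arrow_comp_assoc E f y
  have e₄ := C.ιm_arrow χ (𝟙 _) (𝟙 _) (by rw [h₁]; exact Category.comp_id _)
    (n := n) (m := m) (by rw [χ.len_eq, len_comp_of_top, len_comp_of_top, h])
    (by rw [len_comp_of_top, len_comp_of_top, h])
  rw [C.ι_eq_ιm, ← Category.assoc]
  refine e₃.trans (Eq.trans ?_ (congrArg (· ≫ _) e₁).symm)
  rw [Linear.units_smul_comp]
  refine Eq.trans ?_ (congrArg (_ • ·) e₂).symm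
  rw [topSign_comp E f y rfl, hs, one_smul]
  exact congrArg (_ • ·) (e₄.trans (by rw [h₂, one_smul]; rfl))

theorem cobarMap_cobarD (γ : S ⟶ S') (m m' : ℤ) :
    C.cobarMap γ m ≫ C.cobarD S m m' = C.cobarD S' m m' ≫ C.cobarMap γ m' := by
  by_cases hm : m' + 1 = m
  · refine C.hom_ext fun y n h => ?_
    have h' : n + -1 * (((ofHom γ).comp y).len + 1) = m := by rw [len_comp_of_top, h]
    have e₁ := C.ιSum_cobarMap (ofHom γ) y (𝟙 y.tgt) (n := n) (m := m') (by lia)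
    have e₂ := C.ιm_cobarMap (ofHom γ) y (𝟙 y.tgt) (n := n - 1) (m := m') (by lia)
    have e₃ := C.ιm_cobarD ((ofHom γ).comp y) (𝟙 y.tgt) n (n - 1) m m' hm h' (by lia)
    rw [← Category.assoc, ← Category.assoc, C.ι_eq_ιm, C.ιm_cobarMap',
      C.ιm_cobarD y _ n (n - 1) m m' hm h (by lia), Linear.units_smul_comp, Preadditive.sub_comp,
      Linear.units_smul_comp, Category.assoc]
    refine Eq.trans (congrArg (_ • ·) e₃) (Eq.trans ?_ (congrArg₂ (fun u v => u - _ • (_ ≫ v))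
      e₁ e₂).symm)
    rw [Linear.comp_units_smul, smul_comm _ (topSign _ _), ← smul_sub]
    exact congrArg (fun l : ℕ => _ • (_ - (l : ℤ).negOnePow • _)) (len_comp_of_top _ _)
  · rw [cobarD, cobarD, dif_neg hm, dif_neg hm, Limits.comp_zero, Limits.zero_comp]

/-- The cobar construction, as a functor to complexes. -/
noncomputable def cobarFunctor : RTreeᵒᵖ ⥤ Ch k where
  obj S :=
    { X := X S.unop
      d := C.cobarD S.unop
      shape := fun _ _ h => dif_neg h
      d_comp_d' := fun i j l h h' => C.cobarD_cobarD S.unop i j l h h' }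
  map γ :=
    { f := C.cobarMap γ.unop
      comm' := fun i j _ => C.cobarMap_cobarD γ.unop i j }
  map_id S := HomologicalComplex.hom_ext _ _ fun m => C.cobarMap_id S.unop m
  map_comp γ γ' := HomologicalComplex.hom_ext _ _ fun m => C.cobarMap_comp γ'.unop γ.unop m

/-- The coinvariants, as modules of chains of the cobar construction. -/
def cobarCoinv : Coinv Y.action (-1) fun S m => (C.cobarFunctor.obj (op S)).X m := C

end Coinv

end CobarConstruction

open Extension

section CobarSplitting

variable {k : Type u} [CommRing k]

/-- The structure maps of a precooperad. -/
abbrev LinearPrecooperad.splitting (Y : LinearPrecooperad k) : Splitting Y.action where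
  t := Y.Δ
  naturality g g' θS θR θ h := Y.naturality g g' θS.hom θR.hom θ.hom h

theorem LinearPrecooperad.splitting_isAssoc (Y : LinearPrecooperad k) : Y.splitting.IsAssoc :=
  ⟨Y.assoc_seq, Y.assoc_par⟩

/-- The sign in the structure maps of the cobar construction. -/
def cobarSign (dS eS dR eR : ℕ) : ℤˣ := (-1) ^ ((dS + eS + 1) * (dR + eR) + dR * eS)

theorem seqRule_cobarSign : Coinv.SeqRule cobarSign := fun dS eS dR eR dQ eQ => by
  simp only [cobarSign, ← pow_add]
  exact Int.negOnePow_coe _ ▸ Int.negOnePow_coe _ ▸ (Int.negOnePow_eq_iff _ _).2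
    ⟨eS, by push_cast; ring⟩

theorem parRule_cobarSign : Coinv.ParRule cobarSign := fun dS eS dR eR dQ eQ => by
  simp only [cobarSign, ← pow_add]
  exact Int.negOnePow_coe _ ▸ Int.negOnePow_coe _ ▸ (Int.negOnePow_eq_iff _ _).2
    ⟨eR * dQ + dQ + eQ, by push_cast; ring⟩

namespace Coinv

variable {Y : LinearPrecooperad k} {C : RTree → Ch k}
  (B : Coinv Y.action (-1) fun S m => (C S).X m) {S R U W W' WS WR : RTree} {a : S.Edge}
  {aW : WS.Edge} {x y : Extension S}

/-- A morphism, followed by the inclusion at `x`, as a graded map. -/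
def im (x : Extension S) (u : W ⟶ x.tgt) : GradedMap (-1 * (x.len + 1)) (Y.cop.obj W) (C S) :=
  (B.i x).pre (Y.cop.map u)

theorem im_arrow (φ : Arrow x y) (u : W ⟶ x.tgt) (u' : W ⟶ y.tgt) (h : u ≫ φ.θ.hom = u') :
    B.im x u = φ.sign • (B.im y u').cast (by rw [φ.len_eq]) :=
  GradedMap.hom_ext fun p q hq => by
    rw [GradedMap.units_smul_apply]
    exact B.ιm_arrow φ u u' h _ _

variable {xS : Extension S} {xR : Extension R} {x : Extension U} {g : RTree.Grafting S a R U}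

theorem ιm_split (D : x.Degrafting g xS xR) (gW : RTree.Grafting WS aW WR W) {uS : WS ⟶ xS.tgt}
    {uR : WR ⟶ xR.tgt} {u : W ⟶ x.tgt} (hu : gW.Compatible D.graft uS uR u) (n m : ℤ)
    (h : n + -1 * (x.len + 1) = m) :
    B.ιm x u n m h ≫ B.split Y.splitting cobarSign g m = splitSign cobarSign xS xR •
      (Y.Δ gW).f n ≫ (B.im xS uS).tens (B.im xR uR) n m (D.index h) := by
  rw [im, im, ← GradedMap.pre_tens, ιm, Category.assoc, B.ι_split _ _ D n m h,
    Linear.comp_units_smul, ← Category.assoc, ← Category.assoc, ← HomologicalComplex.comp_f,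
    ← HomologicalComplex.comp_f]
  change _ • (_ ≫ Y.Δ D.graft).f n ≫ _ = _
  rw [Y.naturality gW D.graft uS uR u hu]

/-- The sum in the differential of the cobar construction, as a graded map. -/
noncomputable def iSum (x : Extension S) (u : W ⟶ x.tgt) :
    GradedMap (-1 * (x.len + 1) - 1) (Y.cop.obj W) (C S) :=
  sum₁ fun (f : Extension x.tgt) hf => (B.im (x.comp f) (u ≫ f.map)).cast
    (by rw [len_comp, hf]; push_cast; ring)

theorem iSum_apply (x : Extension S) (u : W ⟶ x.tgt) (n m : ℤ) (h) (h') :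
    B.iSum x u n m h = B.ιSum x u n m h' :=
  map_sum₁ (AddMonoidHom.mk' (fun v : GradedMap (-1 * (x.len + 1) - 1) (Y.cop.obj W) (C S) =>
    v n m h) fun _ _ => rfl) _

theorem im_comp_of_new_eq_nil (x : Extension S) (f : Extension x.tgt) (hf : f.new = []) :
    B.im x (𝟙 _) = (B.im (x.comp f) f.map).cast (by rw [len_comp, hf]; rfl) := by
  obtain ⟨φ, h₁, h₂⟩ := exists_arrow_comp_of_new_eq_nil x f hf
  have := B.im_arrow φ (𝟙 _) f.map (by rw [h₁]; exact Category.id_comp _)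
  rwa [h₂, one_smul] at this

theorem ιm_comp_split (D : x.Degrafting g xS xR) {f : Extension x.tgt} {fS : Extension xS.tgt}
    {fR : Extension xR.tgt} (E : f.Degrafting D.graft fS fR) (n m : ℤ)
    (h : n + -1 * ((x.comp f).len + 1) = m) :
    B.ιm (x.comp f) f.map n m h ≫ B.split Y.splitting cobarSign g m =
      (splitSign cobarSign (xS.comp fS) (xR.comp fR) * (-1) ^ (xR.new.length * fS.new.length)) •
        (Y.Δ D.graft).f n ≫ (B.im (xS.comp fS) fS.map).tens (B.im (xR.comp fR) fR.map) n m
          ((D.comp E).index (n := n) (m := m) (index_setNew (D.sperm_compNew E).perm h)) := by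
  obtain ⟨φ, h₁, h₂⟩ := exists_arrow_setNew (x.comp f) (D.sperm_compNew E)
  have := B.ιm_arrow φ f.map f.map (by rw [h₁]; exact Category.comp_id _) (n := n) (m := m) h
    (index_setNew (D.sperm_compNew E).perm h)
  rw [this, h₂, Linear.units_smul_comp]
  refine (congrArg (_ • ·) (B.ιm_split (D.comp E) D.graft (u := f.map) E.compat n m
    (index_setNew (D.sperm_compNew E).perm h))).trans ?_
  rw [smul_smul, mul_comm]

theorem cobarSign_comp_left {fS : Extension xS.tgt} {fR : Extension xR.tgt}
    (hS : fS.new.length = 1) (hR : fR.new = []) :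
    splitSign cobarSign (xS.comp fS) (xR.comp fR) * (-1) ^ (xR.new.length * fS.new.length) =
      splitSign cobarSign xS xR := by
  have h₁ : (xS.comp fS).new.length = xS.new.length + 1 := by
    rw [length_new_comp, hS]
  have h₂ : (xR.comp fR).new.length = xR.new.length := by rw [length_new_comp, hR]; rfl
  have h₄ : (xS.comp fS).old.length = xS.old.length := rfl
  have h₅ : (xR.comp fR).old.length = xR.old.length := rfl
  rw [splitSign, splitSign, cobarSign, cobarSign, h₁, h₂, h₄, h₅, hS,
    ← Int.negOnePow_coe, ← Int.negOnePow_coe, ← Int.negOnePow_coe, ← Int.negOnePow_add,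
    Int.negOnePow_eq_iff]
  exact ⟨xR.old.length + xR.new.length, by push_cast; ring⟩

theorem cobarSign_comp_right {fS : Extension xS.tgt} {fR : Extension xR.tgt}
    (hS : fS.new = []) (hR : fR.new.length = 1) :
    splitSign cobarSign (xS.comp fS) (xR.comp fR) * (-1) ^ (xR.new.length * fS.new.length) =
      splitSign cobarSign xS xR * (-1 * (xS.len + 1) : ℤ).negOnePow := by
  have h₁ : (xS.comp fS).new.length = xS.new.length := by
    rw [length_new_comp, hS]; rfl
  have h₂ : (xR.comp fR).new.length = xR.new.length + 1 := by rw [length_new_comp, hR]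
  have h₄ : (xS.comp fS).old.length = xS.old.length := rfl
  have h₅ : (xR.comp fR).old.length = xR.old.length := rfl
  rw [splitSign, splitSign, cobarSign, cobarSign, h₁, h₂, h₄, h₅, hS, List.length_nil, mul_zero,
    pow_zero, mul_one, len, ← Int.negOnePow_coe, ← Int.negOnePow_coe, ← Int.negOnePow_add,
    Int.negOnePow_eq_iff]
  exact ⟨1 + xS.old.length + xS.new.length, by push_cast; ring⟩

theorem iSum_tens (D : x.Degrafting g xS xR) (n m : ℤ) (h : n + -1 * (x.len + 1) = m + 1) :
    splitSign cobarSign xS xR • (Y.Δ D.graft).f n ≫ (B.iSum xS (𝟙 _)).tens (B.im xR (𝟙 _)) n m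
        (by rw [eq_sub_of_add_eq h.symm, D.len_eq]; push_cast; ring) =
      sum₁ fun f hf => B.ιm (x.comp (graftPair D.graft f (ofHom (𝟙 _))))
        (𝟙 _ ≫ (graftPair D.graft f (ofHom (𝟙 _))).map) n m (by
          rw [len_comp, (graftPairD _ _ _).new_length, hf, new_ofHom_id, eq_sub_of_add_eq h.symm]
          push_cast [List.length_nil]; ring) ≫ B.split Y.splitting cobarSign g m := by
  refine (map_sum₁ (AddMonoidHom.mk' (fun w => splitSign cobarSign xS xR •
    (Y.Δ D.graft).f n ≫ GradedMap.tens w (B.im xR (𝟙 _)) n m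
      (by rw [eq_sub_of_add_eq h.symm, D.len_eq]; push_cast; ring))
    fun w w' => by rw [GradedMap.add_tens, Preadditive.comp_add, smul_add]) _).trans
    (sum₁_congr fun f hf => ?_)
  have e := B.ιm_comp_split D (graftPairD D.graft f (ofHom (𝟙 xR.tgt))) n m (by
    rw [len_comp, (graftPairD _ _ _).new_length, hf, new_ofHom_id, eq_sub_of_add_eq h.symm]
    push_cast [List.length_nil]; ring)
  refine Eq.trans ?_ ((congrArg (· • _) (cobarSign_comp_left hf (new_ofHom_id _))).symm.trans
    (e.symm.trans (congrArg (fun w => B.ιm _ w n m _ ≫ _) (Category.id_comp _).symm)))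
  rw [B.im_comp_of_new_eq_nil xR _ (new_ofHom_id _)]
  exact congrArg (fun w => splitSign cobarSign xS xR • (Y.Δ D.graft).f n ≫ w)
    (GradedMap.cast_tens_cast _ _ _ _ _ _ _)

theorem tens_iSum (D : x.Degrafting g xS xR) (n m : ℤ) (h : n + -1 * (x.len + 1) = m + 1) :
    (splitSign cobarSign xS xR * (-1 * (xS.len + 1) : ℤ).negOnePow) • (Y.Δ D.graft).f n ≫
        (B.im xS (𝟙 _)).tens (B.iSum xR (𝟙 _)) n m
        (by rw [eq_sub_of_add_eq h.symm, D.len_eq]; push_cast; ring) =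
      sum₁ fun f hf => B.ιm (x.comp (graftPair D.graft (ofHom (𝟙 _)) f))
        (𝟙 _ ≫ (graftPair D.graft (ofHom (𝟙 _)) f).map) n m (by
          rw [len_comp, (graftPairD _ _ _).new_length, hf, new_ofHom_id, eq_sub_of_add_eq h.symm]
          push_cast [List.length_nil]; ring) ≫ B.split Y.splitting cobarSign g m := by
  refine (map_sum₁ (AddMonoidHom.mk' (fun w => (splitSign cobarSign xS xR *
      (-1 * (xS.len + 1) : ℤ).negOnePow) • (Y.Δ D.graft).f n ≫
    GradedMap.tens (B.im xS (𝟙 _)) w n m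
      (by rw [eq_sub_of_add_eq h.symm, D.len_eq]; push_cast; ring))
    fun w w' => by rw [GradedMap.tens_add, Preadditive.comp_add, smul_add]) _).trans
    (sum₁_congr fun f hf => ?_)
  have e := B.ιm_comp_split D (graftPairD D.graft (ofHom (𝟙 xS.tgt)) f) n m (by
    rw [len_comp, (graftPairD _ _ _).new_length, hf, new_ofHom_id, eq_sub_of_add_eq h.symm]
    push_cast [List.length_nil]; ring)
  refine Eq.trans ?_ ((congrArg (· • _) (cobarSign_comp_right (new_ofHom_id _) hf)).symm.trans
    (e.symm.trans (congrArg (fun w => B.ιm _ w n m _ ≫ _) (Category.id_comp _).symm)))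
  rw [B.im_comp_of_new_eq_nil xS _ (new_ofHom_id _)]
  exact congrArg (fun w => (splitSign cobarSign xS xR * (-1 * (xS.len + 1) : ℤ).negOnePow) •
    (Y.Δ D.graft).f n ≫ w) (GradedMap.cast_tens_cast _ _ _ _ _ _ _)

theorem ιSum_split (D : x.Degrafting g xS xR) (n m : ℤ) (h : n + -1 * (x.len + 1) = m + 1) :
    B.ιSum x (𝟙 _) n m h ≫ B.split Y.splitting cobarSign g m =
      splitSign cobarSign xS xR • (Y.Δ D.graft).f n ≫
        ((B.iSum xS (𝟙 _)).tens (B.im xR (𝟙 _)) n m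
          (by rw [eq_sub_of_add_eq h.symm, D.len_eq]; push_cast; ring) +
        (-1 * (xS.len + 1) : ℤ).negOnePow • (B.im xS (𝟙 _)).tens (B.iSum xR (𝟙 _)) n m
          (by rw [eq_sub_of_add_eq h.symm, D.len_eq]; push_cast; ring)) := by
  rw [Preadditive.comp_add, Linear.comp_units_smul, smul_add, smul_smul, B.iSum_tens D n m h,
    B.tens_iSum D n m h]
  refine (congrArg (· ≫ _) (sum₁_graft D.graft (B.invariant_ιm x (𝟙 _) n m h))).trans
    ((Preadditive.add_comp _ _ _ _ _ _).trans (congrArg₂ (· + ·) ?_ ?_))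
  · exact map_sum₁ (Preadditive.rightComp _ (B.split Y.splitting cobarSign g m)) _
  · exact map_sum₁ (Preadditive.rightComp _ (B.split Y.splitting cobarSign g m)) _

end Coinv

namespace Coinv

variable {Y : LinearPrecooperad k} {X : RTree → ℤ → ModuleCat.{u} k}
  (B : Coinv Y.action (-1) X) {S R U : RTree} {a : S.Edge}

theorem im_postD {W : RTree} (x : Extension S) (u : W ⟶ x.tgt) :
    (B.cobarCoinv.im x u).postD = B.cobarCoinv.iSum x u -
      (x.len : ℤ).negOnePow • (B.cobarCoinv.im x u).preD :=
  GradedMap.hom_ext fun p q h => by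
    rw [GradedMap.sub_apply, GradedMap.units_smul_apply, B.cobarCoinv.iSum_apply x u p q h (by lia),
      (B.cobarCoinv.im x u).postD_apply h (r := q + 1) (by lia)]
    exact B.ιm_cobarD x u p (p - 1) (q + 1) q rfl (by lia) (by lia)

/-- The structure maps of the cobar construction. -/
noncomputable def cobarθf (g : RTree.Grafting S a R U) (m : ℤ) :
    (B.cobarFunctor.obj (op U)).X m ⟶
      (B.cobarFunctor.obj (op S) ⊗ B.cobarFunctor.obj (op R)).X m :=
  B.cobarCoinv.split Y.splitting cobarSign g m

theorem _root_.d_split_combine {A : Type*} [AddCommGroup A] {lS lR lx a b : ℤˣ}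
    {G G' P P' Q : A} (h : b • P + P' = Q) (h₁ : lx * b = lS) (h₂ : lx = a * lR) :
    (G - lS • P) + a • (G' - lR • P') = (G + a • G') - lx • Q := by
  rw [← h, smul_add, smul_smul, h₁, h₂, smul_sub, smul_smul]
  abel

theorem cobarθf_d (g : RTree.Grafting S a R U) (m m' : ℤ) (hm : m' + 1 = m) :
    B.cobarθf g m ≫ (B.cobarFunctor.obj (op S) ⊗ B.cobarFunctor.obj (op R)).d m m' =
      (B.cobarFunctor.obj (op U)).d m m' ≫ B.cobarθf g m' := by
  refine B.cobarCoinv.hom_ext_graft g fun xS xR x D n hx => ?_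
  have e₁ := B.cobarCoinv.ιm_split D D.graft D.graft.compatible_id n m hx
  have e₁' := B.cobarCoinv.ιm_split D D.graft D.graft.compatible_id (n - 1) m' (by lia)
  have e₂ := B.cobarCoinv.ιSum_split D n m' (by lia)
  have e₄ := GradedMap.d_tens (B.cobarCoinv.im xS (𝟙 _)) (B.cobarCoinv.im xR (𝟙 _)) n (n - 1) m'
    (D.index (by lia)) (by lia)
  have e₃ := B.ιm_cobarD x (𝟙 _) n (n - 1) m m' hm hx (by lia)
  rw [B.cobarCoinv.ι_eq_ιm]
  refine (Category.assoc _ _ _).symm.trans ((congrArg (· ≫ _) e₁).trans (Eq.trans ?_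
    (Eq.trans (congrArg (· ≫ _) e₃.symm) (Category.assoc _ _ _))))
  refine Eq.trans ?_ (Preadditive.sub_comp _ _ _).symm
  refine Eq.trans ?_ (congrArg₂ (· - ·) e₂ ((Linear.units_smul_comp _ _ _).trans
    (congrArg (_ • ·) ((Category.assoc _ _ _).trans (congrArg (_ ≫ ·) e₁'))))).symm
  rw [Linear.units_smul_comp, Category.assoc, GradedMap.tens_d _ _ n m m' _ hm, im_postD, im_postD,
    GradedMap.sub_tens, GradedMap.tens_sub, GradedMap.units_smul_tens, GradedMap.tens_units_smul,
    Linear.comp_units_smul, smul_comm _ (splitSign _ _ _), ← smul_sub,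
        ← Category.assoc ((Y.cop.obj _).d _ _),
    ← HomologicalComplex.Hom.comm, Category.assoc, e₄]
  refine congrArg (_ • ·) ?_
  rw [← Linear.comp_units_smul, ← Preadditive.comp_sub]
  refine congrArg (_ ≫ ·) (d_split_combine rfl ?_ ?_)
  · rw [D.len_eq, ← Int.negOnePow_add, Int.negOnePow_eq_iff]
    exact ⟨0, by push_cast; ring⟩
  · rw [D.len_eq, ← Int.negOnePow_add, Int.negOnePow_eq_iff]
    exact ⟨xS.len + 1, by push_cast; ring⟩

/-- The structure maps of the cobar construction. -/
noncomputable def cobarθ (g : RTree.Grafting S a R U) :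
    B.cobarFunctor.obj (op U) ⟶ B.cobarFunctor.obj (op S) ⊗ B.cobarFunctor.obj (op R) where
  f := B.cobarθf g
  comm' m m' hm := B.cobarθf_d g m m' hm

variable {xS : Extension S} {xR : Extension R} {x : Extension U} {g : RTree.Grafting S a R U}

theorem im_post_cobarMap (E : Extension S) (y : Extension E.tgt) :
    (B.cobarCoinv.im y (𝟙 _)).post (B.cobarFunctor.map E.map.op) = topSign E y •
      (B.cobarCoinv.im (W := y.tgt) (E.comp y) (𝟙 y.tgt)).cast (by rw [len_comp_of_top]) :=
  GradedMap.hom_ext fun p q h => by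
    rw [GradedMap.units_smul_apply]
    exact B.ιm_cobarMap E y (𝟙 _) h

theorem cobarSign_top (D : x.Degrafting g xS xR) {y : Extension x.tgt} {yS : Extension xS.tgt}
    {yR : Extension xR.tgt} (E : y.Degrafting D.graft yS yR) :
    topSign x y * ((-1) ^ (xR.new.length * yS.new.length) *
      splitSign cobarSign (xS.comp yS) (xR.comp yR)) =
    splitSign cobarSign yS yR * (topSign xS yS * topSign xR yR) := by
  have h : (-1) ^ (xR.old.length * xS.new.length) * ((-1) ^ (xR.new.length * yS.new.length) *
      splitSign cobarSign (xS.comp yS) (xR.comp yR)) = splitSign cobarSign yS yR := by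
    have h₁ : (xS.comp yS).old.length = xS.old.length := rfl
    have h₂ : (xR.comp yR).old.length = xR.old.length := rfl
    rw [splitSign, splitSign, cobarSign, cobarSign, h₁, h₂, length_new_comp, length_new_comp,
      length_top, length_top, len, len,
      ← Int.negOnePow_coe, ← Int.negOnePow_coe, ← Int.negOnePow_coe, ← Int.negOnePow_coe,
      ← Int.negOnePow_add, ← Int.negOnePow_add, Int.negOnePow_eq_iff]
    exact ⟨xR.old.length * xS.new.length, by push_cast; ring⟩
  rw [D.topSign_eq E, ← h]
  ac_rfl

theorem cobarMap_cobarθf (D : x.Degrafting g xS xR) (m : ℤ) :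
    (B.cobarFunctor.map x.map.op).f m ≫ B.cobarθf g m = B.cobarθf D.graft m ≫
      (B.cobarFunctor.map xS.map.op ⊗ₘ B.cobarFunctor.map xR.map.op).f m := by
  refine B.cobarCoinv.hom_ext_graft D.graft fun yS yR y E n hy => ?_
  have hy' : n + -1 * ((x.comp y).len + 1) = m := by rw [len_comp_of_top, hy]
  have e₁ := B.cobarCoinv.ιm_split E E.graft E.graft.compatible_id n m hy
  have e₂ := B.cobarCoinv.ιm_split (D.comp E) E.graft E.graft.compatible_id n m
    (index_setNew (D.sperm_compNew E).perm hy')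
  obtain ⟨φ, h₁, h₂⟩ := exists_arrow_setNew (x.comp y) (D.sperm_compNew E)
  have e₃ : B.cobarCoinv.ιm (W := y.tgt) (x.comp y) (𝟙 y.tgt) n m hy' =
      ((-1) ^ (xR.new.length * yS.new.length) : ℤˣ) • B.cobarCoinv.ιm (W := y.tgt)
        ((x.comp y).setNew (D.compNew E) (D.sperm_compNew E).perm) (𝟙 y.tgt) n m
          (index_setNew (D.sperm_compNew E).perm hy') :=
    (B.cobarCoinv.ιm_arrow φ (𝟙 _) (𝟙 _) (by rw [h₁]; exact Category.comp_id _) _ _).trans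
      (congrArg (· • _) h₂)
  have e₄ : B.cobarCoinv.ιm y (𝟙 y.tgt) n m hy ≫ (B.cobarFunctor.map x.map.op).f m =
      topSign x y • B.cobarCoinv.ιm (W := y.tgt) (x.comp y) (𝟙 y.tgt) n m hy' :=
    B.ιm_cobarMap x y (𝟙 _) hy
  have e₅ : ((B.cobarCoinv.im yS (𝟙 _)).post (B.cobarFunctor.map xS.map.op)).tens
      ((B.cobarCoinv.im yR (𝟙 _)).post (B.cobarFunctor.map xR.map.op)) n m (E.index hy) =
      (topSign xS yS * topSign xR yR) •
        (B.cobarCoinv.im (W := yS.tgt) (xS.comp yS) (𝟙 yS.tgt)).tens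
        (B.cobarCoinv.im (W := yR.tgt) (xR.comp yR) (𝟙 yR.tgt)) n m
        (by rw [len_comp_of_top, len_comp_of_top, E.index hy]) := by
    rw [im_post_cobarMap, im_post_cobarMap, GradedMap.units_smul_tens, GradedMap.tens_units_smul,
      smul_smul, GradedMap.cast_tens_cast]
  rw [B.cobarCoinv.ι_eq_ιm]
  refine (Category.assoc _ _ _).symm.trans ((congrArg (· ≫ _) (e₄.trans
    (congrArg (_ • ·) e₃))).trans (Eq.trans ?_ (Category.assoc _ _ _)))
  refine Eq.trans ?_ (congrArg (· ≫ _) e₁).symm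
  rw [smul_smul, Linear.units_smul_comp, Linear.units_smul_comp, Category.assoc,
    GradedMap.tens_post, e₅, Linear.comp_units_smul, smul_smul, ← cobarSign_top D E, ← mul_assoc]
  exact (congrArg (_ • ·) e₂).trans (smul_smul _ _ _)

/-- The cobar construction of a precooperad. -/
noncomputable def cobarPreoperad : LinearPreoperad k where
  pre := B.cobarFunctor
  θ := B.cobarθ
  naturality {S S' R R' T T' a a'} g g' β γ δ h := by
    obtain rfl := h.map_leaf
    ext1 m
    exact B.cobarMap_cobarθf (degraftingOfGraft (xS := ofHom β) (xR := ofHom γ) g g' δ h) m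
  assoc_seq := B.cobarCoinv.assoc_seq Y.splitting cobarSign Y.splitting_isAssoc seqRule_cobarSign
    B.cobarθ fun _ _ => rfl
  assoc_par := B.cobarCoinv.assoc_par Y.splitting cobarSign Y.splitting_isAssoc (by decide)
    parRule_cobarSign B.cobarθ fun _ _ => rfl

theorem ιm_π_zero {x y : Extension S} (hxy : ¬ Nonempty (Arrow x y)) {W : RTree} (g : W ⟶ x.tgt)
    {n n' m : ℤ} (h : n + -1 * (x.len + 1) = m) (h' : n' + -1 * (y.len + 1) = m) :
    B.ιm x g n m h ≫ B.π y n' m h' = 0 := by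
  rw [ιm, Category.assoc, B.ι_π_zero hxy, Limits.comp_zero]

theorem ιSum_π_zero {x y : Extension S} (hxy : y.new.length ≠ x.new.length + 1) {W : RTree}
    (g : W ⟶ x.tgt) {n n' m : ℤ} (h : n + -1 * (x.len + 1) = m + 1)
    (h' : n' + -1 * (y.len + 1) = m) : B.ιSum x g n m h ≫ B.π y n' m h' = 0 := by
  refine (map_sum₁ (Preadditive.rightComp ((Y.cop.obj W).X n) (B.π y n' m h')) _).trans
    (sum₁_eq_zero fun f hf => B.ιm_π_zero (x := x.comp f) ?_ (g ≫ f.map) _ _)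
  rintro ⟨φ⟩
  exact hxy (by rw [← φ.new_length, length_new_comp, hf])

theorem isTriangular_cobar : B.cobarCoinv.IsTriangular 1 where
  diag x p q r t h hq h' := by
    refine (Category.assoc _ _ _).symm.trans
      ((congrArg (· ≫ B.π x t r h') (B.ι_cobarD x p t q r hq (by lia) h)).trans ?_)
    rw [Preadditive.sub_comp, B.ιSum_π_zero (by lia), Linear.units_smul_comp, Category.assoc,
      B.ι_π_self, Category.comp_id, zero_sub, ← Units.neg_smul]
    refine congrArg (· • _) ?_
    rw [← Int.negOnePow_succ, Int.negOnePow_eq_iff]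
    exact ⟨x.len + 1, by ring⟩
  entry x y hxy hw p q r t h hq h' := by
    refine (Category.assoc _ _ _).symm.trans
      ((congrArg (· ≫ B.π y t r h') (B.ι_cobarD x p (p - 1) q r hq (by lia) h)).trans ?_)
    rw [Preadditive.sub_comp, B.ιSum_π_zero (by lia), Linear.units_smul_comp, Category.assoc,
      B.ι_π_zero hxy, Limits.comp_zero, zero_sub, smul_zero, neg_zero]

theorem quasiIso_cobarθ (hY : Y.IsInftyCooperad) (g : RTree.Grafting S a R U) :
    QuasiIso (B.cobarθ g) :=
  B.isTriangular_cobar.quasiIso (t := Y.splitting) (c := cobarSign) hY g (B.cobarθ g) fun _ => rfl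

end Coinv

end CobarSplitting

open Extension

section CobarHom

variable {k : Type u} [CommRing k]

namespace Coinv

variable {Y Z V : LinearPrecooperad k} {X X' X'' : RTree → ℤ → ModuleCat.{u} k}
  (C : Coinv Y.action (-1) X) (C' : Coinv Z.action (-1) X') (C'' : Coinv V.action (-1) X'')
  (f : Y ⟶ Z) (f' : Z ⟶ V) {S S' R U W : RTree} {a : S.Edge} {n m m' : ℤ}

theorem _root_.LinearPrecooperad.Hom.naturality_f {T T' : RTree} (β : T ⟶ T') (n : ℤ) :
    (Y.cop.map β).f n ≫ (f.nat.app T').f n = (f.nat.app T).f n ≫ (Z.cop.map β).f n := by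
  rw [← HomologicalComplex.comp_f, f.nat.naturality, HomologicalComplex.comp_f]

/-- The map of cobar constructions induced by a morphism of precooperads. -/
noncomputable def cobarHomf (S : RTree) (m : ℤ) : X S m ⟶ X' S m :=
  C.desc fun x n h => (f.nat.app x.tgt).f n ≫ C'.ι x n m h

theorem ι_cobarHomf (x : Extension S) (h : n + -1 * (x.len + 1) = m) :
    C.ι x n m h ≫ C.cobarHomf C' f S m = (f.nat.app x.tgt).f n ≫ C'.ι x n m h := by
  refine C.ι_desc _ (fun x y φ n hx hy => ?_) x n h
  rw [C'.ι_arrow φ n m hx hy, Linear.comp_units_smul, ← Category.assoc, ← Category.assoc]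
  exact congrArg (fun w => _ • (w ≫ _)) (LinearPrecooperad.Hom.naturality_f f φ.θ.hom n).symm

theorem ιm_cobarHomf (x : Extension S) (g : W ⟶ x.tgt) (h : n + -1 * (x.len + 1) = m) :
    C.ιm x g n m h ≫ C.cobarHomf C' f S m = (f.nat.app W).f n ≫ C'.ιm x g n m h := by
  rw [ιm, Category.assoc, ι_cobarHomf, ← Category.assoc, LinearPrecooperad.Hom.naturality_f,
    Category.assoc, ιm]

theorem ιSum_cobarHomf (x : Extension S) (g : W ⟶ x.tgt) (h : n + -1 * (x.len + 1) = m + 1) :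
    C.ιSum x g n m h ≫ C.cobarHomf C' f S m = (f.nat.app W).f n ≫ C'.ιSum x g n m h := by
  refine (map_sum₁ (Preadditive.rightComp _ (C.cobarHomf C' f S m)) _).trans
    (Eq.trans (sum₁_congr fun z hz => ?_)
      (map_sum₁ (Preadditive.leftComp _ ((f.nat.app W).f n)) _).symm)
  exact C.ιm_cobarHomf C' f (x.comp z) (g ≫ z.map) _

theorem cobarHomf_cobarD (S : RTree) (hm : m' + 1 = m) :
    C.cobarHomf C' f S m ≫ C'.cobarD S m m' = C.cobarD S m m' ≫ C.cobarHomf C' f S m' := by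
  refine C.hom_ext fun x n h => ?_
  rw [← Category.assoc, ← Category.assoc, C.ι_cobarD x n (n - 1) m m' hm (by lia) h, ι_cobarHomf,
    Category.assoc, C'.ι_cobarD x n (n - 1) m m' hm (by lia) h, Preadditive.sub_comp,
    ιSum_cobarHomf, Linear.units_smul_comp, Category.assoc, ι_cobarHomf, Preadditive.comp_sub,
    Linear.comp_units_smul, ← Category.assoc, ← Category.assoc, HomologicalComplex.Hom.comm]

theorem cobarHomf_cobarMap (γ : S ⟶ S') (m : ℤ) :
    C.cobarHomf C' f S' m ≫ C'.cobarMap γ m = C.cobarMap γ m ≫ C.cobarHomf C' f S m := by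
  refine C.hom_ext fun x n h => ?_
  rw [← Category.assoc, ← Category.assoc, ι_cobarHomf, Category.assoc, C'.ι_cobarMap',
    C.ι_cobarMap']
  exact (Linear.comp_units_smul _ _ _).trans ((congrArg (_ • ·)
    (C.ι_cobarHomf C' f ((ofHom γ).comp x) _)).symm.trans (Linear.units_smul_comp _ _ _).symm)

/-- The map of complexes induced by a morphism of precooperads. -/
noncomputable def cobarHomNat : C.cobarFunctor ⟶ C'.cobarFunctor where
  app S :=
    { f := C.cobarHomf C' f S.unop
      comm' := fun _ _ h => C.cobarHomf_cobarD C' f S.unop h }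
  naturality _ _ γ := HomologicalComplex.hom_ext _ _ fun m =>
    (C.cobarHomf_cobarMap C' f γ.unop m).symm

theorem i_post_cobarHom (x : Extension S) :
    (C.cobarCoinv.i x).post ((C.cobarHomNat C' f).app (op S)) =
      (C'.cobarCoinv.i x).pre (f.nat.app x.tgt) :=
  GradedMap.hom_ext fun _ _ h => C.ι_cobarHomf C' f x h

theorem cobarθ_cobarHom (g : RTree.Grafting S a R U) (m : ℤ) :
    C.cobarθf g m ≫
        ((C.cobarHomNat C' f).app (op S) ⊗ₘ (C.cobarHomNat C' f).app (op R)).f m =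
      ((C.cobarHomNat C' f).app (op U)).f m ≫ C'.cobarθf g m := by
  refine C.cobarCoinv.hom_ext_graft g fun xS xR x D n hx => ?_
  have e : C.cobarCoinv.ι x n m hx ≫ ((C.cobarHomNat C' f).app (op U)).f m = _ :=
    C.ι_cobarHomf C' f x hx
  refine (Category.assoc _ _ _).symm.trans (Eq.trans ?_ (Category.assoc _ _ _))
  refine (congrArg (· ≫ _) (C.cobarCoinv.ι_split Y.splitting cobarSign D n m hx)).trans
    (Eq.trans ?_ ((congrArg (· ≫ _) e).trans ((Category.assoc _ _ _).trans (congrArg (_ ≫ ·)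
      (C'.cobarCoinv.ι_split Z.splitting cobarSign D n m hx)))).symm)
  rw [Linear.units_smul_comp, Linear.comp_units_smul, Category.assoc, GradedMap.tens_post,
    i_post_cobarHom, i_post_cobarHom, ← GradedMap.pre_tens]
  refine congrArg (_ • ·) ?_
  refine (Category.assoc _ _ _).symm.trans (Eq.trans (congrArg (· ≫ _) ?_) (Category.assoc _ _ _))
  exact congrArg (fun u => HomologicalComplex.Hom.f u n) (f.comm D.graft)

/-- The map of cobar constructions induced by a morphism of precooperads. -/
noncomputable def cobarHom : C.cobarPreoperad ⟶ C'.cobarPreoperad where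
  nat := C.cobarHomNat C' f
  comm g := HomologicalComplex.hom_ext _ _ fun m => C.cobarθ_cobarHom C' f g m

theorem cobarHomf_id (S : RTree) (m : ℤ) : C.cobarHomf C (𝟙 Y) S m = 𝟙 _ :=
  C.hom_ext fun x n h => by
    rw [ι_cobarHomf, Category.comp_id]
    exact Category.id_comp _

theorem cobarHomf_comp (S : RTree) (m : ℤ) :
    C.cobarHomf C'' (f ≫ f') S m = C.cobarHomf C' f S m ≫ C'.cobarHomf C'' f' S m :=
  C.hom_ext fun x n h => by
    rw [ι_cobarHomf, ← Category.assoc, ι_cobarHomf, Category.assoc, ι_cobarHomf, ← Category.assoc]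
    rfl

theorem cobarHom_id : C.cobarHom C (𝟙 Y) = 𝟙 _ :=
  LinearPreoperad.Hom.ext (NatTrans.ext (funext fun S =>
    HomologicalComplex.hom_ext _ _ fun m => C.cobarHomf_id S.unop m))

theorem cobarHom_comp : C.cobarHom C'' (f ≫ f') = C.cobarHom C' f ≫ C'.cobarHom C'' f' :=
  LinearPreoperad.Hom.ext (NatTrans.ext (funext fun S =>
    HomologicalComplex.hom_ext _ _ fun m => C.cobarHomf_comp C' C'' f f' S.unop m))

theorem ι_cobarMap (E : Extension S) (z : Extension E.tgt) (h : n + -1 * (z.len + 1) = m) :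
    C.ι z n m h ≫ C.cobarMap E.map m =
      topSign E z • C.ι (E.comp z) n m (by rw [len_comp_of_top, h]) := by
  rw [C.ι_eq_ιm, C.ιm_cobarMap]
  exact congrArg (_ • ·) (C.ι_eq_ιm (x := E.comp z) _).symm

theorem ι_cobarD_eq (x : Extension S) (n m : ℤ) (h : n + -1 * (x.len + 1) = m) :
    C.ι x n m h ≫ C.cobarD S m (m - 1) = (∑ᶠ z : Component₁ x.tgt, (Y.cop.map z.out.1.map).f n ≫
        C.ι (x.comp z.out.1) n (m - 1) (by rw [len_comp, z.out.2]; push_cast; lia)) +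
      Int.negOnePow (x.old.length + x.new.length + 1) •
        ((Y.cop.obj x.tgt).d n (n - 1) ≫ C.ι x (n - 1) (m - 1) (by lia)) := by
  refine (C.ι_cobarD x n (n - 1) m (m - 1) (by lia) (by lia) h).trans (Eq.trans ?_
    (congrArg (· + _) (finsum_eq_sum₁ (T := x.tgt) fun f hf => (Y.cop.map f.map).f n ≫
      C.ι (x.comp f) n (m - 1) (by rw [len_comp, hf]; push_cast; lia))).symm)
  refine (sub_eq_add_neg _ _).trans (congrArg₂ (· + ·) (sum₁_congr fun f hf =>
    congrArg (fun u => C.ιm (x.comp f) u n (m - 1) _) (Category.id_comp _)) ?_)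
  rw [Int.negOnePow_succ, Units.neg_smul]
  rfl

end Coinv

theorem cobar_index {n l m : ℤ} : n - 1 - l = m ↔ n + -1 * (l + 1) = m := by
  constructor <;> intro h <;> lia

/-- The cobar construction as coinvariants. -/
theorem LinearPrecooperad.exists_cobarCoinv (Y : LinearPrecooperad k) :
    ∃ C : Coinv Y.action (-1) (cobarX Y.cop), ∀ {S : RTree} (x : Extension S) n m h,
      C.ι x n m h = cobarι Y.cop x n m (by lia) := by
  classical
  refine Coinv.exists_of_desc (ε := -1) (F := Y.action)
    (fun x n m h => cobarι Y.cop x n m (by lia)) ?_ ?_ ?_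
  · intro S x y φ n m hx hy
    refine ModuleCat.hom_ext (LinearMap.ext fun v => ?_)
    have := (Submodule.Quotient.eq (Submodule.span k (cobarRelations Y.cop S m))).2
      (Submodule.subset_span ⟨x, y, φ, n, cobar_index.2 hx, cobar_index.2 hy, v, rfl⟩)
    refine this.trans ?_
    change (Submodule.mkQ (Submodule.span k (cobarRelations Y.cop S m))) _ = _
    rw [map_zsmul]
    rfl
  · intro S m A f g h
    refine ModuleCat.hom_ext (Submodule.linearMap_qext _ (DirectSum.linearMap_ext k fun i => ?_))
    exact congrArg ModuleCat.Hom.hom (h i.1 i.2.1 (cobar_index.1 i.2.2))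
  · intro S m A f hf
    let G : (⨁ i : CobarIndex S m, (Y.cop.obj i.1.tgt).X i.2.1) →ₗ[k] A :=
      DirectSum.toModule k (CobarIndex S m) A fun i => (f i.1 i.2.1 (cobar_index.1 i.2.2)).hom
    have hG : ∀ (x : Extension S) (n : ℤ) (h : n - 1 - x.len = m) v,
        G (DirectSum.lof k (CobarIndex S m) (fun i => (Y.cop.obj i.1.tgt).X i.2.1)
          ⟨x, n, h⟩ v) = f x n (cobar_index.1 h) v := fun x n h v => DirectSum.toModule_lof k _ _
    refine ⟨ModuleCat.ofHom (Submodule.liftQ _ G (Submodule.span_le.2 ?_)), fun x n h => ?_⟩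
    · rintro _ ⟨x, y, φ, n, hx, hy, v, rfl⟩
      rw [SetLike.mem_coe, LinearMap.mem_ker, map_sub, map_zsmul, hG, hG,
        hf x y φ n (cobar_index.1 hx) (cobar_index.1 hy)]
      exact sub_self _
    · refine ModuleCat.hom_ext (LinearMap.ext fun v => ?_)
      exact hG x n (cobar_index.2 h) v

/-- The coinvariants that define the cobar construction. -/
noncomputable def LinearPrecooperad.cobarC (Y : LinearPrecooperad k) :
    Coinv Y.action (-1) (cobarX Y.cop) := Y.exists_cobarCoinv.choose

theorem LinearPrecooperad.cobarC_ι (Y : LinearPrecooperad k) {S : RTree} (x : Extension S)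
    (n m : ℤ) (h) : Y.cobarC.ι x n m h = cobarι Y.cop x n m (by lia) :=
  Y.exists_cobarCoinv.choose_spec x n m h

variable (k) in
/-- The cobar construction, from `∞`-cooperads to `∞`-operads. -/
noncomputable def cobarInfty : LinearInftyCooperad k ⥤ LinearInftyOperad k where
  obj Y := ⟨Y.obj.cobarC.cobarPreoperad, Y.obj.cobarC.quasiIso_cobarθ Y.property⟩
  map f := ⟨Coinv.cobarHom _ _ f.hom⟩
  map_id Y := by
    ext1
    exact Y.obj.cobarC.cobarHom_id
  map_comp f f' := by
    ext1
    exact Coinv.cobarHom_comp _ _ _ _ _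

/-- The identification of the cobar construction with the coinvariants. -/
noncomputable def LinearPrecooperad.cobarIso (Y : LinearPrecooperad k) :
    CobarIso Y Y.cobarC.cobarPreoperad := fun S m => Iso.refl (cobarX Y.cop S m)

theorem LinearPrecooperad.cobarIso_ι (Y : LinearPrecooperad k) {S : RTree} (x : Extension S)
    (n m : ℤ) (h) : Y.cobarIso.ι x n m h = Y.cobarC.ι x n m (by lia) := by
  rw [cobarC_ι]
  exact Category.comp_id _

theorem LinearPrecooperad.isCobar_cobarIso (Y : LinearPrecooperad k) : Y.cobarIso.IsCobar where
  d_eq x n m h := by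
    have e := Y.cobarC.ι_cobarD_eq x n m (by lia)
    simp only [cobarIso_ι]
    exact e
  map_eq {R R' T} β α b' b'' d h₁ h₂ h₃ h₄ n m h h' := by
    let E : Extension R' := ⟨R, β, b', b'', h₃, enumerates_of_append β h₃ h₁⟩
    let z : Extension R := ⟨T, α, b'.map β ++ b'', d, h₁, h₂⟩
    have e := Y.cobarC.ι_cobarMap E z (n := n) (m := m) (by lia)
    rw [topSign_eq (E := E) (y := z) (SPerm.refl _), one_smul] at e
    rw [cobarIso_ι, cobarIso_ι]
    exact e
  mul_eq {S a R U} g x xS xR D n m h := by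
    have e := Y.cobarC.cobarCoinv.ι_split Y.splitting cobarSign D n m (by lia)
    simp only [cobarIso_ι]
    refine e.trans ?_
    rw [← Linear.comp_units_smul]
    refine congrArg (_ ≫ ·) (tensor_hom_ext fun p q hpq => ?_)
    rw [Linear.comp_units_smul, GradedMap.tensorIncl_tens _ _ hpq (p' := p - 1 - xS.len)
      (q' := q - 1 - xR.len) (by lia) (by lia)]
    refine Eq.trans ?_ (tensorIncl_desc _ hpq).symm
    refine (smul_smul _ _ _).trans (congrArg (· • _) ?_)
    rw [Coinv.splitSign, cobarSign, ← Int.negOnePow_coe, ← Int.negOnePow_add, Int.negOnePow_eq_iff]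
    exact ⟨(xR.old.length + xR.new.length) - p * (xR.old.length + xR.new.length + 1), by
      rw [len]; push_cast; ring⟩

end CobarHom

open Extension

namespace Extension

variable {S : RTree}

theorem perm_top_old (x : Extension S) (f : Extension x.tgt) : f.old.Perm x.top.old :=
  f.old_enum.perm x.top.old_enum

theorem topSign_setOld_top (x : Extension S) (f : Extension x.tgt) :
    topSign (f.setOld x.top.old (x.perm_top_old f)) (x.comp f).top = 1 := by
  refine topSign_eq (SPerm.of_eq ?_)
  change (x.old.map x.map ++ x.new).map f.map ++ f.new =
    x.old.map (x.map ≫ f.map) ++ (x.new.map f.map ++ f.new)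
  rw [List.map_append, List.map_map, List.append_assoc]
  rfl

theorem exists_arrow_top_comp (x : Extension S) (f : Extension x.tgt) :
    ∃ φ : Arrow ((f.setOld x.top.old (x.perm_top_old f)).comp (x.comp f).top) (x.top.comp f),
      φ.θ = Iso.refl f.tgt ∧ φ.sign = 1 := by
  refine Arrow.exists_of_sperm
    (x := (f.setOld x.top.old (x.perm_top_old f)).comp (x.comp f).top) (y := x.top.comp f)
    (Iso.refl f.tgt) ?_ (SPerm.refl x.top.old) (t := 1) (SPerm.of_eq ?_)
  · exact (Category.comp_id _).trans ((Category.comp_id _).trans (Category.id_comp _).symm)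
  · refine (List.map_id _).trans ?_
    exact (List.append_nil (List.map id f.new)).trans (List.map_id _)

theorem exists_arrow_comp_top_top (E : Extension S) (y : Extension E.tgt) :
    ∃ φ : Arrow (E.comp y).top y.top, φ.θ = Iso.refl y.tgt ∧ φ.sign = topSign E y := by
  have h : SPerm (E.comp y).top.old y.top.old (topSign E y) := by
    have := ((sperm_topSign E y).map y.map).append (SPerm.refl y.new)
    rw [mul_one] at this
    refine ((SPerm.of_eq ?_).trans this).cast (one_mul _)
    change E.old.map (E.map ≫ y.map) ++ (E.new.map y.map ++ y.new) =
      (E.old.map E.map ++ E.new).map y.map ++ y.new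
    rw [List.map_append, List.map_map, List.append_assoc]
    rfl
  obtain ⟨φ, h₁, h₂⟩ := Arrow.exists_of_sperm (x := (E.comp y).top) (y := y.top)
    (Iso.refl y.tgt) (Category.comp_id _) h (t := 1) (SPerm.of_eq (List.map_id _))
  exact ⟨φ, h₁, h₂.trans (mul_one _)⟩

theorem new_ofHom_inv {T T' : RTree} (θ : T ≅ T') : (ofHom θ.inv).new = [] :=
  List.eq_nil_iff_forall_not_mem.2 fun e he =>
    (((ofHom θ.inv).new_enum.2 e).1 he).2 ⟨θ.hom e, RTree.iso_hom_inv_apply θ e⟩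

theorem exists_arrow_top_ofHom {x y : Extension S} (φ : Arrow x y) :
    ∃ ψ : Arrow x.top (y.comp (ofHom φ.θ.inv)).top,
      ψ.θ = Iso.refl x.tgt ∧ ψ.sign = φ.sign := by
  have h : SPerm x.top.old (y.comp (ofHom φ.θ.inv)).top.old φ.sign := by
    have e := (φ.sperm_old.map x.map).append (φ.sperm_new.map φ.θ.inv)
    rw [List.map_map, show (φ.θ.inv : y.tgt.Edge → x.tgt.Edge) ∘ φ.θ.hom = id from
      funext (RTree.iso_hom_inv_apply φ.θ), List.map_id] at e
    refine (e.trans (SPerm.of_eq ?_)).cast (mul_one _)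
    change _ = y.old.map (y.map ≫ φ.θ.inv) ++ (y.new.map φ.θ.inv ++ (ofHom φ.θ.inv).new)
    rw [new_ofHom_inv, List.append_nil, (Iso.comp_inv_eq φ.θ).2 φ.map_eq.symm]
  obtain ⟨ψ, h₁, h₂⟩ := Arrow.exists_of_sperm (x := x.top) (y := (y.comp (ofHom φ.θ.inv)).top)
    (Iso.refl x.tgt) (Category.comp_id _) h (t := 1) (SPerm.of_eq (List.map_id _))
  exact ⟨ψ, h₁, h₂.trans (mul_one _)⟩

theorem topSign_top_top (x : Extension S) : topSign x x.top.top = 1 := by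
  refine topSign_eq (SPerm.of_eq ?_)
  exact ((List.append_nil (List.map id x.top.old)).trans (List.map_id _)).symm

theorem exists_arrow_comp_top_top_self (x : Extension S) :
    ∃ φ : Arrow (x.comp x.top.top) x, φ.θ = Iso.refl x.tgt ∧ φ.sign = 1 := by
  refine Arrow.exists_of_sperm (x := x.comp x.top.top) (y := x)
    (Iso.refl x.tgt) ?_ (SPerm.refl x.old) (t := 1) (SPerm.of_eq ?_)
  · exact (Category.comp_id _).trans (Category.comp_id _)
  · refine (List.map_id _).trans ?_
    exact (List.append_nil (List.map id x.new)).trans (List.map_id _)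

end Extension

section Unit

variable {k : Type u} [CommRing k]

namespace Coinv

section

variable {Y : LinearPrecooperad k} {X : RTree → ℤ → ModuleCat.{u} k}
  (A : Coinv Y.action (-1) X) {S W : RTree} {n m : ℤ}

theorem ιm_top_cobarMap (x : Extension S) (f : Extension x.tgt) (g : W ⟶ f.tgt)
    (h : n + -1 * ((x.comp f).top.len + 1) = m) (h' : n + -1 * ((x.top.comp f).len + 1) = m) :
    A.ιm (x := (x.comp f).top) g n m h ≫ A.cobarMap f.map m = A.ιm (x := x.top.comp f) g n m h' :=
        by
  have e := A.ιm_cobarMap (f.setOld x.top.old (x.perm_top_old f)) (x.comp f).top g h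
  obtain ⟨φ, h₁, h₂⟩ := exists_arrow_top_comp x f
  have e' := A.ιm_arrow φ g g (by rw [h₁]; exact Category.comp_id _) (n := n) (m := m)
    (by rw [φ.len_eq]; exact h') h'
  rw [topSign_setOld_top, one_smul] at e
  rw [h₂, one_smul] at e'
  exact e.trans e'

theorem ιm_comp_top (E : Extension S) (y : Extension E.tgt) (g : W ⟶ y.tgt)
    (h : n + -1 * ((E.comp y).top.len + 1) = m) (h' : n + -1 * (y.top.len + 1) = m) :
    A.ιm (x := (E.comp y).top) g n m h = topSign E y • A.ιm (x := y.top) g n m h' := by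
  obtain ⟨φ, h₁, h₂⟩ := exists_arrow_comp_top_top E y
  rw [← h₂]
  exact A.ιm_arrow φ g g (by rw [h₁]; exact Category.comp_id _) _ _

theorem ιm_top_cobarMap_inv {x y : Extension S} (φ : Arrow x y)
    (h : n + -1 * (x.top.len + 1) = m) (h' : n + -1 * (y.top.len + 1) = m) :
    A.ιm (x := x.top) x.map n m h ≫ A.cobarMap φ.θ.inv m =
      φ.sign • A.ιm (x := y.top) y.map n m h' := by
  obtain ⟨ψ, h₁, h₂⟩ := exists_arrow_top_ofHom φ
  have h₃ : n + -1 * ((y.comp (ofHom φ.θ.inv)).top.len + 1) = m :=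
    (congrArg (fun l : ℕ => n + -1 * ((l : ℤ) + 1)) ψ.len_eq).symm.trans h
  have e₁ := A.ιm_arrow ψ x.map x.map (by rw [h₁]; exact Category.comp_id _) (n := n) (m := m) h h₃
  obtain ⟨χ, h₄, h₅⟩ := exists_arrow_comp_of_new_eq_nil y.top (ofHom φ.θ.inv) (new_ofHom_inv _)
  have h₆ : n + -1 * ((y.top.comp (ofHom φ.θ.inv)).len + 1) = m :=
    (congrArg (fun l : ℕ => n + -1 * ((l : ℤ) + 1)) χ.len_eq).symm.trans h'
  have e₂ := A.ιm_top_cobarMap y (ofHom φ.θ.inv) x.map h₃ h₆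
  have e₃ := A.ιm_arrow χ y.map x.map (by
    rw [h₄]; exact (Iso.comp_inv_eq φ.θ).2 φ.map_eq.symm) (n := n) (m := m) h' h₆
  rw [h₅, one_smul] at e₃
  rw [h₂] at e₁
  refine (congrArg (· ≫ _) e₁).trans ((Linear.units_smul_comp _ _ _).trans (congrArg (_ • ·) ?_))
  exact e₂.trans e₃.symm

theorem ιSum_top (x : Extension S) (h : n + -1 * (x.top.len + 1) = m + 1) :
    A.ιSum x.top x.map n m h = sum₁ fun (f : Extension x.tgt) hf =>
      A.ιm (x := (x.comp f).top) (x.map ≫ f.map) n m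
        (by rw [len_top, len_comp, hf, ← len_top]; push_cast; lia) ≫ A.cobarMap f.map m :=
  sum₁_congr fun f _ => (A.ιm_top_cobarMap x f (x.map ≫ f.map) _ _).symm

end

variable {Y : LinearPrecooperad k} {X X' : RTree → ℤ → ModuleCat.{u} k}
  (A : Coinv Y.action (-1) X) (B : Coinv A.cobarPreoperad.action 1 X') {S S' R U : RTree}
  {a : S.Edge} {n m m' : ℤ}

/-- The unit `v ↦ ∑ (α, a|e, s(id, α(a) e|-, s⁻¹ α_* v))`. -/
noncomputable def unitf (S : RTree) (m : ℤ) : (Y.cop.obj S).X m ⟶ X' S m :=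
  B.lift fun x n h => A.ιm x.top x.map m n (by rw [len_top]; lia)

theorem unitf_π (x : Extension S) (h : n + 1 * (x.len + 1) = m) :
    A.unitf B S m ≫ B.π x n m h = A.ιm x.top x.map m n (by rw [len_top]; lia) :=
  B.lift_π _ (fun _ _ φ _ _ _ => A.ιm_top_cobarMap_inv φ _ _) x n h

theorem unitf_πm (x : Extension S) (f : Extension x.tgt) (h : n + 1 * ((x.comp f).len + 1) = m) :
    A.unitf B S m ≫ B.πm (x.comp f) f.map n m h =
      A.ιm (x := (x.comp f).top) (x.map ≫ f.map) m n (by rw [len_top]; lia) ≫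
        A.cobarMap f.map n :=
  (Category.assoc _ _ _).symm.trans (congrArg (· ≫ _) (A.unitf_π B (x.comp f) h))

theorem unitf_πSum (x : Extension S) (h : n + 1 * (x.len + 1) + 1 = m) :
    A.unitf B S m ≫ B.πSum x (𝟙 _) n m h = A.ιSum x.top x.map m n (by rw [len_top]; lia) := by
  refine (map_sum₁ (Preadditive.leftComp _ (A.unitf B S m)) _).trans (Eq.trans
    (sum₁_congr fun f hf => ?_) (A.ιSum_top x _).symm)
  refine Eq.trans ?_ (A.unitf_πm B x f (by rw [len_comp, hf]; push_cast; lia))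
  exact congrArg (fun u => _ ≫ B.πm (x.comp f) u n m _) (Category.id_comp _)

theorem unitf_d (S : RTree) (hm : m' + 1 = m) :
    A.unitf B S m ≫ B.barD S m m' = (Y.cop.obj S).d m m' ≫ A.unitf B S m' := by
  refine B.ext_π fun x n h => ?_
  have e₁ := A.unitf_πSum B x (n := n) (m := m) (by lia)
  have e₂ := A.unitf_π B x (n := n + 1) (m := m) (by lia)
  have e₃ := A.ιm_cobarD x.top x.map m m' (n + 1) n rfl (by rw [len_top]; lia) hm
  have e₄ := A.unitf_π B x h
  have e₅ : A.unitf B S m ≫ B.π x (n + 1) m (by lia) ≫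
      (A.cobarPreoperad.pre.obj (op x.tgt)).d (n + 1) n = _ :=
    (Category.assoc _ _ _).symm.trans ((congrArg (· ≫ _) e₂).trans e₃)
  rw [Category.assoc, Category.assoc, B.barD_π x n m m' hm h, Linear.comp_units_smul,
    Preadditive.comp_sub]
  refine (congrArg (_ • ·) (congrArg₂ (· - ·) e₁ e₅)).trans
    (Eq.trans ?_ (congrArg (_ ≫ ·) e₄).symm)
  refine (congrArg (_ • ·) (sub_sub_cancel _ _)).trans ((smul_smul _ _ _).trans
    ((congrArg (· • _) ?_).trans (one_smul ℤˣ _)))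
  rw [len_top, Int.units_mul_self]

theorem unitf_barMap (γ : S ⟶ S') (m : ℤ) :
    A.unitf B S m ≫ B.barMap γ m = (Y.cop.map γ).f m ≫ A.unitf B S' m := by
  refine B.ext_π fun y n h => ?_
  have h' : n + 1 * (((ofHom γ).comp y).len + 1) = m := by rw [len_comp_of_top, h]
  have e₁ := A.unitf_π B y h
  have e₂ := A.unitf_π B ((ofHom γ).comp y) h'
  have e₃ := A.ιm_comp_top (ofHom γ) y (γ ≫ y.map) (n := m) (m := n)
    (by rw [len_top, len_comp_of_top]; lia) (by rw [len_top]; lia)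
  have e₄ := A.map_ιm (x := y.top) y.map γ (n := m) (m := n) (by rw [len_top]; lia)
  rw [Category.assoc, Category.assoc, B.barMap_π]
  refine (Linear.comp_units_smul _ _ _).trans ((congrArg (_ • ·) (e₂.trans e₃)).trans ?_)
  refine Eq.trans ?_ (e₄.symm.trans (congrArg (_ ≫ ·) e₁).symm)
  exact ((smul_smul _ _ _).trans ((congrArg (· • _) (Int.units_mul_self _)).trans
    (one_smul _ _)))

/-- The unit as a map of complexes. -/
noncomputable def unitNat : Y.cop ⟶ B.barFunctor where
  app S :=
    { f := A.unitf B S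
      comm' := fun _ _ h => A.unitf_d B S h }
  naturality _ _ γ := HomologicalComplex.hom_ext _ _ fun m => (A.unitf_barMap B γ m).symm

theorem pre_unit_p (x : Extension S) :
    GradedMap.pre ((A.unitNat B).app S) (B.barCoinv.p x) =
      (A.cobarCoinv.im x.top x.map).cast (by rw [len_top]; ring) :=
  GradedMap.hom_ext fun _ _ _ => A.unitf_π B x _

theorem unitf_barΔf (g : RTree.Grafting S a R U) (m : ℤ) :
    (Y.Δ g).f m ≫ ((A.unitNat B).app S ⊗ₘ (A.unitNat B).app R).f m =
      ((A.unitNat B).app U).f m ≫ B.barΔf g m := by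
  refine B.barCoinv.tens_ext_p fun xS xR n hn => ?_
  let x := graftPair g xS xR
  let D : x.Degrafting g xS xR := graftPairD g xS xR
  have hx : n + 1 * (x.len + 1) = m := by rw [D.len_eq]; push_cast; lia
  have hx' : m + -1 * (x.top.len + 1) = n := by rw [len_top]; lia
  have e₁ := B.barCoinv.split_π A.cobarPreoperad.splitting barSign D n m hx
  have e₂ : ((A.unitNat B).app U).f m ≫ B.barCoinv.π x n m hx =
      A.ιm x.top x.map m n hx' := A.unitf_π B x hx
  obtain ⟨φ, h₁, h₂⟩ := exists_arrow_setOld x.top D.sperm_topOld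
  have e₃ := A.ιm_arrow φ x.map x.map (by rw [h₁]; exact Category.comp_id _) (n := m) (m := n) hx'
    (by rw [← φ.len_eq, hx'])
  have e₄ := A.cobarCoinv.ιm_split D.top g (u := x.map) D.compat m n (by rw [← φ.len_eq, hx'])
  refine (Category.assoc _ _ _).trans (Eq.trans ?_ (Category.assoc _ _ _).symm)
  rw [GradedMap.pre_tens, pre_unit_p, pre_unit_p]
  refine (congrArg (_ ≫ ·) (GradedMap.cast_tens_cast _ _ _ _ _ _ _)).trans ?_
  refine Eq.trans ?_ (congrArg (_ ≫ ·) e₁).symm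
  refine Eq.trans ?_ (Linear.comp_units_smul _ _ _).symm
  refine Eq.trans ?_ (congrArg (_ • ·) ((Category.assoc _ _ _).symm.trans
    (congrArg (· ≫ _) (e₂.trans e₃)))).symm
  refine Eq.trans ?_ (congrArg (_ • ·) ((Linear.units_smul_comp _ _ _).trans
    (congrArg (_ • ·) e₄))).symm
  refine ((one_smul ℤˣ _).symm.trans (congrArg (· • _) ?_)).trans
    ((congrArg (_ • ·) (smul_smul _ _ _)).trans (smul_smul _ _ _)).symm
  rw [h₂]
  have h₃ : xS.top.old.length = xS.len := length_top xS xS.top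
  have h₄ : xR.top.old.length = xR.len := length_top xR xR.top
  have h₅ : xS.top.new.length = 0 := rfl
  have h₆ : xR.top.new.length = 0 := rfl
  rw [splitSign, splitSign, barSign, cobarSign, h₃, h₄, h₅, h₆, ← Int.negOnePow_coe,
    ← Int.negOnePow_coe, ← Int.negOnePow_coe, ← Int.negOnePow_add, ← Int.negOnePow_add,
    ← Int.negOnePow_add, ← Int.negOnePow_zero, Int.negOnePow_eq_iff, len, len]
  exact ⟨-(1 + xS.old.length + xS.new.length + xR.old.length + xR.new.length +
    (xS.old.length + xS.new.length) * (xR.old.length + xR.new.length) +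
    xS.new.length * xR.old.length : ℤ), by push_cast; ring⟩

/-- The unit. -/
noncomputable def unit : Y ⟶ B.barPrecooperad where
  nat := A.unitNat B
  comm g := HomologicalComplex.hom_ext _ _ fun m => A.unitf_barΔf B g m

end Coinv

end Unit

open Extension

section Counit

variable {k : Type u} [CommRing k]

namespace Coinv

section

variable {M : LinearPreoperad k} {X : RTree → ℤ → ModuleCat.{u} k}
  (B : Coinv M.action 1 X) {S W : RTree} {n m : ℤ}

theorem barMap_πm_top (x : Extension S) (f : Extension x.tgt) (g : W ⟶ f.tgt)
    (h : n + 1 * ((x.comp f).top.len + 1) = m) (h' : n + 1 * ((x.top.comp f).len + 1) = m) :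
    B.barMap f.map m ≫ B.πm (x := (x.comp f).top) g n m h = B.πm (x := x.top.comp f) g n m h' := by
  have e := B.barMap_πm (f.setOld x.top.old (x.perm_top_old f)) (x.comp f).top g h
  obtain ⟨φ, h₁, h₂⟩ := exists_arrow_top_comp x f
  have e' := B.πm_arrow φ g g (by rw [h₁]; exact Category.comp_id _) (n := n) (m := m)
    (by rw [φ.len_eq]; exact h') h'
  rw [topSign_setOld_top, one_smul] at e
  rw [h₂, one_smul] at e'
  exact e.trans e'

theorem πm_comp_top (E : Extension S) (y : Extension E.tgt) (g : W ⟶ y.tgt)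
    (h : n + 1 * ((E.comp y).top.len + 1) = m) (h' : n + 1 * (y.top.len + 1) = m) :
    B.πm (x := (E.comp y).top) g n m h = topSign E y • B.πm (x := y.top) g n m h' := by
  obtain ⟨φ, h₁, h₂⟩ := exists_arrow_comp_top_top E y
  rw [← h₂]
  exact B.πm_arrow φ g g (by rw [h₁]; exact Category.comp_id _) _ _

theorem barMap_inv_πm_top {x y : Extension S} (φ : Arrow x y)
    (h : n + 1 * (x.top.len + 1) = m) (h' : n + 1 * (y.top.len + 1) = m) :
    B.barMap φ.θ.inv m ≫ B.πm (x := x.top) x.map n m h =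
      φ.sign • B.πm (x := y.top) y.map n m h' := by
  obtain ⟨ψ, h₁, h₂⟩ := exists_arrow_top_ofHom φ
  have h₃ : n + 1 * ((y.comp (ofHom φ.θ.inv)).top.len + 1) = m :=
    (congrArg (fun l : ℕ => n + 1 * ((l : ℤ) + 1)) ψ.len_eq).symm.trans h
  have e₁ := B.πm_arrow ψ x.map x.map (by rw [h₁]; exact Category.comp_id _) (n := n) (m := m) h h₃
  obtain ⟨χ, h₄, h₅⟩ := exists_arrow_comp_of_new_eq_nil y.top (ofHom φ.θ.inv) (new_ofHom_inv _)
  have h₆ : n + 1 * ((y.top.comp (ofHom φ.θ.inv)).len + 1) = m :=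
    (congrArg (fun l : ℕ => n + 1 * ((l : ℤ) + 1)) χ.len_eq).symm.trans h'
  have e₂ := B.barMap_πm_top y (ofHom φ.θ.inv) x.map h₃ h₆
  have e₃ := B.πm_arrow χ y.map x.map (by
    rw [h₄]; exact (Iso.comp_inv_eq φ.θ).2 φ.map_eq.symm) (n := n) (m := m) h' h₆
  rw [h₅, one_smul] at e₃
  rw [h₂] at e₁
  refine (congrArg (_ ≫ ·) e₁).trans ((Linear.comp_units_smul _ _ _).trans (congrArg (_ • ·) ?_))
  exact e₂.trans e₃.symm

theorem πSum_top (x : Extension S) (h : n + 1 * (x.top.len + 1) + 1 = m) :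
    B.πSum x.top x.map n m h = sum₁ fun (f : Extension x.tgt) hf =>
      B.barMap f.map m ≫ B.πm (x := (x.comp f).top) (x.map ≫ f.map) n m
        (by rw [len_top, len_comp, hf, ← len_top]; push_cast; lia) :=
  sum₁_congr fun f _ => (B.barMap_πm_top x f (x.map ≫ f.map) _ _).symm

end

variable {M : LinearPreoperad k} {X X' : RTree → ℤ → ModuleCat.{u} k}
  (B : Coinv M.action 1 X) (A : Coinv B.barPrecooperad.action (-1) X') {S S' R U : RTree}
  {a : S.Edge} {n m m' : ℤ}

/-- The counit, which sends `(α, a|e, s⁻¹ v)` to the restriction along `α` of the coordinate of `v`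
at `(id, α(a) e|-)`. -/
noncomputable def counitf (S : RTree) (m : ℤ) : X' S m ⟶ (M.pre.obj (op S)).X m :=
  A.desc fun x n h => B.πm x.top x.map m n (by rw [len_top]; lia)

theorem ι_counitf (x : Extension S) (h : n + -1 * (x.len + 1) = m) :
    A.ι x n m h ≫ B.counitf A S m = B.πm x.top x.map m n (by rw [len_top]; lia) := by
  refine A.ι_desc _ (fun x y φ n hx hy => ?_) x n h
  obtain ⟨ψ, h₁, h₂⟩ := φ.exists_symm
  have e := B.barMap_inv_πm_top ψ (n := m) (m := n) (by rw [len_top]; lia) (by rw [len_top]; lia)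
  rw [h₁, h₂] at e
  refine (one_smul ℤˣ _).symm.trans ((congrArg (· • _) (Int.units_mul_self φ.sign).symm).trans
    ((smul_smul _ _ _).symm.trans (congrArg (_ • ·) e.symm)))

theorem ιm_counitf (x : Extension S) (f : Extension x.tgt)
    (h : n + -1 * ((x.comp f).len + 1) = m) :
    A.ιm (x.comp f) f.map n m h ≫ B.counitf A S m =
      B.barMap f.map n ≫ B.πm (x := (x.comp f).top) (x.map ≫ f.map) m n
        (by rw [len_top]; lia) :=
  (Category.assoc _ _ _).trans (congrArg (_ ≫ ·) (B.ι_counitf A (x.comp f) h))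

theorem ιSum_counitf (x : Extension S) (h : n + -1 * (x.len + 1) = m + 1) :
    A.ιSum x (𝟙 _) n m h ≫ B.counitf A S m = B.πSum x.top x.map m n (by rw [len_top]; lia) := by
  refine (map_sum₁ (Preadditive.rightComp _ (B.counitf A S m)) _).trans (Eq.trans
    (sum₁_congr fun f hf => ?_) (B.πSum_top x _).symm)
  refine Eq.trans ?_ (B.ιm_counitf A x f (by rw [len_comp, hf]; push_cast; lia))
  exact congrArg (fun u => A.ιm (x.comp f) u n m _ ≫ _) (Category.id_comp _)

theorem counitf_d (S : RTree) (hm : m' + 1 = m) :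
    B.counitf A S m ≫ (M.pre.obj (op S)).d m m' = A.cobarD S m m' ≫ B.counitf A S m' := by
  refine A.hom_ext fun x n h => ?_
  have e₁ := B.ιSum_counitf A x (n := n) (m := m') (by lia)
  have e₂ := B.ι_counitf A x h
  have e₃ := B.barD_πm x.top x.map m' m n (n - 1) (by lia) (by rw [len_top]; lia) hm
  have e₄ : (B.barPrecooperad.cop.obj x.tgt).d n (n - 1) ≫ A.ι x (n - 1) m' (by lia) ≫
      B.counitf A S m' = _ :=
    (congrArg (_ ≫ ·) (B.ι_counitf A x (n := n - 1) (m := m') (by lia))).trans e₃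
  have e₅ : A.ι x n m h ≫ B.counitf A S m ≫ (M.pre.obj (op S)).d m m' = _ :=
    (Category.assoc _ _ _).symm.trans (congrArg (· ≫ _) e₂)
  refine e₅.trans (Eq.symm ?_)
  refine (Category.assoc _ _ _).symm.trans ((congrArg (· ≫ _)
    (A.ι_cobarD x n (n - 1) m m' hm (by lia) h)).trans ?_)
  refine (Preadditive.sub_comp _ _ _).trans ((congrArg₂ (· - ·) e₁
    ((Linear.units_smul_comp _ _ _).trans (congrArg (_ • ·)
      ((Category.assoc _ _ _).trans e₄)))).trans ?_)
  refine (congrArg (fun u : X x.tgt n ⟶ (M.pre.obj (op S)).X m' =>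
    B.πSum x.top x.map m' n (by rw [len_top]; lia) - u) ((smul_smul _ _ _).trans
    ((congrArg (· • _) ?_).trans (one_smul ℤˣ _)))).trans (sub_sub_cancel _ _)
  rw [len_top, Int.units_mul_self]

theorem cobarMap_counitf (γ : S ⟶ S') (m : ℤ) :
    A.cobarMap γ m ≫ B.counitf A S m = B.counitf A S' m ≫ (M.pre.map γ.op).f m := by
  refine A.hom_ext fun y n h => ?_
  have h' : n + -1 * (((ofHom γ).comp y).len + 1) = m := by rw [len_comp_of_top, h]
  have e₁ := B.ι_counitf A y h
  have e₂ := B.ι_counitf A ((ofHom γ).comp y) h'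
  have e₃ := B.πm_comp_top (ofHom γ) y (γ ≫ y.map) (n := m) (m := n)
    (by rw [len_top, len_comp_of_top]; lia) (by rw [len_top]; lia)
  have e₄ := B.πm_map (x := y.top) y.map γ (n := m) (m := n) (by rw [len_top]; lia)
  refine (Category.assoc _ _ _).symm.trans ((congrArg (· ≫ _) (A.ι_cobarMap' γ y h)).trans ?_)
  refine (Linear.units_smul_comp _ _ _).trans ((congrArg (_ • ·) (e₂.trans e₃)).trans ?_)
  refine Eq.trans ?_ (e₄.symm.trans ((congrArg (· ≫ _) e₁).symm.trans (Category.assoc _ _ _)))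
  exact ((smul_smul _ _ _).trans ((congrArg (· • _) (Int.units_mul_self _)).trans
    (one_smul _ _)))

/-- The counit as a map of complexes. -/
noncomputable def counitNat : A.cobarFunctor ⟶ M.pre where
  app S :=
    { f := B.counitf A S.unop
      comm' := fun _ _ h => B.counitf_d A S.unop h }
  naturality _ _ γ := HomologicalComplex.hom_ext _ _ fun m => B.cobarMap_counitf A γ.unop m

theorem i_post_counit (x : Extension S) :
    (A.cobarCoinv.i x).post ((B.counitNat A).app (op S)) =
      (B.barCoinv.pm x.top x.map).cast (by rw [len_top]; ring) :=
  GradedMap.hom_ext fun _ _ _ => B.ι_counitf A x _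

theorem cobarθf_counitf (g : RTree.Grafting S a R U) (m : ℤ) :
    A.cobarθf g m ≫ ((B.counitNat A).app (op S) ⊗ₘ (B.counitNat A).app (op R)).f m =
      ((B.counitNat A).app (op U)).f m ≫ (M.θ g).f m := by
  refine A.cobarCoinv.hom_ext_graft g fun xS xR x D n hx => ?_
  have hx' : m + 1 * (x.top.len + 1) = n := by rw [len_top]; lia
  have e₁ := A.cobarCoinv.ι_split B.barPrecooperad.splitting cobarSign D n m hx
  have e₂ : A.ι x n m hx ≫ ((B.counitNat A).app (op U)).f m =
      B.πm x.top x.map m n hx' := B.ι_counitf A x hx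
  obtain ⟨φ, h₁, h₂⟩ := exists_arrow_setOld x.top D.sperm_topOld
  have e₃ := B.πm_arrow φ x.map x.map (by rw [h₁]; exact Category.comp_id _) (n := m) (m := n) hx'
    (by rw [← φ.len_eq, hx'])
  have e₄ := B.barCoinv.split_pm D.top g (u := x.map) D.compat m n (by rw [← φ.len_eq, hx'])
  refine (Category.assoc _ _ _).symm.trans ((congrArg (· ≫ _) e₁).trans (Eq.trans ?_
    ((congrArg (· ≫ _) (e₂.trans e₃)).symm.trans (Category.assoc _ _ _))))
  refine (Linear.units_smul_comp _ _ _).trans ((congrArg (_ • ·)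
    (Category.assoc _ _ _)).trans ?_)
  rw [GradedMap.tens_post, i_post_counit, i_post_counit]
  refine (congrArg (_ • ·) ((congrArg (_ ≫ ·)
    (GradedMap.cast_tens_cast _ _ _ _ _ _ _)).trans e₄)).trans ?_
  refine ((smul_smul _ _ _).trans (congrArg (· • _) ?_)).trans (Linear.units_smul_comp _ _ _).symm
  have h₃ : xS.top.old.length = xS.len := length_top xS xS.top
  have h₄ : xR.top.old.length = xR.len := length_top xR xR.top
  have h₅ : xS.top.new.length = 0 := rfl
  rw [h₂, barPairSign, splitSign, splitSign, barSign, cobarSign, h₃, h₄, h₅, len_top, len_top,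
    ← Int.negOnePow_coe,
    ← Int.negOnePow_coe, ← Int.negOnePow_coe, ← Int.negOnePow_add, ← Int.negOnePow_add,
    Int.negOnePow_eq_iff, len, len]
  exact ⟨1 + xS.old.length + xS.new.length + xR.old.length + xR.new.length +
    (xS.old.length + xS.new.length) * (xR.old.length + xR.new.length), by push_cast; ring⟩

/-- The counit. -/
noncomputable def counit : A.cobarPreoperad ⟶ M where
  nat := B.counitNat A
  comm g := HomologicalComplex.hom_ext _ _ fun m => B.cobarθf_counitf A g m

end Coinv

end Counit

open Extension

section Adjunction

variable {k : Type u} [CommRing k]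

namespace Coinv

section UnitNaturality

variable {Y Z : LinearPrecooperad k} (f : Y ⟶ Z) {X X' X₁ X₁' : RTree → ℤ → ModuleCat.{u} k}
  (A : Coinv Y.action (-1) X) (A' : Coinv Z.action (-1) X')
  (B : Coinv A.cobarPreoperad.action 1 X₁) (B' : Coinv A'.cobarPreoperad.action 1 X₁')

theorem unitf_barHomf (S : RTree) (m : ℤ) :
    (f.nat.app S).f m ≫ A'.unitf B' S m =
      A.unitf B S m ≫ B.barHomf B' (A.cobarHom A' f) S m := by
  refine B'.ext_π fun x n h => ?_
  refine (Category.assoc _ _ _).trans (Eq.trans ?_ (Category.assoc _ _ _).symm)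
  refine (congrArg (_ ≫ ·) (A'.unitf_π B' x h)).trans (Eq.trans ?_
    (congrArg (_ ≫ ·) (B.barHomf_π B' (A.cobarHom A' f) x h)).symm)
  refine Eq.trans ?_ (Category.assoc _ _ _)
  refine Eq.trans ?_ (congrArg (· ≫ _) (A.unitf_π B x h)).symm
  exact (A.ιm_cobarHomf A' f x.top x.map (by rw [len_top]; lia)).symm

theorem unit_naturality :
    f ≫ A'.unit B' = A.unit B ≫ B.barHom B' (A.cobarHom A' f) :=
  LinearPrecooperad.Hom.ext (NatTrans.ext (funext fun S =>
    HomologicalComplex.hom_ext _ _ fun m => A.unitf_barHomf f A' B B' S m))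

end UnitNaturality

section CounitNaturality

variable {M N : LinearPreoperad k} (f : M ⟶ N) {X X' X₁ X₁' : RTree → ℤ → ModuleCat.{u} k}
  (B : Coinv M.action 1 X) (B' : Coinv N.action 1 X')
  (A : Coinv B.barPrecooperad.action (-1) X₁) (A' : Coinv B'.barPrecooperad.action (-1) X₁')

theorem cobarHomf_counitf (S : RTree) (m : ℤ) :
    A.cobarHomf A' (B.barHom B' f) S m ≫ B'.counitf A' S m =
      B.counitf A S m ≫ (f.nat.app (op S)).f m := by
  refine A.hom_ext fun x n h => ?_
  refine (Category.assoc _ _ _).symm.trans (Eq.trans ?_ (Category.assoc _ _ _))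
  refine (congrArg (· ≫ _) (A.ι_cobarHomf A' (B.barHom B' f) x h)).trans (Eq.trans ?_
    (congrArg (· ≫ _) (B.ι_counitf A x h)).symm)
  refine (Category.assoc _ _ _).trans ?_
  refine (congrArg (_ ≫ ·) (B'.ι_counitf A' x h)).trans ?_
  exact B.barHomf_πm B' f x.top x.map (by rw [len_top]; lia)

theorem counit_naturality :
    A.cobarHom A' (B.barHom B' f) ≫ B'.counit A' = B.counit A ≫ f :=
  LinearPreoperad.Hom.ext (NatTrans.ext (funext fun S =>
    HomologicalComplex.hom_ext _ _ fun m => B.cobarHomf_counitf f B' A A' S.unop m))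

end CounitNaturality

section Triangles

variable {X X' X'' : RTree → ℤ → ModuleCat.{u} k}

theorem ιm_top_top {Y : LinearPrecooperad k} (A : Coinv Y.action (-1) X) {S : RTree}
    (x : Extension S) (n m : ℤ) (h : n + -1 * (x.len + 1) = m)
    (h' : n + -1 * (x.top.top.len + 1) = m) :
    A.ιm (W := x.tgt) x.top.top (𝟙 x.tgt) n m h' ≫ A.cobarMap x.map m = A.ι x n m h := by
  obtain ⟨φ, h₁, h₂⟩ := exists_arrow_comp_top_top_self x
  have e := A.ιm_cobarMap (W := x.tgt) x x.top.top (𝟙 x.tgt) h'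
  have e' := A.ιm_arrow (W := x.tgt) φ (𝟙 x.tgt) (𝟙 x.tgt)
    (by rw [h₁]; exact Category.comp_id _) (n := n) (m := m) (by rw [φ.len_eq]; exact h) h
  rw [topSign_top_top, one_smul] at e
  rw [h₂, one_smul] at e'
  exact e.trans (e'.trans (A.ι_eq_ιm h).symm)

theorem πm_top_top {M : LinearPreoperad k} (B : Coinv M.action 1 X) {S : RTree}
    (x : Extension S) (n m : ℤ) (h : n + 1 * (x.len + 1) = m)
    (h' : n + 1 * (x.top.top.len + 1) = m) :
    B.barMap x.map m ≫ B.πm (W := x.tgt) x.top.top (𝟙 x.tgt) n m h' = B.π x n m h := by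
  obtain ⟨φ, h₁, h₂⟩ := exists_arrow_comp_top_top_self x
  have e := B.barMap_πm (W := x.tgt) x x.top.top (𝟙 x.tgt) h'
  have e' := B.πm_arrow (W := x.tgt) φ (𝟙 x.tgt) (𝟙 x.tgt)
    (by rw [h₁]; exact Category.comp_id _) (n := n) (m := m) (by rw [φ.len_eq]; exact h) h
  rw [topSign_top_top, one_smul] at e
  rw [h₂, one_smul] at e'
  exact e.trans (e'.trans (B.π_eq_πm h).symm)

theorem cobarHom_unit_counit {Y : LinearPrecooperad k} (A : Coinv Y.action (-1) X)
    (B : Coinv A.cobarPreoperad.action 1 X') (A' : Coinv B.barPrecooperad.action (-1) X'') :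
    A.cobarHom A' (A.unit B) ≫ B.counit A' = 𝟙 _ := by
  refine LinearPreoperad.Hom.ext (NatTrans.ext (funext fun S =>
    HomologicalComplex.hom_ext _ _ fun m => ?_))
  refine A.hom_ext (S := S.unop) (m := m) fun x n h => Eq.trans ?_ (Category.comp_id _).symm
  refine (Category.assoc _ _ _).symm.trans ((congrArg (· ≫ _)
    (A.ι_cobarHomf A' (A.unit B) x h)).trans ((Category.assoc _ _ _).trans
    ((congrArg (_ ≫ ·) (B.ι_counitf A' x h)).trans ?_)))
  have e := A.unitf_π B x.top (n := m) (m := n) (by rw [len_top]; lia)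
  refine (Category.assoc _ _ _).symm.trans ((congrArg (· ≫ _) e).trans ?_)
  exact A.ιm_top_top x n m h _

theorem unit_barHom_counit {M : LinearPreoperad k} (B : Coinv M.action 1 X)
    (A : Coinv B.barPrecooperad.action (-1) X') (B' : Coinv A.cobarPreoperad.action 1 X'') :
    A.unit B' ≫ B'.barHom B (B.counit A) = 𝟙 _ := by
  refine LinearPrecooperad.Hom.ext (NatTrans.ext (funext fun S =>
    HomologicalComplex.hom_ext _ _ fun m => ?_))
  refine B.ext_π (S := S) (m := m) fun x n h => Eq.trans ?_ (Category.id_comp _).symm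
  refine (Category.assoc _ _ _).trans ((congrArg (_ ≫ ·)
    (B'.barHomf_π B (B.counit A) x h)).trans ((Category.assoc _ _ _).symm.trans
    ((congrArg (· ≫ _) (A.unitf_π B' x h)).trans ?_)))
  have e := B.ι_counitf A x.top (n := m) (m := n) (by rw [len_top]; lia)
  refine (Category.assoc _ _ _).trans ((congrArg (_ ≫ ·) e).trans ?_)
  exact B.πm_top_top x n m h _

end Triangles

end Coinv

variable (k) in
/-- The adjunction between the cobar and the bar construction. -/
noncomputable def cobarBarAdjunction : cobarInfty k ⊣ barInfty k where
  unit :=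
    { app := fun Y => ⟨Y.obj.cobarC.unit Y.obj.cobarC.cobarPreoperad.barC⟩
      naturality := fun Y Z f => by
        ext1
        exact Coinv.unit_naturality _ _ _ _ _ }
  counit :=
    { app := fun M => ⟨M.obj.barC.counit M.obj.barC.barPrecooperad.cobarC⟩
      naturality := fun M N f => by
        ext1
        exact Coinv.counit_naturality _ _ _ _ _ }
  left_triangle_components Y := by
    ext1
    exact Coinv.cobarHom_unit_counit _ _ _
  right_triangle_components M := by
    ext1
    exact Coinv.unit_barHom_counit _ _ _

theorem Extension.exists_arrow_top {S : RTree} {x : Extension S} (y : Extension x.tgt)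
    (h : y.old = x.top.old) (h' : y.new = []) :
    ∃ φ : Arrow y x.top, y.map ≫ φ.θ.hom = 𝟙 x.tgt ∧ φ.sign = 1 := by
  obtain ⟨θ, hθ⟩ := y.exists_iso_of_new_eq_nil h'
  have e : y.map ≫ θ.inv = 𝟙 x.tgt := by rw [← hθ, θ.hom_inv_id]
  obtain ⟨φ, h₁, h₂⟩ := Arrow.exists_of_sperm (x := y) (y := x.top) θ.symm e (SPerm.of_eq h)
    (t := 1) (SPerm.of_eq (by rw [h']; rfl))
  exact ⟨φ, by rw [h₁]; exact e, h₂⟩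

namespace Coinv

theorem unitf_eq_finsum {Y : LinearPrecooperad k} {X X' : RTree → ℤ → ModuleCat.{u} k}
    (A : Coinv Y.action (-1) X) (B : Coinv A.cobarPreoperad.action 1 X') (S : RTree) (n : ℤ) :
    A.unitf B S n = ∑ᶠ z : Component S, (Y.cop.map z.out.map).f n ≫
      A.ι z.out.top n (n - 1 - z.out.top.len) (by ring) ≫
      B.ι z.out (n - 1 - z.out.top.len) n (by rw [len_top]; ring) := by
  rw [finsum_eq_sum_of_fintype]
  refine Finset.sum_congr rfl fun z _ => ?_
  have e {p q : ℤ} (h : p = q) (h₁ : n + -1 * (z.out.top.len + 1) = p)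
      (h₂ : p + 1 * (z.out.len + 1) = n) :
      A.ιm z.out.top z.out.map n p h₁ ≫ B.ι z.out p n h₂ =
        A.ιm z.out.top z.out.map n q (by rw [h₁, h]) ≫ B.ι z.out q n (by rw [← h, h₂]) := by
    subst h; rfl
  refine (e (q := n - 1 - z.out.top.len) ?_ _ _).trans (Category.assoc _ _ _)
  rw [len_top, Component.rep]
  ring

end Coinv

end Adjunction

theorem mainTheorem3 (k : Type u) [CommRing k] :
    ∃ (B : LinearInftyOperad k ⥤ LinearInftyCooperad k)
      (Ω : LinearInftyCooperad k ⥤ LinearInftyOperad k)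
      (b : ∀ M : LinearInftyOperad k, BarIso M.obj (B.obj M).obj)
      (c : ∀ Y : LinearInftyCooperad k, CobarIso Y.obj (Ω.obj Y).obj)
      (adj : Ω ⊣ B),
      -- on objects, `B` and `Ω` are the bar and the cobar construction
      (∀ M, (b M).IsBar) ∧
      (∀ Y, (c Y).IsCobar) ∧
      -- on morphisms, `B(f)(α, d|e, sv) = (α, d|e, s f(v))`
      (∀ (M N : LinearInftyOperad k) (f : M ⟶ N) (S : RTree) (x : Extension S) (n m : ℤ)
        (h : x.len + (n + 1) = m),
        (b M).ι x n m h ≫ ((B.map f).hom.nat.app S).f m =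
          (f.hom.nat.app (op x.tgt)).f n ≫ (b N).ι x n m h) ∧
      -- on morphisms, `Ω(f)(α, b|d, s⁻¹v) = (α, b|d, s⁻¹ f(v))`
      (∀ (Y Z : LinearInftyCooperad k) (f : Y ⟶ Z) (R : RTree) (x : Extension R) (n m : ℤ)
        (h : n - 1 - x.len = m),
        (c Y).ι x n m h ≫ ((Ω.map f).hom.nat.app (op R)).f m =
          (f.hom.nat.app x.tgt).f n ≫ (c Z).ι x n m h) ∧
      -- the unit, `η_S(v) = ∑_α (α, a|e, s(id_T, a e|-, s⁻¹ α_* v))`, summed over the (finitely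
      -- many) classes of extensions `α : S ⟶ T`
      (∀ (Y : LinearInftyCooperad k) (S : RTree) (n : ℤ),
        ((adj.unit.app Y).hom.nat.app S).f n =
          ∑ᶠ z : Extension.Component S,
            (Y.obj.cop.map z.out.map).f n ≫
              (c Y).ι z.out.top n (n - 1 - z.out.top.len) rfl ≫
              (b (Ω.obj Y)).ι z.out (n - 1 - z.out.top.len) n
                (by have := z.out.len_top; omega)) ∧
      -- the counit, `ε_S(α, a|e, s⁻¹(β, a e|f, sv)) = α^* β^* v` if `β` has codimension `0` ...
      (∀ (M : LinearInftyOperad k) (S : RTree) (x : Extension S) (y : Extension x.tgt)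
        (n m : ℤ) (h : y.len + (n + 1) = m) (h' : m - 1 - x.len = n),
        y.old = x.top.old → y.new = [] →
        (b M).ι y n m h ≫ (c (B.obj M)).ι x m n h' ≫ ((adj.counit.app M).hom.nat.app (op S)).f n =
          (M.obj.pre.map (x.map ≫ y.map).op).f n) ∧
      -- ... and `0` if `β` has positive codimension
      (∀ (M : LinearInftyOperad k) (S : RTree) (x : Extension S) (y : Extension x.tgt)
        (n m p : ℤ) (h : y.len + (n + 1) = m) (h' : m - 1 - x.len = p),
        y.old = x.top.old → y.new ≠ [] →
        (b M).ι y n m h ≫ (c (B.obj M)).ι x m p h' ≫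
          ((adj.counit.app M).hom.nat.app (op S)).f p = 0) := by
  refine ⟨barInfty k, cobarInfty k, fun M => M.obj.barIso, fun Y => Y.obj.cobarIso,
    cobarBarAdjunction k, fun M => M.obj.isBar_barIso, fun Y => Y.obj.isCobar_cobarIso,
    fun M N f S x n m h => ?_, fun Y Z f R x n m h => ?_, fun Y S n => ?_,
    fun M S x y n m h h' hy hy' => ?_, fun M S x y n m p h h' hy hy' => ?_⟩
  · exact (congrArg (· ≫ _) (M.obj.barIso_ι _ _ _ _)).trans
      ((Coinv.ι_barHomf _ _ _ x _).trans (congrArg (_ ≫ ·) (N.obj.barIso_ι _ _ _ _)).symm)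
  · exact (congrArg (· ≫ _) (Y.obj.cobarIso_ι _ _ _ _)).trans
      ((Coinv.ι_cobarHomf _ _ _ x _).trans (congrArg (_ ≫ ·) (Z.obj.cobarIso_ι _ _ _ _)).symm)
  · refine (Coinv.unitf_eq_finsum _ _ S n).trans (finsum_congr fun z => congrArg (_ ≫ ·) ?_)
    exact congrArg₂ (· ≫ ·) (Y.obj.cobarIso_ι _ _ _ _).symm
      (LinearPreoperad.barIso_ι _ _ _ _ _).symm
  · have hl : n + 1 * (x.top.len + 1) = m := by rw [Extension.len_top]; lia
    obtain ⟨φ, h₁, h₂⟩ := Extension.exists_arrow_top y hy hy'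
    refine (congrArg₂ (· ≫ · ≫ _) (M.obj.barIso_ι _ _ _ _)
      (LinearPrecooperad.cobarIso_ι _ _ _ _ _)).trans ?_
    refine (congrArg (_ ≫ ·) (M.obj.barC.ι_counitf _ x _)).trans ?_
    refine (M.obj.barC.ι_πm φ x.map (x.map ≫ y.map) ?_ _ hl).trans ?_
    · exact (Category.assoc _ _ _).trans ((congrArg (_ ≫ ·) h₁).trans (Category.comp_id _))
    · rw [h₂, one_smul]
  · refine (congrArg₂ (· ≫ · ≫ _) (M.obj.barIso_ι _ _ _ _)
      (LinearPrecooperad.cobarIso_ι _ _ _ _ _)).trans ?_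
    refine (congrArg (_ ≫ ·) (M.obj.barC.ι_counitf _ x _)).trans ?_
    refine M.obj.barC.ι_πm_zero (y := x.top) (fun hφ => hy' ?_) x.map _ _
    obtain ⟨φ⟩ := hφ
    exact List.eq_nil_of_length_eq_zero φ.new_length
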